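/- Let $\mathbb K$ be a field and let $M=(M(n))_{n\ge 1}$ be a sequence of finite-dimensional $\mathbb Z$-graded $\mathbb K$-vector spaces (with $M(0)=0$) with a homogeneous basis $B^M$. Let $F_{ns}(M)$ be the free non-symmetric (graded) operad on $M$, with its weight grading by the number of vertices. Its monomial basis consists of the planar trees $\tau$ whose vertices with $n$ entries are labelled by elements of $B^M\cap M(n)$. For such a monomial $\alpha$ and an internal edge $e$, let $\alpha|_{\tau_e}$ be the monomial with two vertices given by the two ends of $e$. Let $\mathcal P=F_{ns}(M)/(R)$, with $R\subset F_{ns}(M)_{(2)}$ a set of homogeneous elements of weight $2$. A *non-symmetric PBW basis* of $F_{ns}(M)/(R)$ consists of a partial order on the monomials of each arity such that $\alpha\le\alpha'$, $\beta\le\beta'$ (with $\alpha,\alpha'$ of the same arity and $\beta,\beta'$ of the same arity) implies $\alpha\circ_i\beta\le\alpha'\circ_i\beta'$ for all $i$, and of a set $B^{\mathcal P}$ of monomials, containing $1$ and $B^M$ and representing a $\mathbb K$-basis of $F_{ns}(M)/(R)$, such that 1. for $\alpha,\beta\in B^{\mathcal P}$, either $\alpha\circ_i\beta\in B^{\mathcal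 P}$ (up to sign), or every $\gamma\in B^{\mathcal P}$ that occurs in the decomposition $\alpha\circ_i\beta\equiv\sum_\gamma c_\gamma\gamma$ satisfies $\gamma>\alpha\circ_i\beta$; 2. a monomial $\alpha$ on a tree $\tau$ is in $B^{\mathcal P}$ if and only if $\alpha|_{\tau_e}\in B^{\mathcal P}$ for every internal edge $e$ of $\tau$. The bar construction $B(\mathcal P)$ is the sum over planar trees of the treewise tensors with labels in the suspended augmentation ideal $\Sigma\tilde{\mathcal P}$, with the differential $\delta$ that is the signed sum of the contractions of the internal edges; $B_d(\mathcal P)_{(s)}$ is the part with $d$ vertices and total weight $s$. The operad $\mathcal P$ is *Koszul* if $H_d(B_*(\mathcal P)_{(s)})=0$ for $d\ne s$. Let $K(\mathcal P)_{(s)}=\ker(\delta:B_s(\mathcal P)_{(s)}\to B_{s-1}(\mathcal P)_{(s)})$, a sub-cooperad of the cofree cooperad $F^c_{ns}(\Sigma M)$, and let $K(\mathcal P)^\#$ be its graded linear dual, a quotient operad of $F_{ns}(\Sigma^{-1}M^\#)$. **Theorem.** Suppose that $\mathcal P=F_{ns}(M)/(R)$ has a non-symmetric PBW basis $B^{\mathcal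 P}$. Then: (a) $\mathcal P$ is Koszul. (b) $K(\mathcal P)^\#=F_{ns}(\Sigma^{-1}M^\#)/(R')$, where $R'$ consists of the weight $2$ elements $\sum_t f_t\,t^\#$ (with $t$ running over the monomials with two vertices and $t^\#$ the corresponding monomial in the dual basis of $B^M$) such that $\sum_t(-1)^{|x_1(t)|}f_t r_t=0$ for all $r=\sum_t r_t t\in R$, $x_1(t)\in B^M$ being the root label of $t$. The set of the monomials $\beta^\#$ such that $\beta|_{\tau_e}\notin B^{\mathcal P}$ for every internal edge $e$ of $\beta$ is a non-symmetric PBW basis of $K(\mathcal P)^\#$ for the opposite order. (c) The symmetric operad $F(M\otimes\Sigma_*)/(R)$ is $\mathcal P\otimes\Sigma_*$, and the orbits $\{\alpha\otimes\sigma:\alpha\in B^{\mathcal P}(n),\ \sigma\in\Sigma_n\}$ form a symmetric PBW basis of it, for the order in which $\alpha\otimes\sigma\le\alpha'\otimes\sigma'$ if and only if $\sigma=\sigma'$ and $\alpha\le\alpha'$. Here a symmetric PBW basis is defined as above, with the monomials $\alpha\otimes\sigma$ of $F(M\otimes\Sigma_*)=F_{ns}(M)\otimes\Sigma_*$ and with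 the composites $w.\,\alpha\circ_i\beta$, for all pointed shuffles $w$ (permutations preserving the relative order of the entries of $\alpha$, that of the entries of $\beta$, and the entry $i$), in place of $\alpha\circ_i\beta$, both in condition 1 and in the compatibility of the order; the entries of a restriction $\alpha|_{\tau_e}$ are numbered in the order of the minima of the entries of $\alpha$ above them. -/

import Mathlib

universe u v

namespace NSOp

/-! ### Planar trees -/

/-- Planar rooted trees whose vertices are labelled by elements `g : G`, a vertex labelled by `g`
having `ar g` linearly ordered entries. `leaf` is the tree without vertices. -/
inductive PTree (G : Type u) (ar : G → ℕ) : Type u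
  | leaf : PTree G ar
  | node (g : G) (c : Fin (ar g) → PTree G ar) : PTree G ar

namespace PTree

variable {G : Type u} {ar : G → ℕ}

/-- Number of entries of the tree. The entries are numbered `0, 1, …` from left to right. -/
def leaves : PTree G ar → ℕ
  | leaf => 1
  | node _ c => ∑ j, leaves (c j)

/-- The sum of `f` over the labels of all vertices. -/
def total {A : Type*} [AddCommMonoid A] (f : G → A) : PTree G ar → A
  | leaf => 0
  | node g c => f g + ∑ j, total f (c j)

/-- Number of vertices. -/
def weight (t : PTree G ar) : ℕ := t.total (fun _ => 1)

/-- In a forest `c`, the number of entries lying to the left of the tree `c j`. -/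
def offset {n : ℕ} (c : Fin n → PTree G ar) (j : Fin n) : ℕ :=
  ∑ k ∈ Finset.univ.filter (· < j), leaves (c k)

/-- `graft s i t` grafts the root of `t` on the entry number `i` of `s` (for `i < s.leaves`). -/
def graft : PTree G ar → ℕ → PTree G ar → PTree G ar
  | leaf, _, t => t
  | node g c, i, t => node g (fun j =>
      if offset c j ≤ i ∧ i < offset c j + leaves (c j) then graft (c j) (i - offset c j) t
      else c j)

/-- The sum of the degrees of the vertices that come after the entry number `i` when the tree is
read from bottom to top and from left to right (a vertex before its entries, and these from left
to right). -/
def degAfter (deg : G → ℤ) : PTree G ar → ℕ → ℤ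
  | leaf, _ => 0
  | node _ c, i => ∑ j,
      if i < offset c j then total deg (c j)
      else if i < offset c j + leaves (c j) then degAfter deg (c j) (i - offset c j)
      else 0

/-- The tree with one vertex. -/
def corolla (g : G) : PTree G ar := node g (fun _ => leaf)

/-- The tree with exactly one internal edge, from a vertex `h` to the entry `j` of a vertex `g`. -/
def twoVertex (g : G) (j : Fin (ar g)) (h : G) : PTree G ar :=
  node g (fun k => if k = j then corolla h else leaf)

/-- `EdgeSub t q`: `q` is the restriction of `t` to the subtree generated by one of the internal
edges of `t`. -/
inductive EdgeSub : PTree G ar → PTree G ar → Prop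
  | root (g : G) (c : Fin (ar g) → PTree G ar) (j : Fin (ar g)) (h : G)
      (c' : Fin (ar h) → PTree G ar) (hc : c j = node h c') :
      EdgeSub (node g c) (twoVertex g j h)
  | child (g : G) (c : Fin (ar g) → PTree G ar) (j : Fin (ar g)) (q : PTree G ar)
      (hq : EdgeSub (c j) q) : EdgeSub (node g c) q

/-- Degree of the label of the root vertex. -/
def rootDeg (deg : G → ℤ) : PTree G ar → ℤ
  | leaf => 0
  | node g _ => deg g

/-- Replacement of the `i`th entry of a sequence by a sequence. -/
def splice {α : Type*} {m n : ℕ} (c : Fin m → α) (i : Fin m) (c' : Fin n → α) :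
    Fin (m + n - 1) → α := fun j =>
  if h₁ : j.1 < i.1 then c ⟨j.1, by omega⟩
  else if h₂ : j.1 < i.1 + n then c' ⟨j.1 - i.1, by omega⟩
  else c ⟨j.1 + 1 - n, by omega⟩

section lemmas

theorem offset_exists {n : ℕ} (c : Fin n → PTree G ar) (i : ℕ) (hi : i < ∑ j, (c j).leaves) :
    ∃ j, offset c j ≤ i ∧ i < offset c j + (c j).leaves := by
  induction n with
  | zero => simp at hi
  | succ n ih =>
    rw [Fin.sum_univ_castSucc] at hi
    by_cases h : i < ∑ j : Fin n, (c j.castSucc).leaves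
    · obtain ⟨j, hj⟩ := ih (fun j => c j.castSucc) h
      refine ⟨j.castSucc, ?_⟩
      have : offset c j.castSucc = offset (fun j : Fin n => c j.castSucc) j := by
        simp only [offset, Finset.sum_filter, Fin.sum_univ_castSucc, Fin.castSucc_lt_castSucc_iff]
        simp [Fin.not_lt.2 (Fin.le_last _)]
      rwa [this]
    · refine ⟨Fin.last n, ?_⟩
      have : offset c (Fin.last n) = ∑ j : Fin n, (c j.castSucc).leaves := by
        simp only [offset, Finset.sum_filter, Fin.sum_univ_castSucc, Fin.castSucc_lt_last]
        simp
      omega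

theorem offset_mono {n : ℕ} (c : Fin n → PTree G ar) {j k : Fin n} (h : j < k) :
    offset c j + (c j).leaves ≤ offset c k := by
  unfold offset
  rw [add_comm, ← Finset.sum_insert (f := fun k => (c k).leaves) (by simp)]
  apply Finset.sum_le_sum_of_subset
  intro l hl
  simp only [Finset.mem_insert, Finset.mem_filter, Finset.mem_univ, true_and] at hl ⊢
  rcases hl with rfl | hl
  · exact h
  · exact hl.trans h

theorem offset_unique {n : ℕ} (c : Fin n → PTree G ar) (i : ℕ) {j k : Fin n}
    (hj : offset c j ≤ i ∧ i < offset c j + (c j).leaves)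
    (hk : offset c k ≤ i ∧ i < offset c k + (c k).leaves) : j = k := by
  rcases lt_trichotomy j k with h | h | h
  · have := offset_mono c h
    omega
  · exact h
  · have := offset_mono c h
    omega

theorem graft_node (g : G) (c : Fin (ar g) → PTree G ar) (i : ℕ) (t : PTree G ar) (j : Fin (ar g))
    (hj : offset c j ≤ i ∧ i < offset c j + (c j).leaves) :
    graft (node g c) i t = node g (Function.update c j (graft (c j) (i - offset c j) t)) := by
  rw [graft]
  congr 1
  funext k
  by_cases h : k = j
  · subst h
    simp [hj]
  · rw [Function.update_of_ne h, if_neg]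
    exact fun hk => h (offset_unique c i hk hj)

theorem total_graft {A : Type*} [AddCommMonoid A] (f : G → A) (t : PTree G ar) :
    ∀ (s : PTree G ar) (i : ℕ), i < s.leaves → (graft s i t).total f = s.total f + t.total f
  | leaf, i, _ => by simp [graft, total]
  | node g c, i, hi => by
    obtain ⟨j, hj⟩ := offset_exists c i hi
    rw [graft_node g c i t j hj]
    have ih := total_graft f t (c j) (i - offset c j) (by omega)
    simp only [total]
    rw [← Finset.add_sum_erase _ _ (Finset.mem_univ j),
      ← Finset.add_sum_erase _ (fun j => total f (c j)) (Finset.mem_univ j),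
      Function.update_self, ih]
    have : ∑ k ∈ Finset.univ.erase j,
        total f (Function.update c j (graft (c j) (i - offset c j) t) k)
        = ∑ k ∈ Finset.univ.erase j, total f (c k) := by
      apply Finset.sum_congr rfl
      intro k hk
      rw [Function.update_of_ne (Finset.ne_of_mem_erase hk)]
    rw [this]
    abel

theorem leaves_graft (t : PTree G ar) :
    ∀ (s : PTree G ar) (i : ℕ), i < s.leaves → (graft s i t).leaves + 1 = s.leaves + t.leaves
  | leaf, i, _ => by simp [graft, leaves, add_comm]
  | node g c, i, hi => by
    obtain ⟨j, hj⟩ := offset_exists c i hi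
    rw [graft_node g c i t j hj]
    have ih := leaves_graft t (c j) (i - offset c j) (by omega)
    simp only [leaves]
    rw [← Finset.add_sum_erase _ _ (Finset.mem_univ j),
      ← Finset.add_sum_erase _ (fun j => leaves (c j)) (Finset.mem_univ j),
      Function.update_self]
    have : ∑ k ∈ Finset.univ.erase j,
        leaves (Function.update c j (graft (c j) (i - offset c j) t) k)
        = ∑ k ∈ Finset.univ.erase j, leaves (c k) := by
      apply Finset.sum_congr rfl
      intro k hk
      rw [Function.update_of_ne (Finset.ne_of_mem_erase hk)]
    omega

end lemmas

end PTree

open PTree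

/-! ### The free non-symmetric operad and its ideals -/

section Free

variable (K : Type v) [Field K] {G : Type u} (ar : G → ℕ)

/-- The sum over all arities `r` of the modules `F_ns(M)(r)`, where `M` is the non-symmetric module
with basis `G`, given by its monomial basis: the planar trees labelled by elements of `G`. The tree
stands for the tensor product of its labels in the order of `degAfter`. -/
abbrev Free : Type _ := PTree G ar →₀ K

variable {K ar}

/-- The sign `(-1) ^ n`. -/
def ksign (K : Type v) [Field K] (n : ℤ) : K := if Even n then 1 else -1

/-- The partial composition product `∘ᵢ` of the free non-symmetric operad on generators `g : G` of
degree `deg g`; it is zero on the components of arity at most `i` in the first factor. -/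
noncomputable def comp (deg : G → ℤ) (i : ℕ) : Free K ar →ₗ[K] Free K ar →ₗ[K] Free K ar :=
  Finsupp.linearCombination K fun s => Finsupp.linearCombination K fun t =>
    if i < s.leaves then
      Finsupp.single (graft s i t) (ksign K (degAfter deg s i * t.total deg))
    else 0

/-- Homogeneous elements of arity `n`, degree `d` and weight `w`. -/
noncomputable def piece (K : Type v) [Field K] (ar : G → ℕ) (deg : G → ℤ) (n : ℕ) (d : ℤ) (w : ℕ) :
    Submodule K (Free K ar) :=
  Finsupp.supported K K {t | t.leaves = n ∧ t.total deg = d ∧ t.weight = w}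

/-- Homogeneous operadic ideals of the free operad: submodules that are closed under composition
with arbitrary elements on both sides, and under taking homogeneous components. -/
structure OpIdeal (K : Type v) [Field K] (ar : G → ℕ) (deg : G → ℤ) where
  carrier : Submodule K (Free K ar)
  comp_left : ∀ (i : ℕ) (f g : Free K ar), f ∈ carrier → comp deg i f g ∈ carrier
  comp_right : ∀ (i : ℕ) (f g : Free K ar), g ∈ carrier → comp deg i f g ∈ carrier
  homogeneous : ∀ (n : ℕ) (d : ℤ) (w : ℕ) (f : Free K ar), f ∈ carrier →
    f.filter (fun t => t.leaves = n ∧ t.total deg = d ∧ t.weight = w) ∈ carrier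

/-- The operadic ideal generated by a set `R` (of homogeneous elements). -/
noncomputable def OpIdeal.gen (deg : G → ℤ) (R : Set (Free K ar)) : OpIdeal K ar deg where
  carrier := sInf {I | R ⊆ I ∧ ∃ J : OpIdeal K ar deg, J.carrier = I}
  comp_left i f g hf := by
    simp only [Submodule.mem_sInf] at hf ⊢
    rintro I ⟨hR, J, rfl⟩
    exact J.comp_left i f g (hf _ ⟨hR, J, rfl⟩)
  comp_right i f g hf := by
    simp only [Submodule.mem_sInf] at hf ⊢
    rintro I ⟨hR, J, rfl⟩
    exact J.comp_right i f g (hf _ ⟨hR, J, rfl⟩)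
  homogeneous n d w f hf := by
    simp only [Submodule.mem_sInf] at hf ⊢
    rintro I ⟨hR, J, rfl⟩
    exact J.homogeneous n d w f (hf _ ⟨hR, J, rfl⟩)

theorem comp_mem_piece (deg : G → ℤ) {i n n' w w' : ℕ} {d d' : ℤ} {f g : Free K ar}
    (hf : f ∈ piece K ar deg n d w) (hg : g ∈ piece K ar deg n' d' w') (hi : i < n) :
    comp deg i f g ∈ piece K ar deg (n + n' - 1) (d + d') (w + w') := by
  rw [comp, Finsupp.linearCombination_apply, Finsupp.sum, LinearMap.sum_apply]
  refine Submodule.sum_mem _ fun s hs => ?_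
  rw [LinearMap.smul_apply, Finsupp.linearCombination_apply, Finsupp.sum]
  refine Submodule.smul_mem _ _ (Submodule.sum_mem _ fun t ht => Submodule.smul_mem _ _ ?_)
  obtain ⟨h1, h2, h3⟩ := hf hs
  obtain ⟨h1', h2', h3'⟩ := hg ht
  rw [if_pos (by omega)]
  refine Finsupp.single_mem_supported K _ ⟨?_, ?_, ?_⟩
  · have := leaves_graft t s i (by omega)
    omega
  · rw [total_graft _ _ _ _ (by omega), h2, h2']
  · rw [weight, total_graft _ _ _ _ (by omega)]
    exact congrArg₂ (· + ·) h3 h3'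

end Free

/-! ### The quotient operad `P = F_ns(M)/I` -/

section Quotient

variable {K : Type v} [Field K] {G : Type u} {ar : G → ℕ} {deg : G → ℤ}

/-- The quotient of the free operad by an operadic ideal (the sum over all arities). -/
abbrev OpIdeal.Quot (I : OpIdeal K ar deg) : Type _ := Free K ar ⧸ I.carrier

/-- The partial composition product `∘ᵢ` of the quotient operad. -/
noncomputable def OpIdeal.qcomp (I : OpIdeal K ar deg) (i : ℕ) : I.Quot →ₗ[K] I.Quot →ₗ[K] I.Quot :=
  I.carrier.liftQ
    (LinearMap.flip (I.carrier.liftQ (LinearMap.flip ((comp deg i).compr₂ I.carrier.mkQ)) (by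
      intro g hg
      refine LinearMap.ext fun f => ?_
      exact (Submodule.Quotient.mk_eq_zero _).2 (I.comp_right i f g hg))))
    (by
      intro f hf
      refine LinearMap.ext fun y => ?_
      obtain ⟨g, rfl⟩ := I.carrier.mkQ_surjective y
      exact (Submodule.Quotient.mk_eq_zero _).2 (I.comp_left i f g hf))

theorem OpIdeal.qcomp_mk (I : OpIdeal K ar deg) (i : ℕ) (f g : Free K ar) :
    I.qcomp i (I.carrier.mkQ f) (I.carrier.mkQ g) = I.carrier.mkQ (comp deg i f g) := rfl

/-- Homogeneous elements of arity `n`, degree `d` and weight `w` of the quotient operad. -/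
noncomputable def OpIdeal.qpiece (I : OpIdeal K ar deg) (n : ℕ) (d : ℤ) (w : ℕ) :
    Submodule K I.Quot :=
  (piece K ar deg n d w).map I.carrier.mkQ

theorem OpIdeal.qcomp_mem (I : OpIdeal K ar deg) {i n n' w w' : ℕ} {d d' : ℤ} {x y : I.Quot}
    (hx : x ∈ I.qpiece n d w) (hy : y ∈ I.qpiece n' d' w') (hi : i < n) :
    I.qcomp i x y ∈ I.qpiece (n + n' - 1) (d + d') (w + w') := by
  obtain ⟨f, hf, rfl⟩ := hx
  obtain ⟨g, hg, rfl⟩ := hy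
  exact ⟨_, comp_mem_piece deg hf hg hi, (I.qcomp_mk i f g).symm⟩

end Quotient

/-! ### The bar construction of the quotient operad -/

section Bar

variable {K : Type v} [Field K] {G : Type u} {ar : G → ℕ} {deg : G → ℤ}

/-- Homogeneous elements of the augmentation ideal of the quotient operad, which is the sum of the
components of positive weight. -/
structure Op (I : OpIdeal K ar deg) where
  arity : ℕ
  degree : ℤ
  weight : ℕ
  pos : 0 < weight
  elt : I.Quot
  mem : elt ∈ I.qpiece arity degree weight

variable {I : OpIdeal K ar deg}

/-- Partial composition of homogeneous operations. -/
noncomputable def Op.comp (p : Op I) (j : Fin p.arity) (q : Op I) : Op I where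
  arity := p.arity + q.arity - 1
  degree := p.degree + q.degree
  weight := p.weight + q.weight
  pos := Nat.add_pos_left p.pos _
  elt := I.qcomp j p.elt q.elt
  mem := I.qcomp_mem p.mem q.mem j.2

/-- Planar trees whose vertices are labelled by homogeneous operations, standing for the treewise
tensors with suspended labels, multiplied from bottom to top and from left to right. -/
abbrev BarTree (I : OpIdeal K ar deg) : Type _ := PTree (Op I) Op.arity

/-- Degree of a treewise tensor of suspended operations, used in the signs. -/
def bdeg (T : BarTree I) : ℤ := T.total fun p => p.degree + 1

/-- The total degree of the trees to the left of `c j`. -/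
def leftDeg {n : ℕ} (c : Fin n → BarTree I) (j : Fin n) : ℤ :=
  ∑ k ∈ Finset.univ.filter (· < j), bdeg (c k)

/-- The forest over the vertex obtained by contracting the edge from a vertex `q` with upper trees
`c'` to the entry `j` of a vertex `p` with upper trees `c`. -/
def contractForest (p : Op I) (c : Fin p.arity → BarTree I) (j : Fin p.arity) (q : Op I)
    (c' : Fin q.arity → BarTree I) : Fin (p.comp j q).arity → BarTree I :=
  splice (n := q.arity) c j c'

/-- The contraction, with its sign, of the edge from the root vertex of `T` to the `j`th entry of
the root vertex `p` in the tree with root `p` and upper trees `c` (where `c j = T`). It is zero if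
`T` has no vertex. -/
noncomputable def contractRoot (p : Op I) (c : Fin p.arity → BarTree I) (j : Fin p.arity) :
    BarTree I → (BarTree I →₀ K)
  | leaf => 0
  | node q c' => Finsupp.single (node (p.comp j q) (contractForest p c j q c'))
      (ksign K (p.degree + (q.degree + 1) * leftDeg c j))

/-- Linear extension of the replacement of the tree over the entry `j` of the root vertex. -/
noncomputable def onChild (p : Op I) (c : Fin p.arity → BarTree I) (j : Fin p.arity) :
    (BarTree I →₀ K) →ₗ[K] (BarTree I →₀ K) :=
  Finsupp.lmapDomain K K fun T => node p (Function.update c j T)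

/-- The signed sum of the contractions of all internal edges of a tree. -/
noncomputable def dTree : BarTree I → (BarTree I →₀ K)
  | leaf => 0
  | node p c => ∑ j, (contractRoot p c j (c j)
      + ksign K (p.degree + 1 + leftDeg c j) • onChild p c j (dTree (c j)))

/-- The relations expressing that treewise tensors are linear in the label of every vertex. -/
inductive IsMultRel : (BarTree I →₀ K) → Prop
  | root (n : ℕ) (d : ℤ) (w : ℕ) (pos : 0 < w) (a : K) (x y : I.Quot)
      (hx : x ∈ I.qpiece n d w) (hy : y ∈ I.qpiece n d w) (hxy : a • x + y ∈ I.qpiece n d w)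
      (c : Fin n → BarTree I) :
      IsMultRel (Finsupp.single (node ⟨n, d, w, pos, a • x + y, hxy⟩ c) 1
        - a • Finsupp.single (node ⟨n, d, w, pos, x, hx⟩ c) 1
        - Finsupp.single (node ⟨n, d, w, pos, y, hy⟩ c) 1)
  | child (p : Op I) (c : Fin p.arity → BarTree I) (j : Fin p.arity) (r : BarTree I →₀ K)
      (hr : IsMultRel r) : IsMultRel (onChild p c j r)

variable (I) in
/-- The span of the multilinearity relations. -/
noncomputable def multRel : Submodule K (BarTree I →₀ K) := Submodule.span K {r | IsMultRel r}

theorem onChild_single (p : Op I) (c : Fin p.arity → BarTree I) (j : Fin p.arity) (T : BarTree I)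
    (a : K) : onChild p c j (Finsupp.single T a)
      = Finsupp.single (node p (Function.update c j T)) a := by
  simp [onChild]

theorem onChild_mem (p : Op I) (c : Fin p.arity → BarTree I) (j : Fin p.arity)
    {r : BarTree I →₀ K} (hr : r ∈ multRel I) : onChild p c j r ∈ multRel I := by
  have : multRel I ≤ (multRel I).comap (onChild p c j) := by
    rw [multRel, Submodule.span_le]
    intro r hr
    exact Submodule.subset_span (IsMultRel.child p c j r hr)
  exact this hr

theorem root_mem {n : ℕ} {d : ℤ} {w : ℕ} {pos : 0 < w} {a : K} {x y z : I.Quot}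
    (hx : x ∈ I.qpiece n d w) (hy : y ∈ I.qpiece n d w) (hz : z ∈ I.qpiece n d w)
    (h : z = a • x + y) (c : Fin n → BarTree I) :
    Finsupp.single (node ⟨n, d, w, pos, z, hz⟩ c) 1
        - a • Finsupp.single (node ⟨n, d, w, pos, x, hx⟩ c) 1
        - Finsupp.single (node ⟨n, d, w, pos, y, hy⟩ c) 1 ∈ multRel I := by
  subst h
  exact Submodule.subset_span (IsMultRel.root n d w pos a x y hx hy hz c)

theorem isMultRel_homogeneous {r : BarTree I →₀ K} (hr : IsMultRel r) :
    ∃ e : ℤ, ∀ T ∈ r.support, bdeg T = e := by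
  suffices h : ∃ e : ℤ, r ∈ Finsupp.supported K K {T : BarTree I | bdeg T = e} by
    obtain ⟨e, he⟩ := h
    exact ⟨e, fun T hT => he hT⟩
  induction hr with
  | root n d w pos a x y hx hy hxy c =>
    refine ⟨d + 1 + ∑ j, bdeg (c j), ?_⟩
    refine Submodule.sub_mem _ (Submodule.sub_mem _ ?_ (Submodule.smul_mem _ _ ?_)) ?_ <;>
    exact Finsupp.single_mem_supported K _ rfl
  | child p c j r hr ih =>
    classical
    obtain ⟨e, he⟩ := ih
    refine ⟨p.degree + 1 + (e + ∑ k ∈ Finset.univ.erase j, bdeg (c k)), ?_⟩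
    rw [onChild, Finsupp.lmapDomain_apply, Finsupp.mem_supported]
    intro T hT
    obtain ⟨S, hS, rfl⟩ := Finset.mem_image.1 (Finsupp.mapDomain_support hT)
    have hS' : bdeg S = e := he hS
    change (node p (Function.update c j S)).total _ = _
    rw [total, ← Finset.add_sum_erase _ _ (Finset.mem_univ j), Function.update_self]
    change _ + (bdeg S + _) = _
    rw [hS']
    congr 2
    apply Finset.sum_congr rfl
    intro k hk
    rw [Function.update_of_ne (Finset.ne_of_mem_erase hk)]
    rfl

theorem linComb_mem {r : BarTree I →₀ K} (v : BarTree I → (BarTree I →₀ K)) (κ : K)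
    (F : (BarTree I →₀ K) →ₗ[K] (BarTree I →₀ K))
    (hv : ∀ T ∈ r.support, v T = κ • F (Finsupp.single T 1)) (hF : F r ∈ multRel I) :
    Finsupp.linearCombination K v r ∈ multRel I := by
  have : Finsupp.linearCombination K v r = κ • F r := by
    conv_rhs => rw [← Finsupp.sum_single r]
    rw [Finsupp.linearCombination_apply, Finsupp.sum, Finsupp.sum, map_sum, Finset.smul_sum]
    refine Finset.sum_congr rfl fun T hT => ?_
    rw [hv T hT, smul_comm, ← map_smul, Finsupp.smul_single, smul_eq_mul, mul_one]
  rw [this]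
  exact Submodule.smul_mem _ _ hF

theorem splice_update_left {α : Type*} {m n : ℕ} (c : Fin m → α) (k j : Fin m) (hj : j ≠ k)
    (c' : Fin n → α) :
    ∃ j' : Fin (m + n - 1), ∀ x, splice (Function.update c j x) k c'
      = Function.update (splice c k c') j' x := by
  have hne : j.1 ≠ k.1 := fun h => hj (Fin.ext h)
  by_cases h : j.1 < k.1
  · refine ⟨⟨j.1, by omega⟩, fun x => ?_⟩
    funext i
    simp only [splice, Function.update_apply, Fin.ext_iff]
    split_ifs <;> first | rfl | omega
  · refine ⟨⟨j.1 + n - 1, by omega⟩, fun x => ?_⟩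
    funext i
    simp only [splice, Function.update_apply, Fin.ext_iff]
    split_ifs <;> first | rfl | omega

theorem splice_update_right {α : Type*} {m n : ℕ} (c : Fin m → α) (k : Fin m)
    (c' : Fin n → α) (l : Fin n) :
    ∃ j' : Fin (m + n - 1), ∀ x, splice c k (Function.update c' l x)
      = Function.update (splice c k c') j' x := by
  refine ⟨⟨k.1 + l.1, by omega⟩, fun x => ?_⟩
  funext i
  simp only [splice, Function.update_apply, Fin.ext_iff]
  split_ifs <;> first | rfl | omega

theorem splice_update_self {α : Type*} {m n : ℕ} (c : Fin m → α) (k : Fin m) (c' : Fin n → α)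
    (x : α) : splice (Function.update c k x) k c' = splice c k c' := by
  funext i
  simp only [splice, Function.update_apply, Fin.ext_iff]
  split_ifs <;> first | rfl | omega

theorem leftDeg_update_self {n : ℕ} (c : Fin n → BarTree I) (j : Fin n) (T : BarTree I) :
    leftDeg (Function.update c j T) j = leftDeg c j := by
  unfold leftDeg
  refine Finset.sum_congr rfl fun k hk => ?_
  rw [Function.update_of_ne (Finset.mem_filter.1 hk).2.ne]

theorem leftDeg_update_congr {n : ℕ} (c : Fin n → BarTree I) (j k : Fin n) {S T : BarTree I}
    (h : bdeg S = bdeg T) :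
    leftDeg (Function.update c j S) k = leftDeg (Function.update c j T) k := by
  unfold leftDeg
  refine Finset.sum_congr rfl fun l _ => ?_
  by_cases hl : l = j
  · subst hl
    simpa using h
  · rw [Function.update_of_ne hl, Function.update_of_ne hl]

theorem contractRoot_update_self (p : Op I) (c : Fin p.arity → BarTree I) (j : Fin p.arity)
    (S T : BarTree I) : contractRoot p (Function.update c j S) j T = contractRoot p c j T := by
  cases T with
  | leaf => rfl
  | node q c' =>
    simp only [contractRoot]
    rw [leftDeg_update_self, contractForest, splice_update_self]
    rfl

theorem linComb_contractRoot_mem (p : Op I) (c : Fin p.arity → BarTree I) (j : Fin p.arity)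
    {r : BarTree I →₀ K} (hr : IsMultRel r) :
    Finsupp.linearCombination K (contractRoot p c j) r ∈ multRel I := by
  cases hr with
  | root n d w pos a x y hx hy hxy c' =>
    simp only [map_sub, map_smul, Finsupp.linearCombination_single, one_smul, contractRoot]
    have key := Submodule.smul_mem (multRel I)
      (ksign K (p.degree + (d + 1) * leftDeg c j))
      (root_mem (pos := Nat.add_pos_left p.pos w) (a := a)
        (x := I.qcomp j p.elt x) (y := I.qcomp j p.elt y) (z := I.qcomp j p.elt (a • x + y))
        (I.qcomp_mem p.mem hx j.2) (I.qcomp_mem p.mem hy j.2) (I.qcomp_mem p.mem hxy j.2)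
        (by rw [map_add, map_smul]) (splice c j c'))
    rw [smul_sub, smul_sub, smul_comm _ a] at key
    simp only [Finsupp.smul_single, smul_eq_mul, mul_one] at key ⊢
    exact key
  | child q c' l r' hr' =>
    obtain ⟨l', hl'⟩ : ∃ l' : Fin (p.comp j q).arity, ∀ x,
        contractForest p c j q (Function.update c' l x)
          = Function.update (contractForest p c j q c') l' x := splice_update_right c j c' l
    have : Finsupp.linearCombination K (contractRoot p c j) (onChild q c' l r')
        = Finsupp.linearCombination K
          (fun T => contractRoot p c j (node q (Function.update c' l T))) r' := by
      rw [onChild, Finsupp.lmapDomain_apply, Finsupp.linearCombination_mapDomain]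
      rfl
    rw [this]
    refine linComb_mem _ (ksign K (p.degree + (q.degree + 1) * leftDeg c j))
      (onChild (p.comp j q) (contractForest p c j q c') l') (fun T _ => ?_)
      (onChild_mem _ _ _ (Submodule.subset_span hr'))
    simp only [contractRoot]
    rw [onChild_single, hl', Finsupp.smul_single, smul_eq_mul, mul_one]

theorem linComb_dTree_onChild (p : Op I) (c : Fin p.arity → BarTree I) (j : Fin p.arity)
    (r : BarTree I →₀ K) :
    Finsupp.linearCombination K dTree (onChild p c j r)
      = ∑ k, (Finsupp.linearCombination K
            (fun T => contractRoot p (Function.update c j T) k (Function.update c j T k)) r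
          + Finsupp.linearCombination K
            (fun T => ksign K (p.degree + 1 + leftDeg (Function.update c j T) k) •
              onChild p (Function.update c j T) k (dTree (Function.update c j T k))) r) := by
  induction r using Finsupp.induction_linear with
  | zero => simp
  | add f g hf hg =>
    simp only [map_add, hf, hg, ← Finset.sum_add_distrib]
    refine Finset.sum_congr rfl fun k _ => ?_
    abel
  | single T b =>
    rw [onChild_single]
    simp only [Finsupp.linearCombination_single, dTree, Finset.smul_sum, smul_add]

theorem linComb_dTree_mem {r : BarTree I →₀ K} (hr : IsMultRel r) :
    Finsupp.linearCombination K dTree r ∈ multRel I := by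
  induction hr with
  | root n d w pos a x y hx hy hxy c =>
    simp only [map_sub, map_smul, Finsupp.linearCombination_single, one_smul, dTree]
    rw [Finset.smul_sum, ← Finset.sum_sub_distrib, ← Finset.sum_sub_distrib]
    refine Submodule.sum_mem _ fun j _ => ?_
    rw [smul_add, add_sub_add_comm, add_sub_add_comm]
    refine Submodule.add_mem _ ?_ ?_
    · rcases hT : c j with _ | ⟨q, c'⟩
      · simp [contractRoot]
      · simp only [contractRoot]
        have key := Submodule.smul_mem (multRel I)
          (ksign K (d + (q.degree + 1) * leftDeg c j))
          (root_mem (pos := Nat.add_pos_left pos q.weight) (a := a)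
            (x := I.qcomp j x q.elt) (y := I.qcomp j y q.elt) (z := I.qcomp j (a • x + y) q.elt)
            (I.qcomp_mem hx q.mem j.2) (I.qcomp_mem hy q.mem j.2) (I.qcomp_mem hxy q.mem j.2)
            (by rw [map_add, map_smul]; rfl) (splice c j c'))
        rw [smul_sub, smul_sub, smul_comm _ a] at key
        simp only [Finsupp.smul_single, smul_eq_mul, mul_one] at key ⊢
        exact key
    · rw [smul_comm a, ← smul_sub, ← smul_sub]
      refine Submodule.smul_mem _ _ ?_
      induction dTree (c j) using Finsupp.induction_linear with
      | zero => simp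
      | add f g hf hg =>
        have := Submodule.add_mem _ hf hg
        simp only [map_add, smul_add]
        convert this using 1
        abel
      | single T b =>
        have key := Submodule.smul_mem (multRel I) b
          (root_mem (pos := pos) hx hy hxy rfl (Function.update c j T))
        rw [smul_sub, smul_sub, smul_comm _ a] at key
        simp only [onChild_single]
        simp only [Finsupp.smul_single, smul_eq_mul, mul_one] at key ⊢
        exact key
  | child p c j r hr ih =>
    obtain ⟨e, he⟩ := isMultRel_homogeneous hr
    rw [linComb_dTree_onChild]
    refine Submodule.sum_mem _ fun k _ => Submodule.add_mem _ ?_ ?_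
    · by_cases hk : k = j
      · subst hk
        simp only [Function.update_self, contractRoot_update_self]
        exact linComb_contractRoot_mem p c k hr
      · simp only [Function.update_of_ne hk]
        rcases hT : c k with _ | ⟨q, c'⟩
        · rw [show (fun T => contractRoot p (Function.update c j T) k leaf)
            = fun _ => (0 : BarTree I →₀ K) from rfl]
          simp [Finsupp.linearCombination_apply]
        · obtain ⟨j', hj'⟩ : ∃ j' : Fin (p.comp k q).arity, ∀ x,
              contractForest p (Function.update c j x) k q c'
                = Function.update (contractForest p c k q c') j' x :=
            splice_update_left c k j (Ne.symm hk) c'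
          by_cases hne : r.support.Nonempty
          · obtain ⟨S, hS⟩ := hne
            refine linComb_mem _
              (ksign K (p.degree + (q.degree + 1) * leftDeg (Function.update c j S) k))
              (onChild (p.comp k q) (contractForest p c k q c') j') (fun T hT' => ?_)
              (onChild_mem _ _ _ (Submodule.subset_span hr))
            simp only [contractRoot]
            rw [onChild_single, hj',
              leftDeg_update_congr c j k ((he T hT').trans (he S hS).symm),
              Finsupp.smul_single, smul_eq_mul, mul_one]
          · rw [Finset.not_nonempty_iff_eq_empty, Finsupp.support_eq_empty] at hne
            subst hne
            simp
    · by_cases hk : k = j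
      · subst hk
        simp only [Function.update_self, leftDeg_update_self]
        have : Finsupp.linearCombination K (fun T => ksign K (p.degree + 1 + leftDeg c k) •
              onChild p (Function.update c k T) k (dTree T)) r
            = ksign K (p.degree + 1 + leftDeg c k) •
              onChild p c k (Finsupp.linearCombination K dTree r) := by
          rw [Finsupp.linearCombination_apply, Finsupp.linearCombination_apply, Finsupp.sum,
            Finsupp.sum, map_sum, Finset.smul_sum]
          refine Finset.sum_congr rfl fun T _ => ?_
          rw [map_smul, smul_comm]
          simp [onChild]
        rw [this]
        exact Submodule.smul_mem _ _ (onChild_mem _ _ _ ih)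
      · simp only [Function.update_of_ne hk]
        by_cases hne : r.support.Nonempty
        · obtain ⟨S, hS⟩ := hne
          induction dTree (c k) using Finsupp.induction_linear with
          | zero => simp [Finsupp.linearCombination_apply]
          | add f g hf hg =>
            have := Submodule.add_mem _ hf hg
            rw [Finsupp.linearCombination_apply, Finsupp.linearCombination_apply,
              ← Finsupp.sum_add] at this
            rw [Finsupp.linearCombination_apply]
            simpa only [map_add, smul_add] using this
          | single U b =>
            refine linComb_mem _
              (ksign K (p.degree + 1 + leftDeg (Function.update c j S) k) * b)
              (onChild p (Function.update c k U) j) (fun T hT' => ?_)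
              (onChild_mem _ _ _ (Submodule.subset_span hr))
            rw [leftDeg_update_congr c j k ((he T hT').trans (he S hS).symm), mul_smul,
              onChild_single, onChild_single, Function.update_comm hk, Finsupp.smul_single,
              Finsupp.smul_single, Finsupp.smul_single]
            simp
        · rw [Finset.not_nonempty_iff_eq_empty, Finsupp.support_eq_empty] at hne
          subst hne
          simp

variable (I) in
/-- The bar construction of the quotient operad (the sum over all arities): the sum over all planar
trees of the modules of treewise tensors with labels in the suspended augmentation ideal. -/
abbrev Bar : Type _ := (BarTree I →₀ K) ⧸ multRel I

variable (I) in
/-- The differential of the bar construction. -/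
noncomputable def barDiff : Bar I →ₗ[K] Bar I :=
  (multRel I).mapQ (multRel I) (Finsupp.linearCombination K dTree) (by
    rw [multRel, Submodule.span_le]
    intro r hr
    exact linComb_dTree_mem hr)

variable (I) in
/-- The part `B_d(P)_(s)` of the bar construction spanned by the tensors on trees with `d` vertices,
whose labels have total weight `s`. -/
noncomputable def barPiece (d s : ℕ) : Submodule K (Bar I) :=
  (Finsupp.supported K K {T : BarTree I | T.weight = d ∧ T.total Op.weight = s}).map
    (multRel I).mkQ

variable (I) in
/-- The quotient operad is Koszul: the homology of the weight `s` part of its bar construction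
vanishes in every degree `d ≠ s`. -/
def IsKoszul : Prop :=
  ∀ d s : ℕ, d ≠ s →
    barPiece I d s ⊓ LinearMap.ker (barDiff I) = (barPiece I (d + 1) s).map (barDiff I)

end Bar

/-! ### Non-symmetric Poincaré–Birkhoff–Witt bases -/

section PBW

variable {K : Type v} [Field K] {G : Type u} {ar : G → ℕ} {deg : G → ℤ}

/-- A partial order on the monomial basis of the free operad that is compatible with the partial
composition products. Only the restrictions to the monomials of a given arity matter. -/
structure IsMonomialOrder (le : PTree G ar → PTree G ar → Prop) : Prop where
  refl : ∀ t, le t t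
  trans : ∀ s t u, le s t → le t u → le s u
  antisymm : ∀ s t, le s t → le t s → s = t
  graft : ∀ s s' t t' : PTree G ar, s.leaves = s'.leaves → t.leaves = t'.leaves →
    le s s' → le t t' → ∀ i < s.leaves, le (graft s i t) (graft s' i t')

/-- `B` is a non-symmetric Poincaré–Birkhoff–Witt basis of the quotient of the free operad by `I`,
for the order `le` on monomials. -/
structure IsPBWBasis (I : OpIdeal K ar deg) (le : PTree G ar → PTree G ar → Prop)
    (B : Set (PTree G ar)) : Prop where
  order : IsMonomialOrder le
  one_mem : leaf ∈ B
  corolla_mem : ∀ g, corolla g ∈ B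
  linearIndependent : LinearIndependent K fun t : B => I.carrier.mkQ (Finsupp.single t.1 1)
  span_eq_top : Submodule.span K
    (Set.range fun t : B => I.carrier.mkQ (Finsupp.single t.1 1)) = ⊤
  comp_mem_or : ∀ α ∈ B, ∀ β ∈ B, ∀ i < α.leaves, graft α i β ∈ B ∨
    ∃ c : Free K ar, (c.support : Set (PTree G ar)) ⊆ B ∧
      I.carrier.mkQ (comp deg i (Finsupp.single α 1) (Finsupp.single β 1)) = I.carrier.mkQ c ∧
      ∀ γ ∈ c.support, le (graft α i β) γ ∧ graft α i β ≠ γ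
  mem_iff : ∀ t, t ∈ B ↔ ∀ q, EdgeSub t q → q ∈ B

/-- The monomials none of whose restrictions to the subtree generated by an internal edge belongs
to `B`. -/
def complementaryBasis (B : Set (PTree G ar)) : Set (PTree G ar) :=
  {t | ∀ q, EdgeSub t q → q ∉ B}

end PBW

/-! ### The Koszul dual operad -/

section Dual

variable {K : Type v} [Field K] {G : Type u} {ar : G → ℕ} {deg : G → ℤ}

theorem single_corolla_mem (deg : G → ℤ) (g : G) :
    (Finsupp.single (corolla g) 1 : Free K ar) ∈ piece K ar deg (ar g) (deg g) 1 :=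
  Finsupp.single_mem_supported K _ (by simp [corolla, leaves, weight, total])

/-- A generator, as an operation of the quotient operad. -/
noncomputable def genOp (I : OpIdeal K ar deg) (g : G) : Op I where
  arity := ar g
  degree := deg g
  weight := 1
  pos := one_pos
  elt := I.carrier.mkQ (Finsupp.single (corolla g) 1)
  mem := ⟨_, single_corolla_mem deg g, rfl⟩

/-- A monomial, as a treewise tensor in the bar construction, all of whose labels are generators. -/
noncomputable def toBarTree (I : OpIdeal K ar deg) : PTree G ar → BarTree I
  | leaf => leaf
  | node g c => node (genOp I g) (fun j => toBarTree I (c j))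

/-- The inclusion in the bar construction of the cofree cooperad `F^c(ΣM)`, identified with the
diagonal part `⨁_s B_s(P)_(s)` of the bar construction of a quadratic operad. -/
noncomputable def diagIncl (I : OpIdeal K ar deg) : Free K ar →ₗ[K] Bar I :=
  (multRel I).mkQ ∘ₗ Finsupp.lmapDomain K K (toBarTree I)

/-- The Koszul construction `K(P)`, with `K(P)_(s) = ker (δ : B_s(P)_(s) → B_{s-1}(P)_(s))`. -/
noncomputable def koszulConstruction (I : OpIdeal K ar deg) : Submodule K (Free K ar) :=
  LinearMap.ker (barDiff I ∘ₗ diagIncl I)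

/-- The degrees of the generators of `Σ⁻¹ M^#`. The dual basis of the basis `G` of `M`, being again
indexed by `G`, the monomials of the free operad on `Σ⁻¹ M^#` are again the trees with labels
in `G`. -/
def dualDeg (deg : G → ℤ) (g : G) : ℤ := -deg g - 1

variable (K ar) in
/-- The pairing of `F_ns(Σ⁻¹ M^#)` with `F^c(ΣM)` for which the monomials form dual bases. -/
noncomputable def pairing : Free K ar →ₗ[K] Module.Dual K (Free K ar) :=
  Finsupp.linearCombination K fun t => Finsupp.lapply t

/-- The restriction of functionals to `K(P)`. When there are finitely many generators in every
arity its image is the graded dual `K(P)^#`, whose operad structure, dual to the cooperad structure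
of `K(P) ⊆ F^c(ΣM)`, is the quotient of that of `F_ns(Σ⁻¹ M^#)`. -/
noncomputable def toKoszulDual (I : OpIdeal K ar deg) :
    Free K ar →ₗ[K] Module.Dual K (koszulConstruction I) :=
  (koszulConstruction I).subtype.dualMap ∘ₗ pairing K ar

/-- The quadratic relations of the dual operad: the orthogonal in weight two of `R`, with the
suspension sign `(-1) ^ |x₁|` of a tensor with root label `x₁`. -/
def dualRel (deg : G → ℤ) (R : Set (Free K ar)) : Set (Free K ar) :=
  {f | (∀ t ∈ f.support, t.weight = 2) ∧
    ∀ r ∈ R, (f.sum fun t a => ksign K (rootDeg deg t) * a * r t) = 0}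

end Dual

/-! ### Symmetrization -/

section Symmetric

variable {G : Type u} {ar : G → ℕ}

/-- A planar tree together with a bijective numbering of its entries by `0, …, n - 1`; `lab` lists
the numbers from left to right. These form (up to signs) the monomial basis of
`F(M ⊗ Σ_*) = F_ns(M) ⊗ Σ_*`, where the basis of `M ⊗ Σ_*` is `G × Σ_*`. -/
structure SymTree (G : Type u) (ar : G → ℕ) where
  tree : PTree G ar
  lab : List ℕ
  perm : lab.Perm (List.range tree.leaves)

/-- The list of labels of the composite of two numbered trees at the entry `i` of the first, if the
second has `n` entries and labels `m`. -/
def labComp (l : List ℕ) (i n : ℕ) (m : List ℕ) : List ℕ :=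
  l.flatMap fun x => if x < i then [x] else if x = i then m.map (· + i) else [x + n - 1]

theorem labComp_perm {l m : List ℕ} {M n i : ℕ} (hl : l.Perm (List.range M))
    (hm : m.Perm (List.range n)) (hi : i < M) :
    (labComp l i n m).Perm (List.range (M + n - 1)) := by
  have hln : l.Nodup := hl.nodup_iff.2 List.nodup_range
  have hmn : m.Nodup := hm.nodup_iff.2 List.nodup_range
  have hlm : ∀ x, x ∈ l ↔ x < M := fun x => hl.mem_iff.trans List.mem_range
  have hmm : ∀ x, x ∈ m ↔ x < n := fun x => hm.mem_iff.trans List.mem_range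
  have key : ∀ x k, k ∈ (if x < i then [x] else if x = i then m.map (· + i) else [x + n - 1]) ↔
      (x < i ∧ k = x) ∨ (x = i ∧ i ≤ k ∧ k < n + i) ∨ (i < x ∧ k = x + n - 1) := by
    intro x k
    split_ifs with h1 h2
    · simp only [List.mem_singleton]
      omega
    · simp only [List.mem_map, hmm]
      constructor
      · rintro ⟨a, ha, rfl⟩
        omega
      · intro h
        exact ⟨k - i, by omega, by omega⟩
    · simp only [List.mem_singleton]
      omega
  refine (List.perm_ext_iff_of_nodup ?_ List.nodup_range).2 ?_
  · rw [labComp, List.nodup_flatMap]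
    refine ⟨fun x _ => ?_, ?_⟩
    · split_ifs
      · exact List.nodup_singleton _
      · exact hmn.map (add_left_injective i)
      · exact List.nodup_singleton _
    · refine hln.imp ?_
      intro x y hxy k hx hy
      rw [key] at hx hy
      omega
  · intro k
    rw [labComp, List.mem_flatMap, List.mem_range]
    simp only [key, hlm]
    constructor
    · rintro ⟨x, hx, h⟩
      omega
    · intro hk
      by_cases h1 : k < i
      · exact ⟨k, by omega, by omega⟩
      · by_cases h2 : k < n + i
        · exact ⟨i, by omega, by omega⟩
        · exact ⟨k + 1 - n, by omega, by omega⟩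

theorem map_perm_range (w : Equiv.Perm ℕ) {l : List ℕ} {N : ℕ} (hl : l.Perm (List.range N))
    (hw : ∀ k, N ≤ k → w k = k) : (l.map w).Perm (List.range N) := by
  refine (hl.map w).trans ?_
  refine (List.perm_ext_iff_of_nodup (List.nodup_range.map w.injective) List.nodup_range).2 ?_
  intro k
  simp only [List.mem_map, List.mem_range]
  constructor
  · rintro ⟨a, ha, rfl⟩
    by_contra h
    have := w.injective (hw (w a) (by omega))
    omega
  · intro hk
    refine ⟨w.symm k, ?_, by simp⟩
    by_contra h
    have := hw (w.symm k) (by omega)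
    rw [Equiv.apply_symm_apply] at this
    omega

theorem leaves_graft_idxOf (x : SymTree G ar) (i : ℕ) (hi : i < x.tree.leaves) (t : PTree G ar) :
    (graft x.tree (x.lab.idxOf i) t).leaves = x.tree.leaves + t.leaves - 1 := by
  have h : x.lab.idxOf i < x.tree.leaves := by
    have := List.idxOf_lt_length_of_mem (x.perm.mem_iff.2 (List.mem_range.2 hi))
    rwa [x.perm.length_eq, List.length_range] at this
  have := leaves_graft t x.tree _ h
  omega

/-- The partial composite `x ∘ᵢ y`: the root of `y` is grafted on the entry of `x` with number `i`
and the entries are renumbered. -/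
def SymTree.comp (x : SymTree G ar) (i : ℕ) (y : SymTree G ar) (hi : i < x.tree.leaves) :
    SymTree G ar where
  tree := graft x.tree (x.lab.idxOf i) y.tree
  lab := labComp x.lab i y.tree.leaves y.lab
  perm := by
    rw [leaves_graft_idxOf x i hi]
    exact labComp_perm x.perm y.perm hi

/-- The action on numbered trees of a permutation of `0, …, n - 1` (a permutation of `ℕ` that fixes
all `k ≥ n`). -/
def SymTree.relabel (x : SymTree G ar) (w : Equiv.Perm ℕ)
    (hw : ∀ k, x.tree.leaves ≤ k → w k = k) : SymTree G ar where
  tree := x.tree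
  lab := x.lab.map w
  perm := map_perm_range w x.perm hw

/-- `w` is a pointed shuffle for a composite `α ∘ᵢ β`, where `α` has `m` and `β` has `n` entries. In
`α ∘ᵢ β` the entries of `β` have the numbers `i, …, i + n - 1`. -/
structure IsPointedShuffle (w : Equiv.Perm ℕ) (m n i : ℕ) : Prop where
  fix : ∀ k, m + n - 1 ≤ k → w k = k
  point : w i = i
  mono_right : StrictMonoOn w (Set.Ico i (i + n))
  mono_left : StrictMonoOn w {k | k ≤ i ∨ i + n ≤ k}

/-- The composite `w . x ∘ᵢ y`, for a pointed shuffle `w`. -/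
def SymTree.shuffleComp (x : SymTree G ar) (i : ℕ) (y : SymTree G ar) (hi : i < x.tree.leaves)
    (w : Equiv.Perm ℕ) (hw : IsPointedShuffle w x.tree.leaves y.tree.leaves i) : SymTree G ar :=
  (x.comp i y hi).relabel w (fun k hk => hw.fix k (by
    rwa [SymTree.comp, leaves_graft_idxOf x i hi] at hk))

/-- The part of a list of labels of a forest that belongs to the tree `c j`. -/
def labBlock {n : ℕ} (c : Fin n → PTree G ar) (l : List ℕ) (j : Fin n) : List ℕ :=
  (l.drop (offset c j)).take (c j).leaves

/-- The minimum of the labels of the entries of the tree `c j` in a forest. -/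
noncomputable def minLab {n : ℕ} (c : Fin n → PTree G ar) (l : List ℕ) (j : Fin n) : ℕ :=
  sInf {k | k ∈ labBlock c l j}

/-- `LabEdgeSub t l q m`: in the tree `t` with list of labels `l`, one of the internal edges
generates the tensor `q`, and `m` lists, for the entries of `q` from left to right, the minima of
the labels of the entries of `t` above them. -/
inductive LabEdgeSub : PTree G ar → List ℕ → PTree G ar → List ℕ → Prop
  | root (g : G) (c : Fin (ar g) → PTree G ar) (j : Fin (ar g)) (h : G)
      (c' : Fin (ar h) → PTree G ar) (hc : c j = node h c') (l : List ℕ) :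
      LabEdgeSub (node g c) l (twoVertex g j h) ((List.finRange (ar g)).flatMap fun k =>
        if k = j then (List.finRange (ar h)).map (minLab c' (labBlock c l j)) else [minLab c l k])
  | child (g : G) (c : Fin (ar g) → PTree G ar) (j : Fin (ar g)) (l : List ℕ) (q : PTree G ar)
      (m : List ℕ) (hq : LabEdgeSub (c j) (labBlock c l j) q m) : LabEdgeSub (node g c) l q m

/-- `x.EdgeSub y`: `y` is the restriction of `x` to the subtree generated by one of the internal
edges of `x`, numbered in the order of the minima of the entries of `x` above each entry. -/
def SymTree.EdgeSub (x y : SymTree G ar) : Prop :=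
  ∃ m, LabEdgeSub x.tree x.lab y.tree m ∧ y.lab = m.map fun k => m.countP (· < k)

/-- A tree with the entries numbered from left to right. -/
def SymTree.std (t : PTree G ar) : SymTree G ar := ⟨t, List.range t.leaves, List.Perm.refl _⟩

/-- The extension of an order on monomials to numbered monomials: trees with different numberings
are not compared. -/
def symLe (le : PTree G ar → PTree G ar → Prop) (x y : SymTree G ar) : Prop :=
  x.lab = y.lab ∧ le x.tree y.tree

/-- A partial order on the monomials that is compatible with pointed shuffles of partial
composites. -/
structure IsSymMonomialOrder (le : SymTree G ar → SymTree G ar → Prop) : Prop where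
  refl : ∀ x, le x x
  trans : ∀ x y z, le x y → le y z → le x z
  antisymm : ∀ x y, le x y → le y x → x = y
  comp : ∀ (x x' y y' : SymTree G ar) (hx : x.tree.leaves = x'.tree.leaves)
    (hy : y.tree.leaves = y'.tree.leaves), le x x' → le y y' →
    ∀ (i : ℕ) (hi : i < x.tree.leaves) (w : Equiv.Perm ℕ)
      (hw : IsPointedShuffle w x.tree.leaves y.tree.leaves i),
      le (x.shuffleComp i y hi w hw) (x'.shuffleComp i y' (hx ▸ hi) w (hx ▸ hy ▸ hw))

variable (K : Type v) [Field K]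

/-- The free operad `F(M ⊗ Σ_*) = F_ns(M) ⊗ Σ_*` (the sum over all arities), given by its monomial
basis. -/
abbrev SymFree (G : Type u) (ar : G → ℕ) : Type _ := SymTree G ar →₀ K

variable {K}

/-- The partial composition product `∘ᵢ` of the free operad. -/
noncomputable def symComp (deg : G → ℤ) (i : ℕ) :
    SymFree K G ar →ₗ[K] SymFree K G ar →ₗ[K] SymFree K G ar :=
  Finsupp.linearCombination K fun x => Finsupp.linearCombination K fun y =>
    if hi : i < x.tree.leaves then
      Finsupp.single (x.comp i y hi)
        (ksign K (degAfter deg x.tree (x.lab.idxOf i) * y.tree.total deg))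
    else 0

open Classical in
/-- The action of a permutation on the free operad; it is zero on the components of those arities
`n` for which `w` does not fix all `k ≥ n`. -/
noncomputable def symAct (w : Equiv.Perm ℕ) : SymFree K G ar →ₗ[K] SymFree K G ar :=
  Finsupp.linearCombination K fun x =>
    if hw : ∀ k, x.tree.leaves ≤ k → w k = k then Finsupp.single (x.relabel w hw) 1 else 0

/-- The inclusion `F_ns(M) → F_ns(M) ⊗ Σ_*`. -/
noncomputable def symIncl : Free K ar →ₗ[K] SymFree K G ar :=
  Finsupp.lmapDomain K K SymTree.std

/-- Homogeneous operadic ideals of the free operad `F(M ⊗ Σ_*)`. -/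
structure SymIdeal (K : Type v) [Field K] (ar : G → ℕ) (deg : G → ℤ) where
  carrier : Submodule K (SymFree K G ar)
  comp_left : ∀ (i : ℕ) (f g : SymFree K G ar), f ∈ carrier → symComp deg i f g ∈ carrier
  comp_right : ∀ (i : ℕ) (f g : SymFree K G ar), g ∈ carrier → symComp deg i f g ∈ carrier
  act : ∀ (w : Equiv.Perm ℕ) (f : SymFree K G ar), f ∈ carrier → symAct w f ∈ carrier
  homogeneous : ∀ (n : ℕ) (d : ℤ) (w : ℕ) (f : SymFree K G ar), f ∈ carrier →
    f.filter (fun x => x.tree.leaves = n ∧ x.tree.total deg = d ∧ x.tree.weight = w) ∈ carrier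

/-- The operadic ideal generated by a set `R` (of homogeneous elements). -/
noncomputable def SymIdeal.gen (deg : G → ℤ) (R : Set (SymFree K G ar)) : SymIdeal K ar deg where
  carrier := sInf {I | R ⊆ I ∧ ∃ J : SymIdeal K ar deg, J.carrier = I}
  comp_left i f g hf := by
    simp only [Submodule.mem_sInf] at hf ⊢
    rintro I ⟨hR, J, rfl⟩
    exact J.comp_left i f g (hf _ ⟨hR, J, rfl⟩)
  comp_right i f g hf := by
    simp only [Submodule.mem_sInf] at hf ⊢
    rintro I ⟨hR, J, rfl⟩
    exact J.comp_right i f g (hf _ ⟨hR, J, rfl⟩)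
  act w f hf := by
    simp only [Submodule.mem_sInf] at hf ⊢
    rintro I ⟨hR, J, rfl⟩
    exact J.act w f (hf _ ⟨hR, J, rfl⟩)
  homogeneous n d w f hf := by
    simp only [Submodule.mem_sInf] at hf ⊢
    rintro I ⟨hR, J, rfl⟩
    exact J.homogeneous n d w f (hf _ ⟨hR, J, rfl⟩)

/-- The submodule `I ⊗ Σ_*` of `F_ns(M) ⊗ Σ_*`, the quotient by which is `P ⊗ Σ_*`. -/
noncomputable def symmetrize {deg : G → ℤ} (I : OpIdeal K ar deg) :
    Submodule K (SymFree K G ar) :=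
  Submodule.span K {x | ∃ f ∈ I.carrier, ∃ w : Equiv.Perm ℕ, x = symAct w (symIncl f)}

/-- `B` is a (symmetric) Poincaré–Birkhoff–Witt basis of the quotient of the free operad
`F(M ⊗ Σ_*)` by `I`, for the order `le` on monomials. -/
structure IsSymPBWBasis {deg : G → ℤ} (I : SymIdeal K ar deg)
    (le : SymTree G ar → SymTree G ar → Prop) (B : Set (SymTree G ar)) : Prop where
  order : IsSymMonomialOrder le
  one_mem : SymTree.std leaf ∈ B
  corolla_mem : ∀ (x : SymTree G ar) (g : G), x.tree = corolla g → x ∈ B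
  linearIndependent : LinearIndependent K fun x : B => I.carrier.mkQ (Finsupp.single x.1 1)
  span_eq_top : Submodule.span K
    (Set.range fun x : B => I.carrier.mkQ (Finsupp.single x.1 1)) = ⊤
  comp_mem_or : ∀ x ∈ B, ∀ y ∈ B, ∀ (i : ℕ) (hi : i < x.tree.leaves) (w : Equiv.Perm ℕ)
    (hw : IsPointedShuffle w x.tree.leaves y.tree.leaves i), x.shuffleComp i y hi w hw ∈ B ∨
      ∃ c : SymFree K G ar, (c.support : Set (SymTree G ar)) ⊆ B ∧
        I.carrier.mkQ (symAct w (symComp deg i (Finsupp.single x 1) (Finsupp.single y 1)))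
          = I.carrier.mkQ c ∧
        ∀ z ∈ c.support, le (x.shuffleComp i y hi w hw) z ∧ x.shuffleComp i y hi w hw ≠ z
  mem_iff : ∀ x, x ∈ B ↔ ∀ y, x.EdgeSub y → y ∈ B

/-- The orbits of a set of monomials under the symmetric groups. -/
def orbits (B : Set (PTree G ar)) : Set (SymTree G ar) := {x | x.tree ∈ B}

end Symmetric

end NSOp

open NSOp

/-! Call an internal edge of a monomial good if its restriction is in `B`. Treewise tensors are
multilinear in the labels, so the bar construction has as basis the trees labelled by elements of
`B` of positive weight (`Model B`, `IsPBWBasis.barBasis`). Composing all labels of such a tree gives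
a monomial (`flat`). By condition 2, the trees with composite `t` correspond to the subsets of the
good edges of `t`, namely those edges that lie inside a label.

The differential contracts the edges between labels. Contracting a good edge keeps the composite.
When any other edge is contracted, condition 1 rewrites the new label in strictly larger monomials,
and the compatibility of the order makes the composite strictly larger. Filtered by the composite,
the bar construction is therefore, for each `t`, the cube on the good edges of `t`. This cube is
acyclic if there is a good edge. If there is none, all labels are generators and the only tree lies
on the diagonal. This is (a).

The cubes are contracted by a matching: `Toggle` moves the first good edge into a label, and
`Marked` says that it already is in one. `exists_eq_of_matching` passes from the cubes to the whole
complex by induction on the number of monomials above the composite. This number is finite because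
arities are positive and each arity has finitely many generators. The resulting exactness
`IsPBWBasis.exact` also holds on the subcomplex given by any upward closed set of monomials.

For (b), let `t` have no good edge. The boundary of the diagonal tree of `t` is a cycle supported on
monomials strictly above `t`, so it is also the boundary of a chain supported there. The difference
is an element of the Koszul construction with lowest term `t`
(`IsPBWBasis.exists_mem_koszulConstruction`). Hence the complementary monomials are linearly
independent as functionals on `K(P)`. On the other side, for a two-vertex monomial in `B` the
coordinate functional at it is, up to signs, a dual relation of which it is the largest term. So
every monomial reduces, modulo the ideal generated by `R'`, to smaller complementary ones
(`IsPBWBasis.exists_complementary_rep`). Finally this ideal vanishes on `K(P)`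
(`gen_dualRel_le_ker`): each composite relation is, up to a scalar, a functional on the bar
construction composed with the differential. Spanning modulo the smaller space and independence
modulo the larger one force the two to agree and give the basis.

For (c), composition in `F_ns(M) ⊗ Σ_*` acts separately on trees and on numberings. The generated
ideal is `I ⊗ Σ_*` (`gen_symIncl_eq`), and every condition can be checked for one numbering at a
time. A shuffle only changes the numbering. Edge restrictions of numbered trees exist because minima
over disjoint blocks are distinct. -/

namespace NSOp

/-! ### Planar trees over sequences of subtrees, and simultaneous grafting. -/

namespace PTree

variable {G : Type u} {ar : G → ℕ}

/-- A finite forest, extended by `leaf` to a sequence of trees. -/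
def ext {n : ℕ} (c : Fin n → PTree G ar) (i : ℕ) : PTree G ar :=
  if h : i < n then c ⟨i, h⟩ else leaf

/-- The tree with root `g` and the first `ar g` trees of the sequence `c` over it. -/
def nd (g : G) (c : ℕ → PTree G ar) : PTree G ar := node g (fun j => c j)

/-- The number of entries of the first `a` trees of a sequence. -/
def pos (c : ℕ → PTree G ar) (a : ℕ) : ℕ := ∑ i ∈ Finset.range a, (c i).leaves

/-- Grafting of a tree of the sequence `c` on every entry of a tree. -/
def graftAll : PTree G ar → (ℕ → PTree G ar) → PTree G ar
  | leaf, c => c 0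
  | node g β, c => node g (fun j => graftAll (β j) (fun i => c (offset β j + i)))

@[simp] theorem ext_fin {n : ℕ} (c : Fin n → PTree G ar) (j : Fin n) : ext c j = c j := by
  simp [ext]

theorem ext_of_lt {n : ℕ} (c : Fin n → PTree G ar) {j : ℕ} (h : j < n) : ext c j = c ⟨j, h⟩ := by
  simp [ext, h]

theorem nd_ext (g : G) (c : Fin (ar g) → PTree G ar) : nd g (ext c) = node g c := by
  simp [nd]

theorem nd_congr (g : G) {c c' : ℕ → PTree G ar} (h : ∀ j < ar g, c j = c' j) :
    nd g c = nd g c' := by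
  unfold nd
  congr 1
  funext j
  exact h j j.2

theorem nd_inj {g g' : G} {c c' : ℕ → PTree G ar} (h : nd g c = nd g' c') :
    g = g' ∧ ∀ j < ar g, c j = c' j := by
  unfold nd at h
  injection h with h1 h2
  subst h1
  refine ⟨rfl, fun j hj => ?_⟩
  exact congrFun (eq_of_heq h2) ⟨j, hj⟩

theorem nd_ne_leaf (g : G) (c : ℕ → PTree G ar) : nd g c ≠ leaf := by
  unfold nd
  intro h
  cases h

theorem leaf_or_nd (t : PTree G ar) : t = leaf ∨ ∃ g c, t = nd g c := by
  cases t with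
  | leaf => exact Or.inl rfl
  | node g c => exact Or.inr ⟨g, ext c, (nd_ext g c).symm⟩

theorem nd_induction {P : PTree G ar → Prop} (hl : P leaf)
    (hn : ∀ (g : G) (c : ℕ → PTree G ar), (∀ j < ar g, P (c j)) → P (nd g c)) :
    ∀ t, P t
  | leaf => hl
  | node g c => by
    rw [← nd_ext]
    refine hn g (ext c) fun j hj => ?_
    rw [ext_of_lt c hj]
    exact nd_induction hl hn (c ⟨j, hj⟩)

theorem offset_nd {n : ℕ} (c : ℕ → PTree G ar) (j : Fin n) :
    offset (fun k : Fin n => c k) j = pos c j := by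
  unfold offset pos
  refine Finset.sum_bij (fun k _ => k.1) ?_ ?_ ?_ ?_
  · intro a ha
    exact Finset.mem_range.2 (Finset.mem_filter.1 ha).2
  · intro a _ b _ h
    exact Fin.ext h
  · intro b hb
    simp only [Finset.mem_range] at hb
    exact ⟨⟨b, hb.trans j.2⟩, Finset.mem_filter.2 ⟨Finset.mem_univ _, hb⟩, rfl⟩
  · intros
    rfl

@[simp] theorem pos_zero (c : ℕ → PTree G ar) : pos c 0 = 0 := rfl

theorem pos_succ (c : ℕ → PTree G ar) (a : ℕ) : pos c (a + 1) = pos c a + (c a).leaves :=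
  Finset.sum_range_succ _ _

theorem pos_mono (c : ℕ → PTree G ar) : Monotone (pos c) :=
  monotone_nat_of_le_succ fun a => by rw [pos_succ]; omega

theorem pos_congr {c c' : ℕ → PTree G ar} {a : ℕ} (h : ∀ i < a, c i = c' i) :
    pos c a = pos c' a :=
  Finset.sum_congr rfl fun i hi => by rw [h i (Finset.mem_range.1 hi)]

theorem pos_add (c : ℕ → PTree G ar) (a b : ℕ) :
    pos c (a + b) = pos c a + pos (fun i => c (a + i)) b :=
  Finset.sum_range_add _ _ _

theorem pos_exists (c : ℕ → PTree G ar) {n i : ℕ} (h : i < pos c n) :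
    ∃ j < n, ∃ q < (c j).leaves, i = pos c j + q := by
  induction n with
  | zero => simp at h
  | succ n ih =>
    by_cases h' : i < pos c n
    · obtain ⟨j, hj, q, hq, e⟩ := ih h'
      exact ⟨j, hj.trans n.lt_succ_self, q, hq, e⟩
    · rw [pos_succ] at h
      exact ⟨n, n.lt_succ_self, i - pos c n, by omega, by omega⟩

theorem pos_add_lt (c : ℕ → PTree G ar) {j n q : ℕ} (hj : j < n) (hq : q < (c j).leaves) :
    pos c j + q < pos c n := by
  have := pos_mono c (Nat.succ_le_of_lt hj)
  rw [Nat.succ_eq_add_one, pos_succ] at this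
  omega

theorem pos_unique (c : ℕ → PTree G ar) {j k q r : ℕ} (hq : q < (c j).leaves)
    (hr : r < (c k).leaves) (h : pos c j + q = pos c k + r) : j = k ∧ q = r := by
  rcases lt_trichotomy j k with hjk | rfl | hjk
  · have := pos_add_lt c hjk hq
    omega
  · exact ⟨rfl, by omega⟩
  · have := pos_add_lt c hjk hr
    omega

@[simp] theorem leaves_leaf : (leaf : PTree G ar).leaves = 1 := rfl

theorem leaves_nd (g : G) (c : ℕ → PTree G ar) : (nd g c).leaves = pos c (ar g) := by
  unfold nd pos
  rw [leaves, Finset.sum_range]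

@[simp] theorem total_leaf {A : Type*} [AddCommMonoid A] (f : G → A) :
    (leaf : PTree G ar).total f = 0 := rfl

theorem total_nd {A : Type*} [AddCommMonoid A] (f : G → A) (g : G) (c : ℕ → PTree G ar) :
    (nd g c).total f = f g + ∑ j ∈ Finset.range (ar g), (c j).total f := by
  unfold nd
  rw [total, Finset.sum_range]

theorem graft_nd (g : G) (c : ℕ → PTree G ar) {j q : ℕ} (hj : j < ar g) (hq : q < (c j).leaves)
    (t : PTree G ar) :
    graft (nd g c) (pos c j + q) t = nd g (Function.update c j (graft (c j) q t)) := by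
  unfold nd
  rw [graft_node g _ _ t ⟨j, hj⟩ (by rw [offset_nd]; simp only; omega), offset_nd]
  congr 1
  funext k
  by_cases h : k = ⟨j, hj⟩
  · subst h
    simp
  · rw [Function.update_of_ne h, Function.update_of_ne (fun e => h (Fin.ext e))]

theorem degAfter_nd (deg : G → ℤ) (g : G) (c : ℕ → PTree G ar) {j q : ℕ} (hj : j < ar g)
    (hq : q < (c j).leaves) :
    degAfter deg (nd g c) (pos c j + q)
      = degAfter deg (c j) q + ∑ k ∈ Finset.Ico (j + 1) (ar g), (c k).total deg := by
  unfold nd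
  rw [degAfter]
  simp only [offset_nd]
  rw [← Finset.sum_range (fun k => if pos c j + q < pos c k then total deg (c k)
      else if pos c j + q < pos c k + leaves (c k) then degAfter deg (c k) (pos c j + q - pos c k)
      else 0), Finset.range_eq_Ico, ← Finset.sum_Ico_consecutive _ (Nat.zero_le (j + 1)) hj,
    ← Finset.range_eq_Ico, Finset.sum_range_succ, Finset.sum_eq_zero, zero_add]
  · congr 1
    · rw [if_neg (by omega), if_pos (by omega)]
      congr 1
      omega
    · refine Finset.sum_congr rfl fun k hk => ?_
      rw [Finset.mem_Ico] at hk
      rw [if_pos]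
      exact pos_add_lt c hk.1 hq
  · intro k hk
    rw [Finset.mem_range] at hk
    have h2 : pos c k + (c k).leaves ≤ pos c j := by
      rw [← pos_succ]
      exact pos_mono c hk
    rw [if_neg (by omega), if_neg (by omega)]

@[simp] theorem graftAll_leaf_left (c : ℕ → PTree G ar) : graftAll leaf c = c 0 := rfl

theorem graftAll_nd (g : G) (β c : ℕ → PTree G ar) :
    graftAll (nd g β) c = nd g (fun j => graftAll (β j) (fun i => c (pos β j + i))) := by
  unfold nd
  rw [graftAll]
  simp only [offset_nd]

theorem graftAll_congr {b : PTree G ar} : ∀ {c c' : ℕ → PTree G ar},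
    (∀ i < b.leaves, c i = c' i) → graftAll b c = graftAll b c' := by
  induction b using nd_induction with
  | hl => intro c c' h; exact h 0 (by simp)
  | hn g β ih =>
    intro c c' h
    rw [graftAll_nd, graftAll_nd]
    refine nd_congr g fun j hj => ih j hj fun i hi => h _ ?_
    rw [leaves_nd]
    exact pos_add_lt β hj hi

theorem graftAll_leaf (b : PTree G ar) : graftAll b (fun _ => leaf) = b := by
  induction b using nd_induction with
  | hl => rfl
  | hn g β ih =>
    rw [graftAll_nd]
    exact nd_congr g ih

theorem sum_blocks {A : Type*} [AddCommMonoid A] (β : ℕ → PTree G ar) (F : ℕ → A) (n : ℕ) :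
    ∑ k ∈ Finset.range n, ∑ i ∈ Finset.range (β k).leaves, F (pos β k + i)
      = ∑ i ∈ Finset.range (pos β n), F i := by
  induction n with
  | zero => simp
  | succ n ih => rw [Finset.sum_range_succ, ih, pos_succ, Finset.sum_range_add]

theorem total_graftAll {A : Type*} [AddCommMonoid A] (f : G → A) (b : PTree G ar) :
    ∀ c : ℕ → PTree G ar,
    (graftAll b c).total f = b.total f + ∑ i ∈ Finset.range b.leaves, (c i).total f := by
  induction b using nd_induction with
  | hl => intro c; simp
  | hn g β ih =>
    intro c
    rw [graftAll_nd, total_nd, total_nd, leaves_nd, add_assoc, ← sum_blocks,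
      ← Finset.sum_add_distrib]
    congr 1
    refine Finset.sum_congr rfl fun j hj => ?_
    rw [ih j (Finset.mem_range.1 hj)]

theorem leaves_graftAll (b : PTree G ar) : ∀ c : ℕ → PTree G ar,
    (graftAll b c).leaves = pos c b.leaves := by
  induction b using nd_induction with
  | hl => intro c; simp [pos]
  | hn g β ih =>
    intro c
    rw [graftAll_nd, leaves_nd, leaves_nd, pos, pos, ← sum_blocks]
    refine Finset.sum_congr rfl fun j hj => ?_
    rw [ih j (Finset.mem_range.1 hj)]
    rfl

theorem pos_graftAll (β c : ℕ → PTree G ar) (n : ℕ) :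
    pos (fun j => graftAll (β j) (fun i => c (pos β j + i))) n = pos c (pos β n) := by
  rw [pos, pos, ← sum_blocks]
  exact Finset.sum_congr rfl fun j _ => leaves_graftAll _ _

theorem weight_graftAll (b : PTree G ar) (c : ℕ → PTree G ar) :
    (graftAll b c).weight = b.weight + ∑ i ∈ Finset.range b.leaves, (c i).weight :=
  total_graftAll _ b c

/-- Grafting on an entry of `graftAll b c` that belongs to the tree `c a`. -/
theorem graft_graftAll (y b : PTree G ar) : ∀ (c : ℕ → PTree G ar) (a q : ℕ), a < b.leaves →
    q < (c a).leaves → graft (graftAll b c) (pos c a + q) y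
      = graftAll b (Function.update c a (graft (c a) q y)) := by
  induction b using nd_induction with
  | hl =>
    intro c a q ha hq
    obtain rfl : a = 0 := by simpa using ha
    simp
  | hn g β ih =>
    intro c a q ha hq
    rw [leaves_nd] at ha
    obtain ⟨j, hj, a', ha', rfl⟩ := pos_exists β ha
    rw [graftAll_nd, graftAll_nd, pos_add, add_assoc, ← pos_graftAll,
      graft_nd _ _ hj (by rw [leaves_graftAll]; exact pos_add_lt _ ha' hq),
      ih j hj (fun i => c (pos β j + i)) a' q ha' hq]
    refine nd_congr g fun k _ => ?_
    by_cases hk : k = j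
    · subst hk
      rw [Function.update_self]
      refine graftAll_congr fun i _ => ?_
      simp [Function.update_apply]
    · rw [Function.update_of_ne hk]
      refine graftAll_congr fun i hi => ?_
      rw [Function.update_of_ne]
      intro e
      exact hk (pos_unique β hi ha' e).1

/-- In the reading order, what follows an entry of `c a` consists of three groups: later vertices of
`b`, later vertices of `c a`, and all trees grafted further to the right. -/
theorem degAfter_graftAll (deg : G → ℤ) (b : PTree G ar) : ∀ (c : ℕ → PTree G ar) (a q : ℕ),
    a < b.leaves → q < (c a).leaves → degAfter deg (graftAll b c) (pos c a + q)
      = degAfter deg b a + degAfter deg (c a) q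
        + ∑ l ∈ Finset.Ico (a + 1) b.leaves, (c l).total deg := by
  induction b using nd_induction with
  | hl =>
    intro c a q ha hq
    obtain rfl : a = 0 := by simpa using ha
    simp [degAfter]
  | hn g β ih =>
    intro c a q ha hq
    rw [leaves_nd] at ha
    obtain ⟨j, hj, a', ha', rfl⟩ := pos_exists β ha
    rw [graftAll_nd, pos_add, add_assoc, ← pos_graftAll,
      degAfter_nd _ _ _ hj (by rw [leaves_graftAll]; exact pos_add_lt _ ha' hq),
      ih j hj (fun i => c (pos β j + i)) a' q ha' hq, degAfter_nd _ _ _ hj ha', leaves_nd]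
    simp only [total_graftAll, Finset.sum_add_distrib]
    have e1 := Finset.sum_Ico_consecutive
      (fun k => ∑ i ∈ Finset.range (β k).leaves, total deg (c (pos β k + i)))
      (Nat.zero_le (j + 1)) hj
    rw [← Finset.range_eq_Ico, ← Finset.range_eq_Ico,
      sum_blocks β (fun i => total deg (c i)), sum_blocks β (fun i => total deg (c i))] at e1
    have l1 : pos β j + a' + 1 ≤ pos β (j + 1) := by rw [pos_succ]; omega
    have l2 : pos β (j + 1) ≤ pos β (ar g) := pos_mono β hj
    have e2 := Finset.sum_Ico_consecutive (fun i => total deg (c i))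
      (Nat.zero_le (pos β (j + 1))) l2
    have e3 := Finset.sum_Ico_consecutive (fun i => total deg (c i)) l1 l2
    have e4 : ∑ l ∈ Finset.Ico (a' + 1) (β j).leaves, total deg (c (pos β j + l))
        = ∑ l ∈ Finset.Ico (pos β j + a' + 1) (pos β (j + 1)), total deg (c l) := by
      rw [Finset.sum_Ico_add (fun i => total deg (c i)), pos_succ]
      congr 2 <;> omega
    rw [← Finset.range_eq_Ico, ← Finset.range_eq_Ico] at e2
    linarith

theorem graft_eq_graftAll (s t : PTree G ar) {i : ℕ} (hi : i < s.leaves) :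
    graft s i t = graftAll s (Function.update (fun _ => leaf) i t) := by
  have := graft_graftAll t s (fun _ => leaf) i 0 hi (by simp)
  rw [graftAll_leaf] at this
  simpa [pos, graft] using this

theorem graftAll_graftAll (b : PTree G ar) : ∀ (c e : ℕ → PTree G ar),
    graftAll (graftAll b c) e = graftAll b (fun i => graftAll (c i) (fun k => e (pos c i + k))) := by
  induction b using nd_induction with
  | hl => intro c e; simp
  | hn g β ih =>
    intro c e
    rw [graftAll_nd, graftAll_nd, graftAll_nd]
    refine nd_congr g fun j hj => ?_
    rw [ih j hj, pos_graftAll]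
    refine graftAll_congr fun i _ => ?_
    simp only [pos_add, add_assoc]

/-- Replacement of the entry `k` of a sequence by the first `n` entries of another one. -/
def spliceN {α : Type*} (c : ℕ → α) (k n : ℕ) (c' : ℕ → α) (j : ℕ) : α :=
  if j < k then c j else if j < k + n then c' (j - k) else c (j + 1 - n)

theorem pos_update_leaf (k : ℕ) (t : PTree G ar) (i : ℕ) :
    pos (Function.update (fun _ => leaf) k t) i = if i ≤ k then i else i + t.leaves - 1 := by
  induction i with
  | zero => simp
  | succ i ih =>
    rw [pos_succ, ih]
    by_cases h : i = k
    · subst h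
      simp
    · rw [Function.update_of_ne h, leaves_leaf]
      split_ifs <;> omega

/-- Associativity of simultaneous grafting. It is the reason why contracting an edge of a tree of
labels does not change the monomial obtained by composing the labels. -/
theorem graftAll_graft_splice (b b' : PTree G ar) {k : ℕ} (hk : k < b.leaves)
    (c c' : ℕ → PTree G ar) :
    graftAll (graft b k b') (spliceN c k b'.leaves c')
      = graftAll b (Function.update c k (graftAll b' c')) := by
  rw [graft_eq_graftAll b b' hk, graftAll_graftAll]
  refine graftAll_congr fun i _ => ?_
  rw [pos_update_leaf]
  by_cases h : i = k
  · subst h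
    rw [Function.update_self, Function.update_self]
    refine graftAll_congr fun j hj => ?_
    rw [if_pos le_rfl, spliceN, if_neg (by omega), if_pos (by omega)]
    congr 1
    omega
  · rw [Function.update_of_ne h, Function.update_of_ne h, graftAll_leaf_left, spliceN]
    split_ifs <;> first | omega | rfl | (congr 1; omega)

/-- Trees with no entries have to be excluded in `c`: only then can the arities of the subtrees of
`b` be read off from those of the composite. The lemma makes strict inequalities survive grafting.
-/
theorem graftAll_injective (b : PTree G ar) : ∀ (b' : PTree G ar) (c : ℕ → PTree G ar),
    (∀ i, 0 < (c i).leaves) → b.leaves = b'.leaves → graftAll b c = graftAll b' c → b = b' := by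
  induction b using nd_induction with
  | hl =>
    intro b' c _ hl h
    rcases leaf_or_nd b' with rfl | ⟨g, β, rfl⟩
    · rfl
    · have := congrArg weight h
      rw [weight_graftAll, weight_graftAll, ← hl] at this
      simp [weight, total_nd] at this
  | hn g β ih =>
    intro b' c hc hl h
    rcases leaf_or_nd b' with rfl | ⟨g', β', rfl⟩
    · have := congrArg weight h
      rw [weight_graftAll, weight_graftAll, hl] at this
      simp [weight, total_nd] at this
    · rw [graftAll_nd, graftAll_nd] at h
      obtain ⟨rfl, h'⟩ := nd_inj h
      have hpos : StrictMono (pos c) := strictMono_nat_of_lt_succ fun n => by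
        rw [pos_succ]
        have := hc n
        omega
      -- The blocks of `c` over successive subtrees have equal total size on both sides, and `pos c`
      -- is strictly increasing, so they begin and end at the same places.
      have key : ∀ j ≤ ar g, pos β j = pos β' j := by
        intro j
        induction j with
        | zero => simp
        | succ j ihj =>
          intro hj
          have h1 := ihj (by omega)
          have h2 := congrArg leaves (h' j hj)
          rw [leaves_graftAll, leaves_graftAll, ← h1] at h2
          have h3 : pos c (pos β j + (β j).leaves) = pos c (pos β j + (β' j).leaves) := by
            rw [pos_add, pos_add, h2]
          rw [pos_succ, pos_succ, ← h1]
          exact hpos.injective h3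
      refine nd_congr g fun j hj => ih j hj (β' j) (fun i => c (pos β j + i)) (fun i => hc _) ?_ ?_
      · have h1 := key j hj.le
        have h2 := key (j + 1) hj
        rw [pos_succ, pos_succ] at h2
        omega
      · rw [h' j hj, key j hj.le]

theorem leaves_pos (har : ∀ g, 0 < ar g) (t : PTree G ar) : 0 < t.leaves := by
  induction t using nd_induction with
  | hl => simp
  | hn g c ih =>
    rw [leaves_nd]
    have h := ih 0 (har g)
    have := pos_add_lt c (har g) h
    omega

theorem le_pos (har : ∀ g, 0 < ar g) (c : ℕ → PTree G ar) (a : ℕ) : a ≤ pos c a := by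
  induction a with
  | zero => simp
  | succ a ih =>
    rw [pos_succ]
    have := leaves_pos har (c a)
    omega

theorem leaves_le_pos (c : ℕ → PTree G ar) {j n : ℕ} (hj : j < n) : (c j).leaves ≤ pos c n := by
  have := pos_mono c (Nat.succ_le_of_lt hj)
  rw [Nat.succ_eq_add_one, pos_succ] at this
  omega

/-- With positive arities a vertex has no more entries than the whole tree, so only finitely many
root labels are possible; the subtrees have smaller weight. All inductions along the order terminate
for this reason. -/
theorem finite_leaves_weight (har : ∀ g, 0 < ar g)
    (hfin : ∀ n, {g | ar g = n}.Finite) (n w : ℕ) :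
    {t : PTree G ar | t.leaves ≤ n ∧ t.weight ≤ w}.Finite := by
  have hG : {g | ar g ≤ n}.Finite := by
    have : {g | ar g ≤ n} = ⋃ k ∈ Set.Iic n, {g | ar g = k} := by
      refine Set.ext fun g => ?_
      simp
    rw [this]
    exact (Set.finite_Iic n).biUnion fun k _ => hfin k
  induction w with
  | zero =>
    refine (Set.finite_singleton leaf).subset ?_
    rintro t ⟨_, ht⟩
    rcases leaf_or_nd t with rfl | ⟨g, c, rfl⟩
    · rfl
    · simp [weight, total_nd] at ht
  | succ w ih =>
    refine ((Set.finite_singleton leaf).union (hG.biUnion fun g _ =>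
      (Set.Finite.pi' (fun _ : Fin (ar g) => ih)).image (node g))).subset ?_
    rintro t ⟨h1, h2⟩
    rcases leaf_or_nd t with rfl | ⟨g, c, rfl⟩
    · exact Or.inl rfl
    · right
      rw [leaves_nd] at h1
      rw [weight, total_nd] at h2
      simp only [Set.mem_iUnion]
      refine ⟨g, (le_pos har c _).trans h1, fun j => c j, fun j => ⟨?_, ?_⟩, rfl⟩
      · exact (leaves_le_pos c j.2).trans h1
      · have := Finset.single_le_sum (f := fun j => (c j).total fun _ => 1)
          (fun _ _ => Nat.zero_le _) (Finset.mem_range.2 j.2)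
        change (c j).total (fun _ => 1) ≤ w
        omega

end PTree

open PTree

/-! ### Compatibility of the order with simultaneous grafting. -/

section order

variable {G : Type u} {ar : G → ℕ} {le : PTree G ar → PTree G ar → Prop}

/-- The composite of the first `a` trees of the sequence `c` with `b`. -/
def upTo (c : ℕ → PTree G ar) (a i : ℕ) : PTree G ar := if i < a then c i else leaf

theorem upTo_zero (c : ℕ → PTree G ar) : upTo c 0 = fun _ => leaf := by
  funext i
  simp [upTo]

theorem graftAll_upTo_zero (b : PTree G ar) (c : ℕ → PTree G ar) : graftAll b (upTo c 0) = b := by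
  rw [upTo_zero, graftAll_leaf]

theorem pos_upTo (c : ℕ → PTree G ar) (a : ℕ) : pos (upTo c a) a = pos c a :=
  pos_congr fun _ hi => if_pos hi

theorem graftAll_upTo_succ (b : PTree G ar) (c : ℕ → PTree G ar) {a : ℕ} (ha : a < b.leaves) :
    graftAll b (upTo c (a + 1)) = graft (graftAll b (upTo c a)) (pos c a) (c a) := by
  have h0 : upTo c a a = leaf := if_neg (lt_irrefl a)
  have := graft_graftAll (c a) b (upTo c a) a 0 ha (by rw [h0]; simp)
  rw [pos_upTo, add_zero] at this
  rw [this, h0]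
  refine graftAll_congr fun i _ => ?_
  by_cases h : i = a
  · subst h
    simp [upTo, graft]
  · rw [Function.update_of_ne h]
    unfold upTo
    by_cases h2 : i < a
    · rw [if_pos h2, if_pos (by omega)]
    · rw [if_neg h2, if_neg (by omega)]

theorem graftAll_upTo_leaves (b : PTree G ar) (c : ℕ → PTree G ar) :
    graftAll b (upTo c b.leaves) = graftAll b c :=
  graftAll_congr fun _ hi => if_pos hi

theorem pos_lt_leaves_upTo (b : PTree G ar) (c : ℕ → PTree G ar) {a : ℕ} (ha : a < b.leaves) :
    pos c a < (graftAll b (upTo c a)).leaves := by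
  rw [leaves_graftAll, ← pos_upTo]
  have := pos_add_lt (upTo c a) ha (q := 0) (by simp [upTo])
  omega

/-- The axiom concerns a single grafting, so the trees are grafted one at a time from left to right.
Equality of arities keeps the next free entry at the same position on both sides. -/
theorem IsMonomialOrder.graftAll (h : IsMonomialOrder le) {b b' : PTree G ar}
    {c c' : ℕ → PTree G ar} (hb : le b b') (hl : b.leaves = b'.leaves)
    (hc : ∀ i < b.leaves, le (c i) (c' i)) (hcl : ∀ i < b.leaves, (c i).leaves = (c' i).leaves) :
    le (graftAll b c) (graftAll b' c') := by
  have hpos : ∀ a ≤ b.leaves, pos c a = pos c' a := fun a ha =>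
    Finset.sum_congr rfl fun i hi => hcl i ((Finset.mem_range.1 hi).trans_le ha)
  have key : ∀ a ≤ b.leaves, le (PTree.graftAll b (upTo c a)) (PTree.graftAll b' (upTo c' a)) := by
    intro a
    induction a with
    | zero => intro _; simpa only [graftAll_upTo_zero] using hb
    | succ a ih =>
      intro ha
      rw [graftAll_upTo_succ _ _ ha, graftAll_upTo_succ _ _ (hl ▸ ha), ← hpos a (by omega)]
      refine h.graft _ _ _ _ ?_ (hcl a ha) (ih (by omega)) (hc a ha) _ (pos_lt_leaves_upTo b c ha)
      rw [leaves_graftAll, leaves_graftAll, ← hl]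
      refine Finset.sum_congr rfl fun i hi => ?_
      unfold upTo
      split_ifs
      · exact hcl i (Finset.mem_range.1 hi)
      · rfl
  have := key b.leaves le_rfl
  rwa [graftAll_upTo_leaves, hl, graftAll_upTo_leaves] at this

theorem graftAll_corolla (g : G) (c : ℕ → PTree G ar) : graftAll (corolla g) c = nd g c := by
  change graftAll (nd g fun _ => leaf) c = _
  rw [graftAll_nd]
  refine nd_congr g fun j _ => ?_
  simp [pos]

@[simp] theorem leaves_corolla (g : G) : (corolla g : PTree G ar).leaves = ar g := by
  change (nd g fun _ => leaf).leaves = _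
  rw [leaves_nd]
  simp [pos]

theorem IsMonomialOrder.nd (h : IsMonomialOrder le) (g : G) {c c' : ℕ → PTree G ar}
    (hc : ∀ i < ar g, le (c i) (c' i)) (hcl : ∀ i < ar g, (c i).leaves = (c' i).leaves) :
    le (nd g c) (nd g c') := by
  rw [← graftAll_corolla, ← graftAll_corolla]
  exact h.graftAll (h.refl _) rfl (by simpa using hc) (by simpa using hcl)

end order


open PTree

/-! ### Signs, and the associativity axioms in the free operad and its quotients. -/

section ksign

variable (K : Type v) [Field K]

theorem ksign_add (a b : ℤ) : ksign K (a + b) = ksign K a * ksign K b := by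
  unfold ksign
  rcases Int.even_or_odd a with ha | ha <;> rcases Int.even_or_odd b with hb | hb <;>
    simp [ha, hb, Int.even_add, Int.not_even_iff_odd.2]

theorem ksign_neg_congr {a b : ℤ} (h : Odd (a - b)) : ksign K a = -ksign K b := by
  unfold ksign
  rw [← Int.not_even_iff_odd, Int.even_sub] at h
  by_cases ha : Even a <;> by_cases hb : Even b
  · exact absurd (iff_of_true ha hb) h
  · rw [if_pos ha, if_neg hb, neg_neg]
  · rw [if_neg ha, if_pos hb]
  · exact absurd (iff_of_false ha hb) h

@[simp] theorem ksign_zero : ksign K 0 = 1 := by simp [ksign]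

theorem ksign_mul_self (a : ℤ) : ksign K a * ksign K a = 1 := by
  unfold ksign
  split_ifs <;> simp

theorem ksign_ne_zero (a : ℤ) : ksign K a ≠ 0 := left_ne_zero_of_mul_eq_one (ksign_mul_self K a)

end ksign

section graft

variable {G : Type u} {ar : G → ℕ}

theorem pos_update_leaf_self (k : ℕ) (t : PTree G ar) :
    pos (Function.update (fun _ => leaf) k t) k = k := by
  rw [pos_update_leaf, if_pos le_rfl]

theorem graft_graft (s t u : PTree G ar) {i j : ℕ} (hi : i < s.leaves) (hj : j < t.leaves) :
    graft (graft s i t) (i + j) u = graft s i (graft t j u) := by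
  have := graft_graftAll u s (Function.update (fun _ => leaf) i t) i j hi (by simpa)
  rw [pos_update_leaf_self, ← graft_eq_graftAll s t hi] at this
  rw [this, Function.update_self, Function.update_idem, ← graft_eq_graftAll _ _ hi]

theorem graft_graft_parallel (s t u : PTree G ar) {i k : ℕ} (hik : i < k) (hk : k < s.leaves) :
    graft (graft s i t) (k + t.leaves - 1) u = graft (graft s k u) i t := by
  have h1 := graft_graftAll u s (Function.update (fun _ => leaf) i t) k 0 hk
    (by simp [hik.ne'])
  rw [pos_update_leaf, if_neg (by omega), ← graft_eq_graftAll s t (hik.trans hk), add_zero,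
    Function.update_of_ne hik.ne'] at h1
  have h2 := graft_graftAll t s (Function.update (fun _ => leaf) k u) i 0 (hik.trans hk)
    (by simp [hik.ne])
  rw [pos_update_leaf, if_pos hik.le, ← graft_eq_graftAll s u hk, add_zero,
    Function.update_of_ne hik.ne] at h2
  rw [h1, h2, Function.update_comm hik.ne]
  rfl

theorem degAfter_graft (deg : G → ℤ) (s t : PTree G ar) {i j : ℕ} (hi : i < s.leaves)
    (hj : j < t.leaves) :
    degAfter deg (graft s i t) (i + j) = degAfter deg s i + degAfter deg t j := by
  have := degAfter_graftAll deg s (Function.update (fun _ => leaf) i t) i j hi (by simpa)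
  rw [pos_update_leaf_self, ← graft_eq_graftAll s t hi, Function.update_self] at this
  rw [this, Finset.sum_eq_zero, add_zero]
  intro l hl
  rw [Function.update_of_ne (by rw [Finset.mem_Ico] at hl; omega), total_leaf]

theorem degAfter_graft_of_lt (deg : G → ℤ) (s t : PTree G ar) {i k : ℕ} (hik : i < k)
    (hk : k < s.leaves) :
    degAfter deg (graft s i t) (k + t.leaves - 1) = degAfter deg s k := by
  have := degAfter_graftAll deg s (Function.update (fun _ => leaf) i t) k 0 hk
    (by simp [hik.ne'])
  rw [pos_update_leaf, if_neg (by omega), ← graft_eq_graftAll s t (hik.trans hk), add_zero,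
    Function.update_of_ne hik.ne'] at this
  rw [this, Finset.sum_eq_zero]
  · simp [degAfter]
  · intro l hl
    rw [Function.update_of_ne (by rw [Finset.mem_Ico] at hl; omega), total_leaf]

theorem degAfter_graft_of_gt (deg : G → ℤ) (s t : PTree G ar) {i k : ℕ} (hik : i < k)
    (hk : k < s.leaves) :
    degAfter deg (graft s k t) i = degAfter deg s i + t.total deg := by
  have := degAfter_graftAll deg s (Function.update (fun _ => leaf) k t) i 0 (hik.trans hk)
    (by simp [hik.ne])
  rw [pos_update_leaf, if_pos hik.le, ← graft_eq_graftAll s t hk, add_zero,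
    Function.update_of_ne hik.ne] at this
  rw [this, Finset.sum_eq_single k]
  · simp [degAfter]
  · intro l _ hl
    rw [Function.update_of_ne hl, total_leaf]
  · intro h
    rw [Finset.mem_Ico] at h
    omega

end graft

section operad

variable {K : Type v} [Field K] {G : Type u} {ar : G → ℕ} {deg : G → ℤ}

theorem comp_single (i : ℕ) (s t : PTree G ar) (a b : K) :
    comp deg i (Finsupp.single s a) (Finsupp.single t b) = if i < s.leaves then
      Finsupp.single (graft s i t) (a * b * ksign K (degAfter deg s i * t.total deg)) else 0 := by
  simp only [comp, Finsupp.linearCombination_single, LinearMap.smul_apply]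
  split_ifs
  · rw [Finsupp.smul_single, Finsupp.smul_single, smul_eq_mul, smul_eq_mul, mul_assoc]
  · simp

theorem comp_single_of_lt {i : ℕ} {s : PTree G ar} (t : PTree G ar) (h : i < s.leaves) (a b : K) :
    comp deg i (Finsupp.single s a) (Finsupp.single t b) =
      Finsupp.single (graft s i t) (a * b * ksign K (degAfter deg s i * t.total deg)) := by
  rw [comp_single, if_pos h]

theorem single_mem_piece (t : PTree G ar) (a : K) :
    Finsupp.single t a ∈ piece K ar deg t.leaves (t.total deg) t.weight :=
  Finsupp.single_mem_supported K _ ⟨rfl, rfl, rfl⟩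

@[elab_as_elim]
theorem piece_induction {n w : ℕ} {d : ℤ} {P : Free K ar → Prop} (h0 : P 0)
    (hadd : ∀ f g, P f → P g → P (f + g))
    (hs : ∀ (t : PTree G ar) (a : K), t.leaves = n → t.total deg = d → t.weight = w →
      P (Finsupp.single t a)) (f : Free K ar) (hf : f ∈ piece K ar deg n d w) : P f := by
  rw [← Finsupp.sum_single f, Finsupp.sum]
  refine Finset.sum_induction _ P hadd h0 fun t ht => ?_
  obtain ⟨h1, h2, h3⟩ := hf ht
  exact hs t _ h1 h2 h3

theorem comp_comp {n n' n'' w w' w'' : ℕ} {d d' d'' : ℤ} {f g h : Free K ar}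
    (hf : f ∈ piece K ar deg n d w) (hg : g ∈ piece K ar deg n' d' w')
    (hh : h ∈ piece K ar deg n'' d'' w'') {i j : ℕ} (hi : i < n) (hj : j < n') :
    comp deg (i + j) (comp deg i f g) h = comp deg i f (comp deg j g h) := by
  refine piece_induction ?_ (fun f₁ f₂ h₁ h₂ => ?_) (fun s a hs _ _ => ?_) f hf
  · simp
  · simp only [map_add, LinearMap.add_apply, h₁, h₂]
  refine piece_induction ?_ (fun f₁ f₂ h₁ h₂ => ?_) (fun t b ht _ _ => ?_) g hg
  · simp
  · simp only [map_add, LinearMap.add_apply, h₁, h₂]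
  refine piece_induction ?_ (fun f₁ f₂ h₁ h₂ => ?_) (fun u c _ _ _ => ?_) h hh
  · simp
  · simp only [map_add, h₁, h₂]
  subst hs ht
  have hl := leaves_graft t s i hi
  rw [comp_single_of_lt t hi, comp_single_of_lt u hj, comp_single_of_lt _ hi,
    comp_single_of_lt u (by omega), graft_graft s t u hi hj, degAfter_graft deg s t hi hj,
    total_graft deg u t j hj]
  congr 1
  rw [add_mul, mul_add, ksign_add, ksign_add]
  ring

/-- Grafting on two different entries can be done in either order, up to the Koszul sign for
exchanging the two grafted factors. The position `k + n' - 1` is the entry `k` after the `n'`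
entries of `g` have replaced one entry to its left. -/
theorem comp_comp_parallel {n n' n'' w w' w'' : ℕ} {d d' d'' : ℤ} {f g h : Free K ar}
    (hf : f ∈ piece K ar deg n d w) (hg : g ∈ piece K ar deg n' d' w')
    (hh : h ∈ piece K ar deg n'' d'' w'') {i k : ℕ} (hik : i < k) (hk : k < n) :
    comp deg (k + n' - 1) (comp deg i f g) h
      = ksign K (d' * d'') • comp deg i (comp deg k f h) g := by
  refine piece_induction ?_ (fun f₁ f₂ h₁ h₂ => ?_) (fun s a hs _ _ => ?_) f hf
  · simp
  · simp only [map_add, LinearMap.add_apply, h₁, h₂, smul_add]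
  refine piece_induction ?_ (fun f₁ f₂ h₁ h₂ => ?_) (fun t b ht ht' _ => ?_) g hg
  · simp
  · simp only [map_add, LinearMap.add_apply, h₁, h₂, smul_add]
  refine piece_induction ?_ (fun f₁ f₂ h₁ h₂ => ?_) (fun u c _ hu _ => ?_) h hh
  · simp
  · simp only [map_add, LinearMap.add_apply, h₁, h₂, smul_add]
  subst hs ht ht' hu
  have hl := leaves_graft t s i (hik.trans hk)
  have hl' := leaves_graft u s k hk
  rw [comp_single_of_lt t (hik.trans hk), comp_single_of_lt u hk,
    comp_single_of_lt u (by omega), comp_single_of_lt t (by omega),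
    graft_graft_parallel s t u hik hk, degAfter_graft_of_lt deg s t hik hk,
    degAfter_graft_of_gt deg s u hik hk, Finsupp.smul_single, smul_eq_mul]
  congr 1
  rw [add_mul, ksign_add, mul_comm (total deg u)]
  linear_combination (-(a * b * c * ksign K (degAfter deg s k * total deg u)
    * ksign K (degAfter deg s i * total deg t))) * (ksign_mul_self K (total deg t * total deg u))

theorem OpIdeal.qcomp_qcomp (I : OpIdeal K ar deg) {n n' n'' w w' w'' : ℕ} {d d' d'' : ℤ}
    {x y z : I.Quot} (hx : x ∈ I.qpiece n d w) (hy : y ∈ I.qpiece n' d' w')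
    (hz : z ∈ I.qpiece n'' d'' w'') {i j : ℕ} (hi : i < n) (hj : j < n') :
    I.qcomp (i + j) (I.qcomp i x y) z = I.qcomp i x (I.qcomp j y z) := by
  obtain ⟨f, hf, rfl⟩ := hx
  obtain ⟨g, hg, rfl⟩ := hy
  obtain ⟨h, hh, rfl⟩ := hz
  simp only [OpIdeal.qcomp_mk, comp_comp hf hg hh hi hj]

theorem OpIdeal.qcomp_qcomp_parallel (I : OpIdeal K ar deg) {n n' n'' w w' w'' : ℕ}
    {d d' d'' : ℤ} {x y z : I.Quot} (hx : x ∈ I.qpiece n d w) (hy : y ∈ I.qpiece n' d' w')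
    (hz : z ∈ I.qpiece n'' d'' w'') {i k : ℕ} (hik : i < k) (hk : k < n) :
    I.qcomp (k + n' - 1) (I.qcomp i x y) z = ksign K (d' * d'') • I.qcomp i (I.qcomp k x z) y := by
  obtain ⟨f, hf, rfl⟩ := hx
  obtain ⟨g, hg, rfl⟩ := hy
  obtain ⟨h, hh, rfl⟩ := hz
  simp only [OpIdeal.qcomp_mk, comp_comp_parallel hf hg hh hik hk, map_smul]

end operad

/-! ### Coordinates and rewriting with respect to a Poincaré–Birkhoff–Witt basis. -/

section PBW

variable {K : Type v} [Field K] {G : Type u} {ar : G → ℕ} {deg : G → ℤ} {I : OpIdeal K ar deg}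
  {le : PTree G ar → PTree G ar → Prop} {B : Set (PTree G ar)}

/-- The class of a monomial in the quotient operad. -/
noncomputable def OpIdeal.mon (I : OpIdeal K ar deg) (t : PTree G ar) : I.Quot :=
  I.carrier.mkQ (Finsupp.single t 1)

theorem OpIdeal.mon_mem (I : OpIdeal K ar deg) (t : PTree G ar) :
    I.mon t ∈ I.qpiece t.leaves (t.total deg) t.weight :=
  ⟨_, single_mem_piece t 1, rfl⟩

theorem OpIdeal.qcomp_mon (I : OpIdeal K ar deg) {s : PTree G ar} (t : PTree G ar) {i : ℕ}
    (hi : i < s.leaves) : I.qcomp i (I.mon s) (I.mon t)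
      = ksign K (degAfter deg s i * t.total deg) • I.mon (graft s i t) := by
  rw [OpIdeal.mon, OpIdeal.mon, OpIdeal.qcomp_mk, comp_single_of_lt t hi, OpIdeal.mon,
    ← map_smul, Finsupp.smul_single, smul_eq_mul, mul_one, mul_one, one_mul]

/-- The basis of the quotient operad given by a Poincaré–Birkhoff–Witt basis. -/
noncomputable def IsPBWBasis.basis (h : IsPBWBasis I le B) : Module.Basis B K I.Quot :=
  Module.Basis.mk h.linearIndependent h.span_eq_top.ge

theorem IsPBWBasis.basis_apply (h : IsPBWBasis I le B) (b : B) : h.basis b = I.mon b.1 := by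
  rw [IsPBWBasis.basis, Module.Basis.mk_apply, OpIdeal.mon]

/-- The ideal is homogeneous, so the relation `f - c` may be replaced by its component in the piece
of `f`. A decomposition can thus always be taken homogeneous. -/
theorem mkQ_eq_mkQ_filter (I : OpIdeal K ar deg) {n w : ℕ} {d : ℤ} {f c : Free K ar}
    (hf : f ∈ piece K ar deg n d w) (h : I.carrier.mkQ f = I.carrier.mkQ c) :
    I.carrier.mkQ f
      = I.carrier.mkQ (c.filter (fun t => t.leaves = n ∧ t.total deg = d ∧ t.weight = w)) := by
  have h1 : f - c ∈ I.carrier := (Submodule.Quotient.eq _).1 h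
  have h2 := I.homogeneous n d w _ h1
  have h3 : f.filter (fun t => t.leaves = n ∧ t.total deg = d ∧ t.weight = w) = f :=
    (Finsupp.filter_eq_self_iff _ _).2 fun t ht => hf (Finsupp.mem_support_iff.2 ht)
  rw [Finsupp.filter_sub, h3] at h2
  exact (Submodule.Quotient.eq _).2 h2

/-- The monomials in `B` of the given arity, degree and weight span the corresponding piece. -/
theorem IsPBWBasis.exists_rep (h : IsPBWBasis I le B) {n w : ℕ} {d : ℤ} {x : I.Quot}
    (hx : x ∈ I.qpiece n d w) :
    ∃ c : Free K ar, (∀ t ∈ c.support, t ∈ B ∧ t.leaves = n ∧ t.total deg = d ∧ t.weight = w) ∧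
      x = I.carrier.mkQ c := by
  obtain ⟨f, hf, rfl⟩ := hx
  obtain ⟨c, hc, e⟩ : ∃ c : Free K ar, (∀ t ∈ c.support, t ∈ B) ∧
      I.carrier.mkQ f = I.carrier.mkQ c := by
    have : I.carrier.mkQ f ∈ (Finsupp.supported K K B).map I.carrier.mkQ := by
      have h1 : (⊤ : Submodule K I.Quot) ≤ (Finsupp.supported K K B).map I.carrier.mkQ := by
        rw [← h.span_eq_top, Submodule.span_le]
        rintro _ ⟨b, rfl⟩
        exact ⟨_, Finsupp.single_mem_supported K _ b.2, rfl⟩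
      exact h1 trivial
    obtain ⟨c, hc, e⟩ := this
    exact ⟨c, fun t ht => hc ht, e.symm⟩
  refine ⟨_, fun t ht => ?_, mkQ_eq_mkQ_filter I hf e⟩
  rw [Finsupp.support_filter, Finset.mem_filter] at ht
  exact ⟨hc t ht.1, ht.2⟩

theorem mkQ_eq_sum (I : OpIdeal K ar deg) (c : Free K ar) :
    I.carrier.mkQ c = ∑ t ∈ c.support, c t • I.mon t := by
  conv_lhs => rw [← Finsupp.sum_single c]
  rw [Finsupp.sum, map_sum]
  refine Finset.sum_congr rfl fun t _ => ?_
  rw [OpIdeal.mon, ← map_smul, Finsupp.smul_single, smul_eq_mul, mul_one]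

/-- The coordinate functional of the quotient operad at `b ∈ B`. -/
noncomputable def IsPBWBasis.coord (h : IsPBWBasis I le B) (b : B) : I.Quot →ₗ[K] K :=
  h.basis.coord b

theorem IsPBWBasis.coord_mkQ (h : IsPBWBasis I le B) (b : B) {c : Free K ar}
    (hc : ∀ t ∈ c.support, t ∈ B) : h.coord b (I.carrier.mkQ c) = c b.1 := by
  classical
  rw [mkQ_eq_sum, map_sum]
  have : ∀ t ∈ c.support, h.coord b (c t • I.mon t) = if t = b.1 then c t else 0 := by
    intro t ht
    have e : I.mon t = h.basis ⟨t, hc t ht⟩ := (h.basis_apply ⟨t, hc t ht⟩).symm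
    rw [map_smul, e, IsPBWBasis.coord, Module.Basis.coord_apply, Module.Basis.repr_self,
      Finsupp.single_apply]
    by_cases htb : t = b.1
    · rw [if_pos (Subtype.ext htb), if_pos htb, smul_eq_mul, mul_one]
    · rw [if_neg (fun e => htb (congrArg Subtype.val e)), if_neg htb, smul_zero]
  rw [Finset.sum_congr rfl this, Finset.sum_ite_eq']
  split_ifs with hb
  · rfl
  · exact (Finsupp.notMem_support_iff.1 hb).symm

theorem IsPBWBasis.coord_mon [DecidableEq (PTree G ar)] (h : IsPBWBasis I le B) (b : B)
    {t : PTree G ar} (ht : t ∈ B) : h.coord b (I.mon t) = if t = b.1 then 1 else 0 := by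
  rw [OpIdeal.mon, h.coord_mkQ, Finsupp.single_apply]
  intro s hs
  obtain rfl := Finset.mem_singleton.1 (Finsupp.support_single_subset hs)
  exact ht

theorem IsPBWBasis.of_coord_ne_zero (h : IsPBWBasis I le B) {n w : ℕ} {d : ℤ} {x : I.Quot}
    (hx : x ∈ I.qpiece n d w) {b : B} (hb : h.coord b x ≠ 0) :
    b.1.leaves = n ∧ b.1.total deg = d ∧ b.1.weight = w := by
  obtain ⟨c, hc, rfl⟩ := h.exists_rep hx
  rw [h.coord_mkQ b fun t ht => (hc t ht).1] at hb
  exact (hc _ (Finsupp.mem_support_iff.2 hb)).2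

/-- The decomposition of a composite of monomials in `B` that is not in `B`. -/
theorem IsPBWBasis.exists_rewrite (h : IsPBWBasis I le B) {s t : PTree G ar} (hs : s ∈ B)
    (ht : t ∈ B) {i : ℕ} (hi : i < s.leaves) (hn : graft s i t ∉ B) :
    ∃ c : Free K ar, I.mon (graft s i t) = I.carrier.mkQ c ∧
      ∀ γ ∈ c.support, γ ∈ B ∧ γ.leaves = (graft s i t).leaves ∧
        γ.total deg = (graft s i t).total deg ∧ γ.weight = (graft s i t).weight ∧
        le (graft s i t) γ ∧ graft s i t ≠ γ := by
  obtain h1 | ⟨c, hc, e, hle⟩ := h.comp_mem_or s hs t ht i hi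
  · exact absurd h1 hn
  -- The composite of two monomials is the grafted monomial only up to this sign, which is its own
  -- inverse and is moved into the decomposition.
  set ε := ksign K (degAfter deg s i * t.total deg) with hε
  have e' : I.mon (graft s i t) = I.carrier.mkQ (ε • c) := by
    have := I.qcomp_mon t hi
    rw [OpIdeal.mon, OpIdeal.mon, OpIdeal.qcomp_mk, e] at this
    rw [map_smul, this, smul_smul, ksign_mul_self, one_smul]
  refine ⟨_, mkQ_eq_mkQ_filter I (single_mem_piece (graft s i t) 1) e', fun γ hγ => ?_⟩
  rw [Finsupp.support_filter, Finset.mem_filter] at hγ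
  have hγc := Finsupp.support_smul hγ.1
  exact ⟨hc hγc, hγ.2.1, hγ.2.2.1, hγ.2.2.2, hle γ hγc⟩

end PBW


open PTree

/-! ### Splicing of sequences, which describes the forest over a contracted vertex. -/

section splice

variable {α : Type*}

/-- The position in `spliceN c j m c'` of the entry `k ≠ j` of `c`. -/
def shift (j m k : ℕ) : ℕ := if k < j then k else k + m - 1

theorem spliceN_add (c : ℕ → α) (j m : ℕ) (c' : ℕ → α) {l : ℕ} (hl : l < m) :
    spliceN c j m c' (j + l) = c' l := by
  rw [spliceN, if_neg (by omega), if_pos (by omega)]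
  congr 1
  omega

theorem spliceN_shift (c : ℕ → α) (j m : ℕ) (c' : ℕ → α) {k : ℕ} (hk : k ≠ j) :
    spliceN c j m c' (shift j m k) = c k := by
  unfold spliceN shift
  by_cases h : k < j
  · simp only [if_pos h]
  · simp only [if_neg h]
    rw [if_neg (by omega), if_neg (by omega)]
    congr 1
    omega

theorem spliceN_update_right (c : ℕ → α) (j m : ℕ) (c' : ℕ → α) {l : ℕ} (hl : l < m) (x : α) :
    spliceN c j m (Function.update c' l x) = Function.update (spliceN c j m c') (j + l) x := by
  funext i
  simp only [spliceN, Function.update_apply]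
  split_ifs <;> first | rfl | omega

theorem spliceN_update_left (c : ℕ → α) (j m : ℕ) (c' : ℕ → α) {k : ℕ} (hk : k ≠ j) (x : α) :
    spliceN (Function.update c k x) j m c' = Function.update (spliceN c j m c') (shift j m k) x := by
  funext i
  simp only [spliceN, shift, Function.update_apply]
  split_ifs <;> first | rfl | omega

theorem spliceN_update_self (c : ℕ → α) (j m : ℕ) (c' : ℕ → α) (x : α) :
    spliceN (Function.update c j x) j m c' = spliceN c j m c' := by
  funext i
  simp only [spliceN, Function.update_apply]
  split_ifs <;> first | rfl | omega

theorem spliceN_spliceN (c : ℕ → α) (j m : ℕ) (c' : ℕ → α) {l : ℕ} (hl : l < m) (r : ℕ)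
    (c'' : ℕ → α) : spliceN (spliceN c j m c') (j + l) r c''
      = spliceN c j (m + r - 1) (spliceN c' l r c'') := by
  funext i
  simp only [spliceN]
  split_ifs <;> first | rfl | omega | (congr 1; omega)

theorem spliceN_parallel (c : ℕ → α) {j k : ℕ} (hjk : j < k) (m r : ℕ) (c' c'' : ℕ → α) :
    spliceN (spliceN c j m c') (k + m - 1) r c'' = spliceN (spliceN c k r c'') j m c' := by
  funext i
  simp only [spliceN]
  split_ifs <;> first | rfl | omega | (congr 1; omega)

/-- After a contraction the entries of the new vertex are those of the upper vertex, together with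
those of the lower vertex other than the contracted one. Sums over entries are split accordingly. -/
theorem sum_range_splice {A : Type*} [AddCommMonoid A] (F : ℕ → A) {j n : ℕ} (hj : j < n) (m : ℕ) :
    ∑ i ∈ Finset.range (n + m - 1), F i = ∑ l ∈ Finset.range m, F (j + l)
      + ∑ k ∈ (Finset.range n).erase j, F (shift j m k) := by
  obtain ⟨a, rfl⟩ : ∃ a, n = j + 1 + a := ⟨n - j - 1, by omega⟩
  have e : (Finset.range (j + 1 + a)).erase j
      = Finset.range j ∪ (Finset.range a).image (j + 1 + ·) := by
    ext k
    simp only [Finset.mem_erase, Finset.mem_range, Finset.mem_union, Finset.mem_image]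
    constructor
    · rintro ⟨h1, h2⟩
      by_cases h : k < j
      · exact Or.inl h
      · exact Or.inr ⟨k - j - 1, by omega, by omega⟩
    · rintro (h | ⟨b, hb, rfl⟩) <;> omega
  rw [show j + 1 + a + m - 1 = j + m + a by omega, Finset.sum_range_add, Finset.sum_range_add, e,
    Finset.sum_union, Finset.sum_image (fun x _ y _ h => by simpa using h)]
  · have e1 : ∑ x ∈ Finset.range j, F (shift j m x) = ∑ x ∈ Finset.range j, F x :=
      Finset.sum_congr rfl fun x hx => by rw [shift, if_pos (Finset.mem_range.1 hx)]
    have e2 : ∑ x ∈ Finset.range a, F (shift j m (j + 1 + x))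
        = ∑ x ∈ Finset.range a, F (j + m + x) :=
      Finset.sum_congr rfl fun x _ => by
        rw [shift, if_neg (by omega)]
        congr 1
        omega
    rw [e1, e2, ← add_assoc, add_comm (∑ x ∈ Finset.range j, F x)]
  · rw [Finset.disjoint_left]
    intro k hk
    simp only [Finset.mem_image, Finset.mem_range] at hk ⊢
    rintro ⟨b, hb, rfl⟩
    omega

end splice

/-! ### The differential of the bar construction, by recursion on the root vertex. -/

section bar

variable {K : Type v} [Field K] {G : Type u} {ar : G → ℕ} {deg : G → ℤ} {I : OpIdeal K ar deg}

theorem Op.ext' {p q : Op I} (h1 : p.arity = q.arity) (h2 : p.degree = q.degree)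
    (h3 : p.weight = q.weight) (h4 : p.elt = q.elt) : p = q := by
  cases p
  cases q
  simp only at h1 h2 h3 h4
  subst h1 h2 h3 h4
  rfl

/-- The class of a treewise tensor in the bar construction. -/
noncomputable def cl (T : BarTree I) : Bar I := (multRel I).mkQ (Finsupp.single T 1)

theorem mkQ_eq_sum_cl (r : BarTree I →₀ K) :
    (multRel I).mkQ r = ∑ T ∈ r.support, r T • cl T := by
  conv_lhs => rw [← Finsupp.sum_single r]
  rw [Finsupp.sum, map_sum]
  refine Finset.sum_congr rfl fun t _ => ?_
  rw [cl, ← map_smul, Finsupp.smul_single, smul_eq_mul, mul_one]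

theorem bar_hom_ext {V : Type*} [AddCommGroup V] [Module K V] {f g : Bar I →ₗ[K] V}
    (h : ∀ T, f (cl T) = g (cl T)) : f = g := by
  apply Submodule.linearMap_qext
  apply Finsupp.lhom_ext
  intro T a
  have := congrArg (a • ·) (h T)
  simp only [← map_smul, cl] at this
  simpa only [Finsupp.smul_single, smul_eq_mul, mul_one, LinearMap.comp_apply] using this

/-- Treewise tensors are linear in the label of the root. -/
noncomputable def rootB (n : ℕ) (d : ℤ) (w : ℕ) (hw : 0 < w) (c : ℕ → BarTree I) :
    I.qpiece n d w →ₗ[K] Bar I :=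
  have key : ∀ (a : K) (x y : I.qpiece n d w),
      cl (nd (⟨n, d, w, hw, (a • x + y).1, (a • x + y).2⟩ : Op I) c)
        = a • cl (nd (⟨n, d, w, hw, x.1, x.2⟩ : Op I) c)
          + cl (nd (⟨n, d, w, hw, y.1, y.2⟩ : Op I) c) := fun a x y => by
    have := root_mem (pos := hw) (a := a) x.2 y.2 (a • x + y).2 rfl (fun j : Fin n => c j)
    rw [sub_sub] at this
    have := (Submodule.Quotient.eq _).2 this
    simp only [Submodule.Quotient.mk_add, Submodule.Quotient.mk_smul] at this
    exact this
  have h0 : cl (nd (⟨n, d, w, hw, (0 : I.qpiece n d w).1, (0 : I.qpiece n d w).2⟩ : Op I) c)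
      = 0 := by
    have := key 1 0 0
    simpa using this
  { toFun := fun x => cl (nd (⟨n, d, w, hw, x.1, x.2⟩ : Op I) c)
    map_add' := fun x y => by simpa using key 1 x y
    map_smul' := fun a x => by
      have := key a x 0
      rw [h0, add_zero] at this
      simpa using this }

theorem rootB_apply (p : Op I) (c : ℕ → BarTree I) :
    rootB p.arity p.degree p.weight p.pos c ⟨p.elt, p.mem⟩ = cl (nd p c) := rfl

theorem cl_nd_smul {p p' : Op I} (h1 : p.arity = p'.arity) (h2 : p.degree = p'.degree)
    (h3 : p.weight = p'.weight) (a : K) (h4 : p.elt = a • p'.elt) (c : ℕ → BarTree I) :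
    cl (nd p c) = a • cl (nd p' c) := by
  rw [← rootB_apply p', ← map_smul]
  obtain ⟨n, d, w, hw, x, hx⟩ := p
  obtain ⟨n', d', w', hw', x', hx'⟩ := p'
  simp only at h1 h2 h3 h4
  subst h1 h2 h3 h4
  rfl

theorem cl_nd_congr (p : Op I) {c c' : ℕ → BarTree I} (h : ∀ j < p.arity, c j = c' j) :
    cl (nd p c) = cl (nd p c') := by rw [nd_congr p h]

/-- The total degree of the first `j` trees of a sequence. -/
def lD (c : ℕ → BarTree I) (j : ℕ) : ℤ := ∑ k ∈ Finset.range j, bdeg (c k)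

theorem leftDeg_nd {n : ℕ} (c : ℕ → BarTree I) (j : Fin n) :
    leftDeg (fun k : Fin n => c k) j = lD c j := by
  unfold leftDeg lD
  refine Finset.sum_bij (fun k _ => k.1) ?_ ?_ ?_ ?_
  · intro a ha
    exact Finset.mem_range.2 (Finset.mem_filter.1 ha).2
  · intro a _ b _ h
    exact Fin.ext h
  · intro b hb
    simp only [Finset.mem_range] at hb
    exact ⟨⟨b, hb.trans j.2⟩, Finset.mem_filter.2 ⟨Finset.mem_univ _, hb⟩, rfl⟩
  · intros
    rfl

theorem bdeg_nd (p : Op I) (c : ℕ → BarTree I) : bdeg (nd p c) = p.degree + 1 + lD c p.arity :=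
  total_nd _ _ _

theorem lD_succ (c : ℕ → BarTree I) (j : ℕ) : lD c (j + 1) = lD c j + bdeg (c j) :=
  Finset.sum_range_succ _ _

theorem lD_congr {c c' : ℕ → BarTree I} {j : ℕ} (h : ∀ k < j, bdeg (c k) = bdeg (c' k)) :
    lD c j = lD c' j :=
  Finset.sum_congr rfl fun k hk => h k (Finset.mem_range.1 hk)

theorem lD_update (c : ℕ → BarTree I) (k : ℕ) (T : BarTree I) (j : ℕ) :
    lD (Function.update c k T) j = if k < j then lD c j + bdeg T - bdeg (c k) else lD c j := by
  induction j with
  | zero => simp [lD]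
  | succ j ih =>
    rw [lD_succ, ih, lD_succ]
    rcases lt_trichotomy k j with h | rfl | h
    · rw [if_pos h, if_pos (by omega), Function.update_of_ne h.ne']
      ring
    · rw [if_neg (lt_irrefl _), if_pos (by omega), Function.update_self]
      ring
    · rw [if_neg (by omega), if_neg (by omega), Function.update_of_ne h.ne]

theorem lD_spliceN_le (c : ℕ → BarTree I) (j m : ℕ) (c' : ℕ → BarTree I) {k : ℕ} (hk : k ≤ j) :
    lD (spliceN c j m c') k = lD c k :=
  lD_congr fun i hi => by rw [spliceN, if_pos (hi.trans_le hk)]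

theorem lD_spliceN_add (c : ℕ → BarTree I) (j m : ℕ) (c' : ℕ → BarTree I) {l : ℕ} (hl : l ≤ m) :
    lD (spliceN c j m c') (j + l) = lD c j + lD c' l := by
  induction l with
  | zero => rw [add_zero, lD_spliceN_le _ _ _ _ le_rfl]; simp [lD]
  | succ l ih => rw [← add_assoc, lD_succ, ih (by omega), spliceN_add _ _ _ _ hl, lD_succ, add_assoc]

theorem lD_spliceN_gt (c : ℕ → BarTree I) (j m : ℕ) (c' : ℕ → BarTree I) {k : ℕ} (hk : j < k) :
    lD (spliceN c j m c') (k + m - 1) = lD c k - bdeg (c j) + lD c' m := by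
  obtain ⟨a, rfl⟩ : ∃ a, k = j + 1 + a := ⟨k - j - 1, by omega⟩
  induction a with
  | zero =>
    rw [show j + 1 + 0 + m - 1 = j + m by omega, lD_spliceN_add _ _ _ _ le_rfl, add_zero, lD_succ]
    ring
  | succ a ih =>
    have := ih (by omega)
    rw [show j + 1 + (a + 1) + m - 1 = (j + 1 + a + m - 1) + 1 by omega, lD_succ, this,
      ← add_assoc, lD_succ]
    have e := spliceN_shift c j m c' (k := j + 1 + a) (by omega)
    rw [shift, if_neg (by omega)] at e
    rw [e]
    ring

/-- Replacement of the tree over the entry `j` of the root vertex `p`. -/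
noncomputable def nodeB (p : Op I) (c : ℕ → BarTree I) (j : ℕ) : Bar I →ₗ[K] Bar I :=
  if h : j < p.arity then
    (multRel I).mapQ (multRel I) (onChild p (fun k => c k) ⟨j, h⟩) (fun _ hr => onChild_mem _ _ _ hr)
  else 0

theorem nodeB_cl (p : Op I) (c : ℕ → BarTree I) {j : ℕ} (h : j < p.arity) (T : BarTree I) :
    nodeB p c j (cl T) = cl (nd p (Function.update c j T)) := by
  rw [nodeB, dif_pos h, cl, Submodule.mkQ_apply, Submodule.mapQ_apply, onChild_single, cl,
    Submodule.mkQ_apply, nd]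
  congr 4
  funext k
  simp only [Function.update_apply, Fin.ext_iff]

/-- Contraction of the edge from a tree over the entry `j` of the root vertex `p`. -/
noncomputable def conB (p : Op I) (c : ℕ → BarTree I) (j : ℕ) : Bar I →ₗ[K] Bar I :=
  if h : j < p.arity then
    (multRel I).mapQ (multRel I)
      (Finsupp.linearCombination K (contractRoot p (fun k => c k) ⟨j, h⟩)) (by
        rw [multRel, Submodule.span_le]
        intro r hr
        exact linComb_contractRoot_mem _ _ _ hr)
  else 0

theorem conB_cl_leaf (p : Op I) (c : ℕ → BarTree I) (j : ℕ) : conB p c j (cl leaf) = 0 := by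
  unfold conB
  split_ifs
  · rw [cl, Submodule.mkQ_apply, Submodule.mapQ_apply, Finsupp.linearCombination_single]
    simp [contractRoot]
  · rfl

theorem conB_cl_nd (p : Op I) (c : ℕ → BarTree I) {j : ℕ} (h : j < p.arity) (q : Op I)
    (c' : ℕ → BarTree I) : conB p c j (cl (nd q c'))
      = ksign K (p.degree + (q.degree + 1) * lD c j)
        • cl (nd (p.comp ⟨j, h⟩ q) (spliceN c j q.arity c')) := by
  rw [conB, dif_pos h, cl, Submodule.mkQ_apply, Submodule.mapQ_apply,
    Finsupp.linearCombination_single, one_smul, nd, contractRoot, leftDeg_nd, cl, ← map_smul,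
    Finsupp.smul_single, smul_eq_mul, mul_one, Submodule.mkQ_apply]
  rfl

theorem conB_update (p : Op I) (c : ℕ → BarTree I) (j : ℕ) (T : BarTree I) :
    conB p (Function.update c j T) j = conB p c j := by
  by_cases h : j < p.arity
  · refine bar_hom_ext fun U => ?_
    rcases leaf_or_nd U with rfl | ⟨q, c', rfl⟩
    · rw [conB_cl_leaf, conB_cl_leaf]
    · rw [conB_cl_nd _ _ h, conB_cl_nd _ _ h, lD_update, if_neg (lt_irrefl j), spliceN_update_self]
  · simp [conB, h]

theorem nodeB_update (p : Op I) (c : ℕ → BarTree I) (j : ℕ) (T : BarTree I) :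
    nodeB p (Function.update c j T) j = nodeB p c j := by
  by_cases h : j < p.arity
  · refine bar_hom_ext fun U => ?_
    rw [nodeB_cl _ _ h, nodeB_cl _ _ h, Function.update_idem]
  · simp [nodeB, h]

/-- The sign with which the differential of the tree over the entry `j` of `p` contributes. -/
def sg (p : Op I) (c : ℕ → BarTree I) (j : ℕ) : K := ksign K (p.degree + 1 + lD c j)

theorem barDiff_cl (T : BarTree I) : barDiff I (cl T) = (multRel I).mkQ (dTree T) := by
  rw [barDiff, cl, Submodule.mkQ_apply, Submodule.mapQ_apply, Finsupp.linearCombination_single,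
    one_smul, Submodule.mkQ_apply]

theorem barDiff_leaf : barDiff I (cl leaf) = 0 := by
  rw [barDiff_cl, dTree, map_zero]

/-- The recursion is phrased with linear endomorphisms of the quotient, so that a boundary can again
be inserted over an entry; all computations with the differential use it. -/
theorem barDiff_nd (p : Op I) (c : ℕ → BarTree I) : barDiff I (cl (nd p c))
    = ∑ j ∈ Finset.range p.arity,
      (conB p c j (cl (c j)) + sg p c j • nodeB p c j (barDiff I (cl (c j)))) := by
  rw [barDiff_cl, nd, dTree, map_sum, Finset.sum_range]
  refine Finset.sum_congr rfl fun j _ => ?_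
  rw [map_add, map_smul, leftDeg_nd, barDiff_cl]
  congr 1
  · rw [conB, dif_pos j.2, cl, Submodule.mkQ_apply, Submodule.mkQ_apply, Submodule.mapQ_apply,
      Finsupp.linearCombination_single, one_smul]
  · rw [nodeB, dif_pos j.2, Submodule.mkQ_apply, Submodule.mkQ_apply, Submodule.mapQ_apply]
    rfl

end bar


open PTree

/-! ### The differential squares to zero. -/

section bar

variable {K : Type v} [Field K] {G : Type u} {ar : G → ℕ} {deg : G → ℤ} {I : OpIdeal K ar deg}

theorem total_nd_spliceN {A : Type*} [AddCommMonoid A] (f : Op I → A) (p : Op I)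
    (c : ℕ → BarTree I) {j : ℕ} (hj : j < p.arity) (q : Op I) (c' : ℕ → BarTree I) :
    (nd (p.comp ⟨j, hj⟩ q) (spliceN c j q.arity c')).total f
      = f (p.comp ⟨j, hj⟩ q) + (∑ l ∈ Finset.range q.arity, (c' l).total f
        + ∑ k ∈ (Finset.range p.arity).erase j, (c k).total f) := by
  rw [total_nd]
  change _ + ∑ i ∈ Finset.range (p.arity + q.arity - 1), _ = _
  rw [sum_range_splice _ hj]
  congr 2
  · exact Finset.sum_congr rfl fun l hl => by rw [spliceN_add _ _ _ _ (Finset.mem_range.1 hl)]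
  · exact Finset.sum_congr rfl fun k hk => by rw [spliceN_shift _ _ _ _ (Finset.mem_erase.1 hk).1]

theorem total_nd_update {A : Type*} [AddCommMonoid A] {H : Type*} {ah : H → ℕ} (f : H → A) (g : H)
    (c : ℕ → PTree H ah) {j : ℕ} (hj : j < ah g) (t : PTree H ah) :
    (nd g (Function.update c j t)).total f
      = f g + (t.total f + ∑ k ∈ (Finset.range (ah g)).erase j, (c k).total f) := by
  rw [total_nd, ← Finset.add_sum_erase _ _ (Finset.mem_range.2 hj), Function.update_self]
  congr 2
  exact Finset.sum_congr rfl fun k hk => by rw [Function.update_of_ne (Finset.mem_erase.1 hk).1]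

/-- The effect of the differential on an additive statistic of the labels. -/
theorem total_of_mem_dTree {A : Type*} [AddCommMonoid A] (f : Op I → A) (a : A)
    (hf : ∀ (p : Op I) (j : Fin p.arity) (q : Op I), f (p.comp j q) + a = f p + f q)
    (T : BarTree I) :
    dTree T ∈ Finsupp.supported K K {S : BarTree I | S.total f + a = T.total f} := by
  induction T using nd_induction with
  | hl => exact Submodule.zero_mem _
  | hn p c ih =>
    rw [nd, dTree]
    refine Submodule.sum_mem _ fun j _ => Submodule.add_mem _ ?_ (Submodule.smul_mem _ _ ?_)
    · have e := total_nd_update f p c j.2 (c j)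
      rw [Function.update_eq_self] at e
      rcases leaf_or_nd (c j) with h | ⟨q, c', h⟩
      · rw [h]
        exact Submodule.zero_mem _
      · rw [h, total_nd f q c'] at e
        rw [h]
        refine Finsupp.single_mem_supported K _ ?_
        change (nd (p.comp ⟨j, j.2⟩ q) (spliceN c j q.arity c')).total f + a = (nd p c).total f
        rw [total_nd_spliceN, e, add_right_comm, hf]
        simp only [add_assoc]
    · rw [onChild, Finsupp.lmapDomain_apply, Finsupp.mem_supported]
      classical
      intro T hT
      obtain ⟨S, hS, rfl⟩ := Finset.mem_image.1 (Finsupp.mapDomain_support hT)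
      have hS' : S.total f + a = (c j).total f := ih j j.2 hS
      have e := total_nd_update f p c j.2 (c j)
      rw [Function.update_eq_self] at e
      have e' : node p (Function.update (fun k : Fin p.arity => c k) j S)
          = nd p (Function.update c j S) := by
        unfold nd
        congr 1
        funext k
        simp only [Function.update_apply, Fin.ext_iff]
      change _ = (nd p c).total f
      rw [e', total_nd_update f p c j.2, e, ← hS', add_assoc, add_right_comm (S.total f)]

/-- A contraction merges two suspended labels into one, and thereby loses exactly one suspension. -/
theorem bdeg_of_mem_dTree (T S : BarTree I) (hS : S ∈ (dTree T).support) :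
    bdeg S = bdeg T - 1 := by
  have : bdeg S + 1 = bdeg T := total_of_mem_dTree (fun p : Op I => p.degree + 1) 1
    (fun p j q => by simp only [Op.comp]; ring) T hS
  omega

theorem barDiff_cl_eq_sum (T : BarTree I) :
    barDiff I (cl T) = ∑ S ∈ (dTree T).support, dTree T S • cl S := by
  rw [barDiff_cl, mkQ_eq_sum_cl]

/-- Two successive edges of a chain can be contracted in either order with the same result, by
associativity. The exponents of the two signs differ by an odd number, so the two terms cancel in
the square. -/
theorem conB_conB (p : Op I) (c : ℕ → BarTree I) {j : ℕ} (hj : j < p.arity) (q : Op I)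
    (c' : ℕ → BarTree I) {l : ℕ} (hl : l < q.arity) (y : Bar I) :
    ksign K (p.degree + (q.degree + 1) * lD c j)
        • conB (p.comp ⟨j, hj⟩ q) (spliceN c j q.arity c') (j + l) y
      = -(sg p c j • conB p c j (conB q c' l y)) := by
  have hjl : j + l < (p.comp ⟨j, hj⟩ q).arity := by
    change j + l < p.arity + q.arity - 1
    omega
  suffices h : ksign K (p.degree + (q.degree + 1) * lD c j)
        • conB (p.comp ⟨j, hj⟩ q) (spliceN c j q.arity c') (j + l)
      = -(sg p c j • (conB p c j ∘ₗ conB q c' l)) from LinearMap.congr_fun h y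
  refine bar_hom_ext fun T => ?_
  simp only [LinearMap.smul_apply, LinearMap.neg_apply, LinearMap.comp_apply]
  rcases leaf_or_nd T with rfl | ⟨r, c'', rfl⟩
  · simp only [conB_cl_leaf, map_zero, smul_zero, neg_zero]
  · rw [conB_cl_nd _ _ hjl, conB_cl_nd _ _ hl, map_smul, conB_cl_nd _ _ hj,
      spliceN_spliceN _ _ _ _ hl, lD_spliceN_add _ _ _ _ hl.le]
    have e : (p.comp ⟨j, hj⟩ q).comp ⟨j + l, hjl⟩ r = p.comp ⟨j, hj⟩ (q.comp ⟨l, hl⟩ r) := by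
      refine Op.ext' ?_ (add_assoc _ _ _) (add_assoc _ _ _) ?_
      · change p.arity + q.arity - 1 + r.arity - 1 = p.arity + (q.arity + r.arity - 1) - 1
        omega
      · exact I.qcomp_qcomp p.mem q.mem r.mem hj hl
    rw [e, sg, smul_smul, smul_smul, smul_smul, ← neg_smul]
    congr 1
    rw [← ksign_add, ← ksign_add, ← ksign_add]
    apply ksign_neg_congr
    refine ⟨-p.degree - 1 - lD c j + p.degree + lD c j , ?_⟩
    simp only [Op.comp]
    ring

/-- Contracting the edge below `q` anticommutes with inserting a boundary over an entry of `q`,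
because the insertion then passes one suspended label fewer. -/
theorem conB_nodeB (p : Op I) (c : ℕ → BarTree I) {j : ℕ} (hj : j < p.arity) (q : Op I)
    (c' : ℕ → BarTree I) {l : ℕ} (hl : l < q.arity) (y : Bar I) :
    ksign K (p.degree + (q.degree + 1) * lD c j)
        • (sg (p.comp ⟨j, hj⟩ q) (spliceN c j q.arity c') (j + l)
          • nodeB (p.comp ⟨j, hj⟩ q) (spliceN c j q.arity c') (j + l) y)
      = -(sg p c j • conB p c j (sg q c' l • nodeB q c' l y)) := by
  have hjl : j + l < (p.comp ⟨j, hj⟩ q).arity := by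
    change j + l < p.arity + q.arity - 1
    omega
  suffices h : ksign K (p.degree + (q.degree + 1) * lD c j)
        • (sg (p.comp ⟨j, hj⟩ q) (spliceN c j q.arity c') (j + l)
          • nodeB (p.comp ⟨j, hj⟩ q) (spliceN c j q.arity c') (j + l))
      = -(sg p c j • (conB p c j ∘ₗ (sg q c' l • nodeB q c' l))) from LinearMap.congr_fun h y
  refine bar_hom_ext fun T => ?_
  simp only [LinearMap.smul_apply, LinearMap.neg_apply, LinearMap.comp_apply]
  rw [nodeB_cl _ _ hjl, nodeB_cl _ _ hl, map_smul, conB_cl_nd _ _ hj,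
    spliceN_update_right _ _ _ _ hl, smul_smul, smul_smul, smul_smul, ← neg_smul]
  congr 1
  rw [sg, sg, sg, lD_spliceN_add _ _ _ _ hl.le, ← ksign_add, ← ksign_add, ← ksign_add]
  apply ksign_neg_congr
  refine ⟨-1, ?_⟩
  simp only [Op.comp]
  ring

/-- The terms of the square of the differential that contract the edge to `c k` and differentiate
`c j`. -/
noncomputable def crossCon (p : Op I) (c : ℕ → BarTree I) (j k : ℕ) : Bar I :=
  sg p c j • ∑ S ∈ (dTree (c j)).support, dTree (c j) S
    • conB p (Function.update c j S) k (cl (c k))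

/-- The terms of the square of the differential that differentiate `c j` and `c k`. -/
noncomputable def crossNode (p : Op I) (c : ℕ → BarTree I) (j k : ℕ) : Bar I :=
  sg p c j • ∑ S ∈ (dTree (c j)).support, dTree (c j) S
    • (sg p (Function.update c j S) k • nodeB p (Function.update c j S) k (barDiff I (cl (c k))))

/-- The terms of the square of the differential that contract the edges to `c j` and to `c k`. -/
noncomputable def crossPar (p : Op I) (c : ℕ → BarTree I) (j k : ℕ) : Bar I :=
  if hj : j < p.arity then
    match c j with
    | leaf => 0
    | node q c' => ksign K (p.degree + (q.degree + 1) * lD c j)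
      • conB (p.comp ⟨j, hj⟩ q) (spliceN c j q.arity (ext c')) (shift j q.arity k) (cl (c k))
  else 0

theorem spliceN_congr {α : Type*} (c : ℕ → α) (j : ℕ) {m : ℕ} {c' c'' : ℕ → α}
    (h : ∀ l < m, c' l = c'' l) : spliceN c j m c' = spliceN c j m c'' := by
  funext i
  unfold spliceN
  split_ifs
  · rfl
  · exact h _ (by omega)
  · rfl

theorem crossPar_nd (p : Op I) (c : ℕ → BarTree I) {j k : ℕ} (hj : j < p.arity) (q : Op I)
    (c' : ℕ → BarTree I) (h : c j = nd q c') : crossPar p c j k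
      = ksign K (p.degree + (q.degree + 1) * lD c j)
      • conB (p.comp ⟨j, hj⟩ q) (spliceN c j q.arity c') (shift j q.arity k) (cl (c k)) := by
  rw [crossPar, dif_pos hj, h]
  simp only [nd]
  rw [spliceN_congr c j (c' := ext fun j => c' j.1) (c'' := c') fun l hl => ext_of_lt _ hl]

theorem crossPar_leaf (p : Op I) (c : ℕ → BarTree I) {j k : ℕ} (h : c j = leaf) :
    crossPar p c j k = 0 := by
  rw [crossPar]
  split_ifs
  · rw [h]
  · rfl

/-- Two edges at the same vertex: parallel associativity identifies the two double contractions up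
to the sign of exchanging `q` and `r`. The suspensions turn this sign into the opposite of the one
coming from the differential. -/
theorem crossPar_add_swap_of_lt (p : Op I) (c : ℕ → BarTree I) {j k : ℕ} (hjk : j < k)
    (hk : k < p.arity) : crossPar p c j k + crossPar p c k j = 0 := by
  have hj := hjk.trans hk
  rcases leaf_or_nd (c j) with h | ⟨q, c', h⟩
  · rw [crossPar_leaf p c h, zero_add]
    rcases leaf_or_nd (c k) with h' | ⟨r, c'', h'⟩
    · rw [crossPar_leaf p c h']
    · rw [crossPar_nd p c hk r c'' h', h, conB_cl_leaf, smul_zero]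
  · rw [crossPar_nd p c hj q c' h]
    rcases leaf_or_nd (c k) with h' | ⟨r, c'', h'⟩
    · rw [crossPar_leaf p c h', h', conB_cl_leaf, smul_zero, zero_add]
    · have s1 : shift j q.arity k = k + q.arity - 1 := if_neg (by omega)
      have s2 : shift k r.arity j = j := if_pos hjk
      have h1 : k + q.arity - 1 < (p.comp ⟨j, hj⟩ q).arity := by
        change k + q.arity - 1 < p.arity + q.arity - 1
        omega
      have h2 : j < (p.comp ⟨k, hk⟩ r).arity := by
        change j < p.arity + r.arity - 1
        omega
      rw [crossPar_nd p c hk r c'' h', h, h', s1, s2, conB_cl_nd _ _ h1, conB_cl_nd _ _ h2,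
        spliceN_parallel c hjk, lD_spliceN_gt _ _ _ _ hjk, lD_spliceN_le _ _ _ _ hjk.le, h,
        bdeg_nd]
      have e := cl_nd_smul (p := (p.comp ⟨j, hj⟩ q).comp ⟨k + q.arity - 1, h1⟩ r)
          (p' := (p.comp ⟨k, hk⟩ r).comp ⟨j, h2⟩ q)
        (by
          change p.arity + q.arity - 1 + r.arity - 1 = p.arity + r.arity - 1 + q.arity - 1
          omega)
        (add_right_comm _ _ _) (add_right_comm _ _ _) _
        (I.qcomp_qcomp_parallel p.mem q.mem r.mem hjk hk)
        (spliceN (spliceN c k r.arity c'') j q.arity c')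
      rw [e, smul_smul, smul_smul, smul_smul, ← add_smul, ← ksign_add, ← ksign_add, ← ksign_add]
      convert zero_smul K _
      rw [add_eq_zero_iff_eq_neg]
      apply ksign_neg_congr
      refine ⟨-(r.degree + 1) * (q.degree + 1) + q.degree * r.degree + q.degree , ?_⟩
      simp only [Op.comp]
      ring

/-- Boundaries taken in two different subtrees anticommute: the differential lowers by one the
degree of the left subtree, which enters the sign for the right one but not conversely. -/
theorem crossNode_add_swap_of_lt (p : Op I) (c : ℕ → BarTree I) {j k : ℕ} (hjk : j < k)
    (hk : k < p.arity) : crossNode p c j k + crossNode p c k j = 0 := by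
  have hj := hjk.trans hk
  unfold crossNode
  simp only [barDiff_cl_eq_sum, map_sum, map_smul, Finset.smul_sum, nodeB_cl _ _ hj,
    nodeB_cl _ _ hk]
  rw [Finset.sum_comm, ← Finset.sum_add_distrib]
  refine Finset.sum_eq_zero fun U hU => ?_
  rw [← Finset.sum_add_distrib]
  refine Finset.sum_eq_zero fun S hS => ?_
  have h1 := bdeg_of_mem_dTree _ _ hU
  have h2 := bdeg_of_mem_dTree _ _ hS
  rw [Function.update_comm hjk.ne, sg, sg, sg, sg, lD_update, lD_update, if_pos hjk,
    if_neg (by omega)]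
  simp only [smul_smul]
  rw [← add_smul]
  convert zero_smul K _
  have e : ksign K (p.degree + 1 + lD c j) * ksign K (p.degree + 1 + (lD c k + bdeg S - bdeg (c j)))
      = -(ksign K (p.degree + 1 + lD c k) * ksign K (p.degree + 1 + lD c j)) := by
    rw [← ksign_add, ← ksign_add]
    apply ksign_neg_congr
    refine ⟨-1, ?_⟩
    rw [h2]
    ring
  linear_combination (dTree (c j) S * dTree (c k) U) * e

/-- The second differential hits the root edge to the changed subtree, that subtree again, or
another entry `k` of the root. The last two kinds of terms at `k` are `crossCon` and `crossNode`. -/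
theorem barDiff_nodeB (p : Op I) (c : ℕ → BarTree I) {j : ℕ} (hj : j < p.arity)
    (h0 : barDiff I (barDiff I (cl (c j))) = 0) :
    sg p c j • barDiff I (nodeB p c j (barDiff I (cl (c j))))
      = sg p c j • conB p c j (barDiff I (cl (c j)))
        + ∑ k ∈ (Finset.range p.arity).erase j, (crossCon p c j k + crossNode p c j k) := by
  have e1 : barDiff I (nodeB p c j (barDiff I (cl (c j))))
      = ∑ S ∈ (dTree (c j)).support, dTree (c j) S
        • ((conB p c j (cl S) + sg p c j • nodeB p c j (barDiff I (cl S)))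
        + ∑ k ∈ (Finset.range p.arity).erase j, (conB p (Function.update c j S) k (cl (c k))
          + sg p (Function.update c j S) k
            • nodeB p (Function.update c j S) k (barDiff I (cl (c k))))) := by
    conv_lhs => rw [barDiff_cl_eq_sum]
    simp only [map_sum, map_smul, nodeB_cl _ _ hj]
    refine Finset.sum_congr rfl fun S _ => ?_
    rw [barDiff_nd, ← Finset.add_sum_erase _ _ (Finset.mem_range.2 hj), Function.update_self,
      conB_update, nodeB_update, sg, lD_update, if_neg (lt_irrefl j), ← sg]
    congr 2
    refine Finset.sum_congr rfl fun k hk => ?_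
    rw [Function.update_of_ne (Finset.mem_erase.1 hk).1]
  rw [e1]
  simp only [smul_add, Finset.sum_add_distrib, Finset.smul_sum]
  rw [add_assoc]
  congr 1
  · rw [barDiff_cl_eq_sum (c j)]
    simp only [map_sum, map_smul, Finset.smul_sum]
  · have e2 : ∑ S ∈ (dTree (c j)).support,
        sg p c j • dTree (c j) S • sg p c j • nodeB p c j (barDiff I (cl S)) = 0 := by
      rw [barDiff_cl_eq_sum (c j)] at h0
      have := congrArg (fun y => sg (K := K) p c j • sg (K := K) p c j • nodeB p c j y) h0
      simp only [map_sum, map_smul, Finset.smul_sum, map_zero, smul_zero] at this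
      rw [← this]
      refine Finset.sum_congr rfl fun S _ => ?_
      rw [smul_comm (dTree (c j) S)]
    rw [e2, zero_add]
    congr 1
    · rw [Finset.sum_comm]
      refine Finset.sum_congr rfl fun k _ => ?_
      rw [crossCon, Finset.smul_sum]
    · rw [Finset.sum_comm]
      refine Finset.sum_congr rfl fun k _ => ?_
      rw [crossNode, Finset.smul_sum]

/-- The entries of the contracted vertex that come from the upper vertex reproduce, with the
opposite sign, the contraction applied to the boundary of `c j`. The other entries give the mixed
terms. -/
theorem barDiff_conB (p : Op I) (c : ℕ → BarTree I) {j : ℕ} (hj : j < p.arity) :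
    barDiff I (conB p c j (cl (c j)))
      = -(sg p c j • conB p c j (barDiff I (cl (c j))))
        + ∑ k ∈ (Finset.range p.arity).erase j, (crossPar p c j k - crossCon p c k j) := by
  rcases leaf_or_nd (c j) with h | ⟨q, c', h⟩
  · rw [h, conB_cl_leaf, barDiff_leaf, map_zero, map_zero, smul_zero, neg_zero, zero_add,
      Finset.sum_eq_zero]
    intro k _
    rw [crossPar_leaf p c h, crossCon, h]
    simp only [conB_cl_leaf, smul_zero, Finset.sum_const_zero, sub_zero]
  · rw [h, conB_cl_nd _ _ hj, map_smul, barDiff_nd, barDiff_nd]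
    change _ • ∑ i ∈ Finset.range (p.arity + q.arity - 1), _ = _
    rw [sum_range_splice _ hj, smul_add]
    congr 1
    · rw [map_sum, Finset.smul_sum, Finset.smul_sum, ← Finset.sum_neg_distrib]
      refine Finset.sum_congr rfl fun l hl => ?_
      rw [Finset.mem_range] at hl
      rw [smul_add, spliceN_add _ _ _ _ hl, conB_conB _ _ _ _ _ hl, conB_nodeB _ _ _ _ _ hl,
        map_add, smul_add, neg_add]
    · rw [Finset.smul_sum]
      refine Finset.sum_congr rfl fun k hk => ?_
      obtain ⟨hkj, hk⟩ := Finset.mem_erase.1 hk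
      rw [Finset.mem_range] at hk
      rw [smul_add, spliceN_shift _ _ _ _ hkj, crossPar_nd p c hj q c' h, sub_eq_add_neg]
      congr 1
      have hs : shift j q.arity k < (p.comp ⟨j, hj⟩ q).arity := by
        change shift j q.arity k < p.arity + q.arity - 1
        rw [shift]
        split_ifs <;> omega
      rw [barDiff_cl_eq_sum, crossCon, h]
      simp only [map_sum, map_smul, Finset.smul_sum, ← Finset.sum_neg_distrib]
      refine Finset.sum_congr rfl fun S hS => ?_
      have hd := bdeg_of_mem_dTree _ _ hS
      rw [nodeB_cl _ _ hs, conB_cl_nd _ _ hj, spliceN_update_left _ _ _ _ hkj]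
      simp only [smul_smul]
      rw [← neg_smul]
      congr 1
      have e : ksign K (p.degree + (q.degree + 1) * lD c j)
            * sg (p.comp ⟨j, hj⟩ q) (spliceN c j q.arity c') (shift j q.arity k)
          = -(sg p c k * ksign K (p.degree + (q.degree + 1) * lD (Function.update c k S) j)) := by
        rw [sg, sg, ← ksign_add, ← ksign_add, lD_update]
        apply ksign_neg_congr
        by_cases hlt : k < j
        · rw [if_pos hlt, shift, if_pos hlt, lD_spliceN_le _ _ _ _ hlt.le, hd]
          refine ⟨q.degree, ?_⟩
          simp only [Op.comp]
          ring
        · rw [if_neg hlt, shift, if_neg hlt, lD_spliceN_gt _ _ _ _ (by omega), h, bdeg_nd]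
          refine ⟨-1, ?_⟩
          simp only [Op.comp]
          ring
      linear_combination dTree (c k) S * e

theorem sum_sum_erase_eq_zero {A : Type*} [AddCommGroup A] (n : ℕ) (F : ℕ → ℕ → A)
    (h : ∀ j k, j < k → k < n → F j k + F k j = 0) :
    ∑ j ∈ Finset.range n, ∑ k ∈ (Finset.range n).erase j, F j k = 0 := by
  induction n with
  | zero => simp
  | succ n ih =>
    have ih' := ih fun j k h1 h2 => h j k h1 (by omega)
    have e : ∀ j ∈ Finset.range n, ∑ k ∈ (Finset.range (n + 1)).erase j, F j k
        = F j n + ∑ k ∈ (Finset.range n).erase j, F j k := by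
      intro j hj
      rw [Finset.mem_range] at hj
      rw [Finset.range_add_one, Finset.erase_insert_of_ne hj.ne', Finset.sum_insert (by simp)]
    rw [Finset.sum_range_succ, Finset.sum_congr rfl e, Finset.sum_add_distrib, ih', add_zero,
      Finset.range_add_one, Finset.erase_insert (by simp), ← Finset.sum_add_distrib]
    exact Finset.sum_eq_zero fun j hj => h j n (Finset.mem_range.1 hj) n.lt_succ_self

theorem barDiff_barDiff_cl (T : BarTree I) : barDiff I (barDiff I (cl T)) = 0 := by
  induction T using nd_induction with
  | hl => rw [barDiff_leaf, map_zero]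
  | hn p c ih =>
    rw [barDiff_nd, map_sum]
    -- The contractions of the boundary of `c j` cancel between the two expansions. The remaining
    -- terms form a sum over pairs of entries that is antisymmetric in the pair.
    have e : ∀ j ∈ Finset.range p.arity, barDiff I (conB p c j (cl (c j))
          + sg p c j • nodeB p c j (barDiff I (cl (c j))))
        = ∑ k ∈ (Finset.range p.arity).erase j,
          (crossPar p c j k + crossNode p c j k + (crossCon p c j k - crossCon p c k j)) := by
      intro j hj
      rw [Finset.mem_range] at hj
      rw [map_add, map_smul, barDiff_nodeB p c hj (ih j hj), barDiff_conB p c hj]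
      simp only [Finset.sum_add_distrib, Finset.sum_sub_distrib]
      abel
    rw [Finset.sum_congr rfl e]
    refine sum_sum_erase_eq_zero _ _ fun j k hjk hk => ?_
    have h1 := crossPar_add_swap_of_lt p c hjk hk
    have h2 := crossNode_add_swap_of_lt p c hjk hk
    calc _ = (crossPar p c j k + crossPar p c k j) + (crossNode p c j k + crossNode p c k j) := by
          abel
      _ = 0 := by rw [h1, h2, add_zero]

/-- The differential of the bar construction squares to zero. -/
theorem barDiff_barDiff (y : Bar I) : barDiff I (barDiff I y) = 0 := by
  have : barDiff I ∘ₗ barDiff I = 0 := bar_hom_ext fun T => barDiff_barDiff_cl T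
  exact LinearMap.congr_fun this y

end bar


open PTree

/-! ### Treewise tensors of functionals on the bar construction. -/

section evaluation

variable {K : Type v} [Field K] {G : Type u} {ar : G → ℕ} {deg : G → ℤ} {I : OpIdeal K ar deg}
  {L : Type*} {la : L → ℕ}

/-- The value of a treewise tensor of functionals on a treewise tensor of operations. -/
noncomputable def evT (φ : L → I.Quot →ₗ[K] K) : PTree L la → BarTree I → K
  | leaf => fun T => match T with
    | leaf => 1
    | node _ _ => 0
  | node l m => fun T => match T with
    | leaf => 0
    | node p c => if p.arity = la l then φ l p.elt * ∏ j, evT φ (m j) (ext c j) else 0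

variable (φ : L → I.Quot →ₗ[K] K)

@[simp] theorem evT_leaf_leaf : evT φ (leaf : PTree L la) leaf = 1 := rfl

@[simp] theorem evT_leaf_nd (p : Op I) (c : ℕ → BarTree I) :
    evT φ (leaf : PTree L la) (nd p c) = 0 := rfl

@[simp] theorem evT_nd_leaf (l : L) (m : ℕ → PTree L la) : evT φ (nd l m) leaf = 0 := by
  rw [nd, evT]

theorem evT_nd_nd (l : L) (m : ℕ → PTree L la) (p : Op I) (c : ℕ → BarTree I) :
    evT φ (nd l m) (nd p c) = if p.arity = la l then
      φ l p.elt * ∏ j ∈ Finset.range (la l), evT φ (m j) (c j) else 0 := by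
  have e : evT φ (nd l m) (nd p c) = if p.arity = la l then
      φ l p.elt * ∏ j : Fin (la l), evT φ (m j) (ext (fun k : Fin p.arity => c k) j) else 0 := by
    rw [nd, nd, evT]
  rw [e]
  split_ifs with h
  · rw [Finset.prod_range]
    congr 1
    refine Finset.prod_congr rfl fun j _ => ?_
    rw [ext_of_lt _ (by rw [h]; exact j.2)]
  · rfl

theorem evT_nd_nd_update (l : L) (m : ℕ → PTree L la) (p : Op I) (c : ℕ → BarTree I) {j : ℕ}
    (hj : j < p.arity) (T : BarTree I) :
    evT φ (nd l m) (nd p (Function.update c j T)) = (if p.arity = la l then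
      φ l p.elt * ∏ k ∈ (Finset.range (la l)).erase j, evT φ (m k) (c k) else 0)
        * evT φ (m j) T := by
  rw [evT_nd_nd]
  split_ifs with h
  · rw [← Finset.mul_prod_erase _ _ (Finset.mem_range.2 (h ▸ hj)), Function.update_self,
      mul_comm (evT φ (m j) T), mul_assoc]
    congr 2
    refine Finset.prod_congr rfl fun k hk => ?_
    rw [Function.update_of_ne (Finset.mem_erase.1 hk).1]
  · rw [zero_mul]

/-- Each label enters exactly one factor of the product, and linearly, so a product of functionals
respects the multilinearity relations. -/
theorem linearCombination_evT {r : BarTree I →₀ K} (hr : IsMultRel r) :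
    ∀ m : PTree L la, Finsupp.linearCombination K (evT φ m) r = 0 := by
  induction hr with
  | root n d w pos a x y hx hy hxy c =>
    intro m
    rw [← nd_ext, ← nd_ext, ← nd_ext]
    simp only [map_sub, map_smul, Finsupp.linearCombination_single, one_smul]
    rcases leaf_or_nd m with rfl | ⟨l, m, rfl⟩
    · simp
    · simp only [evT_nd_nd, map_add, map_smul, smul_eq_mul]
      split_ifs <;> ring
  | child p c j r hr ih =>
    intro m
    rcases leaf_or_nd m with rfl | ⟨l, m, rfl⟩
    · rw [onChild, Finsupp.lmapDomain_apply, Finsupp.linearCombination_mapDomain]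
      have : (evT φ (leaf : PTree L la)) ∘ (fun T => node p (Function.update c j T)) = 0 := rfl
      rw [this, Finsupp.linearCombination_zero, LinearMap.zero_apply]
    · rw [onChild, Finsupp.lmapDomain_apply, Finsupp.linearCombination_mapDomain]
      have e : (evT φ (nd l m)) ∘ (fun T => node p (Function.update c j T))
          = fun T => (if p.arity = la l then
            φ l p.elt * ∏ k ∈ (Finset.range (la l)).erase j, evT φ (m k) (ext c k) else 0)
              * evT φ (m j) T := by
        funext T
        rw [← evT_nd_nd_update φ l m p (ext c) j.2]
        change evT φ (nd l m) (node p (Function.update c j T)) = _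
        congr 1
        unfold nd
        congr 1
        funext k
        simp only [Function.update_apply, Fin.ext_iff, ext_fin]
      rw [e, Finsupp.linearCombination_apply]
      have := congrArg ((if p.arity = la l then
            φ l p.elt * ∏ k ∈ (Finset.range (la l)).erase j, evT φ (m k) (ext c k) else 0) * ·)
            (ih (m j))
      rw [mul_zero, Finsupp.linearCombination_apply, Finsupp.mul_sum] at this
      refine Eq.trans (Finsupp.sum_congr fun T _ => ?_) this
      rw [smul_eq_mul, smul_eq_mul, mul_left_comm]

/-- The functional on the bar construction given by a treewise tensor of functionals. -/
noncomputable def ev (m : PTree L la) : Bar I →ₗ[K] K :=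
  (multRel I).liftQ (Finsupp.linearCombination K (evT φ m)) (by
    rw [multRel, Submodule.span_le]
    intro r hr
    exact linearCombination_evT φ hr m)

@[simp] theorem ev_cl (m : PTree L la) (T : BarTree I) : ev φ m (cl T) = evT φ m T := by
  rw [ev, cl, Submodule.mkQ_apply, Submodule.liftQ_apply, Finsupp.linearCombination_single,
    one_smul]

theorem ev_nodeB (l : L) (m : ℕ → PTree L la) (p : Op I) (c : ℕ → BarTree I) {j : ℕ}
    (hj : j < p.arity) (y : Bar I) :
    ev φ (nd l m) (nodeB p c j y) = (if p.arity = la l then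
      φ l p.elt * ∏ k ∈ (Finset.range (la l)).erase j, evT φ (m k) (c k) else 0)
        * ev φ (m j) y := by
  suffices h : ev φ (nd l m) ∘ₗ nodeB p c j = (if p.arity = la l then
      φ l p.elt * ∏ k ∈ (Finset.range (la l)).erase j, evT φ (m k) (c k) else 0) • ev φ (m j) from
    LinearMap.congr_fun h y
  refine bar_hom_ext fun T => ?_
  rw [LinearMap.comp_apply, nodeB_cl _ _ hj, ev_cl, evT_nd_nd_update φ _ _ _ _ hj,
    LinearMap.smul_apply, ev_cl, smul_eq_mul]

end evaluation

/-! ### A basis of the bar construction indexed by trees of basis monomials. -/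

section model

variable {K : Type v} [Field K] {G : Type u} {ar : G → ℕ} {deg : G → ℤ}

/-- A monomial of positive weight, as an operation of the quotient operad. -/
noncomputable def monOp (I : OpIdeal K ar deg) (t : PTree G ar) (ht : 0 < t.weight) : Op I where
  arity := t.leaves
  degree := t.total deg
  weight := t.weight
  pos := ht
  elt := I.mon t
  mem := I.mon_mem t

theorem weight_nd (g : G) (c : ℕ → PTree G ar) :
    (nd g c).weight = 1 + ∑ j ∈ Finset.range (ar g), (c j).weight := total_nd _ _ _

theorem weight_pos_of_ne_leaf {t : PTree G ar} (h : t ≠ leaf) : 0 < t.weight := by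
  rcases leaf_or_nd t with rfl | ⟨g, c, rfl⟩
  · exact absurd rfl h
  · rw [weight_nd]
    omega

theorem ne_leaf_of_weight_pos {t : PTree G ar} (h : 0 < t.weight) : t ≠ leaf := by
  rintro rfl
  exact lt_irrefl _ h

/-- The labels of the trees that index a basis of the bar construction. -/
abbrev Lab (B : Set (PTree G ar)) : Type u := {b : PTree G ar // b ∈ B ∧ 0 < b.weight}

/-- The trees that index a basis of the bar construction. -/
abbrev Model (B : Set (PTree G ar)) : Type u := PTree (Lab B) (fun b => b.1.leaves)

variable {B : Set (PTree G ar)} (I : OpIdeal K ar deg)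

/-- The treewise tensor given by a tree labelled by monomials. -/
noncomputable def toBar : Model B → BarTree I
  | leaf => leaf
  | node b m => node (monOp I b.1 b.2.2) (fun j => toBar (m j))

@[simp] theorem toBar_leaf : toBar I (leaf : Model B) = leaf := rfl

theorem toBar_nd (b : Lab B) (m : ℕ → Model B) :
    toBar I (nd b m) = nd (monOp I b.1 b.2.2) (fun j => toBar I (m j)) := rfl

theorem toBar_update (m : ℕ → Model B) (j : ℕ) (y : Model B) :
    (fun k => toBar I (Function.update m j y k))
      = Function.update (fun k => toBar I (m k)) j (toBar I y) := by
  funext k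
  simp only [Function.update_apply]
  split_ifs <;> rfl

/-- The class in the bar construction of a tree labelled by monomials. -/
noncomputable def clM (m : Model B) : Bar I := cl (toBar I m)

/-- The total weight of the labels. -/
def wt (m : Model B) : ℕ := m.total fun b => b.1.weight

variable {I}

/-- Expansion of the root label in monomials. -/
theorem cl_nd_eq_sum (p : Op I) (a : K) {f : Free K ar}
    (hf : ∀ t ∈ f.support, t.leaves = p.arity ∧ t.total deg = p.degree ∧ t.weight = p.weight)
    (he : p.elt = a • I.carrier.mkQ f) (c : ℕ → BarTree I) :
    cl (nd p c) = a • ∑ t ∈ f.support, f t • if ht : 0 < t.weight then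
      cl (nd (monOp I t ht) c) else 0 := by
  have hmem : ∀ t ∈ f.support, I.mon t ∈ I.qpiece p.arity p.degree p.weight := fun t ht => by
    obtain ⟨h1, h2, h3⟩ := hf t ht
    rw [← h1, ← h2, ← h3]
    exact I.mon_mem t
  have e : (⟨p.elt, p.mem⟩ : I.qpiece p.arity p.degree p.weight)
      = a • ∑ t ∈ f.support.attach, f t.1 • ⟨I.mon t.1, hmem t.1 t.2⟩ := by
    apply Subtype.ext
    simp only [Submodule.coe_smul, Submodule.coe_sum]
    rw [he, mkQ_eq_sum, ← Finset.sum_attach]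
  rw [← rootB_apply, e, map_smul, map_sum, ← Finset.sum_attach f.support]
  congr 1
  refine Finset.sum_congr rfl fun t _ => ?_
  obtain ⟨h1, h2, h3⟩ := hf t.1 t.2
  rw [map_smul, dif_pos (h3 ▸ p.pos)]
  congr 1
  have := rootB_apply (⟨p.arity, p.degree, p.weight, p.pos, I.mon t.1, hmem t.1 t.2⟩ : Op I) c
  simp only at this
  rw [this]
  congr 1
  congr 1
  exact Op.ext' h1.symm h2.symm h3.symm rfl

variable {le : PTree G ar → PTree G ar → Prop}

/-- The coordinate functionals of the labels. -/
noncomputable def IsPBWBasis.labCoord (h : IsPBWBasis I le B) (b : Lab B) : I.Quot →ₗ[K] K := h.coord ⟨b.1, b.2.1⟩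

open Classical in
theorem evT_toBar (h : IsPBWBasis I le B) (x : Model B) : ∀ y : Model B,
    evT h.labCoord x (toBar I y) = if x = y then 1 else 0 := by
  induction x using nd_induction with
  | hl =>
    intro y
    rcases leaf_or_nd y with rfl | ⟨b, m, rfl⟩
    · simp
    · rw [toBar_nd, evT_leaf_nd, if_neg (nd_ne_leaf b m).symm]
  | hn b m ih =>
    intro y
    rcases leaf_or_nd y with rfl | ⟨b', m', rfl⟩
    · rw [toBar_leaf, evT_nd_leaf, if_neg (nd_ne_leaf b m)]
    · rw [toBar_nd, evT_nd_nd]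
      have e1 : h.labCoord b (monOp I b'.1 b'.2.2).elt = if b'.1 = b.1 then 1 else 0 :=
        h.coord_mon _ b'.2.1
      rw [e1]
      by_cases hb : b' = b
      · subst hb
        rw [if_pos (show (monOp I b'.1 b'.2.2).arity = b'.1.leaves from rfl), if_pos rfl, one_mul]
        by_cases hm : ∀ j < b'.1.leaves, m j = m' j
        · rw [if_pos (nd_congr b' hm), Finset.prod_eq_one]
          intro j hj
          rw [Finset.mem_range] at hj
          rw [ih j hj, if_pos (hm j hj)]
        · rw [if_neg fun e => hm (nd_inj e).2]
          push Not at hm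
          obtain ⟨j, hj, hne⟩ := hm
          rw [Finset.prod_eq_zero (Finset.mem_range.2 hj)]
          rw [ih j hj, if_neg hne]
      · rw [if_neg fun e => hb (Subtype.ext e), if_neg fun e => hb (nd_inj e).1.symm, zero_mul,
          ite_self]

/-- Treewise tensors of coordinate functionals form a dual family to these classes. -/
theorem clM_linearIndependent (h : IsPBWBasis I le B) :
    LinearIndependent K (clM I : Model B → Bar I) := by
  classical
  rw [linearIndependent_iff]
  intro l hl
  refine Finsupp.ext fun x => ?_
  have := congrArg (ev h.labCoord x) hl
  rw [Finsupp.linearCombination_apply, Finsupp.sum, map_sum, map_zero] at this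
  simp only [map_smul, clM, ev_cl, evT_toBar, smul_eq_mul, mul_ite, mul_one, mul_zero] at this
  rw [Finset.sum_ite_eq] at this
  rw [Finsupp.zero_apply]
  by_contra hx
  rw [if_pos (Finsupp.mem_support_iff.2 hx)] at this
  exact hx this

/-- The subtrees are expanded one at a time, from the last entry to the first: `n` counts those not
yet expanded. The function `W` records the number of vertices and the total weight of each subtree,
so that both gradings survive the expansion. -/
theorem cl_nd_mem_span_children (p : Op I) (W : ℕ → ℕ × ℕ) (n : ℕ) :
    ∀ (_ : n ≤ p.arity) (e : ℕ → BarTree I),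
    (∀ j < n, cl (e j) ∈ Submodule.span K
      (clM I '' {m : Model B | (m.weight, wt m) = W j})) →
    (∀ j, n ≤ j → j < p.arity → ∃ m : Model B, (m.weight, wt m) = W j ∧ e j = toBar I m) →
    cl (nd p e) ∈ Submodule.span K ((fun m : ℕ → Model B => cl (nd p fun j => toBar I (m j))) ''
      {m | ∀ j < p.arity, ((m j).weight, wt (m j)) = W j}) := by
  induction n with
  | zero =>
    intro _ e _ he
    have : ∀ j, ∃ m : Model B, j < p.arity → (m.weight, wt m) = W j ∧ e j = toBar I m := by
      intro j
      by_cases hj : j < p.arity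
      · obtain ⟨m, hm⟩ := he j (Nat.zero_le _) hj
        exact ⟨m, fun _ => hm⟩
      · exact ⟨leaf, fun h => absurd h hj⟩
    choose m hm using this
    refine Submodule.subset_span ⟨m, fun j hj => (hm j hj).1, ?_⟩
    exact cl_nd_congr p fun j hj => (hm j hj).2.symm
  | succ n ih =>
    intro hn e he1 he2
    have e1 : cl (nd p e) = nodeB p e n (cl (e n)) := by
      rw [nodeB_cl _ _ hn, Function.update_eq_self]
    rw [e1]
    have h1 := he1 n n.lt_succ_self
    have h2 := Submodule.mem_map_of_mem (f := nodeB p e n) h1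
    rw [Submodule.map_span] at h2
    refine Submodule.span_le.2 ?_ h2
    rintro _ ⟨_, ⟨m, hm, rfl⟩, rfl⟩
    rw [clM, nodeB_cl _ _ hn]
    refine ih (by omega) _ (fun j hj => ?_) (fun j hj hj' => ?_)
    · rw [Function.update_of_ne hj.ne]
      exact he1 j (by omega)
    · by_cases hjn : j = n
      · subst hjn
        exact ⟨m, hm, Function.update_self _ _ _⟩
      · rw [Function.update_of_ne hjn]
        exact he2 j (by omega) hj'

/-- Once all subtrees are trees of basis monomials, only the root label remains to be expanded,
inside its homogeneous piece. -/
theorem cl_mem_span (h : IsPBWBasis I le B) (T : BarTree I) : cl T ∈ Submodule.span K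
    (clM I '' {m : Model B | m.weight = T.weight ∧ wt m = T.total Op.weight}) := by
  induction T using nd_induction with
  | hl => exact Submodule.subset_span ⟨leaf, ⟨rfl, rfl⟩, rfl⟩
  | hn p c ih =>
    have h1 := cl_nd_mem_span_children (B := B) p
      (fun j => ((c j).weight, (c j).total Op.weight)) p.arity le_rfl c
      (fun j hj => by simpa only [Prod.mk.injEq] using ih j hj)
      (fun j hj hj' => absurd hj (by omega))
    refine Submodule.span_le.2 ?_ h1
    rintro _ ⟨m, hm, rfl⟩
    obtain ⟨f, hf, e⟩ := h.exists_rep p.mem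
    rw [SetLike.mem_coe]
    simp only
    rw [cl_nd_eq_sum p 1 (fun t ht => (hf t ht).2) (by rw [one_smul, e]), one_smul]
    refine Submodule.sum_mem _ fun t ht => Submodule.smul_mem _ _ ?_
    obtain ⟨h1, h2, h3, h4⟩ := hf t ht
    have hw : 0 < t.weight := h4 ▸ p.pos
    rw [dif_pos hw]
    refine Submodule.subset_span ⟨nd ⟨t, h1, hw⟩ m, ⟨?_, ?_⟩, rfl⟩
    · rw [weight_nd, weight_nd]
      simp only [h2]
      congr 1
      exact Finset.sum_congr rfl fun j hj =>
        congrArg Prod.fst (hm j (Finset.mem_range.1 hj))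
    · rw [wt, total_nd, total_nd]
      simp only [h2, h4]
      congr 1
      exact Finset.sum_congr rfl fun j hj =>
        congrArg Prod.snd (hm j (Finset.mem_range.1 hj))

/-- The basis of the bar construction given by a Poincaré–Birkhoff–Witt basis. -/
noncomputable def IsPBWBasis.barBasis (h : IsPBWBasis I le B) :
    Module.Basis (Model B) K (Bar I) :=
  Module.Basis.mk (clM_linearIndependent h) (by
    intro y _
    obtain ⟨r, rfl⟩ := (multRel I).mkQ_surjective y
    rw [mkQ_eq_sum_cl]
    refine Submodule.sum_mem _ fun T _ => Submodule.smul_mem _ _ ?_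
    exact Submodule.span_mono (Set.image_subset_range _ _) (cl_mem_span h T))

theorem IsPBWBasis.barBasis_apply (h : IsPBWBasis I le B) (m : Model B) : h.barBasis m = clM I m := by
  rw [IsPBWBasis.barBasis, Module.Basis.mk_apply]

theorem weight_toBar (m : Model B) : (toBar I m).weight = m.weight := by
  induction m using nd_induction with
  | hl => rfl
  | hn b m ih =>
    rw [toBar_nd, weight_nd, weight_nd]
    congr 1
    exact Finset.sum_congr rfl fun j hj => ih j (Finset.mem_range.1 hj)

theorem total_weight_toBar (m : Model B) : (toBar I m).total Op.weight = wt m := by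
  induction m using nd_induction with
  | hl => rfl
  | hn b m ih =>
    rw [toBar_nd, wt, total_nd, total_nd]
    congr 1
    exact Finset.sum_congr rfl fun j hj => ih j (Finset.mem_range.1 hj)

theorem IsPBWBasis.barPiece_eq (h : IsPBWBasis I le B) (d s : ℕ) : barPiece I d s
    = Submodule.span K (clM I '' {m : Model B | m.weight = d ∧ wt m = s}) := by
  apply le_antisymm
  · rw [barPiece, Submodule.map_le_iff_le_comap]
    intro r hr
    rw [Submodule.mem_comap, mkQ_eq_sum_cl]
    refine Submodule.sum_mem _ fun T hT => Submodule.smul_mem _ _ ?_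
    obtain ⟨h1, h2⟩ := hr hT
    have := cl_mem_span h T
    rwa [h1, h2] at this
  · rw [Submodule.span_le]
    rintro _ ⟨m, ⟨h1, h2⟩, rfl⟩
    refine ⟨_, Finsupp.single_mem_supported K 1 ⟨?_, ?_⟩, rfl⟩
    · rw [weight_toBar, h1]
    · rw [total_weight_toBar, h2]

end model


open PTree

/-! ### Exactness from an acyclic matching. -/

section matching

variable {K X V : Type*} [Field K] [AddCommGroup V] [Module K V]

theorem repr_eq_zero_of_mem_span (e : Module.Basis X K V) {S : Set X} {v : V}
    (hv : v ∈ Submodule.span K (e '' S)) {x : X} (hx : x ∉ S) : e.repr v x = 0 := by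
  by_contra h
  exact hx ((e.mem_span_image.1 hv) (Finsupp.mem_support_iff.2 h))

/-- A square zero endomorphism is exact on a coordinate subspace on which an acyclic matching is
given. -/
theorem exists_eq_of_matching (e : Module.Basis X K V) (D : V →ₗ[K] V) (hD : ∀ v, D (D v) = 0)
    (A C P Q : Set X) (T : X → X → Prop) (ρ : X → ℕ) (hP : P ⊆ A ∪ C)
    (hmono : ∀ x, D (e x) ∈ Submodule.span K (e '' {z | ρ z ≤ ρ x}))
    (hQ : ∀ x ∈ Q, D (e x) ∈ Submodule.span K (e '' P))
    (hex : ∀ x ∈ A, ∃ y, T x y)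
    (hA : ∀ x ∈ A, ∀ y, T x y → ∃ ε : K, ε ≠ 0 ∧ D (e x) - ε • e y
      ∈ Submodule.span K (e '' {z | ρ z ≤ ρ x ∧ (ρ z = ρ x → z ∉ C)}))
    (hT : ∀ x y, T x y → y ∈ C ∧ ρ y = ρ x) (hC : ∀ y ∈ C, ∃ x ∈ A, T x y)
    (hTQ : ∀ x y, T x y → y ∈ P → x ∈ Q) (hinj : ∀ x x' y, T x y → T x' y → x = x')
    (z : V) (hz : z ∈ Submodule.span K (e '' P)) (hDz : D z = 0) :
    ∃ y ∈ Submodule.span K (e '' Q), D y = z := by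
  classical
  -- Induction on a strict bound for the rank of the basis vectors that occur in the cycle; the
  -- support is finite, so a bound exists.
  suffices H : ∀ (N : ℕ) (z : V), z ∈ Submodule.span K (e '' P) → D z = 0 →
      z ∈ Submodule.span K (e '' {x | ρ x < N}) → ∃ y ∈ Submodule.span K (e '' Q), D y = z by
    refine H ((e.repr z).support.sup ρ + 1) z hz hDz (e.mem_span_image.2 fun x hx => ?_)
    exact Nat.lt_succ_of_le (Finset.le_sup (f := ρ) hx)
  intro N
  induction N with
  | zero =>
    intro z _ _ h
    have : z = 0 := by simpa using h
    exact ⟨0, Submodule.zero_mem _, by rw [this, map_zero]⟩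
  | succ N ih =>
    intro z hz hDz hN
    have hch : ∀ c, ∃ x, ∃ ε : K, c ∈ C → x ∈ A ∧ T x c ∧ ε ≠ 0 ∧ D (e x) - ε • e c
        ∈ Submodule.span K (e '' {z | ρ z ≤ ρ x ∧ (ρ z = ρ x → z ∉ C)}) := by
      intro c
      by_cases hc : c ∈ C
      · obtain ⟨x, hx, hxc⟩ := hC c hc
        obtain ⟨ε, h1, h2⟩ := hA x hx c hxc
        exact ⟨x, ε, fun _ => ⟨hx, hxc, h1, h2⟩⟩
      · exact ⟨c, 0, fun h => absurd h hc⟩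
    choose ν ε hν using hch
    -- The targets of top rank occurring in `z`. The chain `y` built from their partners, divided by
    -- the leading coefficients `ε`, has a boundary that removes them.
    set F := (e.repr z).support.filter (fun c => c ∈ C ∧ ρ c = N) with hF
    set S : Set X := {x | ρ x ≤ N ∧ (ρ x = N → x ∉ C)} with hS
    set y : V := ∑ c ∈ F, (e.repr z c / ε c) • e (ν c) with hy
    have hPmem : ∀ x ∈ (e.repr z).support, x ∈ P := fun x hx => e.mem_span_image.1 hz hx
    have hyQ : y ∈ Submodule.span K (e '' Q) := by
      refine Submodule.sum_mem _ fun c hc => Submodule.smul_mem _ _ ?_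
      rw [hF, Finset.mem_filter] at hc
      exact Submodule.subset_span ⟨_, hTQ _ c (hν c hc.2.1).2.1 (hPmem c hc.1), rfl⟩
    have hDy : D y ∈ Submodule.span K (e '' P) := by
      have := Submodule.mem_map_of_mem (f := D) hyQ
      rw [Submodule.map_span] at this
      refine Submodule.span_le.2 ?_ this
      rintro _ ⟨_, ⟨x, hx, rfl⟩, rfl⟩
      exact hQ x hx
    have hz'P : z - D y ∈ Submodule.span K (e '' P) := Submodule.sub_mem _ hz hDy
    have hDz' : D (z - D y) = 0 := by rw [map_sub, hDz, hD, sub_zero]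
    -- The remainder of the boundary of a source contains no target of the same rank, so subtracting
    -- `D y` creates no new targets of rank `N`.
    have hz'S : z - D y ∈ Submodule.span K (e '' S) := by
      have e1 : z - D y = ∑ c ∈ (e.repr z).support.filter (fun c => ¬(c ∈ C ∧ ρ c = N)),
          e.repr z c • e c
          - ∑ c ∈ F, (e.repr z c / ε c) • (D (e (ν c)) - ε c • e c) := by
        have e2 : z = ∑ c ∈ F, e.repr z c • e c
            + ∑ c ∈ (e.repr z).support.filter (fun c => ¬(c ∈ C ∧ ρ c = N)),
              e.repr z c • e c := by
          rw [hF, Finset.sum_filter_add_sum_filter_not]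
          exact (e.linearCombination_repr z).symm
        have e3 : ∑ c ∈ F, (e.repr z c / ε c) • (D (e (ν c)) - ε c • e c)
            = D y - ∑ c ∈ F, e.repr z c • e c := by
          rw [hy, map_sum, ← Finset.sum_sub_distrib]
          refine Finset.sum_congr rfl fun c hc => ?_
          rw [hF, Finset.mem_filter] at hc
          rw [smul_sub, map_smul, smul_smul, div_mul_cancel₀ _ (hν c hc.2.1).2.2.1]
        rw [e3]
        conv_lhs => rw [e2]
        abel
      rw [e1]
      refine Submodule.sub_mem _ (Submodule.sum_mem _ fun c hc => Submodule.smul_mem _ _ ?_)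
        (Submodule.sum_mem _ fun c hc => Submodule.smul_mem _ _ ?_)
      · rw [Finset.mem_filter] at hc
        have : ρ c < N + 1 := e.mem_span_image.1 hN hc.1
        exact Submodule.subset_span ⟨c, ⟨by omega, fun h1 h2 => hc.2 ⟨h2, h1⟩⟩, rfl⟩
      · rw [hF, Finset.mem_filter] at hc
        obtain ⟨_, h2, _, h4⟩ := hν c hc.2.1
        rwa [← (hT _ _ h2).2, hc.2.2] at h4
    obtain ⟨y', hy', hDy'⟩ := ih (z - D y) hz'P hDz' (by
      refine e.mem_span_image.2 fun a ha => ?_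
      have haS : ρ a ≤ N ∧ (ρ a = N → a ∉ C) := e.mem_span_image.1 hz'S ha
      have haP : a ∈ P := e.mem_span_image.1 hz'P ha
      by_contra hlt
      have haN : ρ a = N := le_antisymm haS.1 (not_lt.1 hlt)
      -- A term of rank `N` that is left must be a source. Its partner `c` would then occur in the
      -- boundary of the cycle `z - D y` with a nonzero coefficient, contributed by `a` alone.
      have haA : a ∈ A := (hP haP).resolve_right (haS.2 haN)
      obtain ⟨c, hac⟩ := hex a haA
      obtain ⟨hcC, hcρ⟩ := hT _ _ hac
      obtain ⟨δ, hδ, hr⟩ := hA a haA c hac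
      have h0 := congrArg (fun v => e.repr v c) hDz'
      simp only [map_zero, Finsupp.zero_apply] at h0
      rw [← e.linearCombination_repr (z - D y), Finsupp.linearCombination_apply, Finsupp.sum,
        map_sum, map_sum, Finsupp.finsetSum_apply] at h0
      rw [Finset.sum_eq_single a] at h0
      · rw [map_smul, map_smul, Finsupp.smul_apply] at h0
        have e1 : e.repr (D (e a)) c = δ := by
          have := repr_eq_zero_of_mem_span e hr (x := c) fun h => h.2 hcρ hcC
          rw [map_sub, map_smul, e.repr_self, Finsupp.sub_apply, Finsupp.smul_apply,
            Finsupp.single_eq_same, smul_eq_mul, mul_one] at this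
          exact sub_eq_zero.1 this
        rw [e1, smul_eq_mul] at h0
        exact (mul_ne_zero (Finsupp.mem_support_iff.1 ha) hδ) h0
      · intro x hx hxa
        rw [map_smul, map_smul, Finsupp.smul_apply]
        convert smul_zero _
        have hxS : ρ x ≤ N ∧ (ρ x = N → x ∉ C) := e.mem_span_image.1 hz'S hx
        -- No other term contributes to `c`: terms of lower rank have boundaries of lower rank, and
        -- another source of rank `N` has a different partner by injectivity of the matching.
        rcases hxS.1.lt_or_eq with hlt | heq
        · exact repr_eq_zero_of_mem_span e (hmono x) (by
            change ¬ ρ c ≤ ρ x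
            omega)
        · have hxA : x ∈ A := (hP (e.mem_span_image.1 hz'P hx)).resolve_right (hxS.2 heq)
          obtain ⟨c', hxc'⟩ := hex x hxA
          obtain ⟨δ', -, hr'⟩ := hA x hxA c' hxc'
          have hne : c' ≠ c := by
            rintro rfl
            exact hxa (hinj _ _ _ hxc' hac)
          have := repr_eq_zero_of_mem_span e hr' (x := c) fun h => h.2 (by omega) hcC
          rw [map_sub, map_smul, e.repr_self, Finsupp.sub_apply, Finsupp.smul_apply,
            Finsupp.single_eq_of_ne hne.symm, smul_zero, sub_zero] at this
          exact this
      · intro h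
        exact absurd ha h)
    refine ⟨y + y', Submodule.add_mem _ hyQ hy', ?_⟩
    rw [map_add, hDy']
    abel

end matching

/-! ### The number of monomials above a given one, as a rank. -/

section above

variable {G : Type u} {ar : G → ℕ} {le : PTree G ar → PTree G ar → Prop}

/-- `u` is at least `t`, and of the same arity and weight. -/
structure Above (le : PTree G ar → PTree G ar → Prop) (t u : PTree G ar) : Prop where
  le : le t u
  leaves : t.leaves = u.leaves
  weight : t.weight = u.weight

theorem Above.refl (h : IsMonomialOrder le) (t : PTree G ar) : Above le t t :=
  ⟨h.refl t, rfl, rfl⟩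

theorem Above.trans (h : IsMonomialOrder le) {s t u : PTree G ar} (h1 : Above le s t)
    (h2 : Above le t u) : Above le s u :=
  ⟨h.trans _ _ _ h1.le h2.le, h1.leaves.trans h2.leaves, h1.weight.trans h2.weight⟩

theorem Above.antisymm (h : IsMonomialOrder le) {s t : PTree G ar} (h1 : Above le s t)
    (h2 : Above le t s) : s = t := h.antisymm _ _ h1.le h2.le

theorem Above.graftAll (h : IsMonomialOrder le) {b b' : PTree G ar} {c c' : ℕ → PTree G ar}
    (hb : Above le b b') (hc : ∀ i < b.leaves, Above le (c i) (c' i)) :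
    Above le (graftAll b c) (graftAll b' c') := by
  refine ⟨h.graftAll hb.le hb.leaves (fun i hi => (hc i hi).le) fun i hi => (hc i hi).leaves,
    ?_, ?_⟩
  · rw [leaves_graftAll, leaves_graftAll, ← hb.leaves]
    exact Finset.sum_congr rfl fun i hi => (hc i (Finset.mem_range.1 hi)).leaves
  · rw [weight_graftAll, weight_graftAll, ← hb.leaves, hb.weight]
    congr 1
    exact Finset.sum_congr rfl fun i hi => (hc i (Finset.mem_range.1 hi)).weight

/-- The number of monomials above `t`. -/
noncomputable def aboveCard (le : PTree G ar → PTree G ar → Prop) (t : PTree G ar) : ℕ :=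
  {u | Above le t u}.ncard

theorem finite_above (har : ∀ g, 0 < ar g) (hfin : ∀ n, {g | ar g = n}.Finite)
    (t : PTree G ar) : {u | Above le t u}.Finite :=
  (finite_leaves_weight har hfin t.leaves t.weight).subset
    fun _ hu => ⟨hu.leaves.ge, hu.weight.ge⟩

theorem Above.card_le (h : IsMonomialOrder le) (har : ∀ g, 0 < ar g)
    (hfin : ∀ n, {g | ar g = n}.Finite) {t u : PTree G ar} (htu : Above le t u) :
    aboveCard le u ≤ aboveCard le t :=
  Set.ncard_le_ncard (fun _ hv => htu.trans h hv) (finite_above har hfin t)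

/-- The up-set of a strictly larger monomial is smaller, since by antisymmetry it misses `t`.
Induction along the partial order becomes induction on a natural number. -/
theorem Above.card_lt (h : IsMonomialOrder le) (har : ∀ g, 0 < ar g)
    (hfin : ∀ n, {g | ar g = n}.Finite) {t u : PTree G ar} (htu : Above le t u) (hne : t ≠ u) :
    aboveCard le u < aboveCard le t := by
  refine Set.ncard_lt_ncard ⟨fun _ hv => htu.trans h hv, fun hsub => ?_⟩ (finite_above har hfin t)
  exact hne (htu.antisymm h (hsub (Above.refl h t)))

theorem Above.card_eq_iff (h : IsMonomialOrder le) (har : ∀ g, 0 < ar g)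
    (hfin : ∀ n, {g | ar g = n}.Finite) {t u : PTree G ar} (htu : Above le t u) :
    aboveCard le u = aboveCard le t ↔ u = t := by
  constructor
  · intro hc
    by_contra hne
    exact (htu.card_lt h har hfin (Ne.symm hne)).ne hc
  · rintro rfl
    rfl

end above

/-! ### Internal edges with restriction in `B`, and the choice of a first one. -/

section edges

variable {G : Type u} {ar : G → ℕ}

theorem edgeSub_nd (g : G) (c : ℕ → PTree G ar) (q : PTree G ar) : EdgeSub (nd g c) q ↔
    (∃ (j : ℕ) (hj : j < ar g) (h : G) (c' : ℕ → PTree G ar), c j = nd h c' ∧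
      q = twoVertex g ⟨j, hj⟩ h) ∨ ∃ j < ar g, EdgeSub (c j) q := by
  constructor
  · intro hq
    generalize ht : nd g c = t at hq
    cases hq with
    | root g' c₁ j h c' hc =>
      rw [← nd_ext] at ht
      obtain ⟨rfl, h2⟩ := nd_inj ht
      refine Or.inl ⟨j, j.2, h, ext c', ?_, rfl⟩
      rw [h2 j j.2, ext_fin, hc, nd_ext]
    | child g' c₁ j q hq =>
      rw [← nd_ext] at ht
      obtain ⟨rfl, h2⟩ := nd_inj ht
      refine Or.inr ⟨j, j.2, ?_⟩
      rw [h2 j j.2, ext_fin]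
      exact hq
  · rintro (⟨j, hj, h, c', hc, rfl⟩ | ⟨j, hj, hq⟩)
    · exact EdgeSub.root g _ ⟨j, hj⟩ h (fun i => c' i) hc
    · exact EdgeSub.child g _ ⟨j, hj⟩ q hq

theorem not_edgeSub_leaf (q : PTree G ar) : ¬EdgeSub leaf q := by
  intro h
  cases h

/-- The tree over the entry `j` of the root. -/
def childAt : PTree G ar → ℕ → PTree G ar
  | leaf, _ => leaf
  | node _ c, j => ext c j

theorem childAt_nd (g : G) (c : ℕ → PTree G ar) {j : ℕ} (hj : j < ar g) :
    childAt (nd g c) j = c j := by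
  rw [nd, childAt, ext_of_lt _ hj]

/-- The edge from the root vertex of `t` to its entry `j` is internal and has its restriction
in `B`. -/
def RootGood (B : Set (PTree G ar)) (t : PTree G ar) (j : ℕ) : Prop :=
  ∃ (g : G) (c : ℕ → PTree G ar) (hj : j < ar g) (h : G) (c' : ℕ → PTree G ar),
    t = nd g c ∧ c j = nd h c' ∧ twoVertex g ⟨j, hj⟩ h ∈ B

/-- `j` is the first entry with `RootGood B t j`. -/
def FirstGood (B : Set (PTree G ar)) (t : PTree G ar) (j : ℕ) : Prop :=
  RootGood B t j ∧ ∀ i < j, ¬RootGood B t i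

/-- Some internal edge of `t` has its restriction in `B`. -/
def HasGood (B : Set (PTree G ar)) (t : PTree G ar) : Prop := ∃ q, EdgeSub t q ∧ q ∈ B

/-- `c j` is the first among the first `n` trees of a sequence with `HasGood B (c j)`. -/
def FirstTree (B : Set (PTree G ar)) (c : ℕ → PTree G ar) (n j : ℕ) : Prop :=
  j < n ∧ HasGood B (c j) ∧ ∀ i < j, ¬HasGood B (c i)

theorem rootGood_nd {B : Set (PTree G ar)} {g : G} {c : ℕ → PTree G ar} {j : ℕ} :
    RootGood B (nd g c) j ↔ ∃ (hj : j < ar g) (h : G) (c' : ℕ → PTree G ar),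
      c j = nd h c' ∧ twoVertex g ⟨j, hj⟩ h ∈ B := by
  constructor
  · rintro ⟨g', c₁, hj, h, c', e, hc, hB⟩
    obtain ⟨rfl, h2⟩ := nd_inj e
    exact ⟨hj, h, c', (h2 j hj).trans hc, hB⟩
  · rintro ⟨hj, h, c', hc, hB⟩
    exact ⟨g, c, hj, h, c', rfl, hc, hB⟩

theorem hasGood_nd {B : Set (PTree G ar)} {g : G} {c : ℕ → PTree G ar} :
    HasGood B (nd g c) ↔ (∃ j, RootGood B (nd g c) j) ∨ ∃ j < ar g, HasGood B (c j) := by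
  constructor
  · rintro ⟨q, hq, hB⟩
    rcases (edgeSub_nd g c q).1 hq with ⟨j, hj, h, c', hc, rfl⟩ | ⟨j, hj, hq'⟩
    · exact Or.inl ⟨j, rootGood_nd.2 ⟨hj, h, c', hc, hB⟩⟩
    · exact Or.inr ⟨j, hj, q, hq', hB⟩
  · rintro (⟨j, hj⟩ | ⟨j, hj, q, hq, hB⟩)
    · obtain ⟨hj, h, c', hc, hB⟩ := rootGood_nd.1 hj
      exact ⟨_, (edgeSub_nd g c _).2 (Or.inl ⟨j, hj, h, c', hc, rfl⟩), hB⟩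
    · exact ⟨q, (edgeSub_nd g c q).2 (Or.inr ⟨j, hj, hq⟩), hB⟩

theorem exists_firstGood {B : Set (PTree G ar)} {t : PTree G ar} (h : ∃ j, RootGood B t j) :
    ∃ j, FirstGood B t j := by
  classical
  exact ⟨Nat.find h, Nat.find_spec h, fun i hi => Nat.find_min h hi⟩

theorem FirstGood.unique {B : Set (PTree G ar)} {t : PTree G ar} {i j : ℕ}
    (hi : FirstGood B t i) (hj : FirstGood B t j) : i = j := by
  rcases lt_trichotomy i j with h | h | h
  · exact absurd hi.1 (hj.2 i h)
  · exact h
  · exact absurd hj.1 (hi.2 j h)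

theorem exists_firstTree {B : Set (PTree G ar)} {c : ℕ → PTree G ar} {n : ℕ}
    (h : ∃ j < n, HasGood B (c j)) : ∃ j, FirstTree B c n j := by
  classical
  refine ⟨Nat.find h, (Nat.find_spec h).1, (Nat.find_spec h).2, fun i hi hg => ?_⟩
  exact Nat.find_min h hi ⟨hi.trans (Nat.find_spec h).1, hg⟩

theorem FirstTree.unique {B : Set (PTree G ar)} {c : ℕ → PTree G ar} {n i j : ℕ}
    (hi : FirstTree B c n i) (hj : FirstTree B c n j) : i = j := by
  rcases lt_trichotomy i j with h | h | h
  · exact absurd hi.2.1 (hj.2.2 i h)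
  · exact h
  · exact absurd hj.2.1 (hi.2.2 j h)

theorem FirstTree.congr {B : Set (PTree G ar)} {c c' : ℕ → PTree G ar} {n j : ℕ}
    (h : FirstTree B c n j) (hc : ∀ i < n, c i = c' i) : FirstTree B c' n j :=
  ⟨h.1, hc j h.1 ▸ h.2.1, fun i hi => hc i (hi.trans h.1) ▸ h.2.2 i hi⟩

theorem graftAll_inj_right (b : PTree G ar) : ∀ {c c' : ℕ → PTree G ar},
    graftAll b c = graftAll b c' → ∀ i < b.leaves, c i = c' i := by
  induction b using nd_induction with
  | hl =>
    intro c c' h i hi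
    obtain rfl : i = 0 := by simpa using hi
    exact h
  | hn g β ih =>
    intro c c' h i hi
    rw [graftAll_nd, graftAll_nd] at h
    rw [leaves_nd] at hi
    obtain ⟨j, hj, q, hq, rfl⟩ := pos_exists β hi
    exact ih j hj ((nd_inj h).2 j hj) q hq

end edges


open PTree

/-! ### The matching that moves the first good edge into a label. -/

section model

variable {G : Type u} {ar : G → ℕ} {B : Set (PTree G ar)}

/-- The monomial obtained from a tree labelled by monomials by composing all labels. -/
def flat : Model B → PTree G ar
  | leaf => leaf
  | node b m => graftAll b.1 (ext fun j => flat (m j))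

@[simp] theorem flat_leaf : flat (leaf : Model B) = leaf := rfl

theorem flat_nd (b : Lab B) (m : ℕ → Model B) :
    flat (nd b m) = graftAll b.1 (fun j => flat (m j)) := by
  rw [nd, flat]
  exact graftAll_congr fun i hi => ext_of_lt _ hi

theorem weight_flat (x : Model B) : (flat x).weight = wt x := by
  induction x using nd_induction with
  | hl => rfl
  | hn b m ih =>
    rw [flat_nd, weight_graftAll, wt, total_nd]
    congr 1
    exact Finset.sum_congr rfl fun j hj => ih j (Finset.mem_range.1 hj)

theorem comp_spliceN {α β : Type*} (f : α → β) (c : ℕ → α) (k n : ℕ) (c' : ℕ → α) :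
    (fun j => f (spliceN c k n c' j)) = spliceN (fun j => f (c j)) k n (fun j => f (c' j)) := by
  funext j
  unfold spliceN
  split_ifs <;> rfl

theorem comp_update {α β : Type*} (f : α → β) (c : ℕ → α) (k : ℕ) (x : α) :
    (fun j => f (Function.update c k x j)) = Function.update (fun j => f (c j)) k (f x) := by
  funext j
  simp only [Function.update_apply]
  split_ifs <;> rfl

/-- The composite can be computed after contracting a root edge, even when the contracted label is
not in `B`. This compares the composite of a tree with those of the terms of its boundary. -/
theorem flat_nd_contract (b : Lab B) (m : ℕ → Model B) {k : ℕ} (hk : k < b.1.leaves) (b' : Lab B)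
    (m' : ℕ → Model B) (h : m k = nd b' m') :
    flat (nd b m) = graftAll (graft b.1 k b'.1) (fun j => flat (spliceN m k b'.1.leaves m' j)) := by
  rw [comp_spliceN flat, graftAll_graft_splice _ _ hk, ← flat_nd, ← h, flat_nd]
  congr 1
  rw [← comp_update flat, Function.update_eq_self]

theorem weight_spliceN (b : Lab B) (m : ℕ → Model B) {k : ℕ} (hk : k < b.1.leaves) (b' : Lab B)
    (m' : ℕ → Model B) (h : m k = nd b' m') (γ : Lab B)
    (hγ : γ.1.leaves = (graft b.1 k b'.1).leaves) :
    (nd γ (spliceN m k b'.1.leaves m')).weight + 1 = (nd b m).weight := by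
  have e := leaves_graft b'.1 b.1 k hk
  rw [weight_nd, weight_nd]
  have e1 : γ.1.leaves = b.1.leaves + b'.1.leaves - 1 := by omega
  rw [e1, sum_range_splice _ hk, ← Finset.add_sum_erase _ _ (Finset.mem_range.2 hk), h, weight_nd]
  have e2 : ∑ l ∈ Finset.range b'.1.leaves, (spliceN m k b'.1.leaves m' (k + l)).weight
      = ∑ l ∈ Finset.range b'.1.leaves, (m' l).weight :=
    Finset.sum_congr rfl fun l hl => by rw [spliceN_add _ _ _ _ (Finset.mem_range.1 hl)]
  have e3 : ∑ i ∈ (Finset.range b.1.leaves).erase k,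
        (spliceN m k b'.1.leaves m' (shift k b'.1.leaves i)).weight
      = ∑ i ∈ (Finset.range b.1.leaves).erase k, (m i).weight :=
    Finset.sum_congr rfl fun i hi => by rw [spliceN_shift _ _ _ _ (Finset.mem_erase.1 hi).1]
  rw [e2, e3]
  ring

theorem weight_nd_update {H : Type*} {ah : H → ℕ} (g : H)
    (c : ℕ → PTree H ah) {j : ℕ} (hj : j < ah g) {t : PTree H ah} (ht : t.weight + 1 = (c j).weight) :
    (nd g (Function.update c j t)).weight + 1 = (nd g c).weight := by
  have e := total_nd_update (fun _ => 1) g c hj (c j)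
  rw [Function.update_eq_self] at e
  rw [weight, weight, total_nd_update _ g c hj, e]
  change _ + (t.weight + _) + 1 = _ + ((c j).weight + _)
  omega

theorem Lab.exists_eq_nd (b : Lab B) : ∃ g β, b.1 = nd g β := by
  rcases leaf_or_nd b.1 with h | h
  · exact absurd h (ne_leaf_of_weight_pos b.2.2)
  · exact h

theorem flat_nd_nd (b : Lab B) (m : ℕ → Model B) {g : G} {β : ℕ → PTree G ar} (hb : b.1 = nd g β) :
    flat (nd b m) = nd g (fun j => graftAll (β j) (fun i => flat (m (pos β j + i)))) := by
  rw [flat_nd, hb, graftAll_nd]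

/-- A nontrivial tree over the root of a label gives an internal edge with restriction in `B`. -/
theorem rootGood_of_childAt_ne (hB : ∀ t ∈ B, ∀ q, EdgeSub t q → q ∈ B) (b : Lab B)
    (m : ℕ → Model B) {g : G} {β : ℕ → PTree G ar} (hb : b.1 = nd g β) {j : ℕ} (hj : j < ar g)
    (h : β j ≠ leaf) : RootGood B (flat (nd b m)) j := by
  rcases leaf_or_nd (β j) with h' | ⟨g', β', h'⟩
  · exact absurd h' h
  · rw [flat_nd_nd b m hb, rootGood_nd]
    refine ⟨hj, g', _, by rw [h', graftAll_nd], ?_⟩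
    have := b.2.1
    rw [hb] at this
    exact hB _ this _ ((edgeSub_nd g β _).2 (Or.inl ⟨j, hj, g', β', h', rfl⟩))

/-- A label with an edge at its root would give a good root edge. When there is none the label is a
single vertex, so the subtrees of the composite are the composites of the subtrees and the search
for the first good edge can recurse. -/
theorem eq_corolla_of_not_rootGood (hB : ∀ t ∈ B, ∀ q, EdgeSub t q → q ∈ B) (b : Lab B)
    (m : ℕ → Model B) (h : ∀ i, ¬RootGood B (flat (nd b m)) i) : ∃ g, b.1 = corolla g := by
  obtain ⟨g, β, hb⟩ := b.exists_eq_nd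
  refine ⟨g, hb.trans ?_⟩
  change nd g β = nd g fun _ => leaf
  refine nd_congr g fun j hj => ?_
  by_contra hne
  exact h j (rootGood_of_childAt_ne hB b m hb hj hne)

theorem flat_nd_corolla (b : Lab B) (m : ℕ → Model B) {g : G} (h : b.1 = corolla g) :
    flat (nd b m) = nd g (fun j => flat (m j)) := by
  rw [flat_nd, h, graftAll_corolla]

/-- An edge inside a label is good. Without good edges every label is a single generator, and the
tree lies on the diagonal. -/
theorem wt_eq_weight_of_not_hasGood (hB : ∀ t ∈ B, ∀ q, EdgeSub t q → q ∈ B) (x : Model B) :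
    ¬HasGood B (flat x) → wt x = x.weight := by
  induction x using nd_induction with
  | hl => intro _; rfl
  | hn b m ih =>
    intro h
    have h1 : ∀ i, ¬RootGood B (flat (nd b m)) i := by
      intro i hi
      obtain ⟨g, β, hb⟩ := b.exists_eq_nd
      rw [flat_nd_nd b m hb] at h hi
      exact h (hasGood_nd.2 (Or.inl ⟨i, hi⟩))
    obtain ⟨g, hg⟩ := eq_corolla_of_not_rootGood hB b m h1
    have hl : b.1.leaves = ar g := by rw [hg, leaves_corolla]
    rw [flat_nd_corolla b m hg, hasGood_nd] at h
    rw [wt, total_nd, weight_nd]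
    congr 1
    · rw [hg]
      change (nd g fun _ => leaf).weight = 1
      have e0 : (leaf : PTree G ar).weight = 0 := rfl
      simp [weight_nd, e0]
    · refine Finset.sum_congr rfl fun j hj => ih j (Finset.mem_range.1 hj) fun hg' => h ?_
      exact Or.inr ⟨j, hl ▸ Finset.mem_range.1 hj, hg'⟩

/-- The first edge of `flat x` with restriction in `B` (a root edge if there is one, or else
recursively in the first tree over the root that has such an edge) belongs to a label of `x`. -/
def Marked : Model B → Prop
  | leaf => False
  | node b m => (∃ j, FirstGood B (flat (node b m)) j ∧ childAt b.1 j ≠ leaf) ∨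
    ((∀ i, ¬RootGood B (flat (node b m)) i) ∧
      ∃ j : Fin b.1.leaves, FirstTree B (ext fun i => flat (m i)) b.1.leaves j ∧ Marked (m j))

theorem marked_nd (b : Lab B) (m : ℕ → Model B) : Marked (nd b m) ↔
    (∃ j, FirstGood B (flat (nd b m)) j ∧ childAt b.1 j ≠ leaf) ∨
    ((∀ i, ¬RootGood B (flat (nd b m)) i) ∧
      ∃ j, FirstTree B (fun i => flat (m i)) b.1.leaves j ∧ Marked (m j)) := by
  have e : ∀ i < b.1.leaves, (ext fun i : Fin b.1.leaves => flat (m i)) i = flat (m i) :=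
    fun i hi => ext_of_lt _ hi
  rw [nd, Marked]
  refine or_congr Iff.rfl (and_congr Iff.rfl ⟨?_, ?_⟩)
  · rintro ⟨j, h1, h2⟩
    exact ⟨j, h1.congr e, h2⟩
  · rintro ⟨j, h1, h2⟩
    exact ⟨⟨j, h1.1⟩, h1.congr fun i hi => (e i hi).symm, h2⟩

theorem not_marked_of_childAt {b : Lab B} {m : ℕ → Model B} {j : ℕ}
    (h1 : FirstGood B (flat (nd b m)) j) (h2 : childAt b.1 j = leaf) : ¬Marked (nd b m) := by
  rw [marked_nd]
  rintro (⟨i, hi, hne⟩ | ⟨hn, -⟩)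
  · rw [hi.unique h1] at hne
    exact hne h2
  · exact hn _ h1.1

theorem marked_iff_of_firstTree {b : Lab B} {m : ℕ → Model B} {j : ℕ}
    (h1 : ∀ i, ¬RootGood B (flat (nd b m)) i)
    (h2 : FirstTree B (fun i => flat (m i)) b.1.leaves j) : Marked (nd b m) ↔ Marked (m j) := by
  rw [marked_nd]
  constructor
  · rintro (⟨i, hi, -⟩ | ⟨-, i, hi, hm⟩)
    · exact absurd hi.1 (h1 i)
    · rwa [hi.unique h2] at hm
  · intro h
    exact Or.inr ⟨h1, j, h2, h⟩

/-- `y` is obtained from `x` by contracting the first edge of `flat x` with restriction in `B`. -/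
def Toggle : Model B → Model B → Prop
  | leaf, _ => False
  | node b m, y => (∃ j, FirstGood B (flat (node b m)) j ∧ childAt b.1 j = leaf ∧
      ∃ (b' : Lab B) (m' : ℕ → Model B) (γ : Lab B), ext m (pos (childAt b.1) j) = nd b' m' ∧
        γ.1 = graft b.1 (pos (childAt b.1) j) b'.1 ∧
        y = nd γ (spliceN (ext m) (pos (childAt b.1) j) b'.1.leaves m')) ∨
    ((∀ i, ¬RootGood B (flat (node b m)) i) ∧
      ∃ j : Fin b.1.leaves, FirstTree B (ext fun i => flat (m i)) b.1.leaves j ∧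
        ∃ y', Toggle (m j) y' ∧ y = nd b (Function.update (ext m) j y'))

theorem toggle_leaf (y : Model B) : ¬Toggle leaf y := by
  rw [Toggle]
  exact id

theorem pos_childAt_nd (g : G) (β : ℕ → PTree G ar) {j : ℕ} (hj : j ≤ ar g) :
    pos (childAt (nd g β)) j = pos β j :=
  pos_congr fun _ hi => childAt_nd g β (hi.trans_le hj)

theorem graft_nd_leaf (g : G) (β : ℕ → PTree G ar) {j : ℕ} (hj : j < ar g) (hl : β j = leaf)
    (t : PTree G ar) : graft (nd g β) (pos β j) t = nd g (Function.update β j t) := by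
  have := graft_nd g β (q := 0) hj (by rw [hl]; simp) t
  rwa [add_zero, hl] at this

theorem pos_lt_leaves_of_leaf (b : Lab B) {g : G} {β : ℕ → PTree G ar} (hb : b.1 = nd g β) {j : ℕ}
    (hj : j < ar g) (hl : β j = leaf) : pos β j < b.1.leaves := by
  rw [hb, leaves_nd]
  exact pos_add_lt β hj (q := 0) (by rw [hl]; simp)

/-- Working form of the definition: when the entry `j` of the root of the label is free, it is the
entry number `pos β j` of the whole label, and grafting there only replaces `β j`. -/
theorem toggle_nd (b : Lab B) (m : ℕ → Model B) (y : Model B) {g : G} {β : ℕ → PTree G ar}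
    (hb : b.1 = nd g β) : Toggle (nd b m) y ↔
    (∃ j < ar g, FirstGood B (flat (nd b m)) j ∧ β j = leaf ∧
      ∃ (b' : Lab B) (m' : ℕ → Model B) (γ : Lab B), m (pos β j) = nd b' m' ∧
        γ.1 = nd g (Function.update β j b'.1) ∧
        y = nd γ (spliceN m (pos β j) b'.1.leaves m')) ∨
    ((∀ i, ¬RootGood B (flat (nd b m)) i) ∧
      ∃ j, FirstTree B (fun i => flat (m i)) b.1.leaves j ∧
        ∃ y', Toggle (m j) y' ∧ y = nd b (Function.update m j y')) := by
  have e : ∀ i < b.1.leaves, (ext fun i : Fin b.1.leaves => flat (m i)) i = flat (m i) :=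
    fun i hi => ext_of_lt _ hi
  have e' : ∀ i < b.1.leaves, (ext fun i : Fin b.1.leaves => m i) i = m i :=
    fun i hi => ext_of_lt _ hi
  have ep : ∀ j < ar g, pos (childAt b.1) j = pos β j := fun j hj => by
    rw [hb, pos_childAt_nd g β hj.le]
  have eg : ∀ (j : ℕ) (t : PTree G ar), j < ar g → β j = leaf →
      graft b.1 (pos β j) t = nd g (Function.update β j t) := by
    intro j t hj hl
    rw [hb, graft_nd_leaf g β hj hl]
  have hk : ∀ j, j < ar g → β j = leaf → pos β j < b.1.leaves :=
    fun j hj hl => pos_lt_leaves_of_leaf b hb hj hl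
  have es : ∀ (j n : ℕ) (m' : ℕ → Model B) (γ : Lab B), j < ar g → β j = leaf →
      γ.1.leaves + 1 = b.1.leaves + n →
      nd γ (spliceN (ext fun i : Fin b.1.leaves => m i) (pos β j) n m')
        = nd γ (spliceN m (pos β j) n m') := by
    intro j n m' γ hj hl hγ
    refine nd_congr γ fun i hi => ?_
    have := hk j hj hl
    have hi' : i < γ.1.leaves := hi
    unfold spliceN
    split_ifs
    · exact e' _ (by omega)
    · rfl
    · exact e' _ (by omega)
  rw [nd, Toggle]
  refine or_congr ⟨?_, ?_⟩ (and_congr Iff.rfl ⟨?_, ?_⟩)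
  · rintro ⟨j, h1, h2, b', m', γ, h3, h4, h5⟩
    have hj : j < ar g := by
      have := h1.1
      rw [← nd, flat_nd_nd b m hb] at this
      exact (rootGood_nd.1 this).1
    rw [hb, childAt_nd g β hj] at h2
    rw [ep j hj] at h3 h4 h5
    have hl := leaves_graft b'.1 b.1 _ (hk j hj h2)
    rw [← h4] at hl
    rw [e' _ (hk j hj h2)] at h3
    rw [es j _ m' γ hj h2 hl] at h5
    exact ⟨j, hj, h1, h2, b', m', γ, h3, h4.trans (eg j _ hj h2), h5⟩
  · rintro ⟨j, hj, h1, h2, b', m', γ, h3, h4, h5⟩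
    refine ⟨j, h1, by rw [hb, childAt_nd g β hj, h2], b', m', γ, ?_⟩
    have hl := leaves_graft b'.1 b.1 _ (hk j hj h2)
    rw [eg j _ hj h2, ← h4] at hl
    rw [ep j hj, eg j _ hj h2, es j _ m' γ hj h2 hl, e' _ (hk j hj h2)]
    exact ⟨h3, h4, h5⟩
  · rintro ⟨j, h1, y', h2, h3⟩
    refine ⟨j, h1.congr e, y', h2, h3.trans (nd_congr b fun i hi => ?_)⟩
    simp only [Function.update_apply, e' i hi]
  · rintro ⟨j, h1, y', h2, h3⟩
    refine ⟨⟨j, h1.1⟩, h1.congr fun i hi => (e i hi).symm, y', h2,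
      h3.trans (nd_congr b fun i hi => ?_)⟩
    simp only [Function.update_apply, e' i hi]

/-- Contraction preserves the underlying monomial, and gives a marked tree from an unmarked one. -/
theorem toggle_spec (hB : ∀ t ∈ B, ∀ q, EdgeSub t q → q ∈ B) (x : Model B) : ∀ y, Toggle x y → flat y = flat x ∧ y.weight + 1 = x.weight ∧
    HasGood B (flat x) ∧ ¬Marked x ∧ Marked y := by
  induction x using nd_induction with
  | hl => intro y h; exact absurd h (toggle_leaf y)
  | hn b m ih =>
    intro y h
    obtain ⟨g, β, hb⟩ := b.exists_eq_nd
    rw [toggle_nd b m y hb] at h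
    rcases h with ⟨j, hj, h1, h2, b', m', γ, h3, h4, rfl⟩ | ⟨h1, j, h2, y', h3, rfl⟩
    · have hk := pos_lt_leaves_of_leaf b hb hj h2
      have e : γ.1 = graft b.1 (pos β j) b'.1 := by rw [h4, hb, graft_nd_leaf g β hj h2]
      have hf : flat (nd γ (spliceN m (pos β j) b'.1.leaves m')) = flat (nd b m) := by
        rw [flat_nd_contract b m hk b' m' h3, flat_nd, e]
      refine ⟨hf, weight_spliceN b m hk b' m' h3 γ (by rw [e]), ?_, ?_, ?_⟩
      · have := h1.1
        rw [flat_nd_nd b m hb] at this ⊢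
        exact hasGood_nd.2 (Or.inl ⟨j, this⟩)
      · exact not_marked_of_childAt h1 (by rw [hb, childAt_nd g β hj, h2])
      · rw [marked_nd]
        refine Or.inl ⟨j, by rwa [hf], ?_⟩
        rw [h4, childAt_nd _ _ hj, Function.update_self]
        exact ne_leaf_of_weight_pos b'.2.2
    · obtain ⟨i1, i2, i3, i4, i5⟩ := ih j h2.1 y' h3
      -- The composites of all subtrees are unchanged, so the first good edge of the new tree is
      -- found along the same path.
      have hc : ∀ i, flat (Function.update m j y' i) = flat (m i) := by
        intro i
        by_cases hi : i = j
        · subst hi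
          rw [Function.update_self, i1]
        · rw [Function.update_of_ne hi]
      have hf : flat (nd b (Function.update m j y')) = flat (nd b m) := by
        rw [flat_nd, flat_nd]
        exact graftAll_congr fun i _ => hc i
      have h2' : FirstTree B (fun i => flat (Function.update m j y' i)) b.1.leaves j :=
        h2.congr fun i _ => (hc i).symm
      refine ⟨hf, weight_nd_update b m h2.1 i2, ?_, ?_, ?_⟩
      · obtain ⟨q, hq⟩ := i3
        obtain ⟨g', hg'⟩ := eq_corolla_of_not_rootGood hB b m h1
        rw [flat_nd_corolla b m hg']
        have hj := h2.1
        rw [hg', leaves_corolla] at hj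
        exact hasGood_nd.2 (Or.inr ⟨j, hj, q, hq⟩)
      · rwa [marked_iff_of_firstTree h1 h2]
      · rw [marked_iff_of_firstTree (by rwa [hf]) h2', Function.update_self]
        exact i5

/-- The label that contains the first good edge is cut along it. By condition 2 both parts are again
in `B`. -/
theorem exists_toggle_of_marked (hB : ∀ t, t ∈ B ↔ ∀ q, EdgeSub t q → q ∈ B) (y : Model B) :
    Marked y → ∃ x, Toggle x y := by
  have hB' : ∀ t ∈ B, ∀ q, EdgeSub t q → q ∈ B := fun t ht => (hB t).1 ht
  induction y using nd_induction with
  | hl => intro h; exact absurd h (by rw [Marked]; exact id)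
  | hn γ n ih =>
    intro h
    rw [marked_nd] at h
    obtain ⟨g, β, hγ⟩ := γ.exists_eq_nd
    rcases h with ⟨j, h1, h2⟩ | ⟨h1, j, h2, h3⟩
    · have hj : j < ar g := by
        have := h1.1
        rw [flat_nd_nd γ n hγ] at this
        exact (rootGood_nd.1 this).1
      rw [hγ, childAt_nd g β hj] at h2
      have hγB := (hB _).1 (hγ ▸ γ.2.1)
      -- The lower part: its edges are edges of the original label with the same restrictions.
      have hbB : nd g (Function.update β j leaf) ∈ B := by
        refine (hB _).2 fun q hq => ?_
        rcases (edgeSub_nd _ _ _).1 hq with ⟨i, hi, h, c', hc, rfl⟩ | ⟨i, hi, hq'⟩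
        · have hij : i ≠ j := by
            rintro rfl
            rw [Function.update_self] at hc
            exact nd_ne_leaf _ _ hc.symm
          rw [Function.update_of_ne hij] at hc
          exact hγB _ ((edgeSub_nd _ _ _).2 (Or.inl ⟨i, hi, h, c', hc, rfl⟩))
        · have hij : i ≠ j := by
            rintro rfl
            rw [Function.update_self] at hq'
            exact not_edgeSub_leaf _ hq'
          rw [Function.update_of_ne hij] at hq'
          exact hγB _ ((edgeSub_nd _ _ _).2 (Or.inr ⟨i, hi, hq'⟩))
      have hbB' : β j ∈ B :=
        (hB _).2 fun q hq => hγB _ ((edgeSub_nd _ _ _).2 (Or.inr ⟨j, hj, hq⟩))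
      set b : Lab B := ⟨nd g (Function.update β j leaf), hbB, by rw [weight_nd]; omega⟩ with hb
      set b' : Lab B := ⟨β j, hbB', weight_pos_of_ne_leaf h2⟩ with hb'
      set k := pos β j with hk
      have hpos : pos (Function.update β j leaf) j = k :=
        pos_congr fun i hi => Function.update_of_ne hi.ne _ _
      -- The trees over the entries of the upper part are gathered over a new vertex at position
      -- `k`, and the later ones are shifted back; this undoes the splicing.
      set m : ℕ → Model B := fun i => if i < k then n i else if i = k then
        nd b' (fun l => n (k + l)) else n (i + b'.1.leaves - 1) with hm
      have hmk : m k = nd b' (fun l => n (k + l)) := by simp [hm]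
      have hs : spliceN m k b'.1.leaves (fun l => n (k + l)) = n := by
        funext i
        simp only [spliceN, hm]
        split_ifs <;> first | omega | rfl | (congr 1; omega)
      have hg : γ.1 = graft b.1 k b'.1 := by
        rw [hγ, hb, ← hpos, graft_nd_leaf _ _ hj (Function.update_self _ _ _),
          Function.update_idem, hb', Function.update_eq_self]
      have hkl : k < b.1.leaves := by
        rw [← hpos]
        exact pos_lt_leaves_of_leaf b rfl hj (Function.update_self _ _ _)
      have hf : flat (nd b m) = flat (nd γ n) := by
        rw [flat_nd_contract b m hkl b' _ hmk, hs, flat_nd, hg]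
      refine ⟨nd b m, (toggle_nd b m _ rfl).2 (Or.inl ⟨j, hj, by rwa [hf], Function.update_self _ _ _,
        b', fun l => n (k + l), γ, ?_, ?_, ?_⟩)⟩
      · rw [hpos, hmk]
      · rw [Function.update_idem, hb', Function.update_eq_self, hγ]
      · rw [hpos, hs]
    · obtain ⟨x', hx'⟩ := ih j h2.1 h3
      obtain ⟨i1, -, -, -, -⟩ := toggle_spec hB' x' _ hx'
      have hc : ∀ i, flat (Function.update n j x' i) = flat (n i) := by
        intro i
        by_cases hi : i = j
        · subst hi
          rw [Function.update_self, i1]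
        · rw [Function.update_of_ne hi]
      have hf : flat (nd γ (Function.update n j x')) = flat (nd γ n) := by
        rw [flat_nd, flat_nd]
        exact graftAll_congr fun i _ => hc i
      refine ⟨nd γ (Function.update n j x'), (toggle_nd γ _ _ hγ).2 (Or.inr ⟨by rwa [hf], j,
        h2.congr fun i _ => (hc i).symm, n j, by rwa [Function.update_self], ?_⟩)⟩
      rw [Function.update_idem, Function.update_eq_self]

theorem spliceN_inj {α : Type*} {c c₁ : ℕ → α} {k n : ℕ} {c' c₁' : ℕ → α} {N : ℕ}
    (h : ∀ i < N + n - 1, spliceN c k n c' i = spliceN c₁ k n c₁' i) (hk : k < N) :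
    (∀ i < N, i ≠ k → c i = c₁ i) ∧ ∀ i < n, c' i = c₁' i := by
  constructor
  · intro i hi hik
    have := h (shift k n i) (by unfold shift; split_ifs <;> omega)
    rwa [spliceN_shift _ _ _ _ hik, spliceN_shift _ _ _ _ hik] at this
  · intro i hi
    have := h (k + i) (by omega)
    rwa [spliceN_add _ _ _ _ hi, spliceN_add _ _ _ _ hi] at this

/-- Contraction preserves the composite, so `y` determines the first good edge, and cutting `y`
along it is the only way back. -/
theorem toggle_injective (hB : ∀ t ∈ B, ∀ q, EdgeSub t q → q ∈ B) (x : Model B) :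
    ∀ x' y, Toggle x y → Toggle x' y → x = x' := by
  induction x using nd_induction with
  | hl => intro x' y h; exact absurd h (toggle_leaf y)
  | hn b m ih =>
    intro x' y h h'
    have hf : flat x' = flat (nd b m) := (toggle_spec hB _ _ h').1.symm.trans (toggle_spec hB _ _ h).1
    rcases leaf_or_nd x' with rfl | ⟨b₁, m₁, rfl⟩
    · exact absurd h' (toggle_leaf y)
    obtain ⟨g, β, hb⟩ := b.exists_eq_nd
    obtain ⟨g₁, β₁, hb₁⟩ := b₁.exists_eq_nd
    rw [toggle_nd b m y hb] at h
    rw [toggle_nd b₁ m₁ y hb₁, hf] at h'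
    rcases h with ⟨j, hj, h1, h2, b', m', γ, h3, h4, h5⟩ | ⟨h1, j, h2, y', h3, h4⟩ <;>
      rcases h' with ⟨j₁, hj₁, h1', h2', b₁', m₁', γ', h3', h4', h5'⟩ | ⟨h1', j₁, h2', y₁', h3', h4'⟩
    · obtain rfl := h1.unique h1'
      obtain ⟨hγ, hs⟩ := nd_inj (h5.symm.trans h5')
      obtain ⟨rfl, hu⟩ := nd_inj ((h4.symm.trans (congrArg Subtype.val hγ)).trans h4')
      have hβ : ∀ i < ar g, β i = β₁ i := by
        intro i hi
        by_cases hij : i = j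
        · rw [hij, h2, h2']
        · have := hu i hi
          rwa [Function.update_of_ne hij, Function.update_of_ne hij] at this
      have hb' : b' = b₁' := by
        have := hu j hj
        rw [Function.update_self, Function.update_self] at this
        exact Subtype.ext this
      have hbb : b = b₁ := Subtype.ext (by rw [hb, hb₁]; exact nd_congr g hβ)
      subst hb' hbb
      have hp : pos β₁ j = pos β j := pos_congr fun i hi => (hβ i (hi.trans hj)).symm
      rw [hp] at h3' hs
      have hk := pos_lt_leaves_of_leaf b hb hj h2
      have hl := leaves_graft b'.1 b.1 _ hk
      rw [hb, graft_nd_leaf g β hj h2, ← h4, ← hb] at hl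
      obtain ⟨e1, e2⟩ := spliceN_inj (N := b.1.leaves) (fun i hi => hs i (by omega)) hk
      refine nd_congr b fun i hi => ?_
      by_cases hik : i = pos β j
      · rw [hik, h3, h3']
        exact nd_congr b' e2
      · exact e1 i hi hik
    · exact absurd h1.1 (h1' j)
    · exact absurd h1'.1 (h1 j₁)
    · obtain ⟨rfl, hu⟩ := nd_inj (h4.symm.trans h4')
      have hfi : ∀ i < b.1.leaves, flat (m₁ i) = flat (m i) := by
        rw [flat_nd, flat_nd] at hf
        exact graftAll_inj_right _ hf
      obtain rfl := h2.unique (h2'.congr hfi)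
      have hy := hu j h2.1
      rw [Function.update_self, Function.update_self] at hy
      subst hy
      refine nd_congr b fun i hi => ?_
      by_cases hij : i = j
      · subst hij
        exact ih i hi _ _ h3 h3'
      · have := hu i hi
        rwa [Function.update_of_ne hij, Function.update_of_ne hij] at this

end model


open PTree

/-! ### Leading terms of the differential. -/

section differential

variable {K : Type v} [Field K] {G : Type u} {ar : G → ℕ} {deg : G → ℤ} {I : OpIdeal K ar deg}
  {le : PTree G ar → PTree G ar → Prop} {B : Set (PTree G ar)}

/-- The trees that may occur in the contraction of the edge to the tree `m k` over the root `b`. -/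
def Contr (le : PTree G ar → PTree G ar → Prop) (b : Lab B) (m : ℕ → Model B) (k : ℕ) :
    Set (Model B) :=
  {y | ∃ (b' : Lab B) (m' : ℕ → Model B) (γ : Lab B), m k = nd b' m' ∧
    y = nd γ (spliceN m k b'.1.leaves m') ∧ (γ.1 = graft b.1 k b'.1 ∨
      (graft b.1 k b'.1 ∉ B ∧ Above le (graft b.1 k b'.1) γ.1 ∧ graft b.1 k b'.1 ≠ γ.1))}

theorem weight_graft (s t : PTree G ar) {i : ℕ} (hi : i < s.leaves) :
    (graft s i t).weight = s.weight + t.weight := total_graft _ _ _ _ hi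

theorem monOp_comp_elt (b b' : Lab B) {k : ℕ} (hk : k < b.1.leaves) :
    ((monOp I b.1 b.2.2).comp ⟨k, hk⟩ (monOp I b'.1 b'.2.2)).elt
      = ksign K (degAfter deg b.1 k * b'.1.total deg) • I.mon (graft b.1 k b'.1) :=
  I.qcomp_mon _ hk

theorem toBar_spliceN (m : ℕ → Model B) (k n : ℕ) (m' : ℕ → Model B) :
    spliceN (fun j => toBar I (m j)) k n (fun j => toBar I (m' j))
      = fun j => toBar I (spliceN m k n m' j) := (comp_spliceN _ _ _ _ _).symm

/-- If the grafted label stays in `B`, no rewriting takes place and the coefficient is a product of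
signs. This supplies the nonzero coefficient of a matched pair. -/
theorem conB_clM_of_mem (b : Lab B) (m : ℕ → Model B) {k : ℕ} (hk : k < b.1.leaves) (b' : Lab B)
    (m' : ℕ → Model B) (h : m k = nd b' m') (γ : Lab B) (hγ : γ.1 = graft b.1 k b'.1) :
    ∃ ε : K, ε ≠ 0 ∧ conB (monOp I b.1 b.2.2) (fun j => toBar I (m j)) k (clM I (m k))
      = ε • clM I (nd γ (spliceN m k b'.1.leaves m')) := by
  have hl := leaves_graft b'.1 b.1 k hk
  rw [h, clM, toBar_nd, conB_cl_nd _ _ (show k < (monOp I b.1 b.2.2).arity from hk)]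
  have e := cl_nd_smul (p := (monOp I b.1 b.2.2).comp ⟨k, hk⟩ (monOp I b'.1 b'.2.2))
    (p' := monOp I γ.1 γ.2.2)
    (by
      change b.1.leaves + b'.1.leaves - 1 = γ.1.leaves
      rw [hγ]
      omega)
    (by
      change b.1.total deg + b'.1.total deg = γ.1.total deg
      rw [hγ, total_graft _ _ _ _ hk])
    (by
      change b.1.weight + b'.1.weight = γ.1.weight
      rw [hγ, weight_graft _ _ hk])
    _ (by rw [monOp_comp_elt b b' hk, ← hγ]; rfl)
    (spliceN (fun j => toBar I (m j)) k b'.1.leaves (fun j => toBar I (m' j)))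
  refine ⟨ksign K (((monOp I b.1 b.2.2).degree + ((monOp I b'.1 b'.2.2).degree + 1)
    * lD (fun j => toBar I (m j)) k)) * ksign K (degAfter deg b.1 k * b'.1.total deg),
    mul_ne_zero (ksign_ne_zero K _) (ksign_ne_zero K _), ?_⟩
  refine (congrArg (_ • ·) e).trans ?_
  rw [smul_smul, toBar_spliceN]
  rfl

/-- Condition 1 is used here: either the composite of the two labels is a label, or it is a
combination of strictly larger ones of the same arity and weight. -/
theorem IsPBWBasis.conB_clM (h : IsPBWBasis I le B) (b : Lab B) (m : ℕ → Model B) {k : ℕ}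
    (hk : k < b.1.leaves) :
    conB (monOp I b.1 b.2.2) (fun j => toBar I (m j)) k (clM I (m k))
      ∈ Submodule.span K (clM I '' Contr le b m k) := by
  rcases leaf_or_nd (m k) with hl | ⟨b', m', hm⟩
  · rw [hl, clM, toBar_leaf, conB_cl_leaf]
    exact Submodule.zero_mem _
  · have hw := weight_graft b.1 b'.1 hk
    have hw' := b.2.2
    by_cases hB : graft b.1 k b'.1 ∈ B
    · obtain ⟨ε, -, e⟩ := conB_clM_of_mem (I := I) b m hk b' m' hm ⟨_, hB, by omega⟩ rfl
      rw [e]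
      exact Submodule.smul_mem _ _ (Submodule.subset_span
        ⟨_, ⟨b', m', ⟨_, hB, by omega⟩, hm, rfl, Or.inl rfl⟩, rfl⟩)
    · obtain ⟨f, e, hf⟩ := h.exists_rewrite b.2.1 b'.2.1 hk hB
      have hl := leaves_graft b'.1 b.1 k hk
      rw [hm, clM, toBar_nd, conB_cl_nd _ _ (show k < (monOp I b.1 b.2.2).arity from hk)]
      refine Submodule.smul_mem _ _ ?_
      have e1 := cl_nd_eq_sum ((monOp I b.1 b.2.2).comp ⟨k, hk⟩ (monOp I b'.1 b'.2.2)) (f := f) _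
        (by
          intro t ht
          obtain ⟨-, h1, h2, h3, -⟩ := hf t ht
          refine ⟨h1.trans ?_, h2.trans (total_graft _ _ _ _ hk), h3.trans hw⟩
          change _ = b.1.leaves + b'.1.leaves - 1
          omega)
        (by rw [monOp_comp_elt b b' hk, e])
        (spliceN (fun j => toBar I (m j)) k b'.1.leaves (fun j => toBar I (m' j)))
      refine (congrArg (· ∈ _) e1).mpr ?_
      refine Submodule.smul_mem _ _ (Submodule.sum_mem _ fun t ht => Submodule.smul_mem _ _ ?_)
      obtain ⟨h1, h2, -, h3, h4, h5⟩ := hf t ht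
      have ht0 : 0 < t.weight := by omega
      rw [dif_pos ht0, toBar_spliceN]
      exact Submodule.subset_span ⟨nd ⟨t, h1, ht0⟩ _, ⟨b', m', ⟨t, h1, ht0⟩, hm, rfl,
        Or.inr ⟨hB, ⟨h4, h2.symm, h3.symm⟩, h5⟩⟩, rfl⟩

theorem nodeB_clM (b : Lab B) (m : ℕ → Model B) {j : ℕ} (hj : j < b.1.leaves) (y : Model B) :
    nodeB (monOp I b.1 b.2.2) (fun i => toBar I (m i)) j (clM I y)
      = clM I (nd b (Function.update m j y)) := by
  rw [clM, nodeB_cl _ _ (show j < (monOp I b.1 b.2.2).arity from hj), clM, toBar_nd, toBar_update]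

theorem nodeB_mem (b : Lab B) (m : ℕ → Model B) {j : ℕ} (hj : j < b.1.leaves) {S S' : Set (Model B)}
    (hS : ∀ y ∈ S, nd b (Function.update m j y) ∈ S') {v : Bar I}
    (hv : v ∈ Submodule.span K (clM I '' S)) :
    nodeB (monOp I b.1 b.2.2) (fun i => toBar I (m i)) j v ∈ Submodule.span K (clM I '' S') := by
  have := Submodule.mem_map_of_mem (f := nodeB (monOp I b.1 b.2.2) (fun i => toBar I (m i)) j) hv
  rw [Submodule.map_span] at this
  refine Submodule.span_le.2 ?_ this
  rintro _ ⟨_, ⟨y, hy, rfl⟩, rfl⟩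
  rw [nodeB_clM b m hj]
  exact Submodule.subset_span ⟨_, hS y hy, rfl⟩

theorem barDiff_clM_nd (b : Lab B) (m : ℕ → Model B) : barDiff I (clM I (nd b m))
    = ∑ j ∈ Finset.range b.1.leaves,
      (conB (monOp I b.1 b.2.2) (fun i => toBar I (m i)) j (clM I (m j))
      + sg (monOp I b.1 b.2.2) (fun i => toBar I (m i)) j
        • nodeB (monOp I b.1 b.2.2) (fun i => toBar I (m i)) j (barDiff I (clM I (m j)))) := by
  rw [clM, toBar_nd, barDiff_nd]
  rfl

theorem contr_spec (h : IsMonomialOrder le) (b : Lab B) (m : ℕ → Model B)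
    {k : ℕ} (hk : k < b.1.leaves) {y : Model B} (hy : y ∈ Contr le b m k) :
    Above le (flat (nd b m)) (flat y) ∧ y.weight + 1 = (nd b m).weight := by
  obtain ⟨b', m', γ, hm, rfl, hγ⟩ := hy
  have hab : Above le (graft b.1 k b'.1) γ.1 := by
    rcases hγ with e | ⟨-, e, -⟩
    · rw [e]
      exact Above.refl h _
    · exact e
  rw [flat_nd_contract b m hk b' m' hm, flat_nd]
  exact ⟨hab.graftAll h fun i _ => Above.refl h _, weight_spliceN b m hk b' m' hm γ hab.leaves.symm⟩

/-- A genuine rewriting of the root label cannot be hidden by the trees over it, because grafting a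
fixed forest is injective. -/
theorem flat_ne_of_contr (har : ∀ g, 0 < ar g) (b : Lab B) (m : ℕ → Model B)
    {k : ℕ} (hk : k < b.1.leaves) {b' γ : Lab B} {m' : ℕ → Model B} (hm : m k = nd b' m')
    (hl : (graft b.1 k b'.1).leaves = γ.1.leaves) (hne : graft b.1 k b'.1 ≠ γ.1) :
    flat (nd γ (spliceN m k b'.1.leaves m')) ≠ flat (nd b m) := by
  rw [flat_nd_contract b m hk b' m' hm, flat_nd]
  exact fun e => hne (graftAll_injective _ _ _ (fun i => leaves_pos har _) hl e.symm)

theorem above_flat_update (h : IsMonomialOrder le) (b : Lab B) (m : ℕ → Model B) {j : ℕ}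
    {y : Model B} (hy : Above le (flat (m j)) (flat y)) :
    Above le (flat (nd b m)) (flat (nd b (Function.update m j y))) := by
  rw [flat_nd, flat_nd]
  refine (Above.refl h _).graftAll h fun i _ => ?_
  by_cases hij : i = j
  · subst hij
    rwa [Function.update_self]
  · rw [Function.update_of_ne hij]
    exact Above.refl h _

/-- The differential of a tree only involves trees with larger or equal underlying monomials. -/
theorem IsPBWBasis.barDiff_clM_mem (h : IsPBWBasis I le B) (x : Model B) :
    barDiff I (clM I x) ∈ Submodule.span K
      (clM I '' {y : Model B | Above le (flat x) (flat y) ∧ y.weight + 1 = x.weight}) := by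
  induction x using nd_induction with
  | hl =>
    rw [clM, toBar_leaf, barDiff_leaf]
    exact Submodule.zero_mem _
  | hn b m ih =>
    rw [barDiff_clM_nd]
    refine Submodule.sum_mem _ fun j hj => Submodule.add_mem _ ?_ (Submodule.smul_mem _ _ ?_)
    · rw [Finset.mem_range] at hj
      refine Submodule.span_mono (Set.image_mono fun y hy => ?_) (h.conB_clM b m hj)
      exact contr_spec h.order b m hj hy
    · rw [Finset.mem_range] at hj
      refine nodeB_mem b m hj (fun y hy => ?_) (ih j hj)
      exact ⟨above_flat_update h.order b m hy.1, weight_nd_update b m hj hy.2⟩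

/-- The leading term of the differential of an unmarked tree. -/
theorem IsPBWBasis.barDiff_clM_sub_mem (h : IsPBWBasis I le B) (har : ∀ g, 0 < ar g) (x : Model B) :
    ∀ y, Toggle x y → ∃ ε : K, ε ≠ 0 ∧ barDiff I (clM I x) - ε • clM I y ∈ Submodule.span K
      (clM I '' {z : Model B | Above le (flat x) (flat z) ∧ (flat z = flat x → ¬Marked z)}) := by
  have hB' : ∀ t ∈ B, ∀ q, EdgeSub t q → q ∈ B := fun t ht => (h.mem_iff t).1 ht
  induction x using nd_induction with
  | hl => intro y hy; exact absurd hy (toggle_leaf y)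
  | hn b m ih =>
    intro y hy
    obtain ⟨g, β, hb⟩ := b.exists_eq_nd
    rw [toggle_nd b m y hb] at hy
    rw [barDiff_clM_nd]
    rcases hy with ⟨j, hj, h1, h2, b', m', γ, h3, h4, rfl⟩ | ⟨h1, j, h2, y', h3, rfl⟩
    · have hk := pos_lt_leaves_of_leaf b hb hj h2
      have e : γ.1 = graft b.1 (pos β j) b'.1 := by rw [h4, hb, graft_nd_leaf g β hj h2]
      have hbj : childAt b.1 j = leaf := by rw [hb, childAt_nd g β hj, h2]
      obtain ⟨ε, hε, e1⟩ := conB_clM_of_mem (I := I) b m hk b' m' h3 γ e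
      refine ⟨ε, hε, ?_⟩
      rw [Finset.sum_add_distrib, ← Finset.add_sum_erase _ _ (Finset.mem_range.2 hk), e1,
        add_assoc, add_sub_cancel_left]
      -- In every other term with the same composite, the entry `j` of the root of the root label is
      -- still free, so the first good edge is not inside a label.
      refine Submodule.add_mem _ (Submodule.sum_mem _ fun k hk' => ?_)
        (Submodule.sum_mem _ fun k hk' => Submodule.smul_mem _ _ ?_)
      · obtain ⟨hne, hk'⟩ := Finset.mem_erase.1 hk'
        rw [Finset.mem_range] at hk'
        refine Submodule.span_mono (Set.image_mono fun z hz => ?_) (h.conB_clM b m hk')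
        refine ⟨(contr_spec h.order b m hk' hz).1, fun hf => ?_⟩
        obtain ⟨b'', m'', γ', hm, rfl, hγ⟩ := hz
        rcases hγ with hγ | ⟨-, hab, hne'⟩
        · refine not_marked_of_childAt (j := j) (by rwa [hf]) ?_
          rw [hb, leaves_nd] at hk'
          obtain ⟨i, hi, q, hq, rfl⟩ := pos_exists β hk'
          have hij : j ≠ i := by
            rintro rfl
            rw [h2] at hq
            obtain rfl : q = 0 := by simpa using hq
            exact hne rfl
          rw [hγ, hb, graft_nd g β hi hq, childAt_nd _ _ hj, Function.update_of_ne hij, h2]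
        · exact absurd hf (flat_ne_of_contr har b m hk' hm hab.leaves hne')
      · rw [Finset.mem_range] at hk'
        refine nodeB_mem b m hk' (fun z hz => ?_) (h.barDiff_clM_mem (m k))
        exact ⟨above_flat_update h.order b m hz.1,
          fun hf => not_marked_of_childAt (j := j) (by rwa [hf]) hbj⟩
    · obtain ⟨ε, hε, e1⟩ := ih j h2.1 y' h3
      obtain ⟨g', hg'⟩ := eq_corolla_of_not_rootGood hB' b m h1
      have hx : ¬Marked (m j) := (toggle_spec hB' _ _ h3).2.2.2.1
      set s : K := sg (monOp I b.1 b.2.2) (fun i => toBar I (m i)) j with hs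
      have hs0 : s ≠ 0 := ksign_ne_zero K _
      refine ⟨s * ε, mul_ne_zero hs0 hε, ?_⟩
      rw [Finset.sum_add_distrib, ← Finset.add_sum_erase _
        (fun j => sg (monOp I b.1 b.2.2) (fun i => toBar I (m i)) j
          • nodeB (monOp I b.1 b.2.2) (fun i => toBar I (m i)) j (barDiff I (clM I (m j))))
        (Finset.mem_range.2 h2.1)]
      have e2 : (s * ε) • clM I (nd b (Function.update m j y'))
          = s • nodeB (monOp I b.1 b.2.2) (fun i => toBar I (m i)) j (ε • clM I y') := by
        rw [map_smul, nodeB_clM b m h2.1, smul_smul]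
      rw [e2, add_sub_assoc, add_sub_right_comm]
      have e3 : s • nodeB (monOp I b.1 b.2.2) (fun i => toBar I (m i)) j (barDiff I (clM I (m j)))
          - s • nodeB (monOp I b.1 b.2.2) (fun i => toBar I (m i)) j (ε • clM I y')
          = s • nodeB (monOp I b.1 b.2.2) (fun i => toBar I (m i)) j
            (barDiff I (clM I (m j)) - ε • clM I y') := by
        rw [map_sub, smul_sub]
      -- If the composite is unchanged, the first tree with a good edge is still the one over `j`,
      -- and whether the result is marked is decided there.
      have key : ∀ k < b.1.leaves, ∀ z, flat (nd b (Function.update m k z)) = flat (nd b m) →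
          Marked (nd b (Function.update m k z)) →
          flat z = flat (m k) ∧ Marked (Function.update m k z j) := by
        intro k hk z hf hz
        have hfi : ∀ i < b.1.leaves, flat (Function.update m k z i) = flat (m i) := by
          rw [flat_nd, flat_nd] at hf
          exact graftAll_inj_right _ hf
        have := hfi k hk
        rw [Function.update_self] at this
        refine ⟨this, ?_⟩
        rwa [marked_iff_of_firstTree (by rwa [hf]) (h2.congr fun i hi => (hfi i hi).symm)] at hz
      refine Submodule.add_mem _ (Submodule.sum_mem _ fun k hk => ?_) (Submodule.add_mem _ ?_
        (Submodule.sum_mem _ fun k hk => Submodule.smul_mem _ _ ?_))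
      · rw [Finset.mem_range] at hk
        refine Submodule.span_mono (Set.image_mono fun z hz => ?_) (h.conB_clM b m hk)
        refine ⟨(contr_spec h.order b m hk hz).1, fun hf => ?_⟩
        obtain ⟨b'', m'', γ', hm, rfl, hγ⟩ := hz
        rcases hγ with hγ | ⟨-, hab, hne'⟩
        -- A root contraction that keeps the composite puts the contracted edge inside a label,
        -- where it is good; but the composite has no good root edge.
        · exfalso
          have hkg : k < ar g' := by rwa [hg', leaves_corolla] at hk
          have hγ' : γ'.1 = nd g' (Function.update (fun _ => leaf) k b''.1) := by
            have := graft_nd_leaf g' (fun _ => leaf) hkg rfl b''.1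
            rw [hγ, hg', ← this]
            congr 1
            simp [pos]
          have := rootGood_of_childAt_ne hB' γ' (spliceN m k b''.1.leaves m'') hγ' hkg
            (by rw [Function.update_self]; exact ne_leaf_of_weight_pos b''.2.2)
          rw [hf] at this
          exact h1 _ this
        · exact absurd hf (flat_ne_of_contr har b m hk hm hab.leaves hne')
      · rw [e3]
        refine Submodule.smul_mem _ _ (nodeB_mem b m h2.1 (fun z hz => ?_) e1)
        refine ⟨above_flat_update h.order b m hz.1, fun hf hm => ?_⟩
        obtain ⟨k1, k2⟩ := key j h2.1 z hf hm
        rw [Function.update_self] at k2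
        exact hz.2 k1 k2
      · obtain ⟨hkj, hk⟩ := Finset.mem_erase.1 hk
        rw [Finset.mem_range] at hk
        refine nodeB_mem b m hk (fun z hz => ?_) (h.barDiff_clM_mem (m k))
        refine ⟨above_flat_update h.order b m hz.1, fun hf hm => ?_⟩
        have k2 := (key k hk z hf hm).2
        rw [Function.update_of_ne (Ne.symm hkj)] at k2
        exact hx k2

end differential


open PTree

/-! ### Exactness off the diagonal and Koszulness. -/

section model

variable {G : Type u} {ar : G → ℕ} {B : Set (PTree G ar)}

/-- For an unmarked tree the first good edge joins two different labels. Merging them gives an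
element of `B`, since the only new edge is good. -/
theorem exists_toggle (hB : ∀ t, t ∈ B ↔ ∀ q, EdgeSub t q → q ∈ B) (x : Model B) :
    HasGood B (flat x) → ¬Marked x → ∃ y, Toggle x y := by
  have hB' : ∀ t ∈ B, ∀ q, EdgeSub t q → q ∈ B := fun t ht => (hB t).1 ht
  induction x using nd_induction with
  | hl =>
    rintro ⟨q, hq, -⟩
    exact absurd hq (not_edgeSub_leaf q)
  | hn b m ih =>
    intro hg hm
    obtain ⟨g, β, hb⟩ := b.exists_eq_nd
    by_cases hr : ∃ i, RootGood B (flat (nd b m)) i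
    · obtain ⟨j, h1⟩ := exists_firstGood hr
      have h1' := h1.1
      rw [flat_nd_nd b m hb, rootGood_nd] at h1'
      obtain ⟨hj, f, c', hc, hBt⟩ := h1'
      have h2 : β j = leaf := by
        by_contra hne
        refine hm ((marked_nd b m).2 (Or.inl ⟨j, h1, ?_⟩))
        rwa [hb, childAt_nd g β hj]
      rw [h2] at hc
      replace hc : flat (m (pos β j)) = nd f c' := hc
      rcases leaf_or_nd (m (pos β j)) with hl | ⟨b', m', h3⟩
      · rw [hl, flat_leaf] at hc
        exact absurd hc.symm (nd_ne_leaf _ _)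
      · obtain ⟨g', β', hb'⟩ := b'.exists_eq_nd
        rw [h3, flat_nd_nd b' m' hb'] at hc
        obtain ⟨rfl, -⟩ := nd_inj hc
        have hbB := (hB _).1 (hb ▸ b.2.1)
        -- Converse use of condition 2: an edge of the merged label lies in the lower label, in the
        -- upper label, or is the good edge joining them.
        have hγ : nd g (Function.update β j b'.1) ∈ B := by
          refine (hB _).2 fun q hq => ?_
          rcases (edgeSub_nd _ _ _).1 hq with ⟨i, hi, h, c'', hc', rfl⟩ | ⟨i, hi, hq'⟩
          · by_cases hij : i = j
            · subst hij
              rw [Function.update_self, hb'] at hc'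
              obtain ⟨rfl, -⟩ := nd_inj hc'
              exact hBt
            · rw [Function.update_of_ne hij] at hc'
              exact hbB _ ((edgeSub_nd _ _ _).2 (Or.inl ⟨i, hi, h, c'', hc', rfl⟩))
          · by_cases hij : i = j
            · subst hij
              rw [Function.update_self] at hq'
              exact hB' _ b'.2.1 _ hq'
            · rw [Function.update_of_ne hij] at hq'
              exact hbB _ ((edgeSub_nd _ _ _).2 (Or.inr ⟨i, hi, hq'⟩))
        exact ⟨_, (toggle_nd b m _ hb).2 (Or.inl ⟨j, hj, h1, h2, b', m',
          ⟨_, hγ, by rw [weight_nd]; omega⟩, h3, rfl, rfl⟩)⟩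
    · have h1 : ∀ i, ¬RootGood B (flat (nd b m)) i := not_exists.1 hr
      obtain ⟨g', hg'⟩ := eq_corolla_of_not_rootGood hB' b m h1
      have hl : b.1.leaves = ar g' := by rw [hg', leaves_corolla]
      obtain ⟨j, h2⟩ : ∃ j, FirstTree B (fun i => flat (m i)) b.1.leaves j := by
        refine exists_firstTree ?_
        rw [flat_nd_corolla b m hg'] at hg h1
        rw [hl]
        exact (hasGood_nd.1 hg).resolve_left fun ⟨i, hi⟩ => h1 i hi
      rw [marked_iff_of_firstTree h1 h2] at hm
      obtain ⟨y', hy'⟩ := ih j h2.1 h2.2.1 hm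
      exact ⟨_, (toggle_nd b m _ hb).2 (Or.inr ⟨h1, j, h2, y', hy', rfl⟩)⟩

theorem weight_le_wt (x : Model B) : x.weight ≤ wt x := by
  induction x using nd_induction with
  | hl => exact le_rfl
  | hn b m ih =>
    rw [wt, total_nd, weight_nd]
    exact add_le_add b.2.2 (Finset.sum_le_sum fun j hj => ih j (Finset.mem_range.1 hj))

end model

section koszul

variable {K : Type v} [Field K] {G : Type u} {ar : G → ℕ} {deg : G → ℤ} {I : OpIdeal K ar deg}
  {le : PTree G ar → PTree G ar → Prop} {B : Set (PTree G ar)}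

theorem IsPBWBasis.barDiff_mem (h : IsPBWBasis I le B) (d s : ℕ) (U : Set (PTree G ar))
    (hU : ∀ t ∈ U, ∀ u, Above le t u → u ∈ U) (x : Model B) (h1 : x.weight = d + 1)
    (h2 : wt x = s) (h3 : flat x ∈ U) : barDiff I (clM I x) ∈ Submodule.span K
      (clM I '' {m : Model B | m.weight = d ∧ wt m = s ∧ flat m ∈ U}) := by
  refine Submodule.span_mono (Set.image_mono ?_) (h.barDiff_clM_mem x)
  rintro y ⟨hy, hw⟩
  refine ⟨by omega, ?_, hU _ h3 _ hy⟩
  rw [← weight_flat, ← hy.weight, weight_flat, h2]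

/-- The bar construction is exact off the diagonal, also on the subcomplexes given by up-closed
sets of monomials. -/
theorem IsPBWBasis.exact (h : IsPBWBasis I le B) (har : ∀ g, 0 < ar g)
    (hfin : ∀ n, {g | ar g = n}.Finite) {d s : ℕ} (hds : d < s) (U : Set (PTree G ar))
    (hU : ∀ t ∈ U, ∀ u, Above le t u → u ∈ U) (z : Bar I) (hz : z ∈ Submodule.span K
      (clM I '' {m : Model B | m.weight = d ∧ wt m = s ∧ flat m ∈ U})) (hDz : barDiff I z = 0) :
    ∃ y ∈ Submodule.span K (clM I '' {m : Model B | m.weight = d + 1 ∧ wt m = s ∧ flat m ∈ U}),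
      barDiff I y = z := by
  have hB' : ∀ t ∈ B, ∀ q, EdgeSub t q → q ∈ B := fun t ht => (h.mem_iff t).1 ht
  -- Sources are the unmarked trees whose composite has a good edge, targets are the marked trees,
  -- and the rank is the number of monomials above the composite.
  have key := exists_eq_of_matching h.barBasis (barDiff I) barDiff_barDiff
    {x | HasGood B (flat x) ∧ ¬Marked x} {x | Marked x}
    {m : Model B | m.weight = d ∧ wt m = s ∧ flat m ∈ U}
    {m : Model B | m.weight = d + 1 ∧ wt m = s ∧ flat m ∈ U} Toggle
    (fun x => aboveCard le (flat x))
  simp only [h.barBasis_apply] at key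
  refine key ?_ ?_ ?_ ?_ ?_ ?_ ?_ ?_ ?_ z hz hDz
  · rintro x ⟨h1, h2, -⟩
    by_cases hm : Marked x
    · exact Or.inr hm
    -- Since `d < s`, the tree is off the diagonal and its composite has a good edge, so every tree
    -- in this degree is a source or a target.
    · refine Or.inl ⟨?_, hm⟩
      by_contra hg
      have := wt_eq_weight_of_not_hasGood hB' x hg
      omega
  · intro x
    refine Submodule.span_mono (Set.image_mono ?_) (h.barDiff_clM_mem x)
    exact fun y hy => hy.1.card_le h.order har hfin
  · rintro x ⟨h1, h2, h3⟩
    exact h.barDiff_mem d s U hU x h1 h2 h3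
  · rintro x ⟨h1, h2⟩
    exact exists_toggle h.mem_iff x h1 h2
  · intro x _ y hxy
    obtain ⟨ε, hε, hm⟩ := h.barDiff_clM_sub_mem har x y hxy
    refine ⟨ε, hε, Submodule.span_mono (Set.image_mono ?_) hm⟩
    rintro z ⟨h1, h2⟩
    exact ⟨h1.card_le h.order har hfin, fun e => h2 ((h1.card_eq_iff h.order har hfin).1 e)⟩
  · intro x y hxy
    obtain ⟨h1, -, -, -, h2⟩ := toggle_spec hB' x y hxy
    exact ⟨h2, congrArg _ h1⟩
  · intro y hy
    obtain ⟨x, hx⟩ := exists_toggle_of_marked h.mem_iff y hy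
    obtain ⟨-, -, h2, h3, -⟩ := toggle_spec hB' x y hx
    exact ⟨x, ⟨h2, h3⟩, hx⟩
  · rintro x y hxy ⟨h1, h2, h3⟩
    obtain ⟨h4, h5, -⟩ := toggle_spec hB' x y hxy
    refine ⟨by omega, ?_, h4 ▸ h3⟩
    rw [← weight_flat, ← h4, weight_flat, h2]
  · exact fun x x' y => toggle_injective hB' x x' y

/-- For `d < s` this is the exactness statement for the set of all monomials. For `d > s` the piece
is zero, because every label has weight at least one. -/
theorem IsPBWBasis.isKoszul (h : IsPBWBasis I le B) (har : ∀ g, 0 < ar g)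
    (hfin : ∀ n, {g | ar g = n}.Finite) : IsKoszul I := by
  intro d s hds
  have hP : ∀ d, barPiece I d s = Submodule.span K
      (clM I '' {m : Model B | m.weight = d ∧ wt m = s ∧ flat m ∈ Set.univ}) := by
    intro d
    simp only [Set.mem_univ, and_true]
    exact h.barPiece_eq d s
  apply le_antisymm
  · rintro z ⟨hz, hDz⟩
    rcases Nat.lt_or_gt_of_ne hds with hlt | hgt
    · rw [SetLike.mem_coe, hP] at hz
      obtain ⟨y, hy, e⟩ := h.exact har hfin hlt Set.univ (fun _ _ _ _ => trivial) z hz hDz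
      exact ⟨y, by rwa [hP], e⟩
    · rw [SetLike.mem_coe, h.barPiece_eq] at hz
      have : {m : Model B | m.weight = d ∧ wt m = s} = ∅ := by
        refine Set.eq_empty_of_forall_notMem fun m hm => ?_
        have := weight_le_wt m
        have := hm.1
        have := hm.2
        omega
      rw [this, Set.image_empty, Submodule.span_empty, Submodule.mem_bot] at hz
      rw [hz]
      exact Submodule.zero_mem _
  · rintro _ ⟨y, hy, rfl⟩
    refine ⟨?_, barDiff_barDiff y⟩
    rw [SetLike.mem_coe, hP] at hy ⊢
    have := Submodule.mem_map_of_mem (f := barDiff I) hy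
    rw [Submodule.map_span] at this
    refine Submodule.span_le.2 ?_ this
    rintro _ ⟨_, ⟨x, hx, rfl⟩, rfl⟩
    exact h.barDiff_mem d s _ (fun _ _ _ _ => trivial) x hx.1 hx.2.1 hx.2.2

end koszul


open PTree

/-! ### Grafting a forest on an element, and inserting an element into a tree. -/

section treeMaps

variable {K : Type v} [Field K] {G : Type u} {ar : G → ℕ} {deg : G → ℤ}

theorem pos_congr_leaves {c c' : ℕ → PTree G ar} {a : ℕ}
    (h : ∀ i < a, (c i).leaves = (c' i).leaves) : pos c a = pos c' a :=
  Finset.sum_congr rfl fun i hi => h i (Finset.mem_range.1 hi)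

theorem comp_eq_zero_of_le {n w : ℕ} {d : ℤ} {f : Free K ar} (hf : f ∈ piece K ar deg n d w)
    (g : Free K ar) {i : ℕ} (hi : n ≤ i) : comp deg i f g = 0 := by
  refine piece_induction ?_ (fun f f' hf hf' => ?_) (fun t a h1 _ _ => ?_) f hf
  · rw [map_zero, LinearMap.zero_apply]
  · rw [map_add, LinearMap.add_apply, hf, hf', add_zero]
  · induction g using Finsupp.induction_linear with
    | zero => rw [map_zero]
    | add g g' hg hg' => rw [map_add, hg, hg', add_zero]
    | single s b => rw [comp_single, if_neg (by omega)]

theorem leaf_comp (g : Free K ar) : comp deg 0 (Finsupp.single leaf 1) g = g := by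
  induction g using Finsupp.induction_linear with
  | zero => rw [map_zero]
  | add g g' hg hg' => rw [map_add, hg, hg']
  | single s b =>
    rw [comp_single_of_lt _ (by simp)]
    simp [graft, degAfter]

variable (deg) in
/-- The exponent of the Koszul sign for grafting the trees `c` on the entries of `u`. -/
def graftSign (c : ℕ → PTree G ar) (u : PTree G ar) : ℤ :=
  ∑ i ∈ Finset.range u.leaves, degAfter deg u i * (c i).total deg

variable (deg) in
/-- The linear map grafting the trees `c` on the entries. -/
noncomputable def graftMap (c : ℕ → PTree G ar) : Free K ar →ₗ[K] Free K ar :=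
  Finsupp.linearCombination K fun u => Finsupp.single (graftAll u c) (ksign K (graftSign deg c u))

/-- The linear map grafting on the entry `j` of a vertex `g` with given trees on the other
entries. -/
noncomputable def childMap (g : G) (c : ℕ → PTree G ar) (j : ℕ) : Free K ar →ₗ[K] Free K ar :=
  Finsupp.lmapDomain K K fun T => nd g (Function.update c j T)

theorem graftMap_single (c : ℕ → PTree G ar) (u : PTree G ar) (a : K) :
    graftMap deg c (Finsupp.single u a)
      = Finsupp.single (graftAll u c) (a * ksign K (graftSign deg c u)) := by
  rw [graftMap, Finsupp.linearCombination_single, Finsupp.smul_single, smul_eq_mul]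

theorem childMap_single (g : G) (c : ℕ → PTree G ar) (j : ℕ) (T : PTree G ar) (a : K) :
    childMap g c j (Finsupp.single T a) = Finsupp.single (nd g (Function.update c j T)) a := by
  rw [childMap, Finsupp.lmapDomain_apply, Finsupp.mapDomain_single]

theorem childMap_update (g : G) (c : ℕ → PTree G ar) (j : ℕ) (T : PTree G ar) :
    childMap (K := K) g (Function.update c j T) j = childMap g c j := by
  rw [childMap, childMap]
  congr 1
  funext S
  rw [Function.update_idem]

theorem graftSign_update (c : ℕ → PTree G ar) {u : PTree G ar} {j : ℕ} (hj : j < u.leaves)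
    (t : PTree G ar) {s : ℤ} (ht : t.total deg = (c j).total deg + s) :
    graftSign deg (Function.update c j t) u = graftSign deg c u + degAfter deg u j * s := by
  unfold graftSign
  rw [← Finset.add_sum_erase _ _ (Finset.mem_range.2 hj),
    ← Finset.add_sum_erase _ (fun i => degAfter deg u i * (c i).total deg) (Finset.mem_range.2 hj),
    Function.update_self, ht]
  have : ∀ i ∈ (Finset.range u.leaves).erase j,
      degAfter deg u i * (Function.update c j t i).total deg
        = degAfter deg u i * (c i).total deg := fun i hi => by
    rw [Function.update_of_ne (Finset.mem_erase.1 hi).1]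
  rw [Finset.sum_congr rfl this]
  ring

/-- The part of the sign that depends on the individual term `u` of `r` is absorbed by `graftSign`;
what is left is a common factor. This makes composite relations stable under grafting. -/
theorem comp_graftMap {n w : ℕ} {d : ℤ} {r : Free K ar} (hr : r ∈ piece K ar deg n d w)
    (c : ℕ → PTree G ar) {j q : ℕ} (hj : j < n) (hq : q < (c j).leaves) (t : PTree G ar) :
    comp deg (pos c j + q) (graftMap deg c r) (Finsupp.single t 1)
      = ksign K ((degAfter deg (c j) q + ∑ l ∈ Finset.Ico (j + 1) n, (c l).total deg)
          * t.total deg) • graftMap deg (Function.update c j (graft (c j) q t)) r := by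
  refine piece_induction ?_ (fun f f' hf hf' => ?_) (fun u a h1 _ _ => ?_) r hr
  · simp
  · rw [map_add, map_add, map_add, LinearMap.add_apply, hf, hf', smul_add]
  · subst h1
    rw [graftMap_single, graftMap_single, comp_single_of_lt _ (by
      rw [leaves_graftAll]
      exact pos_add_lt c hj hq), graft_graftAll t u c j q hj hq, degAfter_graftAll deg u c j q hj hq,
      graftSign_update c hj _ (total_graft deg t (c j) q hq), Finsupp.smul_single, smul_eq_mul]
    congr 1
    rw [add_assoc, add_mul, ksign_add, ksign_add]
    ring

theorem graftMap_congr {n w : ℕ} {d : ℤ} {r : Free K ar} (hr : r ∈ piece K ar deg n d w)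
    {c c' : ℕ → PTree G ar} (h : ∀ i < n, c i = c' i) : graftMap deg c r = graftMap deg c' r := by
  refine piece_induction ?_ (fun f f' hf hf' => ?_) (fun u a h1 _ _ => ?_) r hr
  · rw [map_zero, map_zero]
  · rw [map_add, map_add, hf, hf']
  · subst h1
    rw [graftMap_single, graftMap_single, graftAll_congr h, graftSign, graftSign]
    congr 3
    exact Finset.sum_congr rfl fun i hi => by rw [h i (Finset.mem_range.1 hi)]

theorem graftMap_leaf (r : Free K ar) : graftMap deg (fun _ => leaf) r = r := by
  induction r using Finsupp.induction_linear with
  | zero => rw [map_zero]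
  | add f f' hf hf' => rw [map_add, hf, hf']
  | single u a => simp [graftMap_single, graftAll_leaf, graftSign]

theorem graftMap_mem_piece {n w : ℕ} {d : ℤ} {r : Free K ar} (hr : r ∈ piece K ar deg n d w)
    (c : ℕ → PTree G ar) : graftMap deg c r ∈ piece K ar deg (pos c n)
      (d + ∑ i ∈ Finset.range n, (c i).total deg) (w + ∑ i ∈ Finset.range n, (c i).weight) := by
  refine piece_induction ?_ (fun f f' hf hf' => ?_) (fun u a h1 h2 h3 => ?_) r hr
  · rw [map_zero]; exact Submodule.zero_mem _
  · rw [map_add]; exact Submodule.add_mem _ hf hf'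
  · subst h1 h2 h3
    rw [graftMap_single, ← leaves_graftAll, ← total_graftAll, ← weight_graftAll]
    exact single_mem_piece _ _

theorem leaves_nd_update (g : G) (c : ℕ → PTree G ar) {j : ℕ} (hj : j < ar g) (t : PTree G ar) :
    (nd g (Function.update c j t)).leaves
      = t.leaves + ∑ k ∈ (Finset.range (ar g)).erase j, (c k).leaves := by
  rw [leaves_nd, pos, ← Finset.add_sum_erase _ _ (Finset.mem_range.2 hj), Function.update_self]
  congr 1
  exact Finset.sum_congr rfl fun k hk => by rw [Function.update_of_ne (Finset.mem_erase.1 hk).1]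

theorem childMap_mem_piece {n w : ℕ} {d : ℤ} {x : Free K ar} (hx : x ∈ piece K ar deg n d w)
    (g : G) (c : ℕ → PTree G ar) {j : ℕ} (hj : j < ar g) :
    childMap g c j x ∈ piece K ar deg (n + ∑ k ∈ (Finset.range (ar g)).erase j, (c k).leaves)
      (deg g + (d + ∑ k ∈ (Finset.range (ar g)).erase j, (c k).total deg))
      (1 + (w + ∑ k ∈ (Finset.range (ar g)).erase j, (c k).weight)) := by
  refine piece_induction ?_ (fun f f' hf hf' => ?_) (fun u a h1 h2 h3 => ?_) x hx
  · rw [map_zero]; exact Submodule.zero_mem _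
  · rw [map_add]; exact Submodule.add_mem _ hf hf'
  · subst h1 h2 h3
    rw [childMap_single, ← leaves_nd_update g c hj, ← total_nd_update deg g c hj]
    have := total_nd_update (fun _ => 1) g c hj u
    change (nd g (Function.update c j u)).weight = 1 + (u.weight + _) at this
    refine (congrArg (fun w => _ ∈ piece K ar deg _ _ w) this).mp ?_
    exact single_mem_piece _ _

theorem comp_childMap_self {n w : ℕ} {d : ℤ} {x : Free K ar} (hx : x ∈ piece K ar deg n d w)
    (g : G) (c : ℕ → PTree G ar) {j q : ℕ} (hj : j < ar g) (hq : q < n) (t : PTree G ar) :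
    comp deg (pos c j + q) (childMap g c j x) (Finsupp.single t 1)
      = ksign K ((∑ l ∈ Finset.Ico (j + 1) (ar g), (c l).total deg) * t.total deg)
        • childMap g c j (comp deg q x (Finsupp.single t 1)) := by
  refine piece_induction ?_ (fun f f' hf hf' => ?_) (fun u a h1 _ _ => ?_) x hx
  · simp
  · rw [map_add, map_add, map_add, LinearMap.add_apply, LinearMap.add_apply, map_add, hf, hf',
      smul_add]
  · subst h1
    have hp : pos c j = pos (Function.update c j u) j :=
      pos_congr fun i hi => (Function.update_of_ne hi.ne _ _).symm
    have hq' : q < (Function.update c j u j).leaves := by rwa [Function.update_self]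
    rw [childMap_single, hp, comp_single_of_lt _ (by
      rw [leaves_nd]
      exact pos_add_lt _ hj hq'), graft_nd _ _ hj hq', degAfter_nd _ _ _ hj hq',
      Function.update_self, Function.update_idem, comp_single_of_lt _ hq, childMap_single,
      Finsupp.smul_single, smul_eq_mul, add_mul, ksign_add]
    have : ∀ l ∈ Finset.Ico (j + 1) (ar g), (Function.update c j u l).total deg
        = (c l).total deg := fun l hl => by
      rw [Function.update_of_ne]
      have := Finset.mem_Ico.1 hl
      omega
    rw [Finset.sum_congr rfl this]
    congr 1
    ring

/-- The tree `c j` does not occur in the result. Requiring it to have the arity and degree of the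
terms of `x` lets positions and signs be computed from the sequence `c` itself. -/
theorem comp_childMap_ne {n w : ℕ} {d : ℤ} {x : Free K ar} (hx : x ∈ piece K ar deg n d w)
    (g : G) (c : ℕ → PTree G ar) {j k q : ℕ} (hk : k < ar g) (hkj : k ≠ j)
    (hq : q < (c k).leaves) (hcl : (c j).leaves = n) (hcd : (c j).total deg = d) (t : PTree G ar) :
    comp deg (pos c k + q) (childMap g c j x) (Finsupp.single t 1)
      = ksign K ((degAfter deg (c k) q + ∑ l ∈ Finset.Ico (k + 1) (ar g), (c l).total deg)
          * t.total deg) • childMap g (Function.update c k (graft (c k) q t)) j x := by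
  refine piece_induction ?_ (fun f f' hf hf' => ?_) (fun u a h1 h2 _ => ?_) x hx
  · simp
  · rw [map_add, map_add, map_add, LinearMap.add_apply, hf, hf', smul_add]
  · have hp : pos c k = pos (Function.update c j u) k := by
      refine pos_congr_leaves fun i _ => ?_
      by_cases hij : i = j
      · rw [hij, Function.update_self, hcl, h1]
      · rw [Function.update_of_ne hij]
    have hck : Function.update c j u k = c k := Function.update_of_ne hkj _ _
    have hq' : q < (Function.update c j u k).leaves := by rwa [hck]
    have hs : ∀ l ∈ Finset.Ico (k + 1) (ar g), (Function.update c j u l).total deg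
        = (c l).total deg := fun l _ => by
      by_cases hlj : l = j
      · rw [hlj, Function.update_self, hcd, h2]
      · rw [Function.update_of_ne hlj]
    rw [childMap_single, hp, comp_single_of_lt _ (by
      rw [leaves_nd]
      exact pos_add_lt _ hk hq'), graft_nd _ _ hk hq', degAfter_nd _ _ _ hk hq', hck,
      Finset.sum_congr rfl hs, childMap_single, Finsupp.smul_single, smul_eq_mul,
      Function.update_comm hkj]
    congr 1
    ring

theorem single_nd_comp {n w : ℕ} {d : ℤ} {x : Free K ar} (hx : x ∈ piece K ar deg n d w)
    (g : G) (c : ℕ → PTree G ar) {k q : ℕ} (hk : k < ar g) (hq : q < (c k).leaves) :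
    comp deg (pos c k + q) (Finsupp.single (nd g c) 1) x
      = ksign K ((∑ l ∈ Finset.Ico (k + 1) (ar g), (c l).total deg) * d)
        • childMap g c k (comp deg q (Finsupp.single (c k) 1) x) := by
  refine piece_induction ?_ (fun f f' hf hf' => ?_) (fun u a _ h2 _ => ?_) x hx
  · simp
  · rw [map_add, map_add, map_add, hf, hf', smul_add]
  · subst h2
    rw [comp_single_of_lt _ (by rw [leaves_nd]; exact pos_add_lt _ hk hq), graft_nd _ _ hk hq,
      degAfter_nd _ _ _ hk hq, comp_single_of_lt _ hq, childMap_single, Finsupp.smul_single,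
      smul_eq_mul, add_mul, ksign_add]
    congr 1
    ring

/-- Up to a sign, insertion is right composition with the tree whose entry `j` is left free. -/
theorem OpIdeal.childMap_mem (I : OpIdeal K ar deg) {n w : ℕ} {d : ℤ} {x : Free K ar}
    (hx : x ∈ piece K ar deg n d w) (hI : x ∈ I.carrier) (g : G) (c : ℕ → PTree G ar) {j : ℕ}
    (hj : j < ar g) : childMap g c j x ∈ I.carrier := by
  have e := single_nd_comp hx g (Function.update c j leaf) (q := 0) hj (by simp)
  rw [Function.update_self, leaf_comp, childMap_update] at e
  have h := I.comp_right (pos (Function.update c j leaf) j + 0)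
    (Finsupp.single (nd g (Function.update c j leaf)) 1) x hI
  rw [e] at h
  exact (Submodule.smul_mem_iff _ (ksign_ne_zero K _)).1 h

/-- The forest is grafted one tree at a time from left to right; each step is a left composition up
to a sign. -/
theorem OpIdeal.graftMap_mem (I : OpIdeal K ar deg) {n w : ℕ} {d : ℤ} {r : Free K ar}
    (hr : r ∈ piece K ar deg n d w) (hI : r ∈ I.carrier) (c : ℕ → PTree G ar) :
    graftMap deg c r ∈ I.carrier := by
  have key : ∀ a ≤ n, graftMap deg (upTo c a) r ∈ I.carrier := by
    intro a
    induction a with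
    | zero =>
      intro _
      rwa [upTo_zero, graftMap_leaf]
    | succ a ih =>
      intro ha
      have hl : upTo c a a = leaf := by simp [upTo]
      have e := comp_graftMap hr (upTo c a) (j := a) (q := 0) (by omega) (by rw [hl]; simp) (c a)
      have hu : Function.update (upTo c a) a (graft (upTo c a a) 0 (c a)) = upTo c (a + 1) := by
        funext i
        rw [hl]
        simp only [Function.update_apply, upTo, graft]
        split_ifs <;> first | rfl | omega | (subst_vars; rfl)
      have h := I.comp_left (pos (upTo c a) a + 0) _ (Finsupp.single (c a) 1) (ih (by omega))
      rw [e, hu] at h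
      exact (Submodule.smul_mem_iff _ (ksign_ne_zero K _)).1 h
  have h := key n le_rfl
  rwa [graftMap_congr hr (c' := c) fun i hi => by simp [upTo, hi]] at h

end treeMaps

/-! ### An explicit spanning set of the ideal generated by quadratic relations. -/

section treeIdeal

variable {K : Type v} [Field K] {G : Type u} {ar : G → ℕ} {deg : G → ℤ}

/-- The relations obtained from an element of `S` by grafting trees on its entries, and grafting the
result on an entry of a tree. -/
inductive IsTreeRel (deg : G → ℤ) (S : Set (Free K ar)) : Free K ar → Prop
  | root (r : Free K ar) (hr : r ∈ S) (c : ℕ → PTree G ar) : IsTreeRel deg S (graftMap deg c r)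
  | child (g : G) (c : ℕ → PTree G ar) (j : ℕ) (hj : j < ar g) (x : Free K ar)
      (hx : IsTreeRel deg S x) : IsTreeRel deg S (childMap g c j x)

variable {S : Set (Free K ar)}

theorem IsTreeRel.mem_piece (hS : ∀ r ∈ S, ∃ (n : ℕ) (d : ℤ), r ∈ piece K ar deg n d 2)
    {x : Free K ar} (hx : IsTreeRel deg S x) : ∃ n d w, 2 ≤ w ∧ x ∈ piece K ar deg n d w := by
  induction hx with
  | root r hr c =>
    obtain ⟨n, d, h⟩ := hS r hr
    exact ⟨_, _, _, Nat.le_add_right _ _, graftMap_mem_piece h c⟩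
  | child g c j hj x hx ih =>
    obtain ⟨n, d, w, hw, h⟩ := ih
    exact ⟨_, _, _, by omega, childMap_mem_piece h g c hj⟩

theorem childMap_mem_span (g : G) (c : ℕ → PTree G ar) {j : ℕ} (hj : j < ar g) {x : Free K ar}
    (hx : x ∈ Submodule.span K {x | IsTreeRel deg S x}) :
    childMap g c j x ∈ Submodule.span K {x | IsTreeRel deg S x} := by
  have h := Submodule.mem_map_of_mem (f := childMap g c j) hx
  rw [Submodule.map_span] at h
  refine Submodule.span_mono ?_ h
  rintro _ ⟨y, hy, rfl⟩
  exact IsTreeRel.child g c j hj y hy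

/-- Grafting on a composite relation either enlarges the forest over the relation, or enlarges a
subtree beside it, or recurses towards it. -/
theorem IsTreeRel.comp_single_mem (hS : ∀ r ∈ S, ∃ (n : ℕ) (d : ℤ), r ∈ piece K ar deg n d 2)
    {x : Free K ar} (hx : IsTreeRel deg S x) (t : PTree G ar) : ∀ i,
    comp deg i x (Finsupp.single t 1) ∈ Submodule.span K {x | IsTreeRel deg S x} := by
  induction hx with
  | root r hr c =>
    intro i
    obtain ⟨n, d, h⟩ := hS r hr
    by_cases hi : i < pos c n
    · obtain ⟨j, hj, q, hq, rfl⟩ := pos_exists c hi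
      rw [comp_graftMap h c hj hq]
      exact Submodule.smul_mem _ _ (Submodule.subset_span (IsTreeRel.root r hr _))
    · rw [comp_eq_zero_of_le (graftMap_mem_piece h c) _ (not_lt.1 hi)]
      exact Submodule.zero_mem _
  | child g c j hj x hx ih =>
    intro i
    obtain ⟨n, d, w, -, h⟩ := hx.mem_piece hS
    rcases x.support.eq_empty_or_nonempty with h0 | ⟨T, hT⟩
    · rw [Finsupp.support_eq_empty.1 h0, map_zero, map_zero]
      exact Submodule.zero_mem _
    · obtain ⟨h1, h2, -⟩ := h hT
      -- The entry `j` of `c` is irrelevant for the map, so a term `T` of `x` is placed there to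
      -- make the positions of the other entries correct.
      rw [← childMap_update g c j T]
      set c' := Function.update c j T with hc'
      have hcj : c' j = T := Function.update_self _ _ _
      by_cases hi : i < pos c' (ar g)
      · obtain ⟨k, hk, q, hq, rfl⟩ := pos_exists c' hi
        by_cases hkj : k = j
        · subst hkj
          rw [hcj, h1] at hq
          rw [comp_childMap_self h g c' hk hq]
          exact Submodule.smul_mem _ _ (childMap_mem_span g c' hk (ih q))
        · rw [comp_childMap_ne h g c' hk hkj hq (hcj ▸ h1) (hcj ▸ h2)]
          exact Submodule.smul_mem _ _ (Submodule.subset_span (IsTreeRel.child g _ j hj x hx))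
      · rw [comp_eq_zero_of_le (childMap_mem_piece h g c' hj)]
        · exact Submodule.zero_mem _
        · have e := leaves_nd_update g c' hj T
          rw [← h1, ← e, leaves_nd, hc', Function.update_idem, ← hc']
          exact not_lt.1 hi

theorem single_comp_mem {n w : ℕ} {d : ℤ} {x : Free K ar} (hp : x ∈ piece K ar deg n d w)
    (hx : x ∈ Submodule.span K {x | IsTreeRel deg S x}) (t : PTree G ar) : ∀ i,
    comp deg i (Finsupp.single t 1) x ∈ Submodule.span K {x | IsTreeRel deg S x} := by
  induction t using nd_induction with
  | hl =>
    rintro (_ | i)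
    · rwa [leaf_comp]
    · rw [comp_eq_zero_of_le (single_mem_piece leaf 1) _ (by simp)]
      exact Submodule.zero_mem _
  | hn g c ih =>
    intro i
    by_cases hi : i < pos c (ar g)
    · obtain ⟨k, hk, q, hq, rfl⟩ := pos_exists c hi
      rw [single_nd_comp hp g c hk hq]
      exact Submodule.smul_mem _ _ (childMap_mem_span g c hk (ih k hk q))
    · rw [comp_eq_zero_of_le (single_mem_piece (nd g c) 1) _ (by rw [leaves_nd]; omega)]
      exact Submodule.zero_mem _

/-- The ideal spanned by the relations obtained from a set of homogeneous elements of weight two. -/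
noncomputable def treeIdeal (S : Set (Free K ar))
    (hS : ∀ r ∈ S, ∃ (n : ℕ) (d : ℤ), r ∈ piece K ar deg n d 2) : OpIdeal K ar deg where
  carrier := Submodule.span K {x | IsTreeRel deg S x}
  comp_left i f g hf := by
    induction g using Finsupp.induction_linear with
    | zero => rw [map_zero]; exact Submodule.zero_mem _
    | add g g' hg hg' => rw [map_add]; exact Submodule.add_mem _ hg hg'
    | single t b =>
      rw [← mul_one b, ← smul_eq_mul, ← Finsupp.smul_single, map_smul]
      refine Submodule.smul_mem _ _ ?_
      have h := Submodule.mem_map_of_mem (f := (comp deg i).flip (Finsupp.single t 1)) hf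
      rw [Submodule.map_span] at h
      refine Submodule.span_le.2 ?_ h
      rintro _ ⟨x, hx, rfl⟩
      exact IsTreeRel.comp_single_mem hS hx t i
  comp_right i f g hg := by
    induction f using Finsupp.induction_linear with
    | zero => rw [map_zero]; exact Submodule.zero_mem _
    | add f f' hf hf' => rw [map_add]; exact Submodule.add_mem _ hf hf'
    | single t b =>
      rw [← mul_one b, ← smul_eq_mul, ← Finsupp.smul_single, map_smul]
      refine Submodule.smul_mem _ _ ?_
      have h := Submodule.mem_map_of_mem (f := comp deg i (Finsupp.single t 1)) hg
      rw [Submodule.map_span] at h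
      refine Submodule.span_le.2 ?_ h
      rintro _ ⟨x, hx, rfl⟩
      obtain ⟨n, d, w, -, hp⟩ := IsTreeRel.mem_piece hS hx
      exact single_comp_mem hp (Submodule.subset_span hx) t i
  homogeneous n d w f hf := by
    induction hf using Submodule.span_induction with
    | zero => rw [Finsupp.filter_zero]; exact Submodule.zero_mem _
    | add x y _ _ hx hy => rw [Finsupp.filter_add]; exact Submodule.add_mem _ hx hy
    | smul a x _ hx => rw [Finsupp.filter_smul]; exact Submodule.smul_mem _ _ hx
    | mem x hx =>
      obtain ⟨n', d', w', -, hp⟩ := IsTreeRel.mem_piece hS hx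
      by_cases he : n' = n ∧ d' = d ∧ w' = w
      · obtain ⟨rfl, rfl, rfl⟩ := he
        have e : x.filter (fun t => t.leaves = n' ∧ t.total deg = d' ∧ t.weight = w') = x :=
          (Finsupp.filter_eq_self_iff _ _).2 fun t ht => hp (Finsupp.mem_support_iff.2 ht)
        rw [e]
        exact Submodule.subset_span hx
      · rw [(Finsupp.filter_eq_zero_iff _ _).2]
        · exact Submodule.zero_mem _
        · rintro t ⟨h1, h2, h3⟩
          by_contra ht
          obtain ⟨h1', h2', h3'⟩ := hp (Finsupp.mem_support_iff.2 ht)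
          exact he ⟨h1'.symm.trans h1, h2'.symm.trans h2, h3'.symm.trans h3⟩

/-- The span of the composite relations is itself an ideal. Consequently a linear map kills the
generated ideal as soon as it kills each composite relation. -/
theorem gen_le_treeIdeal (hS : ∀ r ∈ S, ∃ (n : ℕ) (d : ℤ), r ∈ piece K ar deg n d 2)
    {R : Set (Free K ar)} (hR : R ⊆ Submodule.span K S) :
    (OpIdeal.gen deg R).carrier ≤ Submodule.span K {x | IsTreeRel deg S x} := by
  refine sInf_le ⟨hR.trans ?_, treeIdeal S hS, rfl⟩
  refine Submodule.span_mono fun r hr => ?_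
  rw [← graftMap_leaf (deg := deg) r]
  exact IsTreeRel.root r hr _

theorem subset_gen (R : Set (Free K ar)) : R ⊆ (OpIdeal.gen deg R).carrier := by
  intro r hr
  refine (Submodule.mem_sInf).2 ?_
  rintro _ ⟨h, -⟩
  exact h hr

end treeIdeal


open PTree

/-! ### Monomials of weight one and two. -/

section twoVertex

variable {G : Type u} {ar : G → ℕ}

theorem weight_leaf : (leaf : PTree G ar).weight = 0 := rfl

theorem eq_corolla_of_weight {t : PTree G ar} (h : t.weight = 1) : ∃ g, t = corolla g := by
  rcases leaf_or_nd t with rfl | ⟨g, c, rfl⟩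
  · rw [weight_leaf] at h
    omega
  · refine ⟨g, nd_congr (c' := fun _ => leaf) g fun j hj => ?_⟩
    rw [weight_nd] at h
    by_contra hne
    have := Finset.single_le_sum (f := fun j => (c j).weight) (fun _ _ => Nat.zero_le _)
      (Finset.mem_range.2 hj)
    have := weight_pos_of_ne_leaf hne
    omega

theorem weight_corolla (g : G) : (corolla g : PTree G ar).weight = 1 := by
  change (nd g fun _ => leaf).weight = 1
  rw [weight_nd]
  simp [weight_leaf]

theorem twoVertex_eq_nd (g : G) {j : ℕ} (hj : j < ar g) (h : G) :
    twoVertex g ⟨j, hj⟩ h = nd g (Function.update (fun _ => (leaf : PTree G ar)) j (corolla h)) := by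
  rw [twoVertex, nd]
  congr 1
  funext k
  simp only [Function.update_apply, Fin.ext_iff]

theorem twoVertex_eq_graft (g : G) {j : ℕ} (hj : j < ar g) (h : G) :
    twoVertex g ⟨j, hj⟩ h = graft (corolla g : PTree G ar) j (corolla h) := by
  rw [graft_eq_graftAll _ _ (by rwa [leaves_corolla]), graftAll_corolla, twoVertex_eq_nd]

theorem weight_twoVertex (g : G) {j : ℕ} (hj : j < ar g) (h : G) :
    (twoVertex g ⟨j, hj⟩ h : PTree G ar).weight = 2 := by
  rw [twoVertex_eq_graft, weight_graft _ _ (by rwa [leaves_corolla]), weight_corolla,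
    weight_corolla]

theorem eq_twoVertex_of_weight {t : PTree G ar} (h : t.weight = 2) :
    ∃ (g : G) (j : ℕ) (hj : j < ar g) (f : G), t = twoVertex g ⟨j, hj⟩ f := by
  rcases leaf_or_nd t with rfl | ⟨g, c, rfl⟩
  · rw [weight_leaf] at h
    omega
  · rw [weight_nd] at h
    obtain ⟨j, hj, hne⟩ : ∃ j < ar g, c j ≠ leaf := by
      by_contra! hall
      rw [Finset.sum_eq_zero fun j hj => by
        rw [hall j (Finset.mem_range.1 hj), weight_leaf]] at h
      omega
    rw [← Finset.add_sum_erase _ _ (Finset.mem_range.2 hj)] at h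
    have hw := weight_pos_of_ne_leaf hne
    obtain ⟨f, hf⟩ := eq_corolla_of_weight (t := c j) (by omega)
    refine ⟨g, j, hj, f, ?_⟩
    rw [twoVertex_eq_nd]
    refine nd_congr g fun k hk => ?_
    by_cases hkj : k = j
    · rw [hkj, Function.update_self, hf]
    · rw [Function.update_of_ne hkj]
      by_contra hk'
      have := weight_pos_of_ne_leaf hk'
      have := Finset.single_le_sum (f := fun j => (c j).weight) (fun _ _ => Nat.zero_le _)
        (Finset.mem_erase.2 ⟨hkj, Finset.mem_range.2 hk⟩)
      omega

theorem not_edgeSub_corolla (g : G) (q : PTree G ar) : ¬EdgeSub (corolla g) q := by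
  change ¬EdgeSub (nd g fun _ => leaf) q
  rw [edgeSub_nd]
  rintro (⟨j, hj, h, c', hc, -⟩ | ⟨j, hj, hq⟩)
  · exact nd_ne_leaf _ _ hc.symm
  · exact not_edgeSub_leaf _ hq

theorem edgeSub_twoVertex (g : G) {j : ℕ} (hj : j < ar g) (h : G) (q : PTree G ar) :
    EdgeSub (twoVertex g ⟨j, hj⟩ h) q ↔ q = twoVertex g ⟨j, hj⟩ h := by
  rw [twoVertex_eq_nd, edgeSub_nd, ← twoVertex_eq_nd g hj h]
  constructor
  · rintro (⟨k, hk, f, c', hc, rfl⟩ | ⟨k, hk, hq⟩)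
    · by_cases hkj : k = j
      · subst hkj
        rw [Function.update_self] at hc
        obtain ⟨rfl, -⟩ := nd_inj (show nd h (fun _ => leaf) = nd f c' from hc)
        rfl
      · rw [Function.update_of_ne hkj] at hc
        exact absurd hc.symm (nd_ne_leaf _ _)
    · by_cases hkj : k = j
      · subst hkj
        rw [Function.update_self] at hq
        exact absurd hq (not_edgeSub_corolla _ _)
      · rw [Function.update_of_ne hkj] at hq
        exact absurd hq (not_edgeSub_leaf _)
  · rintro rfl
    exact Or.inl ⟨j, hj, h, fun _ => leaf, Function.update_self _ _ _, rfl⟩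

theorem EdgeSub.exists_eq {t q : PTree G ar} (h : EdgeSub t q) :
    ∃ (g : G) (j : ℕ) (hj : j < ar g) (f : G), q = twoVertex g ⟨j, hj⟩ f := by
  induction h with
  | root g c j f c' hc => exact ⟨g, j, j.2, f, rfl⟩
  | child g c j q hq ih => exact ih

theorem total_dualDeg (deg : G → ℤ) (t : PTree G ar) :
    t.total (dualDeg deg) = -t.total deg - t.weight := by
  induction t using nd_induction with
  | hl => simp [weight_leaf]
  | hn g c ih =>
    rw [total_nd, total_nd, weight_nd,
      Finset.sum_congr rfl fun j hj => ih j (Finset.mem_range.1 hj), Finset.sum_sub_distrib,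
      Finset.sum_neg_distrib, dualDeg]
    push_cast
    ring

end twoVertex

/-! ### Reduction of monomials modulo an ideal by leading terms. -/

section reduction

variable {K : Type v} [Field K] {G : Type u} {ar : G → ℕ} {deg : G → ℤ}
  {le : PTree G ar → PTree G ar → Prop} {B : Set (PTree G ar)}

theorem IsMonomialOrder.flip (h : IsMonomialOrder le) : IsMonomialOrder fun s t => le t s where
  refl := h.refl
  trans s t u h1 h2 := h.trans u t s h2 h1
  antisymm s t h1 h2 := h.antisymm s t h2 h1
  graft s s' t t' hs ht h1 h2 i hi := h.graft s' s t' t hs.symm ht.symm h1 h2 i (hs ▸ hi)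

theorem graftMap_apply (har : ∀ g, 0 < ar g) {n w : ℕ} {d : ℤ} {r : Free K ar}
    (hr : r ∈ piece K ar deg n d w) (c : ℕ → PTree G ar) {u : PTree G ar} (hu : u.leaves = n) :
    graftMap deg c r (graftAll u c) = r u * ksign K (graftSign deg c u) := by
  classical
  refine piece_induction ?_ (fun f f' hf hf' => ?_) (fun s a h1 _ _ => ?_) r hr
  · simp
  · rw [map_add, Finsupp.add_apply, hf, hf', Finsupp.add_apply, add_mul]
  · rw [graftMap_single]
    by_cases hs : s = u
    · subst hs
      rw [Finsupp.single_eq_same, Finsupp.single_eq_same]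
    · rw [Finsupp.single_eq_of_ne, Finsupp.single_eq_of_ne (Ne.symm hs), zero_mul]
      exact fun e => hs (graftAll_injective _ _ c (fun i => leaves_pos har _) (h1.trans hu.symm)
        e.symm)

theorem graftMap_mem_supported (r : Free K ar) (c : ℕ → PTree G ar) :
    graftMap deg c r ∈ Finsupp.supported K K ((fun u => graftAll u c) '' r.support) := by
  rw [graftMap, Finsupp.linearCombination_apply, Finsupp.sum]
  exact Submodule.sum_mem _ fun u hu => Submodule.smul_mem _ _
    (Finsupp.single_mem_supported K _ ⟨u, hu, rfl⟩)

theorem nd_update_injective (g : G) (c : ℕ → PTree G ar) {j : ℕ} (hj : j < ar g) :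
    Function.Injective fun T => nd g (Function.update c j T) := by
  intro T T' h
  have := (nd_inj h).2 j hj
  rwa [Function.update_self, Function.update_self] at this

theorem childMap_apply (g : G) (c : ℕ → PTree G ar) {j : ℕ} (hj : j < ar g) (x : Free K ar)
    (T : PTree G ar) : childMap g c j x (nd g (Function.update c j T)) = x T :=
  Finsupp.mapDomain_apply (nd_update_injective g c hj) x T

theorem exists_of_childMap_ne_zero (g : G) (c : ℕ → PTree G ar) (j : ℕ) {x : Free K ar}
    {v : PTree G ar} (h : childMap g c j x v ≠ 0) :
    ∃ T, x T ≠ 0 ∧ v = nd g (Function.update c j T) := by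
  classical
  obtain ⟨T, hT, rfl⟩ := Finset.mem_image.1 (Finsupp.mapDomain_support
    (Finsupp.mem_support_iff.2 h))
  exact ⟨T, Finsupp.mem_support_iff.1 hT, rfl⟩

/-- `t` is congruent modulo `J` to a combination of smaller monomials. -/
def Reducible (le : PTree G ar → PTree G ar → Prop) (J : OpIdeal K ar deg) (t : PTree G ar) :
    Prop :=
  ∃ ρ ∈ J.carrier, ρ ∈ piece K ar deg t.leaves (t.total deg) t.weight ∧ ρ t = 1 ∧
    ∀ u, ρ u ≠ 0 → le u t

/-- Grafting a fixed forest is injective and monotone on trees of a given arity, so it carries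
leading terms to leading terms. The sign factor restores the leading coefficient one. -/
theorem Reducible.graftAll (har : ∀ g, 0 < ar g) (h : IsMonomialOrder le) {J : OpIdeal K ar deg}
    {q : PTree G ar} (hq : Reducible le J q) (c : ℕ → PTree G ar) :
    Reducible le J (graftAll q c) := by
  obtain ⟨ρ, h1, h2, h3, h4⟩ := hq
  refine ⟨ksign K (graftSign deg c q) • graftMap deg c ρ,
    Submodule.smul_mem _ _ (J.graftMap_mem h2 h1 c), Submodule.smul_mem _ _ ?_, ?_, ?_⟩
  · rw [leaves_graftAll, total_graftAll, weight_graftAll]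
    exact graftMap_mem_piece h2 c
  · rw [Finsupp.smul_apply, graftMap_apply har h2 c rfl, h3, one_mul, smul_eq_mul,
      ksign_mul_self]
  · intro v hv
    rw [Finsupp.smul_apply] at hv
    obtain ⟨u, hu, rfl⟩ := graftMap_mem_supported ρ c
      (Finsupp.mem_support_iff.2 (right_ne_zero_of_smul hv))
    exact h.graftAll (h4 u (Finsupp.mem_support_iff.1 hu)) (h2 hu).1 (fun i _ => h.refl _)
      fun i _ => rfl

theorem Reducible.nd (h : IsMonomialOrder le) {J : OpIdeal K ar deg} (g : G)
    (c : ℕ → PTree G ar) {j : ℕ} (hj : j < ar g) (hq : Reducible le J (c j)) :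
    Reducible le J (nd g c) := by
  obtain ⟨ρ, h1, h2, h3, h4⟩ := hq
  refine ⟨childMap g c j ρ, J.childMap_mem h2 h1 g c hj, ?_, ?_, ?_⟩
  · have e := childMap_mem_piece h2 g c hj
    have e1 := total_nd_update (fun _ => 1) g c hj (c j)
    change (PTree.nd g (Function.update c j (c j))).weight = 1 + ((c j).weight + _) at e1
    rw [← leaves_nd_update g c hj, ← total_nd_update deg g c hj] at e
    rw [Function.update_eq_self] at e e1
    rw [e1]
    exact e
  · have := childMap_apply g c hj ρ (c j)
    rwa [Function.update_eq_self, h3] at this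
  · intro v hv
    obtain ⟨T, hT, rfl⟩ := exists_of_childMap_ne_zero g c j hv
    refine h.nd g (fun i hi => ?_) fun i hi => ?_
    · by_cases hij : i = j
      · rw [hij, Function.update_self]
        exact h4 T hT
      · rw [Function.update_of_ne hij]
        exact h.refl _
    · by_cases hij : i = j
      · rw [hij, Function.update_self]
        exact (h2 (Finsupp.mem_support_iff.2 hT)).1
      · rw [Function.update_of_ne hij]

/-- A tree is recovered from the two ends of one root edge by grafting everything above them at
once. -/
theorem graftAll_twoVertex (g : G) (c : ℕ → PTree G ar) {j : ℕ} (hj : j < ar g) (h : G)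
    (c' : ℕ → PTree G ar) (hc : c j = nd h c') :
    PTree.graftAll (twoVertex g ⟨j, hj⟩ h) (spliceN c j (ar h) c') = nd g c := by
  have e := graftAll_graft_splice (corolla g : PTree G ar) (corolla h)
    (by rwa [leaves_corolla] : j < (corolla g : PTree G ar).leaves) c c'
  rw [twoVertex_eq_graft]
  rw [leaves_corolla, graftAll_corolla, graftAll_corolla, ← hc, Function.update_eq_self] at e
  exact e

/-- A quadratic relation with leading term at one edge extends to the whole tree: a forest is
grafted above it, and the result is inserted into the vertices below. -/
theorem Reducible.of_edgeSub (har : ∀ g, 0 < ar g) (h : IsMonomialOrder le) {J : OpIdeal K ar deg}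
    {q : PTree G ar} (hq : Reducible le J q) (t : PTree G ar) :
    EdgeSub t q → Reducible le J t := by
  induction t using nd_induction with
  | hl => intro e; exact absurd e (not_edgeSub_leaf q)
  | hn g c ih =>
    intro e
    rcases (edgeSub_nd g c q).1 e with ⟨j, hj, f, c', hc, rfl⟩ | ⟨j, hj, e'⟩
    · rw [← graftAll_twoVertex g c hj f c' hc]
      exact hq.graftAll har h _
    · exact (ih j hj e').nd h g c hj

/-- Repeated replacement of a reducible monomial by smaller ones stops, since only finitely many
monomials of the same arity and weight lie below it. -/
theorem exists_irreducible_rep (har : ∀ g, 0 < ar g) (hfin : ∀ n, {g | ar g = n}.Finite)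
    (h : IsMonomialOrder le) (J : OpIdeal K ar deg) (C : Set (PTree G ar))
    (hC : ∀ t ∉ C, Reducible le J t) (t : PTree G ar) :
    ∃ c : Free K ar, (∀ u ∈ c.support, u ∈ C ∧ le u t) ∧ Finsupp.single t 1 - c ∈ J.carrier := by
  classical
  induction hN : aboveCard (fun s t => le t s) t using Nat.strong_induction_on generalizing t with
  | _ N ih =>
    by_cases ht : t ∈ C
    · refine ⟨Finsupp.single t 1, fun u hu => ?_, by rw [sub_self]; exact Submodule.zero_mem _⟩
      obtain rfl : u = t := by
        have := Finsupp.support_single_subset hu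
        exact Finset.mem_singleton.1 this
      exact ⟨ht, h.refl _⟩
    · obtain ⟨ρ, h1, h2, h3, h4⟩ := hC t ht
      have hch : ∀ u, ∃ c : Free K ar, u ∈ ρ.support.erase t → (∀ v ∈ c.support, v ∈ C ∧ le v t) ∧
          Finsupp.single u 1 - c ∈ J.carrier := by
        intro u
        by_cases hu : u ∈ ρ.support.erase t
        · obtain ⟨hne, hu'⟩ := Finset.mem_erase.1 hu
          obtain ⟨e1, -, e3⟩ := h2 hu'
          have hut := h4 u (Finsupp.mem_support_iff.1 hu')
          have hlt := Above.card_lt h.flip har hfin (t := t) (u := u) ⟨hut, e1.symm, e3.symm⟩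
            (Ne.symm hne)
          obtain ⟨c, hc, hc'⟩ := ih _ (hN ▸ hlt) u rfl
          exact ⟨c, fun _ => ⟨fun v hv => ⟨(hc v hv).1, h.trans _ _ _ (hc v hv).2 hut⟩, hc'⟩⟩
        · exact ⟨0, fun h => absurd h hu⟩
      choose c hc using hch
      -- Modulo the ideal, `t` is minus the combination of the other terms of `ρ`, each of which is
      -- replaced by its own representative.
      refine ⟨-∑ u ∈ ρ.support.erase t, ρ u • c u, fun v hv => ?_, ?_⟩
      · rw [Finsupp.support_neg] at hv
        obtain ⟨u, hu, hv'⟩ := Finset.mem_biUnion.1 (Finsupp.support_finsetSum hv)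
        exact (hc u hu).1 v (Finsupp.support_smul hv')
      · have e : Finsupp.single t 1 - -∑ u ∈ ρ.support.erase t, ρ u • c u
            = ρ - ∑ u ∈ ρ.support.erase t, ρ u • (Finsupp.single u 1 - c u) := by
          have e1 : ρ = Finsupp.single t 1 + ∑ u ∈ ρ.support.erase t, ρ u • Finsupp.single u 1 := by
            conv_lhs => rw [← Finsupp.sum_single ρ, Finsupp.sum,
              ← Finset.add_sum_erase _ _ (Finsupp.mem_support_iff.2 (by rw [h3]; exact one_ne_zero)),
              h3]
            simp only [Finsupp.smul_single, smul_eq_mul, mul_one]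
          simp only [smul_sub, Finset.sum_sub_distrib]
          have e2 : ∀ s A C r : Free K ar, r = s + A → s - -C = r - (A - C) := by
            rintro s A C _ rfl
            abel
          exact e2 _ _ _ _ e1
        rw [e]
        exact Submodule.sub_mem _ h1 (Submodule.sum_mem _ fun u hu =>
          Submodule.smul_mem _ _ (hc u hu).2)

end reduction

/-! ### Coordinate functionals as dual relations. -/

section dualElement

variable {K : Type v} [Field K] {G : Type u} {ar : G → ℕ} {deg : G → ℤ} {I : OpIdeal K ar deg}
  {le : PTree G ar → PTree G ar → Prop} {B : Set (PTree G ar)}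

/-- The quadratic element with the coordinates at `b` of all monomials as coefficients, up to
sign. -/
noncomputable def IsPBWBasis.dualElt (h : IsPBWBasis I le B) (har : ∀ g, 0 < ar g)
    (hfin : ∀ n, {g | ar g = n}.Finite) (b : B) : Free K ar :=
  Finsupp.onFinset (finite_leaves_weight har hfin b.1.leaves b.1.weight).toFinset
    (fun t => ksign K (rootDeg deg t) * h.coord b (I.mon t)) fun t ht => by
      obtain ⟨h1, -, h3⟩ := h.of_coord_ne_zero (I.mon_mem t) (right_ne_zero_of_mul ht)
      rw [Set.Finite.mem_toFinset]
      exact ⟨h1.ge, h3.ge⟩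

theorem IsPBWBasis.dualElt_apply (h : IsPBWBasis I le B) (har : ∀ g, 0 < ar g)
    (hfin : ∀ n, {g | ar g = n}.Finite) (b : B) (t : PTree G ar) :
    h.dualElt har hfin b t = ksign K (rootDeg deg t) * h.coord b (I.mon t) := rfl

theorem IsPBWBasis.dualElt_mem_piece (h : IsPBWBasis I le B) (har : ∀ g, 0 < ar g)
    (hfin : ∀ n, {g | ar g = n}.Finite) (b : B) : h.dualElt har hfin b
      ∈ piece K ar (dualDeg deg) b.1.leaves (b.1.total (dualDeg deg)) b.1.weight := by
  intro t ht
  obtain ⟨h1, h2, h3⟩ := h.of_coord_ne_zero (I.mon_mem t)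
    (right_ne_zero_of_mul (Finsupp.mem_support_iff.1 ht))
  refine ⟨h1.symm, ?_, h3.symm⟩
  rw [total_dualDeg, total_dualDeg, h2, h3]

/-- The coordinate functional is defined on the quotient, hence kills `R`. Its coefficients were
given the suspension sign that the definition of the dual relations removes again. -/
theorem IsPBWBasis.dualElt_mem_dualRel {R : Set (Free K ar)}
    (h : IsPBWBasis (OpIdeal.gen deg R) le B) (har : ∀ g, 0 < ar g)
    (hfin : ∀ n, {g | ar g = n}.Finite) (b : B) (hb : b.1.weight = 2) :
    h.dualElt har hfin b ∈ dualRel deg R := by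
  classical
  refine ⟨fun t ht => (h.dualElt_mem_piece har hfin b ht).2.2.trans hb, fun r hr => ?_⟩
  have e : h.coord b ((OpIdeal.gen deg R).carrier.mkQ r) = 0 := by
    rw [Submodule.mkQ_apply, (Submodule.Quotient.mk_eq_zero _).2 (subset_gen R hr), map_zero]
  rw [mkQ_eq_sum, map_sum] at e
  rw [Finsupp.sum, ← e]
  have e1 : ∀ t, ksign K (rootDeg deg t) * h.dualElt har hfin b t * r t
      = h.coord b (r t • (OpIdeal.gen deg R).mon t) := by
    intro t
    rw [h.dualElt_apply, ← mul_assoc, ksign_mul_self, one_mul, map_smul, smul_eq_mul, mul_comm]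
  rw [Finset.sum_congr rfl fun t _ => e1 t]
  trans ∑ t ∈ (h.dualElt har hfin b).support ∪ r.support,
    h.coord b (r t • (OpIdeal.gen deg R).mon t)
  · refine Finset.sum_subset Finset.subset_union_left fun t _ ht => ?_
    rw [← e1, Finsupp.notMem_support_iff.1 ht, mul_zero, zero_mul]
  · refine (Finset.sum_subset Finset.subset_union_right fun t _ ht => ?_).symm
    rw [Finsupp.notMem_support_iff.1 ht, zero_smul, map_zero]

/-- The only monomial in `B` with a nonzero coordinate at `q` is `q` itself. Any other quadratic
monomial with such a coordinate is rewritten by condition 1 into larger ones, among them `q`. So `q`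
is the largest term of its dual relation. -/
theorem IsPBWBasis.reducible {R : Set (Free K ar)}
    (h : IsPBWBasis (OpIdeal.gen deg R) le B) (har : ∀ g, 0 < ar g)
    (hfin : ∀ n, {g | ar g = n}.Finite) {q : PTree G ar} (hq : q ∈ B) (hw : q.weight = 2) :
    Reducible le (OpIdeal.gen (dualDeg deg) (dualRel deg R)) q := by
  classical
  set b : B := ⟨q, hq⟩ with hb
  refine ⟨ksign K (rootDeg deg q) • h.dualElt har hfin b, Submodule.smul_mem _ _
    (subset_gen _ (h.dualElt_mem_dualRel har hfin b hw)),
    Submodule.smul_mem _ _ (h.dualElt_mem_piece har hfin b), ?_, ?_⟩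
  · rw [Finsupp.smul_apply, h.dualElt_apply, h.coord_mon b hq, if_pos rfl, smul_eq_mul, mul_one,
      ksign_mul_self]
  · intro u hu
    rw [Finsupp.smul_apply] at hu
    replace hu := right_ne_zero_of_smul hu
    have hu' : h.coord b ((OpIdeal.gen deg R).mon u) ≠ 0 := right_ne_zero_of_mul hu
    by_cases huq : u = q
    · rw [huq]
      exact h.order.refl _
    have huB : u ∉ B := by
      intro huB
      rw [h.coord_mon b huB, if_neg huq] at hu'
      exact hu' rfl
    have hw2 := (h.of_coord_ne_zero ((OpIdeal.gen deg R).mon_mem u) hu').2.2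
    -- Having weight two, `u` is a composite of two generators, which are in `B`; therefore
    -- condition 1 applies to it.
    obtain ⟨g, j, hj, f, rfl⟩ := eq_twoVertex_of_weight (hw2.symm.trans hw)
    rw [twoVertex_eq_graft] at huB hu' ⊢
    obtain ⟨c, e, hc⟩ := h.exists_rewrite (h.corolla_mem g) (h.corolla_mem f)
      (by rwa [leaves_corolla]) huB
    rw [e, h.coord_mkQ b fun t ht => (hc t ht).1] at hu'
    exact (hc q (Finsupp.mem_support_iff.2 hu')).2.2.2.2.1

theorem IsPBWBasis.exists_complementary_rep {R : Set (Free K ar)}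
    (h : IsPBWBasis (OpIdeal.gen deg R) le B) (har : ∀ g, 0 < ar g)
    (hfin : ∀ n, {g | ar g = n}.Finite) (t : PTree G ar) :
    ∃ c : Free K ar, (∀ u ∈ c.support, u ∈ complementaryBasis B ∧ le u t) ∧
      Finsupp.single t 1 - c ∈ (OpIdeal.gen (dualDeg deg) (dualRel deg R)).carrier := by
  refine exists_irreducible_rep har hfin h.order _ _ (fun s hs => ?_) t
  simp only [complementaryBasis, Set.mem_ofPred, not_forall, not_not] at hs
  obtain ⟨q, hq, hqB⟩ := hs
  obtain ⟨g, j, hj, f, rfl⟩ := EdgeSub.exists_eq hq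
  exact (h.reducible har hfin hqB (weight_twoVertex g hj f)).of_edgeSub har h.order s hq

end dualElement


open PTree

/-! ### Elements of the Koszul construction with prescribed lowest term. -/

section leading

variable {K : Type v} [Field K] {G : Type u} {ar : G → ℕ} {deg : G → ℤ} {I : OpIdeal K ar deg}
  {le : PTree G ar → PTree G ar → Prop} {B : Set (PTree G ar)}

theorem toBarTree_nd (g : G) (c : ℕ → PTree G ar) :
    toBarTree I (nd g c) = nd (genOp I g) (fun j => toBarTree I (c j)) := rfl

theorem genOp_eq_monOp {g : G} {t : PTree G ar} (ht : 0 < t.weight) (e : t = corolla g) :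
    genOp I g = monOp I t ht := by
  subst e
  refine Op.ext' (leaves_corolla g).symm ?_ (weight_corolla g).symm rfl
  change deg g = (nd g fun _ => leaf).total deg
  rw [total_nd]
  simp

/-- On the diagonal every label has weight exactly one, hence is a generator, and the tree of labels
is the composite monomial itself. -/
theorem toBarTree_flat (m : Model B) : wt m = m.weight → toBarTree I (flat m) = toBar I m := by
  induction m using nd_induction with
  | hl => intro _; rfl
  | hn b m ih =>
    intro h
    rw [wt, total_nd, weight_nd] at h
    have h1 : ∀ j ∈ Finset.range b.1.leaves, (m j).weight ≤ wt (m j) := fun j _ => weight_le_wt _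
    have h2 := Finset.sum_le_sum h1
    have h3 := b.2.2
    simp only [wt] at h2
    have h4 : ∀ j ∈ Finset.range b.1.leaves, (m j).weight = wt (m j) :=
      (Finset.sum_eq_sum_iff_of_le h1).1 (le_antisymm h2 (by simp only [wt]; omega))
    obtain ⟨g, hg⟩ := eq_corolla_of_weight (t := b.1) (by omega)
    rw [flat_nd_corolla b m hg, toBarTree_nd, toBar_nd, genOp_eq_monOp b.2.2 hg]
    refine nd_congr _ fun j hj => ih j hj (h4 j (Finset.mem_range.2 hj)).symm

theorem exists_flat_eq (hB : ∀ g, corolla g ∈ B) (t : PTree G ar) :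
    ∃ m : Model B, flat m = t ∧ wt m = m.weight := by
  induction t using nd_induction with
  | hl => exact ⟨leaf, rfl, rfl⟩
  | hn g c ih =>
    have hch : ∀ j, ∃ m : Model B, j < ar g → flat m = c j ∧ wt m = m.weight := by
      intro j
      by_cases hj : j < ar g
      · obtain ⟨m, hm⟩ := ih j hj
        exact ⟨m, fun _ => hm⟩
      · exact ⟨leaf, fun h => absurd h hj⟩
    choose m hm using hch
    set b : Lab B := ⟨corolla g, hB g, by rw [weight_corolla]; exact one_pos⟩ with hb
    refine ⟨nd b m, ?_, ?_⟩
    · rw [flat_nd_corolla b m rfl]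
      exact nd_congr g fun j hj => (hm j hj).1
    · have hl : b.1.leaves = ar g := leaves_corolla g
      have hw : b.1.weight = 1 := weight_corolla g
      rw [wt, total_nd, weight_nd, hw, hl]
      congr 1
      exact Finset.sum_congr rfl fun j hj => (hm j (Finset.mem_range.1 hj)).2

theorem diagIncl_single (t : PTree G ar) (a : K) :
    diagIncl I (Finsupp.single t a) = a • cl (toBarTree I t) := by
  rw [diagIncl, LinearMap.comp_apply, Finsupp.lmapDomain_apply, Finsupp.mapDomain_single, cl,
    ← map_smul, Finsupp.smul_single, smul_eq_mul, mul_one]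

/-- The Koszul construction contains an element with any given complementary monomial as its
least term. -/
theorem IsPBWBasis.exists_mem_koszulConstruction (h : IsPBWBasis I le B) (har : ∀ g, 0 < ar g)
    (hfin : ∀ n, {g | ar g = n}.Finite) {t : PTree G ar} (ht : t ∈ complementaryBasis B) :
    ∃ f ∈ koszulConstruction I, f t = 1 ∧ ∀ u ≠ t, f u ≠ 0 → Above le t u := by
  have hB' : ∀ t ∈ B, ∀ q, EdgeSub t q → q ∈ B := fun t ht => (h.mem_iff t).1 ht
  obtain ⟨x, rfl, hx⟩ := exists_flat_eq h.corolla_mem t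
  rcases leaf_or_nd x with rfl | ⟨b, m, hbm⟩
  · refine ⟨Finsupp.single leaf 1, ?_, Finsupp.single_eq_same, fun u hu hf => ?_⟩
    · rw [koszulConstruction, LinearMap.mem_ker, LinearMap.comp_apply, diagIncl_single, one_smul]
      exact barDiff_leaf
    · rw [flat_leaf] at hu
      exact absurd (Finsupp.single_eq_of_ne hu) hf
  · obtain ⟨d, hd⟩ : ∃ d, x.weight = d + 1 := by
      rw [hbm, weight_nd]
      exact ⟨_, add_comm _ _⟩
    -- The monomials strictly above the given one; this set is upward closed, so exactness holds on
    -- its subcomplex.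
    set U : Set (PTree G ar) := {u | Above le (flat x) u ∧ u ≠ flat x} with hU
    have hz : barDiff I (clM I x) ∈ Submodule.span K
        (clM I '' {m : Model B | m.weight = d ∧ wt m = x.weight ∧ flat m ∈ U}) := by
      refine Submodule.span_mono (Set.image_mono ?_) (h.barDiff_clM_mem x)
      rintro y ⟨h1, h2⟩
      have h3 : wt y = x.weight := by rw [← weight_flat, ← h1.weight, weight_flat, hx]
      refine ⟨by omega, h3, h1, fun e => ?_⟩
      -- A term of the boundary with the same composite would have no good edge and lie on the
      -- diagonal, but a contraction has removed one vertex.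
      have := wt_eq_weight_of_not_hasGood hB' y (by
        rw [e]
        rintro ⟨q, hq, hqB⟩
        exact ht q hq hqB)
      omega
    -- The boundary of `x` is a cycle just off the diagonal, hence the boundary of a chain `y` with
    -- strictly larger composites. Then `x - y` is a cycle with lowest term `x`.
    obtain ⟨y, hy, e⟩ := h.exact har hfin (by omega) U (by
      rintro s ⟨h1, h2⟩ u hu
      refine ⟨h1.trans h.order hu, ?_⟩
      rintro rfl
      exact h2 (hu.antisymm h.order h1)) _ hz (barDiff_barDiff _)
    have hy' : Submodule.span K
        (clM I '' {m : Model B | m.weight = d + 1 ∧ wt m = x.weight ∧ flat m ∈ U})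
        ≤ (Finsupp.supported K K U).map (diagIncl I) := by
      rw [Submodule.span_le]
      rintro _ ⟨m, ⟨h1, h2, h3⟩, rfl⟩
      refine ⟨Finsupp.single (flat m) 1, Finsupp.single_mem_supported K _ h3, ?_⟩
      rw [diagIncl_single, one_smul, toBarTree_flat m (by omega), clM]
    obtain ⟨f, hf, rfl⟩ := hy' hy
    have hf0 : ∀ u, f u ≠ 0 → u ∈ U := fun u hu => hf (Finsupp.mem_support_iff.2 hu)
    refine ⟨Finsupp.single (flat x) 1 - f, ?_, ?_, fun u hu hfu => ?_⟩
    · rw [koszulConstruction, LinearMap.mem_ker, LinearMap.comp_apply, map_sub, map_sub, e,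
        diagIncl_single, one_smul, toBarTree_flat x hx, clM, sub_self]
    · have : f (flat x) = 0 := by
        by_contra hne
        exact (hf0 _ hne).2 rfl
      rw [Finsupp.sub_apply, Finsupp.single_eq_same, this, sub_zero]
    · rw [Finsupp.sub_apply, Finsupp.single_eq_of_ne hu, zero_sub, neg_ne_zero] at hfu
      exact (hf0 u hfu).1

theorem pairing_apply (x f : Free K ar) : pairing K ar x f = x.sum fun t a => a * f t := by
  rw [pairing, Finsupp.linearCombination_apply, Finsupp.sum, LinearMap.sum_apply]
  rfl

theorem pairing_single (x : Free K ar) (t : PTree G ar) (a : K) :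
    pairing K ar x (Finsupp.single t a) = a * x t := by
  classical
  rw [pairing_apply, Finsupp.sum]
  simp only [Finsupp.single_apply, mul_ite, mul_zero]
  rw [Finset.sum_ite_eq]
  split_ifs with h
  · rw [mul_comm]
  · rw [Finsupp.notMem_support_iff.1 h, mul_zero]

theorem mem_ker_toKoszulDual {x : Free K ar} : x ∈ LinearMap.ker (toKoszulDual I) ↔
    ∀ f ∈ koszulConstruction I, pairing K ar x f = 0 := by
  rw [LinearMap.mem_ker, toKoszulDual]
  constructor
  · intro h f hf
    exact LinearMap.congr_fun h ⟨f, hf⟩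
  · intro h
    ext f
    exact h f.1 f.2

/-- Complementary monomials are linearly independent as functionals on the Koszul construction. -/
theorem IsPBWBasis.eq_zero_of_mem_ker (h : IsPBWBasis I le B) (har : ∀ g, 0 < ar g)
    (hfin : ∀ n, {g | ar g = n}.Finite) {c : Free K ar}
    (hc : ∀ t ∈ c.support, t ∈ complementaryBasis B)
    (hk : c ∈ LinearMap.ker (toKoszulDual I)) : c = 0 := by
  by_contra hne
  -- A term with the fewest monomials above it: no other term of `c` lies above `t`, so pairing with
  -- the element whose lowest term is `t` isolates the coefficient of `t`.
  obtain ⟨t, ht, hmin⟩ := Finset.exists_min_image c.support (aboveCard le)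
    (Finsupp.support_nonempty_iff.2 hne)
  obtain ⟨f, hf, h1, h2⟩ := h.exists_mem_koszulConstruction har hfin (hc t ht)
  have e := mem_ker_toKoszulDual.1 hk f hf
  rw [pairing_apply, Finsupp.sum, Finset.sum_eq_single t] at e
  · rw [h1, mul_one] at e
    exact Finsupp.mem_support_iff.1 ht e
  · intro u hu hut
    by_contra hne'
    have := (h2 u hut (right_ne_zero_of_mul hne')).card_lt h.order har hfin (Ne.symm hut)
    have := hmin u hu
    omega
  · intro h
    exact absurd ht h

end leading


open PTree

/-! ### Dual relations as functionals on the quotient operad. -/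

section quadraticFunctional

variable {K : Type v} [Field K] {G : Type u} {ar : G → ℕ} {deg : G → ℤ}

variable (deg) in
/-- The functional on the free operad given by an element of the free operad on the dual
generators, with the suspension signs. -/
noncomputable def signedPairing (r : Free K ar) : Free K ar →ₗ[K] K :=
  Finsupp.linearCombination K fun t => ksign K (rootDeg deg t) * r t

theorem signedPairing_single (r : Free K ar) (t : PTree G ar) (a : K) :
    signedPairing deg r (Finsupp.single t a) = a * (ksign K (rootDeg deg t) * r t) := by
  rw [signedPairing, Finsupp.linearCombination_single, smul_eq_mul]

theorem sum_eq_signedPairing (r f : Free K ar) :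
    (r.sum fun t a => ksign K (rootDeg deg t) * a * f t) = signedPairing deg r f := by
  classical
  rw [signedPairing, Finsupp.linearCombination_apply, Finsupp.sum, Finsupp.sum]
  trans ∑ t ∈ r.support ∪ f.support, ksign K (rootDeg deg t) * r t * f t
  · refine Finset.sum_subset Finset.subset_union_left fun t _ ht => ?_
    rw [Finsupp.notMem_support_iff.1 ht, mul_zero, zero_mul]
  · symm
    refine (Finset.sum_subset Finset.subset_union_right fun t _ ht => ?_).trans
      (Finset.sum_congr rfl fun t _ => by rw [smul_eq_mul, mul_comm])
    rw [Finsupp.notMem_support_iff.1 ht, zero_smul]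

theorem signedPairing_eq_zero {r f : Free K ar} (h : ∀ t ∈ f.support, r t = 0) :
    signedPairing deg r f = 0 := by
  rw [signedPairing, Finsupp.linearCombination_apply, Finsupp.sum]
  exact Finset.sum_eq_zero fun t ht => by rw [h t ht, mul_zero, smul_zero]

theorem signedPairing_congr {r r' f : Free K ar} (h : ∀ t ∈ f.support, r t = r' t) :
    signedPairing deg r f = signedPairing deg r' f := by
  rw [signedPairing, signedPairing, Finsupp.linearCombination_apply,
    Finsupp.linearCombination_apply, Finsupp.sum, Finsupp.sum]
  exact Finset.sum_congr rfl fun t ht => by rw [h t ht]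

/-- The homogeneous quadratic relations of the dual operad. -/
def homDualRel (deg : G → ℤ) (R : Set (Free K ar)) : Set (Free K ar) :=
  {f | f ∈ dualRel deg R ∧ ∃ (n : ℕ) (d : ℤ), f ∈ piece K ar (dualDeg deg) n d 2}

theorem mem_span_filter {α : Type*} (f : α →₀ K) {ι : Type*} [DecidableEq ι] (p : α → ι) :
    f ∈ Submodule.span K (Set.range fun i => f.filter fun a => p a = i) := by
  have e : f = ∑ i ∈ f.support.image p, f.filter fun a => p a = i := by
    ext a
    rw [Finsupp.finsetSum_apply]
    by_cases ha : a ∈ f.support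
    · rw [Finset.sum_eq_single (p a)]
      · rw [Finsupp.filter_apply, if_pos rfl]
      · intro i _ hi
        rw [Finsupp.filter_apply, if_neg (Ne.symm hi)]
      · intro h
        exact absurd (Finset.mem_image_of_mem p ha) h
    · rw [Finsupp.notMem_support_iff.1 ha]
      refine (Finset.sum_eq_zero fun i _ => ?_).symm
      rw [Finsupp.filter_apply, Finsupp.notMem_support_iff.1 ha, ite_self]
  have h : ∑ i ∈ f.support.image p, f.filter (fun a => p a = i)
      ∈ Submodule.span K (Set.range fun i => f.filter fun a => p a = i) :=
    Submodule.sum_mem _ fun i _ => Submodule.subset_span (Set.mem_range_self i)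
  rwa [← e] at h

/-- Elements of the orthogonal need not be homogeneous. Since each relation in `R` is, it pairs with
a single component of `f`, and every component of `f` is orthogonal to `R` as well. -/
theorem dualRel_subset_span {R : Set (Free K ar)}
    (hR : ∀ r ∈ R, ∃ (n : ℕ) (d : ℤ), r ∈ piece K ar deg n d 2) :
    dualRel deg R ⊆ Submodule.span K (homDualRel deg R) := by
  classical
  intro f hf
  refine Submodule.span_mono ?_
    (mem_span_filter f fun t => (t.leaves, t.total (dualDeg deg)))
  rintro _ ⟨⟨n, d⟩, rfl⟩
  have hs : ∀ t ∈ (f.filter fun t => (t.leaves, t.total (dualDeg deg)) = (n, d)).support,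
      t ∈ f.support ∧ (t.leaves, t.total (dualDeg deg)) = (n, d) := by
    intro t ht
    rwa [Finsupp.support_filter, Finset.mem_filter] at ht
  refine ⟨⟨fun t ht => hf.1 t (hs t ht).1, fun r hr => ?_⟩, n, d, fun t ht => ?_⟩
  · rw [sum_eq_signedPairing]
    obtain ⟨n', d', hp⟩ := hR r hr
    have hv : ∀ t ∈ r.support, (t.leaves, t.total (dualDeg deg)) = (n', -d' - 2) := by
      intro t ht
      obtain ⟨h1, h2, h3⟩ := hp ht
      rw [total_dualDeg, h1, h2, h3]
      rfl
    -- A tree of degree `d'` with two vertices has degree `-d' - 2` for the dual generators. If this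
    -- is the chosen component, filtering does not change the pairing; otherwise the pairing is
    -- zero.
    by_cases he : (n', -d' - 2) = (n, d)
    · rw [← hf.2 r hr, sum_eq_signedPairing]
      refine signedPairing_congr fun t ht => ?_
      rw [Finsupp.filter_apply_pos]
      exact (hv t ht).trans he
    · refine signedPairing_eq_zero fun t ht => ?_
      rw [Finsupp.filter_apply_neg]
      rw [hv t ht]
      exact he
  · obtain ⟨h1, h2⟩ := hs t ht
    obtain ⟨h3, h4⟩ := Prod.mk.inj h2
    exact ⟨h3, h4, hf.1 t h1⟩

theorem gen_le_ker {V : Type*} [AddCommGroup V] [Module K V] {R : Set (Free K ar)}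
    (hR : ∀ r ∈ R, ∃ (n : ℕ) (d : ℤ), r ∈ piece K ar deg n d 2) (φ : Free K ar →ₗ[K] V)
    (hφ : ∀ x, IsTreeRel deg R x → φ x = 0) :
    (OpIdeal.gen deg R).carrier ≤ LinearMap.ker φ := by
  refine (gen_le_treeIdeal hR Submodule.subset_span).trans ?_
  rw [Submodule.span_le]
  exact hφ

theorem gen_le_ker_lapply {R : Set (Free K ar)}
    (hR : ∀ r ∈ R, ∃ (n : ℕ) (d : ℤ), r ∈ piece K ar deg n d 2) (g : G) :
    (OpIdeal.gen deg R).carrier ≤ LinearMap.ker (Finsupp.lapply (R := K) (corolla g)) := by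
  refine gen_le_ker hR _ fun x hx => ?_
  obtain ⟨n, d, w, hw, hp⟩ := hx.mem_piece hR
  by_contra hne
  have := (hp (Finsupp.mem_support_iff.2 hne)).2.2
  rw [weight_corolla] at this
  omega

/-- Only the weight two part of the ideal matters here. A composite relation of weight two has a
trivial forest and no vertex below it, so it is an element of `R`. -/
theorem gen_le_ker_signedPairing {R : Set (Free K ar)}
    (hR : ∀ r ∈ R, ∃ (n : ℕ) (d : ℤ), r ∈ piece K ar deg n d 2) {r : Free K ar}
    (hr : r ∈ dualRel deg R) :
    (OpIdeal.gen deg R).carrier ≤ LinearMap.ker (signedPairing deg r) := by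
  have h0 : ∀ {x : Free K ar} {n : ℕ} {d : ℤ} {w : ℕ}, x ∈ piece K ar deg n d w → w ≠ 2 →
      signedPairing deg r x = 0 := by
    intro x n d w hx hw
    refine signedPairing_eq_zero fun t ht => ?_
    by_contra hne
    exact hw ((hx ht).2.2.symm.trans (hr.1 t (Finsupp.mem_support_iff.2 hne)))
  refine gen_le_ker hR _ fun x hx => ?_
  cases hx with
  | root s hs c =>
    obtain ⟨n, d, hp⟩ := hR s hs
    by_cases hc : ∀ i < n, c i = leaf
    · rw [graftMap_congr hp (c' := fun _ => leaf) hc, graftMap_leaf, ← sum_eq_signedPairing]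
      exact hr.2 s hs
    · refine h0 (graftMap_mem_piece hp c) ?_
      push Not at hc
      obtain ⟨i, hi, hne⟩ := hc
      have := weight_pos_of_ne_leaf hne
      have := Finset.single_le_sum (f := fun j => (c j).weight) (fun _ _ => Nat.zero_le _)
        (Finset.mem_range.2 hi)
      omega
  | child g c j hj y hy =>
    obtain ⟨n, d, w, hw, hp⟩ := hy.mem_piece hR
    exact h0 (childMap_mem_piece hp g c hj) (by omega)

end quadraticFunctional

/-! ### Composite dual relations as functionals composed with the differential. -/

section annihilator

variable {K : Type v} [Field K] {G : Type u} {ar : G → ℕ} {deg : G → ℤ} {I : OpIdeal K ar deg}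

/-- The arities of the generators together with one more vertex with `n` entries. -/
def addArity (n : ℕ) (ar : G → ℕ) : Option G → ℕ
  | none => n
  | some g => ar g

/-- A tree, as a tree with labels in the extended set of generators. -/
def embed (n : ℕ) : PTree G ar → PTree (Option G) (addArity n ar)
  | leaf => leaf
  | node g c => node (ar := addArity n ar) (some g) (fun j => embed n (c j))

theorem embed_leaf (n : ℕ) : embed n (leaf : PTree G ar) = leaf := rfl

theorem toBarTree_leaf : toBarTree I leaf = leaf := rfl

theorem embed_nd (n : ℕ) (g : G) (c : ℕ → PTree G ar) :
    embed n (nd g c) = nd (ar := addArity n ar) (some g) (fun j => embed n (c j)) := rfl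

variable {n : ℕ} {φ : Option G → I.Quot →ₗ[K] K}

open Classical in
theorem evT_embed (hφ : ∀ g f, φ (some g) (I.carrier.mkQ f) = f (corolla g)) (x : PTree G ar) :
    ∀ y, evT φ (embed n x) (toBarTree I y) = if x = y then 1 else 0 := by
  induction x using nd_induction with
  | hl =>
    intro y
    rcases leaf_or_nd y with rfl | ⟨b, m, rfl⟩
    · exact (evT_leaf_leaf φ).trans (if_pos rfl).symm
    · rw [if_neg (nd_ne_leaf b m).symm]
      rw [embed_leaf, toBarTree_nd, evT_leaf_nd]
  | hn b m ih =>
    intro y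
    rcases leaf_or_nd y with rfl | ⟨b', m', rfl⟩
    · rw [if_neg (nd_ne_leaf b m)]
      rw [embed_nd, toBarTree_leaf, evT_nd_leaf]
    · rw [toBarTree_nd, embed_nd, evT_nd_nd]
      have e1 : φ (some b) (genOp I b').elt = if b' = b then 1 else 0 := by
        rw [genOp, hφ, Finsupp.single_apply]
        refine if_congr ⟨fun e => (nd_inj (c := fun _ => leaf) (c' := fun _ => leaf) e).1, ?_⟩
          rfl rfl
        rintro rfl
        rfl
      rw [e1]
      by_cases hb : b' = b
      · subst hb
        rw [if_pos (show (genOp I b').arity = addArity n ar (some b') from rfl), if_pos rfl,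
          one_mul]
        by_cases hm : ∀ j < ar b', m j = m' j
        · rw [if_pos (nd_congr b' hm), Finset.prod_eq_one]
          intro j hj
          rw [Finset.mem_range] at hj
          rw [ih j hj, if_pos (hm j hj)]
        · rw [if_neg fun e => hm (nd_inj e).2]
          push Not at hm
          obtain ⟨j, hj, hne⟩ := hm
          refine Finset.prod_eq_zero (i := j) (Finset.mem_range.2 hj) ?_
          rw [ih j hj, if_neg hne]
      · rw [if_neg hb, if_neg fun e => hb (nd_inj e).1.symm, zero_mul, ite_self]

theorem degAfter_corolla (deg : G → ℤ) (g : G) (i : ℕ) :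
    degAfter deg (corolla g : PTree G ar) i = 0 := by
  simp [corolla, degAfter]

theorem genOp_comp_elt (g f : G) {j : ℕ} (hj : j < ar g) :
    ((genOp I g).comp ⟨j, hj⟩ (genOp I f)).elt
      = I.carrier.mkQ (Finsupp.single (twoVertex g ⟨j, hj⟩ f) 1) := by
  change I.qcomp j (I.carrier.mkQ _) (I.carrier.mkQ _) = _
  rw [I.qcomp_mk, comp_single_of_lt _ (by rwa [leaves_corolla]), degAfter_corolla, zero_mul,
    ksign_zero, mul_one, mul_one, twoVertex_eq_graft]

/-- The contracted root carries a label of weight two, on which the coordinate at a generator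
vanishes. -/
theorem ev_some_conB (hφ : ∀ g f, φ (some g) (I.carrier.mkQ f) = f (corolla g)) (g g' : G)
    (m : ℕ → PTree (Option G) (addArity n ar)) (a : ℕ → PTree G ar) {j : ℕ} (hj : j < ar g') :
    ev φ (nd (ar := addArity n ar) (some g) m) (conB (genOp I g') (fun i => toBarTree I (a i)) j
      (cl (toBarTree I (a j)))) = 0 := by
  rcases leaf_or_nd (a j) with h | ⟨f, a', h⟩
  · rw [h]
    change ev φ _ (conB _ _ _ (cl leaf)) = 0
    rw [conB_cl_leaf, map_zero]
  · rw [h, toBarTree_nd, conB_cl_nd _ _ (show j < (genOp I g').arity from hj), map_smul, ev_cl,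
      evT_nd_nd, genOp_comp_elt g' f hj, hφ, Finsupp.single_eq_of_ne, zero_mul, ite_self, smul_zero]
    intro e
    have := congrArg PTree.weight e
    rw [weight_corolla, weight_twoVertex] at this
    omega

theorem barDiff_toBarTree_nd (g : G) (a : ℕ → PTree G ar) :
    barDiff I (cl (toBarTree I (nd g a))) = ∑ j ∈ Finset.range (ar g),
      (conB (genOp I g) (fun i => toBarTree I (a i)) j (cl (toBarTree I (a j)))
      + sg (genOp I g) (fun i => toBarTree I (a i)) j
        • nodeB (genOp I g) (fun i => toBarTree I (a i)) j (barDiff I (cl (toBarTree I (a j))))) := by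
  rw [toBarTree_nd, barDiff_nd]
  rfl

theorem barDiff_toBarTree_leaf : barDiff I (cl (toBarTree I leaf)) = 0 := barDiff_leaf

/-- Every term in the boundary of a tree of generators has a label of weight two, so a tensor of
coordinates at generators annihilates the boundary. -/
theorem ev_embed_barDiff (hφ : ∀ g f, φ (some g) (I.carrier.mkQ f) = f (corolla g))
    (x : PTree G ar) : ∀ y, ev φ (embed n x) (barDiff I (cl (toBarTree I y))) = 0 := by
  induction x using nd_induction with
  | hl =>
    intro y
    rcases leaf_or_nd y with rfl | ⟨g, a, rfl⟩
    · rw [barDiff_toBarTree_leaf, map_zero]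
    · rw [barDiff_toBarTree_nd, map_sum]
      refine Finset.sum_eq_zero fun j hj => ?_
      rw [Finset.mem_range] at hj
      have h1 : ev φ (embed n (leaf : PTree G ar)) ∘ₗ nodeB (genOp I g) (fun i => toBarTree I (a i)) j = 0 := by
        refine bar_hom_ext fun T => ?_
        rw [LinearMap.comp_apply, nodeB_cl _ _ (show j < (genOp I g).arity from hj), ev_cl,
          embed_leaf, evT_leaf_nd, LinearMap.zero_apply]
      rw [map_add, map_smul, ← LinearMap.comp_apply, ← LinearMap.comp_apply, h1,
        LinearMap.zero_apply, smul_zero, add_zero, LinearMap.comp_apply]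
      rcases leaf_or_nd (a j) with h | ⟨f, a', h⟩
      · rw [h]
        change ev φ _ (conB _ _ _ (cl leaf)) = 0
        rw [conB_cl_leaf, map_zero]
      · rw [h, toBarTree_nd, conB_cl_nd _ _ (show j < (genOp I g).arity from hj), map_smul, ev_cl,
          embed_leaf, evT_leaf_nd, smul_zero]
  | hn g m ih =>
    intro y
    rcases leaf_or_nd y with rfl | ⟨g', a, rfl⟩
    · rw [barDiff_toBarTree_leaf, map_zero]
    · rw [barDiff_toBarTree_nd, map_sum]
      refine Finset.sum_eq_zero fun j hj => ?_
      rw [Finset.mem_range] at hj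
      rw [map_add, map_smul, embed_nd, ev_some_conB hφ g g' _ a hj, zero_add,
        ev_nodeB _ _ _ _ _ (show j < (genOp I g').arity from hj)]
      by_cases hg : ar g' = ar g
      · rw [ih j (hg ▸ hj), mul_zero, smul_zero]
      · rw [if_neg (show ¬(genOp I g').arity = addArity n ar (some g) from hg), zero_mul, smul_zero]

theorem bdeg_toBarTree (t : PTree G ar) : bdeg (toBarTree I t) = -t.total (dualDeg deg) := by
  induction t using nd_induction with
  | hl => rfl
  | hn g c ih =>
    have e : lD (fun j => toBarTree I (c j)) (ar g)
        = -∑ j ∈ Finset.range (ar g), (c j).total (dualDeg deg) := by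
      rw [lD, ← Finset.sum_neg_distrib]
      exact Finset.sum_congr rfl fun j hj => ih j (Finset.mem_range.1 hj)
    rw [toBarTree_nd, bdeg_nd, total_nd]
    change deg g + 1 + lD _ (ar g) = _
    rw [e, dualDeg]
    ring

theorem total_corolla (deg : G → ℤ) (g : G) : (corolla g : PTree G ar).total deg = deg g := by
  change (nd g fun _ => leaf).total deg = deg g
  rw [total_nd]
  simp

theorem leaves_twoVertex (g : G) {j : ℕ} (hj : j < ar g) (f : G) :
    (twoVertex g ⟨j, hj⟩ f : PTree G ar).leaves + 1 = ar g + ar f := by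
  rw [twoVertex_eq_graft, leaves_graft _ _ _ (by rwa [leaves_corolla]), leaves_corolla,
    leaves_corolla]

theorem graftSign_twoVertex (dd : G → ℤ) (g : G) {j : ℕ} (hj : j < ar g) (f : G)
    (c : ℕ → PTree G ar) : graftSign dd c (twoVertex g ⟨j, hj⟩ f)
      = dd f * ∑ i ∈ Finset.range j, (c i).total dd := by
  have hl := leaves_twoVertex g hj f
  have hjl : j < (corolla g : PTree G ar).leaves := by rwa [leaves_corolla]
  rw [graftSign, Finset.mul_sum]
  rw [← Finset.sum_subset (s₁ := Finset.range j)
    (s₂ := Finset.range (twoVertex g ⟨j, hj⟩ f : PTree G ar).leaves)]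
  · refine Finset.sum_congr rfl fun i hi => ?_
    rw [Finset.mem_range] at hi
    rw [twoVertex_eq_graft, degAfter_graft_of_gt _ _ _ hi hjl, degAfter_corolla, total_corolla,
      zero_add]
  · intro i hi
    rw [Finset.mem_range] at hi ⊢
    omega
  · intro i hi hi'
    rw [Finset.mem_range] at hi hi'
    have : degAfter dd (twoVertex g ⟨j, hj⟩ f) i = 0 := by
      rw [twoVertex_eq_graft]
      by_cases h : i < j + ar f
      · obtain ⟨l, rfl⟩ := Nat.exists_eq_add_of_le (not_lt.1 hi')
        rw [degAfter_graft _ _ _ hjl (by rw [leaves_corolla]; omega), degAfter_corolla,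
          degAfter_corolla, add_zero]
      · obtain ⟨k, hk, hk', e⟩ : ∃ k, j < k ∧ k < ar g ∧
            i = k + (corolla f : PTree G ar).leaves - 1 := by
          rw [leaves_corolla]
          exact ⟨i + 1 - ar f, by omega, by omega, by omega⟩
        rw [e, degAfter_graft_of_lt _ _ _ hk (by rwa [leaves_corolla]), degAfter_corolla]
    rw [this, zero_mul]

theorem graftAll_twoVertex_eq_iff (g : G) {j : ℕ} (hj : j < ar g) (f : G) (c : ℕ → PTree G ar)
    (g' : G) (a : ℕ → PTree G ar) (h : graftAll (twoVertex g ⟨j, hj⟩ f) c = nd g' a) :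
    g' = g ∧ ∃ a', a j = nd f a' ∧
      ∀ i < (twoVertex g ⟨j, hj⟩ f : PTree G ar).leaves, c i = spliceN a j (ar f) a' i := by
  have hl := leaves_twoVertex g hj f
  set c₁ : ℕ → PTree G ar := fun i =>
    if i < j then c i else if i = j then nd f (fun l => c (j + l)) else c (i + ar f - 1) with hc₁
  have hs : spliceN c₁ j (ar f) (fun l => c (j + l)) = c := by
    funext i
    simp only [spliceN, hc₁]
    split_ifs <;> first | omega | rfl | (congr 1; omega)
  have hj' : c₁ j = nd f (fun l => c (j + l)) := by simp [hc₁]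
  have e := graftAll_twoVertex g c₁ hj f _ hj'
  rw [hs, h] at e
  obtain ⟨rfl, h2⟩ := nd_inj e
  refine ⟨rfl, _, (h2 j hj).trans hj', fun i hi => ?_⟩
  conv_lhs => rw [← hs]
  unfold spliceN
  split_ifs with h3 h4
  · exact (h2 i (by omega)).symm
  · rfl
  · exact (h2 _ (by omega)).symm

/-- The evaluation of the contraction of a root edge. -/
theorem ev_none_conB {r : Free K ar}
    (hφ : ∀ g f, φ (some g) (I.carrier.mkQ f) = f (corolla g))
    (hr : ∀ f, φ none (I.carrier.mkQ f) = signedPairing deg r f)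
    (c : ℕ → PTree G ar) (g : G) (a : ℕ → PTree G ar) {j : ℕ} (hj : j < ar g) (f : G)
    (a' : ℕ → PTree G ar) (ha : a j = nd f a') [Decidable
      ((twoVertex g ⟨j, hj⟩ f : PTree G ar).leaves = n ∧ ∀ i < n, c i = spliceN a j (ar f) a' i)] :
    ev φ (nd (ar := addArity n ar) none fun i => embed n (c i)) (conB (genOp I g)
      (fun i => toBarTree I (a i)) j (cl (toBarTree I (a j))))
    = if (twoVertex g ⟨j, hj⟩ f : PTree G ar).leaves = n ∧ ∀ i < n, c i = spliceN a j (ar f) a' i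
      then r (twoVertex g ⟨j, hj⟩ f)
        * ksign K (graftSign (dualDeg deg) c (twoVertex g ⟨j, hj⟩ f)) else 0 := by
  classical
  have hl := leaves_twoVertex g hj f
  rw [ha, toBarTree_nd, conB_cl_nd _ _ (show j < (genOp I g).arity from hj), map_smul, ev_cl,
    evT_nd_nd, genOp_comp_elt g f hj, hr, signedPairing_single]
  have hs : spliceN (fun i => toBarTree I (a i)) j (genOp I f).arity (fun i => toBarTree I (a' i))
      = fun i => toBarTree I (spliceN a j (ar f) a' i) := (comp_spliceN _ _ _ _ _).symm
  rw [hs]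
  simp only [evT_embed hφ]
  have har : ((genOp I g).comp ⟨j, hj⟩ (genOp I f)).arity
      = (twoVertex g ⟨j, hj⟩ f : PTree G ar).leaves := by
    change ar g + ar f - 1 = _
    omega
  rw [har]
  by_cases hn : (twoVertex g ⟨j, hj⟩ f : PTree G ar).leaves = n
  · rw [if_pos (show _ = addArity n ar none from hn)]
    by_cases hc : ∀ i < n, c i = spliceN a j (ar f) a' i
    · have hprod : ∏ x ∈ Finset.range (addArity n ar none),
          (if c x = spliceN a j (ar f) a' x then (1 : K) else 0) = 1 :=
        Finset.prod_eq_one fun i hi => if_pos (hc i (Finset.mem_range.1 hi))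
      rw [if_pos ⟨hn, hc⟩, hprod, graftSign_twoVertex, smul_eq_mul]
      -- Suspended degrees are the negatives of the degrees of the dual generators; in the product
      -- of two such degrees the minus signs cancel. This identifies the sign of the contraction
      -- with the sign for grafting in the dual operad.
      have hX : ((genOp I f).degree + 1) * lD (fun i => toBarTree I (a i)) j
          = dualDeg deg f * ∑ i ∈ Finset.range j, (c i).total (dualDeg deg) := by
        have e : lD (fun i => toBarTree I (a i)) j
            = -∑ i ∈ Finset.range j, (c i).total (dualDeg deg) := by
          rw [lD, ← Finset.sum_neg_distrib]
          refine Finset.sum_congr rfl fun i hi => ?_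
          rw [Finset.mem_range] at hi
          rw [bdeg_toBarTree, hc i (by omega), spliceN, if_pos hi]
        rw [e, dualDeg]
        change (deg f + 1) * _ = _
        ring
      have hd : rootDeg deg (twoVertex g ⟨j, hj⟩ f : PTree G ar) = (genOp I g).degree := rfl
      rw [hX, hd, ksign_add]
      -- The degree of the root label occurs once in the contraction and once in the suspension sign
      -- of the pairing; this cancellation explains the sign in the definition of the dual
      -- relations.
      have := ksign_mul_self K (genOp I g).degree
      linear_combination (r (twoVertex g ⟨j, hj⟩ f) * ksign K (dualDeg deg f
        * ∑ i ∈ Finset.range j, (c i).total (dualDeg deg))) * this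
    · rw [if_neg fun h => hc h.2]
      push Not at hc
      obtain ⟨i, hi, hne⟩ := hc
      rw [Finset.prod_eq_zero (show i ∈ Finset.range (addArity n ar none) from
        Finset.mem_range.2 hi) (if_neg hne), mul_zero, smul_zero]
  · rw [if_neg (show ¬_ = addArity n ar none from hn), if_neg fun h => hn h.1, smul_zero]

/-- The distinguished root applies `r` to a label of weight two, which only the contraction of a
root edge can produce. The coordinates above it check that the remaining forest is `c`. -/
theorem ev_root_barDiff (har : ∀ g, 0 < ar g) {r : Free K ar} {d : ℤ}
    (hp : r ∈ piece K ar (dualDeg deg) n d 2)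
    (hφ : ∀ g f, φ (some g) (I.carrier.mkQ f) = f (corolla g))
    (hr : ∀ f, φ none (I.carrier.mkQ f) = signedPairing deg r f)
    (c : ℕ → PTree G ar) (t : PTree G ar) :
    ev φ (nd (ar := addArity n ar) none fun i => embed n (c i)) (barDiff I (cl (toBarTree I t)))
      = graftMap (dualDeg deg) c r t := by
  classical
  rcases leaf_or_nd t with rfl | ⟨g, a, rfl⟩
  · rw [barDiff_toBarTree_leaf, map_zero]
    by_contra hne
    have := (graftMap_mem_piece hp c (Finsupp.mem_support_iff.2 (Ne.symm hne))).2.2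
    rw [weight_leaf] at this
    omega
  have e1 : ∀ j < ar g, ev φ (nd (ar := addArity n ar) none fun i => embed n (c i))
      (nodeB (genOp I g) (fun i => toBarTree I (a i)) j
        (barDiff I (cl (toBarTree I (a j))))) = 0 := by
    intro j hj
    have : φ none (genOp I g).elt = 0 := by
      rw [genOp, hr, signedPairing_single]
      have : r (corolla g) = 0 := by
        by_contra hne
        have := (hp (Finsupp.mem_support_iff.2 hne)).2.2
        rw [weight_corolla] at this
        omega
      rw [this, mul_zero, mul_zero]
    rw [ev_nodeB _ _ _ _ _ (show j < (genOp I g).arity from hj), this, zero_mul, ite_self,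
      zero_mul]
  have e2 : ev φ (nd (ar := addArity n ar) none fun i => embed n (c i))
      (barDiff I (cl (toBarTree I (nd g a)))) = ∑ j ∈ Finset.range (ar g),
        ev φ (nd (ar := addArity n ar) none fun i => embed n (c i)) (conB (genOp I g)
          (fun i => toBarTree I (a i)) j (cl (toBarTree I (a j)))) := by
    rw [barDiff_toBarTree_nd, map_sum]
    refine Finset.sum_congr rfl fun j hj => ?_
    rw [map_add, map_smul, e1 j (Finset.mem_range.1 hj), smul_zero, add_zero]
  have e3 : ∀ j < ar g, ev φ (nd (ar := addArity n ar) none fun i => embed n (c i))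
      (conB (genOp I g) (fun i => toBarTree I (a i)) j (cl (toBarTree I (a j)))) ≠ 0 →
      ∃ (hj : j < ar g) (f : G), (twoVertex g ⟨j, hj⟩ f : PTree G ar).leaves = n ∧
        graftAll (twoVertex g ⟨j, hj⟩ f) c = nd g a ∧ r (twoVertex g ⟨j, hj⟩ f) ≠ 0 := by
    intro j hj hne
    rcases leaf_or_nd (a j) with h | ⟨f, a', h⟩
    · rw [h] at hne
      change ev φ _ (conB _ _ _ (cl leaf)) ≠ 0 at hne
      rw [conB_cl_leaf, map_zero] at hne
      exact absurd rfl hne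
    · rw [ev_none_conB hφ hr c g a hj f a' h] at hne
      split_ifs at hne with hc
      · refine ⟨hj, f, hc.1, ?_, left_ne_zero_of_mul hne⟩
        rw [← graftAll_twoVertex g a hj f a' h]
        exact graftAll_congr fun i hi => hc.2 i (hc.1 ▸ hi)
      · exact absurd rfl hne
  rw [e2]
  -- A tree has at most one presentation as the forest `c` grafted on a two-vertex tree with `n`
  -- entries, so at most one root edge contributes. Without such a presentation both sides vanish.
  by_cases hu : ∃ (j : ℕ) (hj : j < ar g) (f : G),
      (twoVertex g ⟨j, hj⟩ f : PTree G ar).leaves = n ∧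
        graftAll (twoVertex g ⟨j, hj⟩ f) c = nd g a
  · obtain ⟨j, hj, f, h1, h2⟩ := hu
    obtain ⟨-, a', h3, h4⟩ := graftAll_twoVertex_eq_iff g hj f c g a h2
    rw [h1] at h4
    rw [← h2, graftMap_apply har hp c h1, Finset.sum_eq_single_of_mem j (Finset.mem_range.2 hj),
      ev_none_conB hφ hr c g a hj f a' h3, if_pos ⟨h1, h4⟩]
    intro k hk hkj
    by_contra hne
    obtain ⟨hk', f', h5, h6, -⟩ := e3 k (Finset.mem_range.1 hk) hne
    have h7 := graftAll_injective _ _ c (fun i => leaves_pos har _) (h1.trans h5.symm)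
      (h2.trans h6.symm)
    rw [twoVertex_eq_nd, twoVertex_eq_nd] at h7
    have h8 := (nd_inj h7).2 k hk'
    rw [Function.update_self, Function.update_of_ne hkj] at h8
    exact nd_ne_leaf f' (fun _ => leaf) h8.symm
  · rw [Finset.sum_eq_zero fun j hj => ?_]
    · symm
      by_contra hne
      obtain ⟨u, hu', hu''⟩ := graftMap_mem_supported r c (Finsupp.mem_support_iff.2 hne)
      obtain ⟨h1, -, h3⟩ := hp hu'
      obtain ⟨g', j, hj, f, rfl⟩ := eq_twoVertex_of_weight h3
      obtain ⟨rfl, -⟩ := graftAll_twoVertex_eq_iff g' hj f c g a hu''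
      exact hu ⟨j, hj, f, h1, hu''⟩
    · by_contra hne
      obtain ⟨hj', f, h1, h2, -⟩ := e3 j (Finset.mem_range.1 hj) hne
      exact hu ⟨j, hj', f, h1, h2⟩

/-- The functional is the treewise tensor shaped like the composite relation, with the quadratic
relation as the label of one vertex and coordinates at generators elsewhere. Only the contraction
producing the distinguished vertex survives. -/
theorem IsTreeRel.exists_functional (har : ∀ g, 0 < ar g) {R : Set (Free K ar)}
    (hR : ∀ r ∈ R, ∃ (n : ℕ) (d : ℤ), r ∈ piece K ar deg n d 2) {x : Free K ar}
    (hx : IsTreeRel (dualDeg deg) (homDualRel deg R) x) :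
    ∃ (n : ℕ) (φ : Option G → (OpIdeal.gen deg R).Quot →ₗ[K] K)
      (m : PTree (Option G) (addArity n ar)) (ε : K),
      (∀ g f, φ (some g) ((OpIdeal.gen deg R).carrier.mkQ f) = f (corolla g)) ∧ ε ≠ 0 ∧
      ∀ t, ev φ m (barDiff (OpIdeal.gen deg R) (cl (toBarTree _ t))) = ε * x t := by
  classical
  induction hx with
  | root r hr c =>
    obtain ⟨n, d, hp⟩ := hr.2
    set φ : Option G → (OpIdeal.gen deg R).Quot →ₗ[K] K := fun o => match o with
      | none => (OpIdeal.gen deg R).carrier.liftQ _ (gen_le_ker_signedPairing hR hr.1)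
      | some g => (OpIdeal.gen deg R).carrier.liftQ _ (gen_le_ker_lapply hR g) with hφ
    refine ⟨n, φ, nd (ar := addArity n ar) none fun i => embed n (c i), 1, fun g f => rfl, one_ne_zero, fun t => ?_⟩
    rw [one_mul]
    exact ev_root_barDiff har hp (fun g f => rfl) (fun f => rfl) c t
  | child g c j hj x hx ih =>
    set I := OpIdeal.gen deg R with hI
    obtain ⟨n, φ, m, ε, hφ, hε, h⟩ := ih
    set s : K := sg (genOp I g) (fun i => toBarTree I (c i)) j with hs
    refine ⟨n, φ, nd (ar := addArity n ar) (some g) (Function.update (fun i => embed n (c i)) j m),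
      s * ε, hφ, mul_ne_zero (ksign_ne_zero K _) hε, fun t => ?_⟩
    rcases leaf_or_nd t with rfl | ⟨g', a, rfl⟩
    · rw [barDiff_toBarTree_leaf, map_zero]
      by_cases h0 : childMap g c j x leaf = 0
      · rw [h0, mul_zero]
      · obtain ⟨T, -, e⟩ := exists_of_childMap_ne_zero g c j h0
        exact absurd e.symm (nd_ne_leaf _ _)
    · set M : ℕ → PTree (Option G) (addArity n ar) :=
        Function.update (fun i => embed n (c i)) j m with hM
      have e1 : ∀ k < ar g', ev φ (nd (ar := addArity n ar) (some g) M)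
          (conB (genOp I g') (fun i => toBarTree I (a i)) k (cl (toBarTree I (a k)))
          + sg (genOp I g') (fun i => toBarTree I (a i)) k
            • nodeB (genOp I g') (fun i => toBarTree I (a i)) k
              (barDiff I (cl (toBarTree I (a k)))))
          = if k = j ∧ g' = g ∧ ∀ i < ar g, i ≠ j → c i = a i then s * ε * x (a j) else 0 := by
        intro k hk
        rw [map_add, map_smul, ev_some_conB hφ g g' _ a hk, zero_add,
          ev_nodeB _ _ _ _ _ (show k < (genOp I g').arity from hk)]
        have e2 : φ (some g) (genOp I g').elt = if g' = g then 1 else 0 := by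
          rw [genOp, hφ, Finsupp.single_apply]
          refine if_congr ⟨fun e => (nd_inj (c := fun _ => leaf) (c' := fun _ => leaf) e).1, ?_⟩
            rfl rfl
          rintro rfl
          rfl
        rw [e2]
        by_cases hg : g' = g
        · subst hg
          rw [if_pos (show (genOp I g').arity = addArity n ar (some g') from rfl), if_pos rfl,
            one_mul]
          by_cases hkj : k = j
          · subst hkj
            have e3 : M k = m := Function.update_self _ _ _
            rw [e3, h, smul_eq_mul]
            by_cases hc : ∀ i < ar g', i ≠ k → c i = a i
            · have e4 : ∏ i ∈ (Finset.range (addArity n ar (some g'))).erase k,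
                  evT φ (M i) (toBarTree I (a i)) = 1 := by
                refine Finset.prod_eq_one fun i hi => ?_
                obtain ⟨hik, hi⟩ := Finset.mem_erase.1 hi
                rw [hM, Function.update_of_ne hik, evT_embed hφ,
                  if_pos (hc i (Finset.mem_range.1 hi) hik)]
              -- The sign depends only on the root label and the trees to the left, which agree with
              -- `c`; it is therefore the same for all trees that contribute and goes into the
              -- scalar.
              have e5 : sg (K := K) (genOp I g') (fun i => toBarTree I (a i)) k = s := by
                rw [hs, sg, sg]
                congr 2
                refine lD_congr fun i hi => ?_
                rw [hc i (by omega) hi.ne]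
              rw [e4, e5, if_pos ⟨rfl, rfl, hc⟩]
              ring
            · rw [if_neg fun h => hc h.2.2]
              push Not at hc
              obtain ⟨i, hi, hik, hne⟩ := hc
              have e4 : ∏ i ∈ (Finset.range (addArity n ar (some g'))).erase k,
                  evT φ (M i) (toBarTree I (a i)) = 0 := by
                refine Finset.prod_eq_zero (Finset.mem_erase.2 ⟨hik, Finset.mem_range.2 hi⟩) ?_
                rw [hM, Function.update_of_ne hik, evT_embed hφ, if_neg hne]
              rw [e4, zero_mul, mul_zero]
          · have e3 : M k = embed n (c k) := Function.update_of_ne hkj _ _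
            rw [e3, ev_embed_barDiff hφ, mul_zero, smul_zero, if_neg fun h => hkj h.1]
        · rw [if_neg hg, zero_mul, ite_self, zero_mul, smul_zero, if_neg fun h => hg h.2.1]
      rw [barDiff_toBarTree_nd, map_sum,
        Finset.sum_congr rfl fun k hk => e1 k (Finset.mem_range.1 hk)]
      by_cases hc : g' = g ∧ ∀ i < ar g, i ≠ j → c i = a i
      · obtain ⟨rfl, hc⟩ := hc
        have e2 : nd g' a = nd g' (Function.update c j (a j)) := by
          refine nd_congr g' fun i hi => ?_
          by_cases hij : i = j
          · rw [hij, Function.update_self]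
          · rw [Function.update_of_ne hij, hc i hi hij]
        rw [e2, childMap_apply g' c hj, Finset.sum_eq_single_of_mem j (Finset.mem_range.2 hj),
          if_pos ⟨rfl, rfl, hc⟩]
        intro k _ hkj
        rw [if_neg fun h => hkj h.1]
      · rw [Finset.sum_eq_zero fun k _ => if_neg fun h => hc h.2]
        by_cases h0 : childMap g c j x (nd g' a) = 0
        · rw [h0, mul_zero]
        · obtain ⟨T, -, e⟩ := exists_of_childMap_ne_zero g c j h0
          obtain ⟨rfl, h2⟩ := nd_inj e
          refine absurd ⟨rfl, fun i hi hij => ?_⟩ hc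
          rw [h2 i hi, Function.update_of_ne hij]

end annihilator


open PTree

/-! ### The Koszul dual operad and its basis. -/

section koszulDual

variable {K : Type v} [Field K] {G : Type u} {ar : G → ℕ} {deg : G → ℤ} {R : Set (Free K ar)}
  {le : PTree G ar → PTree G ar → Prop} {B : Set (PTree G ar)}

/-- Pairing with a composite relation factors, up to a nonzero scalar, through the differential, and
hence vanishes on the Koszul construction, which is its kernel. -/
theorem gen_dualRel_le_ker (har : ∀ g, 0 < ar g)
    (hR : ∀ r ∈ R, ∃ (n : ℕ) (d : ℤ), r ∈ piece K ar deg n d 2) :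
    (OpIdeal.gen (dualDeg deg) (dualRel deg R)).carrier
      ≤ LinearMap.ker (toKoszulDual (OpIdeal.gen deg R)) := by
  refine (gen_le_treeIdeal (fun r hr => hr.2) (dualRel_subset_span hR)).trans ?_
  rw [Submodule.span_le]
  intro x hx
  obtain ⟨n, φ, m, ε, -, hε, h⟩ := IsTreeRel.exists_functional har hR hx
  rw [SetLike.mem_coe, mem_ker_toKoszulDual]
  intro f hf
  have e : ev φ m ∘ₗ barDiff (OpIdeal.gen deg R) ∘ₗ diagIncl (OpIdeal.gen deg R)
      = ε • pairing K ar x := by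
    refine Finsupp.lhom_ext fun t a => ?_
    rw [LinearMap.comp_apply, LinearMap.comp_apply, diagIncl_single, map_smul, map_smul, h,
      LinearMap.smul_apply, pairing_single, smul_eq_mul, smul_eq_mul]
    ring
  have e' := LinearMap.congr_fun e f
  rw [LinearMap.comp_apply, LinearMap.mem_ker.1 hf, map_zero, LinearMap.smul_apply] at e'
  exact (smul_eq_zero.1 e'.symm).resolve_left hε

theorem IsPBWBasis.exists_complementary_mem (h : IsPBWBasis (OpIdeal.gen deg R) le B)
    (har : ∀ g, 0 < ar g) (hfin : ∀ n, {g | ar g = n}.Finite) (x : Free K ar) :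
    ∃ c : Free K ar, (∀ u ∈ c.support, u ∈ complementaryBasis B) ∧
      x - c ∈ (OpIdeal.gen (dualDeg deg) (dualRel deg R)).carrier := by
  classical
  induction x using Finsupp.induction_linear with
  | zero => exact ⟨0, by simp, by rw [sub_zero]; exact Submodule.zero_mem _⟩
  | add x y hx hy =>
    obtain ⟨c, h1, h2⟩ := hx
    obtain ⟨c', h1', h2'⟩ := hy
    refine ⟨c + c', fun u hu => ?_, ?_⟩
    · rcases Finset.mem_union.1 (Finsupp.support_add hu) with hu | hu
      · exact h1 u hu
      · exact h1' u hu
    · rw [add_sub_add_comm]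
      exact Submodule.add_mem _ h2 h2'
  | single t a =>
    obtain ⟨c, h1, h2⟩ := h.exists_complementary_rep har hfin t
    refine ⟨a • c, fun u hu => (h1 u (Finsupp.support_smul hu)).1, ?_⟩
    have := Submodule.smul_mem _ a h2
    rwa [smul_sub, Finsupp.smul_single, smul_eq_mul, mul_one] at this

/-- The relations of the Koszul dual operad are quadratic. -/
theorem IsPBWBasis.ker_toKoszulDual (h : IsPBWBasis (OpIdeal.gen deg R) le B)
    (har : ∀ g, 0 < ar g) (hfin : ∀ n, {g | ar g = n}.Finite)
    (hR : ∀ r ∈ R, ∃ (n : ℕ) (d : ℤ), r ∈ piece K ar deg n d 2) :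
    LinearMap.ker (toKoszulDual (OpIdeal.gen deg R))
      = (OpIdeal.gen (dualDeg deg) (dualRel deg R)).carrier := by
  apply le_antisymm
  · intro x hx
    -- Modulo the dual relations `x` is a combination of complementary monomials. This combination
    -- also vanishes on the Koszul construction, so by independence it is zero.
    obtain ⟨c, h1, h2⟩ := h.exists_complementary_mem har hfin x
    have hc : c ∈ LinearMap.ker (toKoszulDual (OpIdeal.gen deg R)) := by
      have := Submodule.sub_mem _ hx (gen_dualRel_le_ker har hR h2)
      rwa [sub_sub_cancel] at this
    rw [h.eq_zero_of_mem_ker har hfin h1 hc, sub_zero] at h2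
    exact h2
  · exact gen_dualRel_le_ker har hR

theorem mem_complementaryBasis_twoVertex {g : G} {j : ℕ} (hj : j < ar g) {f : G} :
    twoVertex g ⟨j, hj⟩ f ∈ complementaryBasis B ↔ twoVertex g ⟨j, hj⟩ f ∉ B := by
  constructor
  · intro h
    exact h _ ((edgeSub_twoVertex g hj f _).2 rfl)
  · intro h q hq
    rwa [(edgeSub_twoVertex g hj f q).1 hq]

theorem linearIndependent_mon {α : Type*} {N : Submodule K (α →₀ K)} {C : Set α}
    (h : ∀ c : α →₀ K, (∀ t ∈ c.support, t ∈ C) → c ∈ N → c = 0) :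
    LinearIndependent K fun t : C => N.mkQ (Finsupp.single t.1 1) := by
  rw [linearIndependent_iff]
  intro l hl
  have e : Finsupp.linearCombination K (fun t : C => N.mkQ (Finsupp.single t.1 1)) l
      = N.mkQ (l.mapDomain Subtype.val) := by
    rw [Finsupp.linearCombination_apply, Finsupp.mapDomain, Finsupp.sum, Finsupp.sum, map_sum]
    refine Finset.sum_congr rfl fun t _ => ?_
    rw [← map_smul, Finsupp.smul_single, smul_eq_mul, mul_one]
  rw [e, Submodule.mkQ_apply, Submodule.Quotient.mk_eq_zero] at hl
  refine Finsupp.mapDomain_injective Subtype.val_injective ?_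
  rw [Finsupp.mapDomain_zero]
  classical
  refine h _ (fun t ht => ?_) hl
  obtain ⟨s, -, rfl⟩ := Finset.mem_image.1 (Finsupp.mapDomain_support ht)
  exact s.2

theorem span_mon_eq_top {α : Type*} {N : Submodule K (α →₀ K)} {C : Set α}
    (h : ∀ t : α, ∃ c : α →₀ K, (∀ s ∈ c.support, s ∈ C) ∧ Finsupp.single t 1 - c ∈ N) :
    Submodule.span K (Set.range fun t : C => N.mkQ (Finsupp.single t.1 1)) = ⊤ := by
  have hmk : ∀ c : α →₀ K, N.mkQ c = ∑ t ∈ c.support, c t • N.mkQ (Finsupp.single t 1) := by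
    intro c
    conv_lhs => rw [← Finsupp.sum_single c, Finsupp.sum, map_sum]
    refine Finset.sum_congr rfl fun t _ => ?_
    rw [← map_smul, Finsupp.smul_single, smul_eq_mul, mul_one]
  rw [eq_top_iff]
  rintro y -
  obtain ⟨x, rfl⟩ := N.mkQ_surjective y
  rw [hmk x]
  refine Submodule.sum_mem _ fun t _ => Submodule.smul_mem _ _ ?_
  obtain ⟨c, h1, h2⟩ := h t
  have e : N.mkQ (Finsupp.single t 1) = N.mkQ c := (Submodule.Quotient.eq _).2 h2
  rw [e, hmk c]
  exact Submodule.sum_mem _ fun t ht => Submodule.smul_mem _ _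
    (Submodule.subset_span ⟨⟨t, h1 t ht⟩, rfl⟩)

/-- The complementary monomials form a Poincaré–Birkhoff–Witt basis of the Koszul dual operad for
the opposite order. -/
theorem IsPBWBasis.isPBWBasis_dual (h : IsPBWBasis (OpIdeal.gen deg R) le B)
    (har : ∀ g, 0 < ar g) (hfin : ∀ n, {g | ar g = n}.Finite)
    (hR : ∀ r ∈ R, ∃ (n : ℕ) (d : ℤ), r ∈ piece K ar deg n d 2) :
    IsPBWBasis (OpIdeal.gen (dualDeg deg) (dualRel deg R)) (fun s t => le t s)
      (complementaryBasis B) where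
  order := h.order.flip
  one_mem q hq := absurd hq (not_edgeSub_leaf q)
  corolla_mem g q hq := absurd hq (not_edgeSub_corolla g q)
  -- Elements of the dual ideal vanish on the Koszul construction, where complementary monomials are
  -- already independent.
  linearIndependent := linearIndependent_mon fun c hc hJ =>
    h.eq_zero_of_mem_ker har hfin hc (gen_dualRel_le_ker har hR hJ)
  span_eq_top := span_mon_eq_top fun t => by
    obtain ⟨c, h1, h2⟩ := h.exists_complementary_rep har hfin t
    exact ⟨c, fun u hu => (h1 u hu).1, h2⟩
  comp_mem_or := by
    intro α hα β hβ i hi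
    by_cases hm : graft α i β ∈ complementaryBasis B
    · exact Or.inl hm
    · right
      -- The representative has terms below the composite, which means above it for the opposite
      -- order. They differ from the composite because the latter is not complementary.
      obtain ⟨c, h1, h2⟩ := h.exists_complementary_rep har hfin (graft α i β)
      set ε : K := ksign K (degAfter (dualDeg deg) α i * β.total (dualDeg deg)) with hε
      refine ⟨ε • c, fun u hu => (h1 u (Finsupp.support_smul hu)).1, ?_, fun γ hγ => ?_⟩
      · rw [comp_single_of_lt _ hi, ← hε]
        refine (Submodule.Quotient.eq _).2 ?_
        have := Submodule.smul_mem _ ε h2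
        rw [smul_sub, Finsupp.smul_single, smul_eq_mul, mul_one] at this
        rwa [one_mul, one_mul]
      · have hγ' := h1 γ (Finsupp.support_smul hγ)
        exact ⟨hγ'.2, fun e => hm (e ▸ hγ'.1)⟩
  mem_iff := by
    intro t
    constructor
    · intro ht q hq
      obtain ⟨g, j, hj, f, rfl⟩ := EdgeSub.exists_eq hq
      exact (mem_complementaryBasis_twoVertex hj).2 (ht _ hq)
    · intro ht q hq
      obtain ⟨g, j, hj, f, rfl⟩ := EdgeSub.exists_eq hq
      exact (mem_complementaryBasis_twoVertex hj).1 (ht _ hq)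

end koszulDual


open PTree

/-! ### Numberings of the entries, and edge restrictions of numbered trees. -/

section labels

variable {G : Type u} {ar : G → ℕ}

theorem SymTree.ext' {x y : SymTree G ar} (h1 : x.tree = y.tree) (h2 : x.lab = y.lab) : x = y := by
  obtain ⟨t, l, p⟩ := x
  obtain ⟨t', l', p'⟩ := y
  simp only at h1 h2
  subst h1 h2
  rfl

theorem idxOf_lt_of_perm {l : List ℕ} {N i : ℕ} (h : l.Perm (List.range N)) (hi : i < N) :
    l.idxOf i < N := by
  have := List.idxOf_lt_length_of_mem (h.mem_iff.2 (List.mem_range.2 hi))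
  rwa [h.length_eq, List.length_range] at this

/-- Renumbering preserves increasing lists, and an increasing list is determined by its elements. -/
theorem labComp_range {M i : ℕ} (n : ℕ) (hi : i < M) :
    labComp (List.range M) i n (List.range n) = List.range (M + n - 1) := by
  refine (labComp_perm (List.Perm.refl _) (List.Perm.refl _) hi).eq_of_pairwise' (r := (· < ·))
    ?_ List.pairwise_lt_range
  rw [labComp, List.pairwise_flatMap]
  refine ⟨fun x _ => ?_, List.pairwise_lt_range.imp fun {x y} hxy a ha b hb => ?_⟩
  · split_ifs
    · exact List.pairwise_singleton _ _
    · exact List.pairwise_map.2 (List.pairwise_lt_range.imp fun h => by omega)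
    · exact List.pairwise_singleton _ _
  · split_ifs at ha hb <;> simp only [List.mem_singleton, List.mem_map, List.mem_range] at ha hb <;>
      grind

theorem idxOf_range {M i : ℕ} (hi : i < M) : (List.range M).idxOf i = i := by
  have h := List.nodup_range (n := M)
  have := h.idxOf_getElem i (by simpa using hi)
  simpa using this

theorem std_comp (s t : PTree G ar) {i : ℕ} (hi : i < s.leaves) :
    (SymTree.std s).comp i (SymTree.std t) hi = SymTree.std (graft s i t) := by
  have h1 := leaves_graft t s i hi
  refine SymTree.ext' ?_ ?_
  · change graft s ((List.range s.leaves).idxOf i) t = graft s i t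
    rw [idxOf_range hi]
  · change labComp (List.range s.leaves) i t.leaves (List.range t.leaves) = List.range _
    rw [labComp_range _ hi]
    congr 1
    omega

/-- A list that is a permutation of `0, …, N - 1` as a permutation of the natural numbers. -/
theorem exists_perm_of_perm_range {l : List ℕ} {N : ℕ} (h : l.Perm (List.range N)) :
    ∃ w : Equiv.Perm ℕ, (∀ k, N ≤ k → w k = k) ∧ (List.range N).map w = l := by
  have hlen : l.length = N := by rw [h.length_eq, List.length_range]
  have hnd : l.Nodup := h.nodup_iff.2 List.nodup_range
  have hmem : ∀ k, k ∈ l ↔ k < N := fun k => h.mem_iff.trans List.mem_range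
  set f : ℕ → ℕ := fun i => if hi : i < l.length then l[i] else i with hf
  have hlt : ∀ i (hi : i < l.length), f i < N := fun i hi => by
    rw [hf]
    simp only [hi, dif_pos]
    exact (hmem _).1 (List.getElem_mem hi)
  have hge : ∀ i, ¬i < l.length → f i = i := fun i hi => by simp [hf, hi]
  have hbij : Function.Bijective f := by
    constructor
    · intro i j hij
      by_cases hi : i < l.length <;> by_cases hj : j < l.length
      · simp only [hf, hi, hj, dif_pos] at hij
        exact (hnd.getElem_inj_iff).1 hij
      · have := hlt i hi
        rw [hij, hge j hj] at this
        omega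
      · have := hlt j hj
        rw [← hij, hge i hi] at this
        omega
      · rwa [hge i hi, hge j hj] at hij
    · intro k
      by_cases hk : k < N
      · obtain ⟨i, hi, e⟩ := List.mem_iff_getElem.1 ((hmem k).2 hk)
        exact ⟨i, by simp [hf, hi, e]⟩
      · exact ⟨k, hge k (by omega)⟩
  refine ⟨Equiv.ofBijective f hbij, fun k hk => hge k (by omega), ?_⟩
  refine List.ext_getElem (by simp [hlen]) fun i h1 h2 => ?_
  simp [hf, h2]

/-- The standardization of a list of distinct numbers. -/
theorem map_countP_perm {m : List ℕ} (h : m.Nodup) :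
    (m.map fun k => m.countP (· < k)).Perm (List.range m.length) := by
  have hc : ∀ k, m.countP (· < k) = (m.toFinset.filter (· < k)).card := by
    intro k
    rw [List.countP_eq_length_filter, ← List.toFinset_card_of_nodup (h.filter _)]
    congr 1
    ext a
    simp
  have hlt : ∀ k ∈ m, ∀ k', k < k' → m.countP (· < k) < m.countP (· < k') := by
    intro k hk k' hkk'
    rw [hc, hc]
    refine Finset.card_lt_card ⟨fun a ha => ?_, fun hsub => ?_⟩
    · simp only [Finset.mem_filter] at ha ⊢
      exact ⟨ha.1, ha.2.trans hkk'⟩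
    · have := hsub (Finset.mem_filter.2 ⟨List.mem_toFinset.2 hk, hkk'⟩)
      simp at this
  have hnd : (m.map fun k => m.countP (· < k)).Nodup := by
    refine h.map_on fun a ha b hb e => ?_
    rcases lt_trichotomy a b with hab | hab | hab
    · exact absurd e (hlt a ha b hab).ne
    · exact hab
    · exact absurd e (hlt b hb a hab).ne'
  have hsub : (m.map fun k => m.countP (· < k)) ⊆ List.range m.length := by
    intro a ha
    obtain ⟨k, hk, rfl⟩ := List.mem_map.1 ha
    rw [List.mem_range, hc, ← List.toFinset_card_of_nodup h]
    exact Finset.card_lt_card (Finset.filter_ssubset.2 ⟨k, List.mem_toFinset.2 hk, lt_irrefl k⟩)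
  exact (List.subperm_of_subset hnd hsub).perm_of_length_le (by simp)

theorem mem_labBlock {n : ℕ} {c : Fin n → PTree G ar} {l : List ℕ} {j : Fin n} {a : ℕ} :
    a ∈ labBlock c l j ↔
      ∃ i, offset c j ≤ i ∧ i < offset c j + (c j).leaves ∧ l[i]? = some a := by
  rw [labBlock, List.mem_iff_getElem?]
  constructor
  · rintro ⟨i, hi⟩
    rw [List.getElem?_take] at hi
    split_ifs at hi with h
    rw [List.getElem?_drop] at hi
    exact ⟨_, by omega, by omega, hi⟩
  · rintro ⟨i, h1, h2, h3⟩
    refine ⟨i - offset c j, ?_⟩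
    rw [List.getElem?_take, if_pos (by omega), List.getElem?_drop]
    rwa [Nat.add_sub_cancel' h1]

theorem labBlock_disjoint {n : ℕ} {c : Fin n → PTree G ar} {l : List ℕ} (hl : l.Nodup)
    {j k : Fin n} {a : ℕ} (hj : a ∈ labBlock c l j) (hk : a ∈ labBlock c l k) : j = k := by
  obtain ⟨i, h1, h2, h3⟩ := mem_labBlock.1 hj
  obtain ⟨i', h1', h2', h3'⟩ := mem_labBlock.1 hk
  obtain ⟨hi, e⟩ := List.getElem?_eq_some_iff.1 h3
  obtain ⟨hi', e'⟩ := List.getElem?_eq_some_iff.1 h3'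
  obtain rfl : i = i' := (hl.getElem_inj_iff).1 (e.trans e'.symm)
  exact offset_unique c i ⟨h1, h2⟩ ⟨h1', h2'⟩

theorem labBlock_subset {n : ℕ} (c : Fin n → PTree G ar) (l : List ℕ) (j : Fin n) :
    labBlock c l j ⊆ l := fun _ ha => List.mem_of_mem_drop (List.mem_of_mem_take ha)

theorem labBlock_nodup {n : ℕ} (c : Fin n → PTree G ar) {l : List ℕ} (hl : l.Nodup) (j : Fin n) :
    (labBlock c l j).Nodup :=
  hl.sublist ((List.take_sublist _ _).trans (List.drop_sublist _ _))

theorem length_labBlock {n : ℕ} (c : Fin n → PTree G ar) {l : List ℕ}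
    (hl : l.length = ∑ j, (c j).leaves) (j : Fin n) : (labBlock c l j).length = (c j).leaves := by
  have h : offset c j + (c j).leaves ≤ ∑ j, (c j).leaves := by
    unfold offset
    rw [add_comm, ← Finset.sum_insert (f := fun k => (c k).leaves) (by simp)]
    exact Finset.sum_le_sum_of_subset (Finset.subset_univ _)
  rw [labBlock, List.length_take, List.length_drop]
  omega

theorem minLab_mem (har : ∀ g, 0 < ar g) {n : ℕ} (c : Fin n → PTree G ar) {l : List ℕ}
    (hl : l.length = ∑ j, (c j).leaves) (j : Fin n) : minLab c l j ∈ labBlock c l j := by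
  have h := leaves_pos har (c j)
  rw [← length_labBlock c hl j] at h
  obtain ⟨a, ha⟩ := List.exists_mem_of_length_pos h
  exact Nat.sInf_mem (s := {k | k ∈ labBlock c l j}) ⟨a, ha⟩

/-- The minima are taken over disjoint blocks of labels, which are nonempty because all arities are
positive; so they are distinct and can be standardized to a numbering. -/
theorem LabEdgeSub.nodup_length (har : ∀ g, 0 < ar g) {t q : PTree G ar} {l m : List ℕ}
    (h : LabEdgeSub t l q m) : l.Nodup → l.length = t.leaves → m.Nodup ∧ m.length = q.leaves := by
  induction h with
  | root g c j h c' hc l =>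
    intro hl hlen
    have hlen' : (labBlock c l j).length = ∑ i, (c' i).leaves := by
      rw [length_labBlock c hlen, hc]
      rfl
    have hnd := labBlock_nodup c hl j
    constructor
    · rw [List.nodup_flatMap]
      have hmem : ∀ k : Fin (ar g), ∀ a ∈ (if k = j then
          (List.finRange (ar h)).map (minLab c' (labBlock c l j)) else [minLab c l k]),
          a ∈ labBlock c l k := by
        intro k a ha
        split_ifs at ha with hk
        · obtain ⟨i, -, rfl⟩ := List.mem_map.1 ha
          rw [hk]
          exact labBlock_subset _ _ _ (minLab_mem har c' hlen' i)
        · obtain rfl := List.mem_singleton.1 ha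
          exact minLab_mem har c hlen k
      refine ⟨fun k _ => ?_, ?_⟩
      · split_ifs with hk
        · refine (List.nodup_finRange _).map_on fun i _ i' _ e => ?_
          have h1 := minLab_mem har c' hlen' i
          rw [e] at h1
          exact labBlock_disjoint hnd h1 (minLab_mem har c' hlen' i')
        · exact List.nodup_singleton _
      · refine (List.nodup_finRange (ar g)).imp ?_
        intro k k' hkk' a ha ha'
        exact hkk' (labBlock_disjoint hl (hmem k a ha) (hmem k' a ha'))
    · rw [List.length_flatMap, twoVertex]
      change _ = ∑ k, _
      rw [Fin.sum_univ_def]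
      congr 1
      refine List.map_congr_left fun k _ => ?_
      by_cases hk : k = j
      · rw [if_pos hk, List.length_map, List.length_finRange]
        beta_reduce
        rw [if_pos hk, leaves_corolla]
      · rw [if_neg hk]
        beta_reduce
        rw [if_neg hk]
        rfl
  | child g c j l q m hq ih =>
    intro hl hlen
    exact ih (labBlock_nodup c hl j) (length_labBlock c hlen j)

theorem LabEdgeSub.edgeSub {t q : PTree G ar} {l m : List ℕ} (h : LabEdgeSub t l q m) :
    EdgeSub t q := by
  induction h with
  | root g c j h c' hc l => exact EdgeSub.root g c j h c' hc
  | child g c j l q m hq ih => exact EdgeSub.child g c j q ih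

theorem _root_.NSOp.PTree.EdgeSub.exists_labEdgeSub {t q : PTree G ar} (h : EdgeSub t q) :
    ∀ l, ∃ m, LabEdgeSub t l q m := by
  induction h with
  | root g c j h c' hc => exact fun l => ⟨_, LabEdgeSub.root g c j h c' hc l⟩
  | child g c j q hq ih =>
    intro l
    obtain ⟨m, hm⟩ := ih (labBlock c l j)
    exact ⟨m, LabEdgeSub.child g c j l q m hm⟩

theorem exists_symEdgeSub (har : ∀ g, 0 < ar g) (x : SymTree G ar) {q : PTree G ar}
    (h : EdgeSub x.tree q) : ∃ y : SymTree G ar, y.tree = q ∧ x.EdgeSub y := by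
  obtain ⟨m, hm⟩ := PTree.EdgeSub.exists_labEdgeSub h x.lab
  obtain ⟨h1, h2⟩ := hm.nodup_length har (x.perm.nodup_iff.2 List.nodup_range)
    (by rw [x.perm.length_eq, List.length_range])
  exact ⟨⟨q, m.map fun k => m.countP (· < k), h2 ▸ map_countP_perm h1⟩, rfl, m, hm, rfl⟩

end labels


open PTree

/-! ### The symmetric operad, treated one numbering at a time. -/

section symmetric

variable {K : Type v} [Field K] {G : Type u} {ar : G → ℕ} {deg : G → ℤ}

/-- The inclusion `f ↦ f ⊗ l` of the arity `N` component of the free operad as the numbered trees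
with list of labels `l`. It is zero on the other components. -/
noncomputable def labIncl {l : List ℕ} {N : ℕ} (hl : l.Perm (List.range N)) :
    Free K ar →ₗ[K] SymFree K G ar :=
  Finsupp.linearCombination K fun t =>
    if h : t.leaves = N then Finsupp.single ⟨t, l, h ▸ hl⟩ 1 else 0

theorem labIncl_single {l : List ℕ} {t : PTree G ar} (hl : l.Perm (List.range t.leaves)) (a : K) :
    labIncl hl (Finsupp.single t a) = Finsupp.single ⟨t, l, hl⟩ a := by
  rw [labIncl, Finsupp.linearCombination_single, dif_pos rfl, Finsupp.smul_single, smul_eq_mul,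
    mul_one]

theorem labIncl_single_of_ne {l : List ℕ} {N : ℕ} (hl : l.Perm (List.range N)) {t : PTree G ar}
    (h : t.leaves ≠ N) (a : K) : labIncl hl (Finsupp.single t a) = 0 := by
  rw [labIncl, Finsupp.linearCombination_single, dif_neg h, smul_zero]

theorem labIncl_congr {l : List ℕ} {N N' : ℕ} (hl : l.Perm (List.range N))
    (hl' : l.Perm (List.range N')) : labIncl (K := K) (ar := ar) hl = labIncl hl' := by
  obtain rfl : N = N' := by
    rw [← List.length_range (n := N), ← hl.length_eq, hl'.length_eq, List.length_range]
  rfl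

theorem labIncl_single_of_eq {l : List ℕ} {N : ℕ} (hl : l.Perm (List.range N)) {x : SymTree G ar}
    (h : x.lab = l) (a : K) : labIncl hl (Finsupp.single x.tree a) = Finsupp.single x a := by
  subst h
  rw [labIncl_congr hl x.perm, labIncl_single]

theorem labIncl_mem_supported {l : List ℕ} {N : ℕ} (hl : l.Perm (List.range N)) (f : Free K ar) :
    labIncl hl f ∈ Finsupp.supported K K {x : SymTree G ar | x.lab = l ∧ x.tree ∈ f.support} := by
  rw [labIncl, Finsupp.linearCombination_apply, Finsupp.sum]
  refine Submodule.sum_mem _ fun t ht => Submodule.smul_mem _ _ ?_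
  split_ifs
  · exact Finsupp.single_mem_supported K _ ⟨rfl, ht⟩
  · exact Submodule.zero_mem _

theorem symComp_single (i : ℕ) (x y : SymTree G ar) (a b : K) :
    symComp deg i (Finsupp.single x a) (Finsupp.single y b) = if hi : i < x.tree.leaves then
      Finsupp.single (x.comp i y hi)
        (a * b * ksign K (degAfter deg x.tree (x.lab.idxOf i) * y.tree.total deg)) else 0 := by
  simp only [symComp, Finsupp.linearCombination_single, LinearMap.smul_apply]
  split_ifs
  · rw [Finsupp.smul_single, Finsupp.smul_single, smul_eq_mul, smul_eq_mul, mul_assoc]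
  · simp

open Classical in
theorem symAct_single (w : Equiv.Perm ℕ) (x : SymTree G ar) (a : K) :
    symAct w (Finsupp.single x a) = if hw : ∀ k, x.tree.leaves ≤ k → w k = k then
      Finsupp.single (x.relabel w hw) a else 0 := by
  rw [symAct, Finsupp.linearCombination_single]
  split_ifs
  · rw [Finsupp.smul_single, smul_eq_mul, mul_one]
  · rw [smul_zero]

/-- The numbering of a composite depends only on the numberings of the factors. With the numbering
fixed, composition is non-symmetric composition at the entry that carries the number `i`. -/
theorem symComp_labIncl_left {l : List ℕ} {N i : ℕ} (hl : l.Perm (List.range N)) (hi : i < N)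
    (f : Free K ar) (y : SymTree G ar) :
    symComp deg i (labIncl hl f) (Finsupp.single y 1) = labIncl (labComp_perm hl y.perm hi)
      (comp deg (l.idxOf i) f (Finsupp.single y.tree 1)) := by
  induction f using Finsupp.induction_linear with
  | zero => simp
  | add f g hf hg => simp only [map_add, LinearMap.add_apply, hf, hg]
  | single t a =>
    by_cases h : t.leaves = N
    · subst h
      rw [labIncl_single, symComp_single, dif_pos hi, comp_single_of_lt _ (idxOf_lt_of_perm hl hi)]
      exact (labIncl_single_of_eq (x := SymTree.comp ⟨t, l, hl⟩ i y hi) _ rfl _).symm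
    · rw [labIncl_single_of_ne hl h, map_zero, LinearMap.zero_apply, comp_single]
      split_ifs with h'
      · have := leaves_graft y.tree t _ h'
        rw [labIncl_single_of_ne _ (by omega)]
      · rw [map_zero]

theorem symComp_labIncl_left_of_le {l : List ℕ} {N i : ℕ} (hl : l.Perm (List.range N)) (hi : N ≤ i)
    (f : Free K ar) (y : SymTree G ar) :
    symComp deg i (labIncl hl f) (Finsupp.single y 1) = 0 := by
  induction f using Finsupp.induction_linear with
  | zero => simp
  | add f g hf hg => simp only [map_add, LinearMap.add_apply, hf, hg, add_zero]
  | single t a =>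
    by_cases h : t.leaves = N
    · subst h
      rw [labIncl_single, symComp_single, dif_neg (not_lt.2 hi)]
    · rw [labIncl_single_of_ne hl h, map_zero, LinearMap.zero_apply]

theorem symComp_labIncl_right (x : SymTree G ar) {i : ℕ} (hi : i < x.tree.leaves) {l : List ℕ}
    {N : ℕ} (hl : l.Perm (List.range N)) (f : Free K ar) :
    symComp deg i (Finsupp.single x 1) (labIncl hl f) = labIncl (labComp_perm x.perm hl hi)
      (comp deg (x.lab.idxOf i) (Finsupp.single x.tree 1) f) := by
  have hi' := idxOf_lt_of_perm x.perm hi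
  induction f using Finsupp.induction_linear with
  | zero => simp
  | add f g hf hg => simp only [map_add, hf, hg]
  | single t a =>
    rw [comp_single_of_lt _ hi']
    by_cases h : t.leaves = N
    · subst h
      rw [labIncl_single, symComp_single, dif_pos hi]
      exact (labIncl_single_of_eq (x := SymTree.comp x i ⟨t, l, hl⟩ hi) _ rfl _).symm
    · have := leaves_graft t x.tree _ hi'
      rw [labIncl_single_of_ne hl h, map_zero, labIncl_single_of_ne _ (by omega)]

theorem symComp_single_of_le (x : SymTree G ar) {i : ℕ} (hi : x.tree.leaves ≤ i)
    (F : SymFree K G ar) : symComp deg i (Finsupp.single x 1) F = 0 := by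
  induction F using Finsupp.induction_linear with
  | zero => simp
  | add f g hf hg => rw [map_add, hf, hg, add_zero]
  | single y a => rw [symComp_single, dif_neg (not_lt.2 hi)]

theorem symAct_labIncl {l : List ℕ} {N : ℕ} (hl : l.Perm (List.range N)) (w : Equiv.Perm ℕ)
    (hw : ∀ k, N ≤ k → w k = k) (f : Free K ar) :
    symAct w (labIncl hl f) = labIncl (map_perm_range w hl hw) f := by
  induction f using Finsupp.induction_linear with
  | zero => simp
  | add f g hf hg => simp only [map_add, hf, hg]
  | single t a =>
    by_cases h : t.leaves = N
    · subst h
      rw [labIncl_single, labIncl_single, symAct_single, dif_pos hw]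
      rfl
    · rw [labIncl_single_of_ne _ h, labIncl_single_of_ne _ h, map_zero]

theorem symAct_labIncl_of_not {l : List ℕ} {N : ℕ} (hl : l.Perm (List.range N)) (w : Equiv.Perm ℕ)
    (hw : ¬∀ k, N ≤ k → w k = k) (f : Free K ar) : symAct w (labIncl hl f) = 0 := by
  induction f using Finsupp.induction_linear with
  | zero => simp
  | add f g hf hg => simp only [map_add, hf, hg, add_zero]
  | single t a =>
    by_cases h : t.leaves = N
    · subst h
      rw [labIncl_single, symAct_single, dif_neg hw]
    · rw [labIncl_single_of_ne _ h, map_zero]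

theorem filter_labIncl {l : List ℕ} {N : ℕ} (hl : l.Perm (List.range N)) (p : PTree G ar → Prop)
    [DecidablePred p] (f : Free K ar) :
    (labIncl hl f).filter (fun x => p x.tree) = labIncl hl (f.filter p) := by
  induction f using Finsupp.induction_linear with
  | zero => simp only [map_zero, Finsupp.filter_zero]
  | add f g hf hg => simp only [map_add, Finsupp.filter_add, hf, hg]
  | single t a =>
    by_cases h : t.leaves = N
    · subst h
      rw [labIncl_single]
      by_cases hp : p t
      · rw [Finsupp.filter_single_of_pos (fun x : SymTree G ar => p x.tree) hp,
          Finsupp.filter_single_of_pos p hp, labIncl_single]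
      · rw [Finsupp.filter_single_of_neg (fun x : SymTree G ar => p x.tree) hp,
          Finsupp.filter_single_of_neg p hp, map_zero]
    · rw [labIncl_single_of_ne _ h, Finsupp.filter_zero]
      by_cases hp : p t
      · rw [Finsupp.filter_single_of_pos _ hp, labIncl_single_of_ne _ h]
      · rw [Finsupp.filter_single_of_neg _ hp, map_zero]

/-- The ideal `I ⊗ Σ_*` of `F_ns(M) ⊗ Σ_*`. -/
noncomputable def OpIdeal.sym (I : OpIdeal K ar deg) : SymIdeal K ar deg where
  carrier := Submodule.span K {F | ∃ (l : List ℕ) (N : ℕ) (hl : l.Perm (List.range N)),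
    ∃ f ∈ I.carrier, F = labIncl hl f}
  comp_left i F H hF := by
    induction H using Finsupp.induction_linear with
    | zero => rw [map_zero]; exact Submodule.zero_mem _
    | add H H' h h' => rw [map_add]; exact Submodule.add_mem _ h h'
    | single y b =>
      rw [← mul_one b, ← smul_eq_mul, ← Finsupp.smul_single, map_smul]
      refine Submodule.smul_mem _ _ ?_
      induction hF using Submodule.span_induction with
      | zero => rw [map_zero, LinearMap.zero_apply]; exact Submodule.zero_mem _
      | add F F' _ _ h h' => rw [map_add, LinearMap.add_apply]; exact Submodule.add_mem _ h h'
      | smul a F _ h => rw [map_smul, LinearMap.smul_apply]; exact Submodule.smul_mem _ _ h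
      | mem F hF =>
        obtain ⟨l, N, hl, f, hf, rfl⟩ := hF
        rcases lt_or_ge i N with hi | hi
        · rw [symComp_labIncl_left hl hi]
          exact Submodule.subset_span ⟨_, _, _, _, I.comp_left _ _ _ hf, rfl⟩
        · rw [symComp_labIncl_left_of_le hl hi]
          exact Submodule.zero_mem _
  comp_right i H F hF := by
    induction H using Finsupp.induction_linear with
    | zero => rw [map_zero, LinearMap.zero_apply]; exact Submodule.zero_mem _
    | add H H' h h' => rw [map_add, LinearMap.add_apply]; exact Submodule.add_mem _ h h'
    | single x b =>
      rw [← mul_one b, ← smul_eq_mul, ← Finsupp.smul_single, map_smul, LinearMap.smul_apply]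
      refine Submodule.smul_mem _ _ ?_
      rcases lt_or_ge i x.tree.leaves with hi | hi
      · induction hF using Submodule.span_induction with
        | zero => rw [map_zero]; exact Submodule.zero_mem _
        | add F F' _ _ h h' => rw [map_add]; exact Submodule.add_mem _ h h'
        | smul a F _ h => rw [map_smul]; exact Submodule.smul_mem _ _ h
        | mem F hF =>
          obtain ⟨l, N, hl, f, hf, rfl⟩ := hF
          rw [symComp_labIncl_right x hi]
          exact Submodule.subset_span ⟨_, _, _, _, I.comp_right _ _ _ hf, rfl⟩
      · rw [symComp_single_of_le x hi]
        exact Submodule.zero_mem _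
  act w F hF := by
    induction hF using Submodule.span_induction with
    | zero => rw [map_zero]; exact Submodule.zero_mem _
    | add F F' _ _ h h' => rw [map_add]; exact Submodule.add_mem _ h h'
    | smul a F _ h => rw [map_smul]; exact Submodule.smul_mem _ _ h
    | mem F hF =>
      obtain ⟨l, N, hl, f, hf, rfl⟩ := hF
      by_cases hw : ∀ k, N ≤ k → w k = k
      · rw [symAct_labIncl hl w hw]
        exact Submodule.subset_span ⟨_, _, _, _, hf, rfl⟩
      · rw [symAct_labIncl_of_not hl w hw]
        exact Submodule.zero_mem _
  homogeneous n d w F hF := by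
    induction hF using Submodule.span_induction with
    | zero => rw [Finsupp.filter_zero]; exact Submodule.zero_mem _
    | add F F' _ _ h h' => rw [Finsupp.filter_add]; exact Submodule.add_mem _ h h'
    | smul a F _ h => rw [Finsupp.filter_smul]; exact Submodule.smul_mem _ _ h
    | mem F hF =>
      obtain ⟨l, N, hl, f, hf, rfl⟩ := hF
      rw [filter_labIncl hl fun t => t.leaves = n ∧ t.total deg = d ∧ t.weight = w]
      exact Submodule.subset_span ⟨_, _, _, _, I.homogeneous n d w f hf, rfl⟩

theorem labIncl_mem_sym {I : OpIdeal K ar deg} {l : List ℕ} {N : ℕ} (hl : l.Perm (List.range N))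
    {f : Free K ar} (hf : f ∈ I.carrier) : labIncl hl f ∈ I.sym.carrier :=
  Submodule.subset_span ⟨l, N, hl, f, hf, rfl⟩

/-- Homogeneity is only given for arity, degree and weight together; the arity component is a sum of
such pieces. -/
theorem OpIdeal.filter_leaves_mem (I : OpIdeal K ar deg) {f : Free K ar} (hf : f ∈ I.carrier)
    (N : ℕ) : f.filter (fun t => t.leaves = N) ∈ I.carrier := by
  have h := mem_span_filter (f.filter fun t => t.leaves = N)
    fun t : PTree G ar => (t.total deg, t.weight)
  refine Submodule.span_le.2 ?_ h
  rintro _ ⟨⟨d, w⟩, rfl⟩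
  refine (congrArg (· ∈ I.carrier) (?_ : _ = _)).mpr (I.homogeneous N d w f hf)
  ext t
  simp only [Finsupp.filter_apply, Prod.mk.injEq]
  split_ifs <;> tauto

theorem symIncl_single (t : PTree G ar) (a : K) :
    symIncl (Finsupp.single t a) = Finsupp.single (SymTree.std t) a := by
  rw [symIncl, Finsupp.lmapDomain_apply, Finsupp.mapDomain_single]

theorem symIncl_comp (i : ℕ) (f g : Free K ar) :
    symIncl (comp deg i f g) = symComp deg i (symIncl f) (symIncl g) := by
  induction f using Finsupp.induction_linear with
  | zero => simp
  | add f f' hf hf' => simp only [map_add, LinearMap.add_apply, hf, hf']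
  | single s a =>
    induction g using Finsupp.induction_linear with
    | zero => simp
    | add g g' hg hg' => simp only [map_add, hg, hg']
    | single t b =>
      rw [symIncl_single, symIncl_single, symComp_single, comp_single]
      by_cases hi : i < s.leaves
      · rw [if_pos hi, dif_pos (show i < (SymTree.std s).tree.leaves from hi), std_comp s t hi,
          symIncl_single]
        change _ = Finsupp.single _ (a * b * ksign K
          (degAfter deg s ((List.range s.leaves).idxOf i) * t.total deg))
        rw [idxOf_range hi]
      · rw [if_neg hi, dif_neg (show ¬i < (SymTree.std s).tree.leaves from hi), map_zero]

theorem filter_symIncl (p : PTree G ar → Prop) [DecidablePred p] (f : Free K ar) :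
    (symIncl f).filter (fun x => p x.tree) = symIncl (f.filter p) := by
  induction f using Finsupp.induction_linear with
  | zero => simp only [map_zero, Finsupp.filter_zero]
  | add f g hf hg => simp only [map_add, Finsupp.filter_add, hf, hg]
  | single t a =>
    rw [symIncl_single]
    by_cases hp : p t
    · rw [Finsupp.filter_single_of_pos (fun x : SymTree G ar => p x.tree) hp,
          Finsupp.filter_single_of_pos p hp, symIncl_single]
    · rw [Finsupp.filter_single_of_neg (fun x : SymTree G ar => p x.tree) hp,
          Finsupp.filter_single_of_neg p hp, map_zero]

theorem labIncl_eq_symAct {l : List ℕ} {N : ℕ} (hl : l.Perm (List.range N)) {w : Equiv.Perm ℕ}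
    (hw : ∀ k, N ≤ k → w k = k) (e : (List.range N).map w = l) (f : Free K ar) :
    labIncl hl f = symAct w (symIncl (f.filter fun t => t.leaves = N)) := by
  induction f using Finsupp.induction_linear with
  | zero => simp only [map_zero, Finsupp.filter_zero]
  | add f g hf hg => simp only [map_add, Finsupp.filter_add, hf, hg]
  | single t a =>
    by_cases h : t.leaves = N
    · subst h
      rw [Finsupp.filter_single_of_pos (fun s : PTree G ar => s.leaves = t.leaves) rfl, symIncl_single, symAct_single,
        dif_pos (show ∀ k, (SymTree.std t).tree.leaves ≤ k → w k = k from hw), labIncl_single]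
      exact congrArg (Finsupp.single · a) (SymTree.ext' rfl e.symm)
    · rw [Finsupp.filter_single_of_neg (fun s : PTree G ar => s.leaves = N) h, labIncl_single_of_ne _ h, map_zero, map_zero]

theorem symIncl_eq_labIncl {n w : ℕ} {d : ℤ} {r : Free K ar} (hr : r ∈ piece K ar deg n d w) :
    symIncl r = labIncl (List.Perm.refl (List.range n)) r := by
  refine piece_induction ?_ (fun f f' hf hf' => ?_) (fun u a h1 h2 h3 => ?_) r hr
  · rw [map_zero, map_zero]
  · rw [map_add, map_add, hf, hf']
  · subst h1
    rw [symIncl_single, labIncl_single]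
    rfl

variable (deg) in
/-- The restriction of an ideal of `F_ns(M) ⊗ Σ_*` to `F_ns(M)`. -/
noncomputable def SymIdeal.comap (J : SymIdeal K ar deg) : OpIdeal K ar deg where
  carrier := J.carrier.comap symIncl
  comp_left i f g hf := by
    rw [Submodule.mem_comap, symIncl_comp]
    exact J.comp_left i _ _ hf
  comp_right i f g hg := by
    rw [Submodule.mem_comap, symIncl_comp]
    exact J.comp_right i _ _ hg
  homogeneous n d w f hf := by
    rw [Submodule.mem_comap,
      ← filter_symIncl fun t => t.leaves = n ∧ t.total deg = d ∧ t.weight = w]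
    exact J.homogeneous n d w _ hf

/-- A cycle of inclusions. The span of numbered copies of `I` is a symmetric ideal, every numbering
comes from the standard one by a permutation, and the generated symmetric ideal contains all
permuted elements of `I`. -/
theorem gen_symIncl_eq {R : Set (Free K ar)}
    (hR : ∀ r ∈ R, ∃ (n : ℕ) (d : ℤ), r ∈ piece K ar deg n d 2) :
    (SymIdeal.gen deg (symIncl '' R)).carrier = (OpIdeal.gen deg R).sym.carrier ∧
      (SymIdeal.gen deg (symIncl '' R)).carrier = symmetrize (OpIdeal.gen deg R) := by
  have h1 : (SymIdeal.gen deg (symIncl '' R)).carrier ≤ (OpIdeal.gen deg R).sym.carrier := by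
    refine sInf_le ⟨?_, _, rfl⟩
    rintro _ ⟨r, hr, rfl⟩
    obtain ⟨n, d, hn⟩ := hR r hr
    rw [symIncl_eq_labIncl hn]
    refine labIncl_mem_sym _ ?_
    rw [OpIdeal.gen, Submodule.mem_sInf]
    exact fun I hI => hI.1 hr
  have h2 : (OpIdeal.gen deg R).sym.carrier ≤ symmetrize (OpIdeal.gen deg R) := by
    refine Submodule.span_le.2 ?_
    rintro _ ⟨l, N, hl, f, hf, rfl⟩
    obtain ⟨w, hw, e⟩ := exists_perm_of_perm_range hl
    exact Submodule.subset_span ⟨_, OpIdeal.filter_leaves_mem _ hf N, w,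
      labIncl_eq_symAct hl hw e f⟩
  have h3 : symmetrize (OpIdeal.gen deg R) ≤ (SymIdeal.gen deg (symIncl '' R)).carrier := by
    refine Submodule.span_le.2 ?_
    rintro _ ⟨f, hf, w, rfl⟩
    refine SymIdeal.act _ w _ ?_
    -- The inclusion `F_ns(M) → F_ns(M) ⊗ Σ_*` respects composition, so the preimage of a symmetric
    -- ideal is a non-symmetric ideal; this one contains `R`.
    have : (OpIdeal.gen deg R).carrier
        ≤ (SymIdeal.comap deg (SymIdeal.gen deg (symIncl '' R))).carrier := by
      refine sInf_le ⟨fun r hr => ?_, _, rfl⟩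
      change symIncl r ∈ (SymIdeal.gen deg (symIncl '' R)).carrier
      rw [SymIdeal.gen, Submodule.mem_sInf]
      exact fun I hI => hI.1 ⟨r, hr, rfl⟩
    exact this hf
  exact ⟨le_antisymm h1 (h2.trans h3), le_antisymm (h1.trans h2) h3⟩

/-- The part of an element of `F_ns(M) ⊗ Σ_*` with list of labels `l`. -/
noncomputable def labSlice (l : List ℕ) : SymFree K G ar →ₗ[K] Free K ar :=
  Finsupp.linearCombination K fun x => if x.lab = l then Finsupp.single x.tree 1 else 0

theorem labSlice_single (l : List ℕ) (x : SymTree G ar) (a : K) :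
    labSlice l (Finsupp.single x a) = if x.lab = l then Finsupp.single x.tree a else 0 := by
  rw [labSlice, Finsupp.linearCombination_single]
  split_ifs
  · rw [Finsupp.smul_single, smul_eq_mul, mul_one]
  · rw [smul_zero]

theorem labSlice_apply (F : SymFree K G ar) (x : SymTree G ar) :
    labSlice x.lab F x.tree = F x := by
  classical
  induction F using Finsupp.induction_linear with
  | zero => simp
  | add F F' h h' => simp only [map_add, Finsupp.add_apply, h, h']
  | single y a =>
    rw [labSlice_single]
    by_cases hl : y.lab = x.lab
    · rw [if_pos hl, Finsupp.single_apply, Finsupp.single_apply]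
      refine if_congr ⟨fun e => SymTree.ext' e hl, fun e => e ▸ rfl⟩ rfl rfl
    · rw [if_neg hl, Finsupp.single_apply, if_neg fun e : y = x => hl (congrArg SymTree.lab e)]
      rfl

theorem labSlice_mem_supported {F : SymFree K G ar} {C : Set (PTree G ar)}
    (hF : ∀ x ∈ F.support, x.tree ∈ C) (l : List ℕ) : labSlice l F ∈ Finsupp.supported K K C := by
  rw [labSlice, Finsupp.linearCombination_apply, Finsupp.sum]
  refine Submodule.sum_mem _ fun x hx => Submodule.smul_mem _ _ ?_
  split_ifs
  · exact Finsupp.single_mem_supported K _ (hF x hx)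
  · exact Submodule.zero_mem _

open Classical in
theorem labSlice_labIncl (l' : List ℕ) {l : List ℕ} {N : ℕ} (hl : l.Perm (List.range N))
    (f : Free K ar) :
    labSlice l' (labIncl hl f) = if l = l' then f.filter (fun t => t.leaves = N) else 0 := by
  induction f using Finsupp.induction_linear with
  | zero => simp only [map_zero, Finsupp.filter_zero, ite_self]
  | add f g hf hg =>
    rw [map_add, map_add, hf, hg, Finsupp.filter_add]
    split_ifs
    · rfl
    · rw [add_zero]
  | single t a =>
    by_cases h : t.leaves = N
    · subst h
      rw [labIncl_single, labSlice_single, Finsupp.filter_single_of_pos (fun s : PTree G ar => s.leaves = t.leaves) rfl]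
    · rw [labIncl_single_of_ne _ h, map_zero, Finsupp.filter_single_of_neg (fun s : PTree G ar => s.leaves = N) h, ite_self]

/-- Slices by numbering detect membership in the non-symmetric ideal; linear independence for the
symmetric operad follows slice by slice. -/
theorem OpIdeal.labSlice_mem (I : OpIdeal K ar deg) {F : SymFree K G ar} (hF : F ∈ I.sym.carrier)
    (l : List ℕ) : labSlice l F ∈ I.carrier := by
  have : I.sym.carrier ≤ I.carrier.comap (labSlice l) := by
    refine Submodule.span_le.2 ?_
    rintro _ ⟨l', N, hl, f, hf, rfl⟩
    change labSlice l (labIncl hl f) ∈ I.carrier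
    rw [labSlice_labIncl]
    split_ifs
    · exact I.filter_leaves_mem hf N
    · exact Submodule.zero_mem _
  exact this hF

/-- Comparable monomials share their numbering, so their composites do too and graft at the same
entry. A shuffle changes the numberings in the same way and leaves the trees alone. -/
theorem IsMonomialOrder.isSymMonomialOrder {le : PTree G ar → PTree G ar → Prop} (h : IsMonomialOrder le) :
    IsSymMonomialOrder (symLe le) where
  refl x := ⟨rfl, h.refl _⟩
  trans x y z hxy hyz := ⟨hxy.1.trans hyz.1, h.trans _ _ _ hxy.2 hyz.2⟩
  antisymm x y hxy hyx := SymTree.ext' (h.antisymm _ _ hxy.2 hyx.2) hxy.1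
  comp x x' y y' hx hy hxx' hyy' i hi w hw := by
    constructor
    · change (labComp x.lab i y.tree.leaves y.lab).map w
        = (labComp x'.lab i y'.tree.leaves y'.lab).map w
      rw [hxx'.1, hyy'.1, hy]
    · change le (PTree.graft x.tree (x.lab.idxOf i) y.tree) (PTree.graft x'.tree (x'.lab.idxOf i) y'.tree)
      rw [← hxx'.1]
      exact h.graft _ _ _ _ hx hy hxx'.2 hyy'.2 _ (idxOf_lt_of_perm x.perm hi)

theorem IsPBWBasis.eq_zero_of_mem {I : OpIdeal K ar deg} {le : PTree G ar → PTree G ar → Prop}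
    {B : Set (PTree G ar)} (h : IsPBWBasis I le B) {c : Free K ar} (hc : ∀ t ∈ c.support, t ∈ B)
    (hI : c ∈ I.carrier) : c = 0 := by
  ext t
  by_cases ht : t ∈ c.support
  · rw [← h.coord_mkQ ⟨t, hc t ht⟩ hc, Submodule.mkQ_apply,
      (Submodule.Quotient.mk_eq_zero _).2 hI, map_zero]
    rfl
  · exact Finsupp.notMem_support_iff.1 ht

/-- The orbits of a Poincaré–Birkhoff–Witt basis form a symmetric Poincaré–Birkhoff–Witt basis. -/
theorem IsPBWBasis.isSymPBWBasis {I : OpIdeal K ar deg} {le : PTree G ar → PTree G ar → Prop}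
    {B : Set (PTree G ar)} (h : IsPBWBasis I le B) (har : ∀ g, 0 < ar g) {J : SymIdeal K ar deg}
    (hJ : J.carrier = I.sym.carrier) : IsSymPBWBasis J (symLe le) (orbits B) where
  order := h.order.isSymMonomialOrder
  one_mem := h.one_mem
  corolla_mem x g hx := by
    change x.tree ∈ B
    rw [hx]
    exact h.corolla_mem g
  linearIndependent := linearIndependent_mon fun F hF hFJ => by
    ext x
    rw [← labSlice_apply, h.eq_zero_of_mem (labSlice_mem_supported hF x.lab)
      (I.labSlice_mem (hJ ▸ hFJ) x.lab)]
    rfl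
  span_eq_top := span_mon_eq_top fun x => by
    obtain ⟨c, hc, e⟩ := h.exists_rep (I.mon_mem x.tree)
    refine ⟨labIncl x.perm c, fun y hy => ?_, ?_⟩
    · exact (hc _ (labIncl_mem_supported x.perm c hy).2).1
    · rw [hJ, ← labIncl_single_of_eq x.perm rfl, ← map_sub]
      exact labIncl_mem_sym _ ((Submodule.Quotient.eq _).1 e)
  comp_mem_or := by
    intro x hx y hy i hi w hw
    have hi' := idxOf_lt_of_perm x.perm hi
    rcases h.comp_mem_or _ hx _ hy _ hi' with hB | ⟨c, hc, e, hle⟩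
    · exact Or.inl hB
    · right
      -- All terms of the non-symmetric decomposition receive the numbering of the shuffled
      -- composite, and `labIncl` discards terms of any other arity. The relation and the strict
      -- inequalities carry over.
      set z := x.shuffleComp i y hi w hw with hz
      have hc' : ∀ u ∈ (labIncl z.perm c).support, u.lab = z.lab ∧ u.tree ∈ c.support :=
        fun u hu => labIncl_mem_supported z.perm c hu
      refine ⟨labIncl z.perm c, fun u hu => hc (hc' u hu).2, ?_, fun u hu => ?_⟩
      · have e1 : symAct w (symComp deg i (Finsupp.single x (1 : K)) (Finsupp.single y 1))
            = labIncl z.perm (comp deg (x.lab.idxOf i) (Finsupp.single x.tree 1)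
              (Finsupp.single y.tree 1)) := by
          rw [symComp_single, dif_pos hi, symAct_single, dif_pos fun k hk => hw.fix k (by
            rwa [SymTree.comp, leaves_graft_idxOf x i hi] at hk), comp_single_of_lt _ hi']
          exact (labIncl_single_of_eq (x := z) _ rfl _).symm
        rw [e1]
        refine (Submodule.Quotient.eq _).2 ?_
        rw [hJ, ← map_sub]
        exact labIncl_mem_sym _ ((Submodule.Quotient.eq _).1 e)
      · obtain ⟨h1, h2⟩ := hc' u hu
        obtain ⟨h3, h4⟩ := hle _ h2
        exact ⟨⟨h1.symm, h3⟩, fun e' => h4 (congrArg SymTree.tree e')⟩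
  mem_iff x := by
    change x.tree ∈ B ↔ _
    rw [h.mem_iff]
    constructor
    · rintro hx y ⟨m, hm, -⟩
      exact hx _ hm.edgeSub
    · intro hx q hq
      -- Every edge restriction of the underlying tree carries a numbering by minima, so the
      -- numbered condition tests all edges; membership in the orbits only sees the tree.
      obtain ⟨y, rfl, hy⟩ := exists_symEdgeSub har x hq
      exact hx y hy

end symmetric

end NSOp

theorem mainTheorem3 {K : Type*} [Field K] {G : Type*} (ar : G → ℕ) (har : ∀ g, 0 < ar g)
    (hfin : ∀ n, {g | ar g = n}.Finite) (deg : G → ℤ) (R : Set (Free K ar))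
    (hR : ∀ r ∈ R, ∃ (n : ℕ) (d : ℤ), r ∈ piece K ar deg n d 2)
    (le : PTree G ar → PTree G ar → Prop) (B : Set (PTree G ar))
    (hB : IsPBWBasis (OpIdeal.gen deg R) le B) :
    IsKoszul (OpIdeal.gen deg R) ∧
    (LinearMap.ker (toKoszulDual (OpIdeal.gen deg R))
        = (OpIdeal.gen (dualDeg deg) (dualRel deg R)).carrier ∧
      IsPBWBasis (OpIdeal.gen (dualDeg deg) (dualRel deg R)) (fun s t => le t s)
        (complementaryBasis B)) ∧
    ((SymIdeal.gen deg (symIncl '' R)).carrier = symmetrize (OpIdeal.gen deg R) ∧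
      IsSymPBWBasis (SymIdeal.gen deg (symIncl '' R)) (symLe le) (orbits B)) := by
  exact ⟨hB.isKoszul har hfin,
    ⟨hB.ker_toKoszulDual har hfin hR, hB.isPBWBasis_dual har hfin hR⟩,
    ⟨(gen_symIncl_eq hR).2, hB.isSymPBWBasis har (gen_symIncl_eq hR).1⟩⟩
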